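/- Fix $q\in\mathbb{C}$ with $0<|q|<1$, and write $(a;q)_\infty=\prod_{j\ge 0}(1-aq^j)$, $(a;q)_n=\prod_{j=0}^{n-1}(1-aq^j)$, $(a_1,\dots,a_m;q)_\infty=\prod_i(a_i;q)_\infty$, $(az^{\pm1};q)_\infty=(az,az^{-1};q)_\infty$ and $\theta(a;q)=(a,q/a;q)_\infty$, $\theta(a,b;q)=\theta(a;q)\theta(b;q)$. Let $M=\{t\in\mathbb{C}^8:\prod_{j=1}^8t_j=1\}$ and $\mathcal{H}_1=M/\{\pm1\}$. For $t\in M$ put $$I_t(t;z)=\frac{(z^{\pm2},t_1^{-1}z^{\pm1},t_8^{-1}z^{\pm1};q)_\infty}{\prod_{j=2}^7(t_jz^{\pm1};q)_\infty},$$ $$J_t^\mu(t;z)=2\,\frac{\theta(t_1t_8/\mu z,\,z/\mu;q)}{\theta(t_1/\mu,\,t_8/\mu;q)}\Bigl(1-\frac{z^2}{q}\Bigr)\prod_{i=2}^7\frac{(z/t_i;q)_\infty}{(t_iz;q)_\infty}\prod_{j=1,8}\frac{1}{(t_jz/q,\,t_j/z;q)_\infty}.$$ For generic $t\in M$ let $$S_t(t)=\int_{\mathcal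 C}I_t(t;z)\frac{dz}{2\pi iz},\qquad U_t(t)=\int_{\mathcal C'}J_t^\mu(t;z)\frac{dz}{2\pi iz},$$ where $\mu\in\mathbb{C}^\times$ is any number with $\theta(t_1/\mu,t_8/\mu;q)\neq0$. Here $\mathcal C$ is a closed $C^1$ curve (a deformation of the positively oriented unit circle) with winding number $1$ around $0$ and the points $t_jq^n$ and winding number $0$ around the points $(t_jq^n)^{-1}$ ($2\le j\le7$, $n\ge0$). Likewise $\mathcal C'$ is such a curve with winding number $1$ around $0$ and the points $t_jq^n$ ($j=1,8$, $n\ge0$), and winding number $0$ around the points $t_j^{-1}q^{1-n}$ ($j=1,8$, $n\geq 0$) and $t_i^{-1}q^{-n}$ ($2\le i\le7$, $n\geq 0$). **Proposition (SU).** The integrals are independent of the choice of contour and of $\mu$, and they extend to meromorphic functions $S_t$ and $U_t$ on $M$. These satisfy $S_t(-t)=S_t(t)$ and $U_t(-t)=U_t(t)$, so they are meromorphic functions on $\mathcal{H}_1$. As meromorphic functions in $t\in\mathcal{H}_1$, $$S_t(t)\,\frac{(t_6t_7;q)_\infty\prod_{2\le j<k\le5}(t_jt_k;q)_\infty}{(1/qt_1t_8,\,1/t_1t_6,\,1/t_1t_7,\,1/t_8t_6,\,1/t_8t_7;q)_\infty}=U_t\bigl(t_6/s,\,st_2,\,st_3,\,st_4,\,st_5,\,t_1/s,\,t_8/s,\,t_7/s\bigr),$$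 where $s^2t_2t_3t_4t_5=1$ (equivalently $t_1t_6t_7t_8=s^2$; either choice of $s$ is allowed). Consequently $S_t$ is a sum of two very-well-poised ${}_{10}\phi_9$ series: the left-hand side also equals $V(\tau)+V(\tau')$, where $\tau=(\tau_1,\dots,\tau_8)=(t_6/s,st_2,st_3,st_4,st_5,t_1/s,t_8/s,t_7/s)$, $\tau'$ is $\tau$ with $\tau_1$ and $\tau_8$ interchanged, and $$V(\tau)=\frac{2}{(q,\tau_1^2,\tau_1\tau_8/q,\tau_8/\tau_1;q)_\infty}\prod_{j=2}^7\frac{(\tau_1/\tau_j;q)_\infty}{(\tau_1\tau_j;q)_\infty}\;{}_{10}W_9\Bigl(\frac{\tau_1^2}{q};\tau_1\tau_2,\dots,\tau_1\tau_7,\frac{\tau_1\tau_8}{q};q,q\Bigr).$$ Here $${}_{10}W_9(a;a_4,\dots,a_{10};q,z)=\sum_{n\ge0}\frac{(a;q)_n(qa^{1/2};q)_n(-qa^{1/2};q)_n\prod_{i=4}^{10}(a_i;q)_n}{(q;q)_n(a^{1/2};q)_n(-a^{1/2};q)_n\prod_{i=4}^{10}(qa/a_i;q)_n}\,z^n.$$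 -/

import Mathlib

open Filter Topology

noncomputable section

namespace TrigHyp

/-! ### q-shifted factorials and basic hypergeometric series -/

/-- The `q`-shifted factorial `(a; q)_∞ = ∏_{j ≥ 0} (1 - a q^j)`. -/
def qPoch (q a : ℂ) : ℂ := ∏' j : ℕ, (1 - a * q ^ j)

/-- The renormalized Jacobi theta function `θ(a; q) = (a, q/a; q)_∞`. -/
def theta (q a : ℂ) : ℂ := qPoch q a * qPoch q (q / a)

/-- The finite `q`-shifted factorial `(a; q)_n = ∏_{j < n} (1 - a q^j)`. -/
def qPochFin (q a : ℂ) (n : ℕ) : ℂ := ∏ j ∈ Finset.range n, (1 - a * q ^ j)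

/-- The basic hypergeometric series with upper parameters `as` and lower parameters `bs`
(one fewer lower than upper parameters). -/
def basicPhi (q : ℂ) (as bs : List ℂ) (z : ℂ) : ℂ :=
  ∑' n : ℕ, (as.map fun a => qPochFin q a n).prod /
    (qPochFin q q n * (bs.map fun b => qPochFin q b n).prod) * z ^ n

/-- The very-well-poised series `W(a; as; q, z)`; for a list `as` of length `r - 2` this is the
`_{r+1}W_r` series.  -/
def vwpW (q a : ℂ) (as : List ℂ) (z : ℂ) : ℂ :=
  basicPhi q
    (a :: (q * a ^ (1 / 2 : ℂ)) :: (-(q * a ^ (1 / 2 : ℂ))) :: as)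
    ((a ^ (1 / 2 : ℂ)) :: (-(a ^ (1 / 2 : ℂ))) :: as.map fun b => q * a / b) z

/-! ### Contours -/

/-- `∫_γ f(z) dz` over a closed curve parametrized by `[0, 2π]`. -/
def loopIntegral (γ : ℝ → ℂ) (f : ℂ → ℂ) : ℂ :=
  ∫ θ in (0 : ℝ)..(2 * Real.pi), f (γ θ) * deriv γ θ

/-- The winding number of a closed curve around a point that is not on the curve. -/
def windingNumber (γ : ℝ → ℂ) (a : ℂ) : ℂ :=
  (2 * Real.pi * Complex.I)⁻¹ * loopIntegral γ fun z => (z - a)⁻¹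

/-- `γ` is a `C¹` closed curve that encircles each point of `A` exactly once in the positive sense,
and does not encircle any point of `B`. -/
structure IsSeparatingLoop (γ : ℝ → ℂ) (A B : Set ℂ) : Prop where
  contDiff : ContDiff ℝ 1 γ
  periodic : Function.Periodic γ (2 * Real.pi)
  avoids_included : ∀ a ∈ A, ∀ θ, γ θ ≠ a
  avoids_excluded : ∀ b ∈ B, ∀ θ, γ θ ≠ b
  winding_included : ∀ a ∈ A, windingNumber γ a = 1
  winding_excluded : ∀ b ∈ B, windingNumber γ b = 0

/-! ### The parameter space and meromorphic functions on it

Parameters `t = (t_1, …, t_8)` are functions on `Fin 8`, with `t_j` written `t (j - 1)`. -/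

/-- The complex hypersurface `t_1 t_2 ⋯ t_8 = 1` in `ℂ^8`, a connected complex manifold. -/
def paramSpace : Set (Fin 8 → ℂ) := {t | ∏ j, t j = 1}

/-- `P` holds generically on the hypersurface: locally it holds off the zero set of an analytic
function which does not vanish identically on the hypersurface. -/
def Generically (P : (Fin 8 → ℂ) → Prop) : Prop :=
  ∀ t₀ ∈ paramSpace, ∃ h : (Fin 8 → ℂ) → ℂ, AnalyticAt ℂ h t₀ ∧
    (∃ᶠ t in 𝓝[paramSpace] t₀, h t ≠ 0) ∧
    ∀ᶠ t in 𝓝[paramSpace] t₀, h t ≠ 0 → P t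

/-- `F` represents a meromorphic function on the hypersurface: locally it is a quotient `g / h` of
analytic functions, with `h` not identically zero on the hypersurface. The values
of `F` at the zeros of `h` are irrelevant. -/
def IsMeromorphic (F : (Fin 8 → ℂ) → ℂ) : Prop :=
  ∀ t₀ ∈ paramSpace, ∃ g h : (Fin 8 → ℂ) → ℂ, AnalyticAt ℂ g t₀ ∧ AnalyticAt ℂ h t₀ ∧
    (∃ᶠ t in 𝓝[paramSpace] t₀, h t ≠ 0) ∧
    ∀ᶠ t in 𝓝[paramSpace] t₀, h t ≠ 0 → F t = g t / h t

/-! ### The function `S_t` -/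

/-- The integrand `I_t(t; z)`. -/
def integrandS (q : ℂ) (t : Fin 8 → ℂ) (z : ℂ) : ℂ :=
  (qPoch q (z ^ 2) * qPoch q ((z ^ 2)⁻¹) *
    (qPoch q ((t 0)⁻¹ * z) * qPoch q ((t 0)⁻¹ * z⁻¹)) *
    (qPoch q ((t 7)⁻¹ * z) * qPoch q ((t 7)⁻¹ * z⁻¹))) /
  ∏ j ∈ Finset.Icc (1 : Fin 8) 6, (qPoch q (t j * z) * qPoch q (t j * z⁻¹))

/-- Admissible contours for `S_t(t)`: deformations of the positively oriented unit circle
including the sequences `t_j q^n` and excluding their reciprocals, `2 ≤ j ≤ 7`, `n ≥ 0`. -/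
def IsContourS (q : ℂ) (t : Fin 8 → ℂ) (γ : ℝ → ℂ) : Prop :=
  IsSeparatingLoop γ
    ({0} ∪ {z | ∃ j ∈ Finset.Icc (1 : Fin 8) 6, ∃ n : ℕ, z = t j * q ^ n})
    {z | ∃ j ∈ Finset.Icc (1 : Fin 8) 6, ∃ n : ℕ, z = (t j * q ^ n)⁻¹}

/-- `∫_γ I_t(t; z) dz / (2π i z)`. -/
def integralS (q : ℂ) (t : Fin 8 → ℂ) (γ : ℝ → ℂ) : ℂ :=
  (2 * Real.pi * Complex.I)⁻¹ * loopIntegral γ fun z => integrandS q t z / z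

/-- `S` is (a representative of) the trigonometric hypergeometric function `S_t`, i.e. the
meromorphic extension of the contour integral to the whole hypersurface. -/
def IsTrigS (q : ℂ) (S : (Fin 8 → ℂ) → ℂ) : Prop :=
  IsMeromorphic S ∧
  ∀ t ∈ paramSpace, ∀ γ : ℝ → ℂ, IsContourS q t γ → integralS q t γ = S t

/-! ### The function `U_t` -/

/-- The integrand `J_t^μ(t; z)`. -/
def integrandU (q μ : ℂ) (t : Fin 8 → ℂ) (z : ℂ) : ℂ :=
  2 * ((theta q (t 0 * t 7 / (μ * z)) * theta q (z / μ)) /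
      (theta q (t 0 / μ) * theta q (t 7 / μ))) *
    (1 - z ^ 2 / q) *
    (∏ j ∈ Finset.Icc (1 : Fin 8) 6, qPoch q (z / t j) / qPoch q (t j * z)) *
    ∏ j ∈ ({0, 7} : Finset (Fin 8)), 1 / (qPoch q (t j * z / q) * qPoch q (t j / z))

/-- Admissible contours for `U_t(t)`: deformations of the positively oriented unit circle including
the sequences `t_j q^n`, `j = 1, 8`, `n ≥ 0`, and excluding the sequences `t_j⁻¹ q^(1-n)`,
`j = 1, 8`, and `t_i⁻¹ q^(-n)`, `2 ≤ i ≤ 7`, `n ≥ 0`. -/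
def IsContourU (q : ℂ) (t : Fin 8 → ℂ) (γ : ℝ → ℂ) : Prop :=
  IsSeparatingLoop γ
    ({0} ∪ {z | ∃ j ∈ ({0, 7} : Finset (Fin 8)), ∃ n : ℕ, z = t j * q ^ n})
    ({z | ∃ j ∈ ({0, 7} : Finset (Fin 8)), ∃ n : ℕ, z = (t j)⁻¹ * q * (q ^ n)⁻¹} ∪
      {z | ∃ j ∈ Finset.Icc (1 : Fin 8) 6, ∃ n : ℕ, z = (t j)⁻¹ * (q ^ n)⁻¹})

/-- `∫_γ J_t^μ(t; z) dz / (2π i z)`. -/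
def integralU (q μ : ℂ) (t : Fin 8 → ℂ) (γ : ℝ → ℂ) : ℂ :=
  (2 * Real.pi * Complex.I)⁻¹ * loopIntegral γ fun z => integrandU q μ t z / z

/-- `U` is (a representative of) the function `U_t`, i.e. the meromorphic extension of the contour
integral to the whole hypersurface; the integral does not depend on the auxiliary parameter `μ`. -/
def IsTrigU (q : ℂ) (U : (Fin 8 → ℂ) → ℂ) : Prop :=
  IsMeromorphic U ∧
  ∀ t ∈ paramSpace, ∀ μ : ℂ, μ ≠ 0 → theta q (t 0 / μ) ≠ 0 → theta q (t 7 / μ) ≠ 0 →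
    ∀ γ : ℝ → ℂ, IsContourU q t γ → integralU q μ t γ = U t

/-! ### The two sides of the relation -/

/-- `∏_{2 ≤ j < k ≤ 5} (t_j t_k; q)_∞ (t_6 t_7; q)_∞ /
(1/(q t_1 t_8), 1/(t_1 t_6), 1/(t_1 t_7), 1/(t_8 t_6), 1/(t_8 t_7); q)_∞`. -/
def suFactor (q : ℂ) (t : Fin 8 → ℂ) : ℂ :=
  ((∏ j ∈ Finset.Icc (1 : Fin 8) 4, ∏ k ∈ Finset.Ioc j 4, qPoch q (t j * t k)) *
    qPoch q (t 5 * t 6)) /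
  (qPoch q (1 / (q * t 0 * t 7)) * qPoch q (1 / (t 0 * t 5)) * qPoch q (1 / (t 0 * t 6)) *
    qPoch q (1 / (t 7 * t 5)) * qPoch q (1 / (t 7 * t 6)))

/-- `(t_6/s, s t_2, s t_3, s t_4, s t_5, t_1/s, t_8/s, t_7/s)`. -/
def suParam (s : ℂ) (t : Fin 8 → ℂ) : Fin 8 → ℂ :=
  ![t 5 / s, s * t 1, s * t 2, s * t 3, s * t 4, t 0 / s, t 7 / s, t 6 / s]

/-- One of the two very-well-poised `₁₀φ₉` terms:
`2 / (q, t_1², t_1 t_8 / q, t_8 / t_1; q)_∞ ∏_{j=2}^7 (t_1/t_j; q)_∞ / (t_1 t_j; q)_∞ ×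
₁₀W₉(t_1²/q; t_1 t_2, …, t_1 t_7, t_1 t_8 / q; q, q)`. -/
def seriesTerm (q : ℂ) (t : Fin 8 → ℂ) : ℂ :=
  2 / (qPoch q q * qPoch q (t 0 ^ 2) * qPoch q (t 0 * t 7 / q) * qPoch q (t 7 / t 0)) *
    (∏ j ∈ Finset.Icc (1 : Fin 8) 6, qPoch q (t 0 / t j) / qPoch q (t 0 * t j)) *
    vwpW q (t 0 ^ 2 / q)
      [t 0 * t 1, t 0 * t 2, t 0 * t 3, t 0 * t 4, t 0 * t 5, t 0 * t 6, t 0 * t 7 / q] q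

/-- The sum of the two `₁₀φ₉` terms, the second one obtained by interchanging `t_1` and `t_8`. -/
def seriesU (q : ℂ) (t : Fin 8 → ℂ) : ℂ :=
  seriesTerm q t + seriesTerm q (t ∘ Equiv.swap 0 7)

end TrigHyp

end

/-! Both functions are evaluated as the same explicit sum of two very-well-poised series, `uSeries`.
For `S` this happens at the parameters `suParam s t`, for `U` at its own parameters. Analytic
continuation then turns equality on an open set into generic equality.

The side of S rests on two classical formulas. The Nassrallah-Rahman integral (`nassrallah_rahman`)
evaluates the integral of (z^{±2}, Az^{±1}) / (az^{±1}, ..., ez^{±1}) with A = abcde. Bailey's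
summation (`wpDifference_eq_wpProduct`) evaluates a difference of two nonterminating
very-well-poised ₈φ₇ series as a product. Bailey's formula is read backwards: with base points t₆/s
and t₇/s it expands the quotient (z^{±1}/t₁, z^{±1}/t₈) / (t₆z^{±1}, t₇z^{±1}) as a combination of
two series in z. Multiplied by the Askey-Wilson weight in t₂, ..., t₅, every term becomes a
Nassrallah-Rahman integrand whose fifth parameter is t₆qⁿ or t₇qⁿ. Integrating term by term replaces
the two z-dependent pairs of q-shifted factorials by four constant ones, so ₈φ₇ becomes ₁₀φ₉
(`integralS_mul_suFactor`).

Both formulas are proved by q-difference certificates. For the integral, the effect of a ↦ qa is a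
combination of integrands equal to a constant times G(z) - G(z/q)/q, and no pole of G lies between γ
and γ/q, so it integrates to zero (`nr_shift`). Sending all parameters to 0 leaves one constant,
found from the parameters (q, -q, √q, -√q, 0). For Bailey's formula the certificate telescopes the
series and gives a first-order q-difference equation in z (`vwp_sum_shift`, `wpDifference_shift`).
The quotient of the two sides is then a holomorphic elliptic function, hence constant
(`eq_of_quotient_invariant`), and it is 1 at a point where one series terminates.

The side of U is a residue computation (`integralU_eq_uSeries`). The theta functions turn the
integrand into a kernel invariant under z ↦ qz times a well-poised weight. The kernel is bounded on
a sequence of circles shrinking to 0, so the integral is the sum of the residues at t₁qⁿ and t₈qⁿ,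
and μ cancels from each residue.

For the continuation, the hypersurface is covered by `expChart` from ℂ⁷. The series are jointly
analytic in their parameters because their terms form an analytic function with values in bounded
sequences (`analyticAt_vwpSum`). A meromorphic function which agrees with the contour integral on
some open set therefore agrees generically with the series (`holdsGenericallyAt_mul_eq`). Existence
of S and U follows by taking the contour integral wherever a contour exists and the series
elsewhere. This needs independence of the contour and of μ at every parameter, not only at generic
ones (`integralS_eq_integralS`, `integralU_eq_integralU`). -/

noncomputable section

namespace TrigHyp

/-! ### Infinite q-products with values in a commutative Banach algebra. -/

section QProd

variable {A : Type*} [NormedCommRing A] [NormedAlgebra ℂ A]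

/-- The finite product `∏_{j < n} (1 - x q^j c_j)` in a commutative Banach algebra. -/
def partialQProd (q : ℂ) (c : ℕ → A) (n : ℕ) (x : ℂ) : A :=
  ∏ j ∈ Finset.range n, (1 - (x * q ^ j) • c j)

/-- The infinite product `∏_{j ≥ 0} (1 - x q^j c_j)` in a commutative Banach algebra. -/
def qProd (q : ℂ) (c : ℕ → A) (x : ℂ) : A :=
  1 - ∑' j, (x * q ^ j) • (partialQProd q c j x * c j)

/-- Telescoping: each new factor changes the product by one summand. The infinite product becomes a
norm-convergent series, to which the Weierstrass theorem on series of holomorphic functions applies.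
-/
theorem partialQProd_eq (q : ℂ) (c : ℕ → A) (n : ℕ) (x : ℂ) :
    partialQProd q c n x =
      1 - ∑ j ∈ Finset.range n, (x * q ^ j) • (partialQProd q c j x * c j) := by
  induction n with
  | zero => simp [partialQProd]
  | succ n ih =>
    rw [Finset.sum_range_succ, ← sub_sub, ← ih]
    simp only [partialQProd, Finset.prod_range_succ]
    rw [mul_sub, mul_one, mul_smul_comm]

variable [NormOneClass A]

/-- From 1 + u ≤ exp u and the geometric series. The bound depends neither on the number of factors
nor on the coefficients, which gives uniform convergence on discs. -/
theorem norm_partialQProd_le {q : ℂ} (hq : ‖q‖ < 1) {c : ℕ → A} (hc : ∀ j, ‖c j‖ ≤ 1) (n : ℕ)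
    {x : ℂ} {r : ℝ} (hx : ‖x‖ ≤ r) : ‖partialQProd q c n x‖ ≤ Real.exp (r * (1 - ‖q‖)⁻¹) := by
  have hr : 0 ≤ r := (norm_nonneg x).trans hx
  calc ‖partialQProd q c n x‖ ≤ ∏ j ∈ Finset.range n, ‖1 - (x * q ^ j) • c j‖ :=
        Finset.norm_prod_le _ _
    _ ≤ ∏ j ∈ Finset.range n, Real.exp (r * ‖q‖ ^ j) := by
        refine Finset.prod_le_prod (fun _ _ => norm_nonneg _) fun j _ => ?_
        calc ‖1 - (x * q ^ j) • c j‖ ≤ ‖(1 : A)‖ + ‖(x * q ^ j) • c j‖ := norm_sub_le _ _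
          _ ≤ 1 + r * ‖q‖ ^ j := by
            rw [norm_one, norm_smul, norm_mul, norm_pow]
            have : ‖x‖ * ‖q‖ ^ j * ‖c j‖ ≤ r * ‖q‖ ^ j * 1 := by
              gcongr
              exact hc j
            linarith
          _ ≤ Real.exp (r * ‖q‖ ^ j) := by
            have := Real.add_one_le_exp (r * ‖q‖ ^ j)
            linarith
    _ = Real.exp (r * ∑ j ∈ Finset.range n, ‖q‖ ^ j) := by
        rw [← Real.exp_sum, Finset.mul_sum]
    _ ≤ _ := by
        gcongr
        rw [← tsum_geometric_of_lt_one (norm_nonneg _) hq]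
        exact (summable_geometric_of_lt_one (norm_nonneg _) hq).sum_le_tsum _
          fun _ _ => by positivity

omit [NormOneClass A] in
theorem differentiable_partialQProd (q : ℂ) (c : ℕ → A) (n : ℕ) :
    Differentiable ℂ (partialQProd q c n) := by
  induction n with
  | zero => exact differentiable_const 1
  | succ n ih =>
    have : partialQProd q c (n + 1) = fun x => partialQProd q c n x * (1 - (x * q ^ n) • c n) := by
      ext x; simp [partialQProd, Finset.prod_range_succ]
    rw [this]
    exact ih.mul (by fun_prop)

theorem norm_qProd_term_le {q : ℂ} (hq : ‖q‖ < 1) {c : ℕ → A} (hc : ∀ j, ‖c j‖ ≤ 1) (j : ℕ)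
    {x : ℂ} {r : ℝ} (hx : ‖x‖ ≤ r) :
    ‖(x * q ^ j) • (partialQProd q c j x * c j)‖ ≤
      r * Real.exp (r * (1 - ‖q‖)⁻¹) * ‖q‖ ^ j := by
  have hr : 0 ≤ r := (norm_nonneg x).trans hx
  rw [norm_smul, norm_mul, norm_pow]
  have h1 : ‖partialQProd q c j x * c j‖ ≤ Real.exp (r * (1 - ‖q‖)⁻¹) * 1 :=
    (norm_mul_le _ _).trans (mul_le_mul (norm_partialQProd_le hq hc j hx) (hc j)
      (norm_nonneg _) (Real.exp_nonneg _))
  calc _ ≤ r * ‖q‖ ^ j * (Real.exp (r * (1 - ‖q‖)⁻¹) * 1) := by gcongr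
    _ = _ := by ring

variable [CompleteSpace A]

theorem differentiable_qProd {q : ℂ} (hq : ‖q‖ < 1) {c : ℕ → A} (hc : ∀ j, ‖c j‖ ≤ 1) :
    Differentiable ℂ (qProd q c) := by
  intro x
  have h := Complex.differentiableOn_tsum_of_summable_norm (U := Metric.ball (0 : ℂ) (‖x‖ + 1))
    (u := fun j : ℕ => (‖x‖ + 1) * Real.exp ((‖x‖ + 1) * (1 - ‖q‖)⁻¹) * ‖q‖ ^ j)
    (F := fun j x => (x * q ^ j) • (partialQProd q c j x * c j))
    ((summable_geometric_of_lt_one (norm_nonneg _) hq).mul_left _)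
    (fun j => by
      have := differentiable_partialQProd q c j
      exact Differentiable.differentiableOn (by fun_prop))
    Metric.isOpen_ball
    (fun j w hw => norm_qProd_term_le hq hc j (by simpa using (mem_ball_zero_iff.1 hw).le))
  have h2 := h.differentiableAt (Metric.isOpen_ball.mem_nhds (x := x) (by simp))
  exact (differentiableAt_const _).sub h2

theorem tendsto_partialQProd {q : ℂ} (hq : ‖q‖ < 1) {c : ℕ → A} (hc : ∀ j, ‖c j‖ ≤ 1) (x : ℂ) :
    Tendsto (fun n => partialQProd q c n x) atTop (𝓝 (qProd q c x)) := by
  have hs : Summable fun j => (x * q ^ j) • (partialQProd q c j x * c j) :=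
    Summable.of_norm_bounded
      ((summable_geometric_of_lt_one (norm_nonneg q) hq).mul_left _)
      (fun j => norm_qProd_term_le hq hc j (le_refl ‖x‖))
  have := hs.hasSum.tendsto_sum_nat.const_sub 1
  refine this.congr fun n => ?_
  rw [partialQProd_eq]

end QProd

/-! ### Zeros and functional equations of q-shifted factorials and theta functions. -/

section Basic

variable {q : ℂ}

theorem tendsto_qPochFin (hq : ‖q‖ < 1) (a : ℂ) :
    Tendsto (qPochFin q a) atTop (𝓝 (qPoch q a)) := by
  have hm : Multipliable fun j : ℕ => (1 - a * q ^ j) := by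
    have : Summable fun j : ℕ => ‖-(a * q ^ j)‖ := by
      simp only [norm_neg, norm_mul, norm_pow]
      exact (summable_geometric_of_lt_one (norm_nonneg _) hq).mul_left _
    simpa [sub_eq_add_neg] using multipliable_one_add_of_summable this
  exact hm.hasProd.tendsto_prod_nat

theorem qPoch_eq_qProd (hq : ‖q‖ < 1) (a : ℂ) : qPoch q a = qProd q (fun _ => (1 : ℂ)) a := by
  refine tendsto_nhds_unique (tendsto_qPochFin hq a) ?_
  refine (tendsto_partialQProd hq (c := fun _ => (1 : ℂ)) (by simp) a).congr fun n => ?_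
  simp [partialQProd, qPochFin]

theorem differentiable_qPoch (hq : ‖q‖ < 1) : Differentiable ℂ (qPoch q) := by
  have : qPoch q = qProd q (fun _ => (1 : ℂ)) := funext (qPoch_eq_qProd hq)
  rw [this]
  exact differentiable_qProd hq (by simp)

theorem continuous_qPoch (hq : ‖q‖ < 1) : Continuous (qPoch q) :=
  (differentiable_qPoch hq).continuous

@[simp]
theorem qPoch_zero (q : ℂ) : qPoch q 0 = 1 := by simp [qPoch]

@[simp]
theorem qPochFin_zero (q a : ℂ) : qPochFin q a 0 = 1 := by simp [qPochFin]

theorem qPochFin_succ (q a : ℂ) (n : ℕ) :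
    qPochFin q a (n + 1) = qPochFin q a n * (1 - a * q ^ n) := by
  simp [qPochFin, Finset.prod_range_succ]

theorem qPochFin_add (q a : ℂ) (m n : ℕ) :
    qPochFin q a (m + n) = qPochFin q a m * qPochFin q (a * q ^ m) n := by
  simp [qPochFin, Finset.prod_range_add, pow_add, mul_assoc]

theorem qPoch_eq_qPochFin_mul (hq : ‖q‖ < 1) (a : ℂ) (n : ℕ) :
    qPoch q a = qPochFin q a n * qPoch q (a * q ^ n) := by
  refine tendsto_nhds_unique ((tendsto_qPochFin hq a).comp (tendsto_add_atTop_nat n)) ?_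
  refine ((tendsto_qPochFin hq (a * q ^ n)).const_mul _).congr fun m => ?_
  simp [← qPochFin_add, add_comm]

theorem qPoch_step (hq : ‖q‖ < 1) (a : ℂ) : qPoch q a = (1 - a) * qPoch q (q * a) := by
  simpa [qPochFin, mul_comm] using qPoch_eq_qPochFin_mul hq a 1

theorem tendsto_mul_pow_zero (hq : ‖q‖ < 1) (a : ℂ) :
    Tendsto (fun n : ℕ => a * q ^ n) atTop (𝓝 0) := by
  simpa using (tendsto_pow_atTop_nhds_zero_of_norm_lt_one hq).const_mul a

theorem tendsto_qPoch_mul_pow (hq : ‖q‖ < 1) (a : ℂ) :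
    Tendsto (fun n : ℕ => qPoch q (a * q ^ n)) atTop (𝓝 1) := by
  have := ((continuous_qPoch hq).tendsto 0).comp (tendsto_mul_pow_zero hq a)
  rwa [qPoch_zero] at this

/-- The tails of the product tend to 1, so splitting off finitely many factors shows that the
product vanishes only through one of its factors. -/
theorem qPoch_eq_zero_iff (hq : ‖q‖ < 1) {a : ℂ} : qPoch q a = 0 ↔ ∃ n : ℕ, a * q ^ n = 1 := by
  constructor
  · intro h
    by_contra! hne
    obtain ⟨n, hn⟩ := ((tendsto_qPoch_mul_pow hq a).eventually_ne one_ne_zero).exists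
    rw [qPoch_eq_qPochFin_mul hq a n] at h
    refine mul_ne_zero ?_ hn h
    exact Finset.prod_ne_zero_iff.2 fun j _ => sub_ne_zero.2 (hne j).symm
  · rintro ⟨n, hn⟩
    rw [qPoch_eq_qPochFin_mul hq a (n + 1), qPochFin_succ, hn]
    simp

theorem qPoch_ne_zero (hq : ‖q‖ < 1) {a : ℂ} (h : ∀ n : ℕ, a * q ^ n ≠ 1) : qPoch q a ≠ 0 := by
  rw [Ne, qPoch_eq_zero_iff hq]
  push Not
  exact h

theorem qPoch_ne_zero_of_norm_lt (hq : ‖q‖ < 1) {a : ℂ} (h : ‖a‖ < 1) : qPoch q a ≠ 0 := by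
  refine qPoch_ne_zero hq fun n hn => ?_
  have h1 : ‖a * q ^ n‖ < 1 := by
    rw [norm_mul, norm_pow]
    calc ‖a‖ * ‖q‖ ^ n ≤ ‖a‖ * 1 := by gcongr; exact pow_le_one₀ (norm_nonneg _) hq.le
      _ < 1 := by linarith
  rw [hn] at h1
  simp at h1

theorem qPoch_self_ne_zero (hq : ‖q‖ < 1) : qPoch q q ≠ 0 := qPoch_ne_zero_of_norm_lt hq hq

theorem ne_one_of_qPoch_ne_zero (hq : ‖q‖ < 1) {a : ℂ} (h : qPoch q a ≠ 0) (n : ℕ) :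
    a * q ^ n ≠ 1 := fun hn => h ((qPoch_eq_zero_iff hq).2 ⟨n, hn⟩)

theorem qPochFin_ne_zero {a : ℂ} (h : ∀ n : ℕ, a * q ^ n ≠ 1) (n : ℕ) : qPochFin q a n ≠ 0 :=
  Finset.prod_ne_zero_iff.2 fun j _ => sub_ne_zero.2 (h j).symm

theorem qPochFin_ne_zero_of_qPoch (hq : ‖q‖ < 1) {a : ℂ} (h : qPoch q a ≠ 0) (n : ℕ) :
    qPochFin q a n ≠ 0 := qPochFin_ne_zero (ne_one_of_qPoch_ne_zero hq h) n

theorem qPoch_mul_pow_ne_zero (hq : ‖q‖ < 1) {a : ℂ} (h : qPoch q a ≠ 0) (n : ℕ) :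
    qPoch q (a * q ^ n) ≠ 0 := by
  intro h0
  rw [qPoch_eq_qPochFin_mul hq a n, h0] at h
  simp at h

/-- The shift relation `θ(q x) = -x⁻¹ θ(x)`. -/
theorem theta_q_mul (hq0 : q ≠ 0) (hq : ‖q‖ < 1) {x : ℂ} (hx : x ≠ 0) :
    theta q (q * x) = -x⁻¹ * theta q x := by
  unfold theta
  rw [qPoch_step hq x, show q / (q * x) = 1 / x by field_simp, qPoch_step hq (1 / x),
    show q * (1 / x) = q / x by ring]
  field_simp
  ring

theorem theta_inv (hq : ‖q‖ < 1) {x : ℂ} (hx : x ≠ 0) :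
    theta q x⁻¹ = -x⁻¹ * theta q x := by
  unfold theta
  rw [show q / x⁻¹ = q * x by simp, qPoch_step hq x⁻¹, qPoch_step hq x, div_eq_mul_inv]
  field_simp
  ring

theorem theta_eq_zero_iff (hq0 : q ≠ 0) (hq : ‖q‖ < 1) {x : ℂ} (hx : x ≠ 0) :
    theta q x = 0 ↔ ∃ k : ℤ, x = q ^ k := by
  unfold theta
  rw [mul_eq_zero, qPoch_eq_zero_iff hq, qPoch_eq_zero_iff hq]
  constructor
  · rintro (⟨n, hn⟩ | ⟨n, hn⟩)
    · exact ⟨-n, by rw [zpow_neg, zpow_natCast]; exact eq_inv_of_mul_eq_one_left hn⟩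
    · refine ⟨(n + 1 : ℕ), ?_⟩
      rw [zpow_natCast, pow_succ]
      field_simp at hn
      rw [← hn]; ring
  · rintro ⟨k, rfl⟩
    rcases le_or_gt k 0 with hk | hk
    · left
      obtain ⟨n, rfl⟩ := Int.exists_eq_neg_ofNat hk
      exact ⟨n, by rw [zpow_neg, zpow_natCast]; exact inv_mul_cancel₀ (pow_ne_zero _ hq0)⟩
    · right
      obtain ⟨n, rfl⟩ : ∃ n : ℕ, k = (n + 1 : ℕ) := ⟨(k - 1).toNat, by omega⟩
      refine ⟨n, ?_⟩
      rw [zpow_natCast, pow_succ]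
      field_simp

end Basic

/-! ### Joint analyticity of very-well-poised series in their parameters. -/

section VwpSum

variable {q : ℂ}

/-- The terms of `vwpSum`. -/
def vwpTerm (q c : ℂ) {ι : Type*} [Fintype ι] (a b : ι → ℂ) (n : ℕ) : ℂ :=
  (1 - c * q ^ (2 * n)) * ∏ i, (qPoch q (a i * q ^ n) * qPochFin q (b i) n)

/-- The renormalized very-well-poised series
`∑ₙ qⁿ (1 - c q^(2n)) ∏ᵢ (aᵢ qⁿ; q)_∞ (bᵢ; q)ₙ`, which has no denominators. -/
def vwpSum (q c : ℂ) {ι : Type*} [Fintype ι] (a b : ι → ℂ) : ℂ :=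
  ∑' n : ℕ, q ^ n * vwpTerm q c a b n

open BoundedContinuousFunction

/-- The sequence of indicators of `{n | P n}` as a bounded sequence. -/
def boundedIndicator (P : ℕ → Prop) [DecidablePred P] : ℕ →ᵇ ℂ :=
  BoundedContinuousFunction.ofNormedAddCommGroup (fun n => if P n then 1 else 0)
    continuous_of_discreteTopology 1 (fun n => by split_ifs <;> simp)

/-- The sequence `(r^n)_n` as a bounded sequence, for `‖r‖ ≤ 1`. -/
def boundedGeom (r : ℂ) (hr : ‖r‖ ≤ 1) : ℕ →ᵇ ℂ :=
  BoundedContinuousFunction.ofNormedAddCommGroup (fun n => r ^ n)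
    continuous_of_discreteTopology 1 (fun n => by
      rw [norm_pow]; exact pow_le_one₀ (norm_nonneg _) hr)

/-- Evaluation at `n` is continuous and multiplicative, so it carries the Banach-algebra product to
the scalar one. -/
theorem qProd_apply (hq : ‖q‖ < 1) {c : ℕ → (ℕ →ᵇ ℂ)} (hc : ∀ j, ‖c j‖ ≤ 1) (x : ℂ) (n : ℕ) :
    Tendsto (fun N => ∏ j ∈ Finset.range N, (1 - x * q ^ j * c j n)) atTop
      (𝓝 (qProd q c x n)) := by
  have h1 := ((BoundedContinuousFunction.evalCLM ℂ n).continuous.tendsto _).comp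
    (tendsto_partialQProd hq hc x)
  refine h1.congr fun N => ?_
  simp [partialQProd]

/-- The entire function `x ↦ ((x qⁿ; q)_∞)ₙ` with values in bounded sequences. -/
def qPochSeq (q : ℂ) (hq : ‖q‖ < 1) : ℂ → (ℕ →ᵇ ℂ) := qProd q fun _ => boundedGeom q hq.le

/-- The entire function `x ↦ ((x; q)ₙ)ₙ` with values in bounded sequences. -/
def qPochFinSeq (q : ℂ) : ℂ → (ℕ →ᵇ ℂ) := qProd q fun j => boundedIndicator fun n => j < n

theorem norm_boundedGeom_le (r : ℂ) (hr : ‖r‖ ≤ 1) : ‖boundedGeom r hr‖ ≤ 1 :=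
  BoundedContinuousFunction.norm_ofNormedAddCommGroup_le _ zero_le_one _

theorem norm_boundedIndicator_le (P : ℕ → Prop) [DecidablePred P] : ‖boundedIndicator P‖ ≤ 1 :=
  BoundedContinuousFunction.norm_ofNormedAddCommGroup_le _ zero_le_one _

theorem qPochSeq_apply (hq : ‖q‖ < 1) (x : ℂ) (n : ℕ) :
    qPochSeq q hq x n = qPoch q (x * q ^ n) := by
  refine tendsto_nhds_unique (qProd_apply hq (fun _ => norm_boundedGeom_le _ _) x n) ?_
  refine (tendsto_qPochFin hq (x * q ^ n)).congr fun N => ?_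
  simp only [qPochFin, boundedGeom, BoundedContinuousFunction.coe_ofNormedAddCommGroup]
  exact Finset.prod_congr rfl fun j _ => by ring

/-- At position `n` the indicator coefficients turn every factor with `j ≥ n` into 1, so the
infinite product is a finite one. -/
theorem qPochFinSeq_apply (hq : ‖q‖ < 1) (x : ℂ) (n : ℕ) :
    qPochFinSeq q x n = qPochFin q x n := by
  refine tendsto_nhds_unique (qProd_apply hq (fun _ => norm_boundedIndicator_le _) x n) ?_
  refine tendsto_const_nhds.congr' ?_
  filter_upwards [eventually_ge_atTop n] with N hN
  rw [qPochFin, ← Finset.prod_subset (Finset.range_subset_range.2 hN)]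
  · refine Finset.prod_congr rfl fun j hj => ?_
    simp [boundedIndicator, Finset.mem_range.1 hj]
  · intro j _ hj
    simp [boundedIndicator, Finset.mem_range.not.1 hj]

theorem norm_pow_mul_le (q : ℂ) (f : ℕ →ᵇ ℂ) (n : ℕ) :
    ‖q ^ n * f n‖ ≤ ‖q‖ ^ n * ‖f‖ := by
  rw [norm_mul, norm_pow]
  gcongr
  exact f.norm_coe_le_norm n

theorem summable_pow_mul (hq : ‖q‖ < 1) (f : ℕ →ᵇ ℂ) : Summable fun n => q ^ n * f n :=
  Summable.of_norm_bounded ((summable_geometric_of_lt_one (norm_nonneg _) hq).mul_right _)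
    (norm_pow_mul_le q f)

/-- The functional `f ↦ ∑ₙ qⁿ f(n)` on bounded sequences. -/
def geomFunctional (q : ℂ) (hq : ‖q‖ < 1) : (ℕ →ᵇ ℂ) →L[ℂ] ℂ :=
  LinearMap.mkContinuous
    { toFun := fun f => ∑' n, q ^ n * f n
      map_add' := fun f g => by
        simp only [BoundedContinuousFunction.coe_add, Pi.add_apply, mul_add]
        exact (summable_pow_mul hq f).tsum_add (summable_pow_mul hq g)
      map_smul' := fun c f => by
        simp only [BoundedContinuousFunction.coe_smul, smul_eq_mul, RingHom.id_apply,
          ← tsum_mul_left]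
        exact tsum_congr fun n => by ring }
    (1 - ‖q‖)⁻¹ (fun f => by
      refine tsum_of_norm_bounded (g := fun n => ‖q‖ ^ n * ‖f‖) ?_ (norm_pow_mul_le q f)
      exact (hasSum_geometric_of_lt_one (norm_nonneg _) hq).mul_right _)

/-- The bounded sequence of the terms of `vwpSum`. -/
def vwpSeq (q : ℂ) (hq : ‖q‖ < 1) (c : ℂ) {ι : Type*} [Fintype ι] (a b : ι → ℂ) : ℕ →ᵇ ℂ :=
  (1 - c • boundedGeom (q ^ 2) (by rw [norm_pow]; exact pow_le_one₀ (norm_nonneg _) hq.le)) *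
    ∏ i, (qPochSeq q hq (a i) * qPochFinSeq q (b i))

theorem vwpSeq_apply (hq : ‖q‖ < 1) (c : ℂ) {ι : Type*} [Fintype ι] (a b : ι → ℂ) (n : ℕ) :
    vwpSeq q hq c a b n = vwpTerm q c a b n := by
  simp [vwpSeq, vwpTerm, qPochSeq_apply hq, qPochFinSeq_apply hq, boundedGeom, pow_mul]

theorem vwpSum_eq_geomFunctional (hq : ‖q‖ < 1) (c : ℂ) {ι : Type*} [Fintype ι] (a b : ι → ℂ) :
    vwpSum q c a b = geomFunctional q hq (vwpSeq q hq c a b) := by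
  simp only [vwpSum, ← vwpSeq_apply hq]
  rfl

theorem hasSum_vwpSum (hq : ‖q‖ < 1) (c : ℂ) {ι : Type*} [Fintype ι] (a b : ι → ℂ) :
    HasSum (fun n => q ^ n * vwpTerm q c a b n) (vwpSum q c a b) := by
  have := (summable_pow_mul hq (vwpSeq q hq c a b)).hasSum
  simp only [vwpSeq_apply hq] at this
  exact this

theorem exists_norm_vwpTerm_le (hq : ‖q‖ < 1) (c : ℂ) {ι : Type*} [Fintype ι] (a b : ι → ℂ) :
    ∃ C, ∀ n, ‖vwpTerm q c a b n‖ ≤ C :=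
  ⟨‖vwpSeq q hq c a b‖, fun n => by
    rw [← vwpSeq_apply hq]; exact BoundedContinuousFunction.norm_coe_le_norm _ n⟩

/-- The sum is a bounded linear functional of a product of entire functions with values in bounded
sequences. Thus one-variable analyticity of each factor suffices, and no uniform estimate in several
variables is needed. -/
theorem analyticAt_vwpSum (hq : ‖q‖ < 1) {E : Type*} [NormedAddCommGroup E] [NormedSpace ℂ E]
    {ι : Type*} [Fintype ι] {c : E → ℂ} {a b : E → ι → ℂ} {w : E} (hc : AnalyticAt ℂ c w)
    (ha : ∀ i, AnalyticAt ℂ (fun w => a w i) w) (hb : ∀ i, AnalyticAt ℂ (fun w => b w i) w) :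
    AnalyticAt ℂ (fun w => vwpSum q (c w) (a w) (b w)) w := by
  simp only [vwpSum_eq_geomFunctional hq]
  refine ((geomFunctional q hq).analyticAt _).comp ?_
  unfold vwpSeq
  refine (analyticAt_const.sub (hc.smul analyticAt_const)).mul ?_
  refine Finset.analyticAt_fun_prod _ fun i _ => ?_
  have h1 : AnalyticAt ℂ (qPochSeq q hq) (a w i) :=
    (differentiable_qProd hq fun _ => norm_boundedGeom_le _ _).analyticAt _
  have h2 : AnalyticAt ℂ (qPochFinSeq q) (b w i) :=
    (differentiable_qProd hq fun _ => norm_boundedIndicator_le _).analyticAt _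
  exact (h1.comp_of_eq (ha i) rfl).mul (h2.comp_of_eq (hb i) rfl)

theorem analyticAt_qPoch (hq : ‖q‖ < 1) {E : Type*} [NormedAddCommGroup E] [NormedSpace ℂ E]
    {f : E → ℂ} {w : E} (hf : AnalyticAt ℂ f w) : AnalyticAt ℂ (fun w => qPoch q (f w)) w :=
  ((differentiable_qPoch hq).analyticAt _).comp hf

theorem analyticAt_theta (hq : ‖q‖ < 1) {E : Type*} [NormedAddCommGroup E] [NormedSpace ℂ E]
    {f : E → ℂ} {w : E} (hf : AnalyticAt ℂ f w) (h0 : f w ≠ 0) :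
    AnalyticAt ℂ (fun w => theta q (f w)) w :=
  (analyticAt_qPoch hq hf).mul (analyticAt_qPoch hq (analyticAt_const.div hf h0))

end VwpSum

/-! ### Cauchy's theorem and the residue theorem for loops in an annulus, in terms of winding
numbers. -/

section Loops

/-- A `C¹` closed curve parametrized by `[0, 2π]`. -/
structure IsLoop (γ : ℝ → ℂ) : Prop where
  contDiff : ContDiff ℝ 1 γ
  periodic : Function.Periodic γ (2 * Real.pi)

variable {γ γ₁ γ₂ : ℝ → ℂ}

theorem IsSeparatingLoop.isLoop {A B : Set ℂ} (h : IsSeparatingLoop γ A B) : IsLoop γ :=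
  ⟨h.contDiff, h.periodic⟩

theorem IsLoop.continuous (h : IsLoop γ) : Continuous γ := h.contDiff.continuous

theorem IsLoop.continuous_deriv (h : IsLoop γ) : Continuous (deriv γ) :=
  h.contDiff.continuous_deriv le_rfl

theorem IsLoop.hasDerivAt (h : IsLoop γ) (θ : ℝ) : HasDerivAt γ (deriv γ θ) θ :=
  ((h.contDiff.differentiable one_ne_zero) θ).hasDerivAt

theorem IsLoop.apply_two_pi (h : IsLoop γ) : γ (2 * Real.pi) = γ 0 := by
  simpa using h.periodic 0

theorem IsLoop.continuous_integrand (h : IsLoop γ) {f : ℂ → ℂ} {s : Set ℂ}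
    (hf : ContinuousOn f s) (hs : ∀ θ, γ θ ∈ s) : Continuous fun θ => f (γ θ) * deriv γ θ :=
  (hf.comp_continuous h.continuous hs).mul h.continuous_deriv

theorem loopIntegral_congr {f g : ℂ → ℂ} (h : ∀ θ, f (γ θ) = g (γ θ)) :
    loopIntegral γ f = loopIntegral γ g := by
  simp only [loopIntegral, h]

theorem loopIntegral_const_mul (c : ℂ) (f : ℂ → ℂ) :
    loopIntegral γ (fun z => c * f z) = c * loopIntegral γ f := by
  simp only [loopIntegral, mul_assoc, intervalIntegral.integral_const_mul]

theorem IsLoop.loopIntegral_add (h : IsLoop γ) {f g : ℂ → ℂ} {s : Set ℂ}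
    (hf : ContinuousOn f s) (hg : ContinuousOn g s) (hs : ∀ θ, γ θ ∈ s) :
    loopIntegral γ (fun z => f z + g z) = loopIntegral γ f + loopIntegral γ g := by
  simp only [loopIntegral, add_mul]
  exact intervalIntegral.integral_add
    ((h.continuous_integrand hf hs).intervalIntegrable _ _)
    ((h.continuous_integrand hg hs).intervalIntegrable _ _)

theorem IsLoop.loopIntegral_sub (h : IsLoop γ) {f g : ℂ → ℂ} {s : Set ℂ}
    (hf : ContinuousOn f s) (hg : ContinuousOn g s) (hs : ∀ θ, γ θ ∈ s) :
    loopIntegral γ (fun z => f z - g z) = loopIntegral γ f - loopIntegral γ g := by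
  simp only [loopIntegral, sub_mul]
  exact intervalIntegral.integral_sub
    ((h.continuous_integrand hf hs).intervalIntegrable _ _)
    ((h.continuous_integrand hg hs).intervalIntegrable _ _)

theorem IsLoop.loopIntegral_eq_zero_of_hasDerivAt (h : IsLoop γ) {f F : ℂ → ℂ} {s : Set ℂ}
    (hf : ContinuousOn f s) (hs : ∀ θ, γ θ ∈ s) (hF : ∀ z ∈ s, HasDerivAt F (f z) z) :
    loopIntegral γ f = 0 := by
  rw [loopIntegral, intervalIntegral.integral_eq_sub_of_hasDerivAt (f := fun θ => F (γ θ))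
    (fun θ _ => (hF _ (hs θ)).comp θ (h.hasDerivAt θ))
    ((h.continuous_integrand hf hs).intervalIntegrable _ _), h.apply_two_pi, sub_self]

/-- A loop in the punctured plane lifts to a curve under the exponential. -/
theorem IsLoop.exists_lift (h : IsLoop γ) (h0 : ∀ θ, γ θ ≠ 0) :
    ∃ w : ℝ → ℂ, (∀ θ, HasDerivAt w (deriv γ θ / γ θ) θ) ∧ (∀ θ, Complex.exp (w θ) = γ θ) ∧
      w (2 * Real.pi) = w 0 + 2 * Real.pi * Complex.I * windingNumber γ 0 := by
  have hc : Continuous fun θ => deriv γ θ / γ θ := h.continuous_deriv.div h.continuous h0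
  let w : ℝ → ℂ := fun θ => Complex.log (γ 0) + ∫ s in (0 : ℝ)..θ, deriv γ s / γ s
  have hw : ∀ θ, HasDerivAt w (deriv γ θ / γ θ) θ := fun θ =>
    (hc.integral_hasStrictDerivAt 0 θ).hasDerivAt.const_add _
  refine ⟨w, hw, fun θ => ?_, ?_⟩
  -- The quotient of `γ` by `exp ∘ w` has derivative zero and starts at 1.
  · have hd : ∀ θ, HasDerivAt (fun θ => Complex.exp (-w θ) * γ θ) 0 θ := fun θ => by
      have h1 := ((hw θ).neg.cexp).mul (h.hasDerivAt θ)
      refine h1.congr_deriv ?_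
      have := h0 θ
      field_simp
      ring
    have h1 := is_const_of_deriv_eq_zero (fun θ => (hd θ).differentiableAt)
      (fun θ => (hd θ).deriv) θ 0
    simp only [w, intervalIntegral.integral_same, add_zero, Complex.exp_neg,
      Complex.exp_log (h0 0), inv_mul_cancel₀ (h0 0)] at h1
    rw [inv_mul_eq_one₀ (Complex.exp_ne_zero _)] at h1
    exact h1
  · have : (2 * Real.pi * Complex.I : ℂ) ≠ 0 := Complex.two_pi_I_ne_zero
    simp only [w, windingNumber, loopIntegral, intervalIntegral.integral_same, add_zero, sub_zero]
    rw [← mul_assoc, mul_inv_cancel₀ this, one_mul]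
    congr 2
    ext θ
    rw [div_eq_inv_mul]

/-- The open annulus `r < |z| < R`. -/
def annulus (r R : ℝ) : Set ℂ := {z | r < ‖z‖ ∧ ‖z‖ < R}

theorem isOpen_annulus (r R : ℝ) : IsOpen (annulus r R) :=
  (isOpen_lt continuous_const continuous_norm).inter (isOpen_lt continuous_norm continuous_const)

theorem ne_zero_of_mem_annulus {r R : ℝ} (hr : 0 < r) {z : ℂ} (hz : z ∈ annulus r R) : z ≠ 0 :=
  norm_pos_iff.1 (hr.trans hz.1)

/-- Cauchy's theorem for a holomorphic function on an annulus. -/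
theorem loopIntegral_eq_of_differentiableOn {r R : ℝ} (hr : 0 < r) (h₁ : IsLoop γ₁)
    (h₂ : IsLoop γ₂) (m₁ : ∀ θ, γ₁ θ ∈ annulus r R) (m₂ : ∀ θ, γ₂ θ ∈ annulus r R)
    (hw : windingNumber γ₁ 0 = windingNumber γ₂ 0) {h : ℂ → ℂ}
    (hh : DifferentiableOn ℂ h (annulus r R)) : loopIntegral γ₁ h = loopIntegral γ₂ h := by
  -- The exponential covers the annulus by a vertical strip. The strip is convex, so the pulled-back
  -- integrand has a primitive `H` there, and a loop integral is the increment of `H` along a lift.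
  let S : Set ℂ := {w | Real.log r < w.re ∧ w.re < Real.log R}
  have hS : Convex ℝ S :=
    (convex_halfSpace_re_gt _).inter (convex_halfSpace_re_lt _)
  have hSo : IsOpen S := (isOpen_lt continuous_const Complex.continuous_re).inter
    (isOpen_lt Complex.continuous_re continuous_const)
  have hRpos : 0 < R := hr.trans ((m₁ 0).1.trans (m₁ 0).2)
  have hSmem : ∀ w, w ∈ S ↔ Complex.exp w ∈ annulus r R := fun w => by
    simp only [S, annulus, Set.mem_ofPred_eq, Complex.norm_exp]
    rw [Real.log_lt_iff_lt_exp hr, Real.lt_log_iff_exp_lt hRpos]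
  have hF : DifferentiableOn ℂ (fun w => h (Complex.exp w) * Complex.exp w) S :=
    (hh.comp Complex.differentiable_exp.differentiableOn fun w hw => (hSmem w).1 hw).mul
      Complex.differentiable_exp.differentiableOn
  obtain ⟨H, hH'⟩ := hS.exists_forall_hasDerivWithinAt hF
  have hH : ∀ w ∈ S, HasDerivAt H (h (Complex.exp w) * Complex.exp w) w := fun w hw =>
    (hH' w hw).hasDerivAt (hSo.mem_nhds hw)
  have key : ∀ γ : ℝ → ℂ, IsLoop γ → (∀ θ, γ θ ∈ annulus r R) →
      ∃ w₀ ∈ S, Complex.exp (2 * Real.pi * Complex.I * windingNumber γ 0) = 1 ∧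
        loopIntegral γ h = H (w₀ + 2 * Real.pi * Complex.I * windingNumber γ 0) - H w₀ := by
    intro γ hγ m
    have h0 : ∀ θ, γ θ ≠ 0 := fun θ => ne_zero_of_mem_annulus hr (m θ)
    obtain ⟨w, hw1, hw2, hw3⟩ := hγ.exists_lift h0
    have hmem : ∀ θ, w θ ∈ S := fun θ => by rw [hSmem, hw2]; exact m θ
    refine ⟨w 0, hmem 0, ?_, ?_⟩
    · have h1 := hw2 (2 * Real.pi)
      rw [hw3, Complex.exp_add, hw2, hγ.apply_two_pi] at h1
      exact mul_left_cancel₀ (h0 0) (by rw [h1, mul_one])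
    · rw [← hw3, loopIntegral]
      refine intervalIntegral.integral_eq_sub_of_hasDerivAt (f := fun θ => H (w θ))
        (fun θ _ => ?_) ((hγ.continuous_integrand hh.continuousOn m).intervalIntegrable _ _)
      have h1 := (hH _ (hmem θ)).comp θ (hw1 θ)
      rw [hw2] at h1
      refine h1.congr_deriv ?_
      rw [mul_assoc, mul_div_cancel₀ _ (h0 θ)]
  obtain ⟨w₁, hw₁, he, e₁⟩ := key γ₁ h₁ m₁
  obtain ⟨w₂, hw₂, -, e₂⟩ := key γ₂ h₂ m₂
  rw [e₁, e₂, ← hw]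
  set c := 2 * Real.pi * Complex.I * windingNumber γ₁ 0 with hc
  -- Since `exp c = 1`, the increment has derivative zero on the strip. Hence it does not matter
  -- that the two lifts start at different points.
  have hd : ∀ w ∈ S, HasDerivWithinAt (fun w => H (w + c) - H w) 0 S w := fun w hw => by
    have hwc : w + c ∈ S := by rw [hSmem, Complex.exp_add, he, mul_one, ← hSmem]; exact hw
    have h1 := (hH _ hwc).comp_add_const w c
    rw [Complex.exp_add, he, mul_one] at h1
    exact ((h1.sub (hH w hw)).congr_deriv (sub_self _)).hasDerivWithinAt
  have := hS.norm_image_sub_le_of_norm_hasDerivWithin_le (C := 0) hd (by simp) hw₂ hw₁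
  rw [zero_mul, norm_le_zero_iff, sub_eq_zero] at this
  exact this

theorem windingNumber_eq (a : ℂ) :
    loopIntegral γ (fun z => (z - a)⁻¹) = 2 * Real.pi * Complex.I * windingNumber γ a := by
  have : (2 * Real.pi * Complex.I : ℂ) ≠ 0 := Complex.two_pi_I_ne_zero
  rw [windingNumber, ← mul_assoc, mul_inv_cancel₀ this, one_mul]

theorem IsLoop.loopIntegral_sub_pow_inv (h : IsLoop γ) {a : ℂ} (ha : ∀ θ, γ θ ≠ a) {n : ℕ}
    (hn : 2 ≤ n) : loopIntegral γ (fun z => ((z - a) ^ n)⁻¹) = 0 := by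
  obtain ⟨m, rfl⟩ : ∃ m, n = m + 2 := ⟨n - 2, by omega⟩
  have hne : ∀ z ∈ ({a}ᶜ : Set ℂ), z - a ≠ 0 := fun z hz => sub_ne_zero.2 hz
  refine h.loopIntegral_eq_zero_of_hasDerivAt (s := {a}ᶜ)
    (F := fun z => -((m : ℂ) + 1)⁻¹ * ((z - a) ^ (m + 1))⁻¹) ?_ ha ?_
  · exact ContinuousOn.inv₀ (by fun_prop) fun z hz => pow_ne_zero _ (hne z hz)
  · intro z hz
    have h1 : HasDerivAt (fun z : ℂ => z - a) 1 z := (hasDerivAt_id z).sub_const a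
    have h2 := ((h1.pow (m + 1)).inv (pow_ne_zero _ (hne z hz))).const_mul (-((m : ℂ) + 1)⁻¹)
    refine h2.congr_deriv ?_
    have : (m : ℂ) + 1 ≠ 0 := by exact_mod_cast Nat.succ_ne_zero m
    have := hne z hz
    push_cast
    simp only [Pi.pow_apply]
    field_simp
    ring

theorem multiset_prod_sub_eq_pow {C : Multiset ℂ} {a : ℂ} (hC : ∀ c ∈ C, c = a) (z : ℂ) :
    (C.map fun b => z - b).prod = (z - a) ^ C.card := by
  conv_lhs => rw [Multiset.eq_replicate_card.2 hC]
  rw [Multiset.map_replicate, Multiset.prod_replicate]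

theorem multiset_prod_sub_ne_zero {C : Multiset ℂ} {z : ℂ} (hz : z ∉ C) :
    (C.map fun b => z - b).prod ≠ 0 := by
  refine Multiset.prod_ne_zero fun h0 => hz ?_
  obtain ⟨c, hc, hc0⟩ := Multiset.mem_map.1 h0
  rwa [sub_eq_zero.1 hc0]

theorem differentiable_multiset_prod_sub (C : Multiset ℂ) :
    Differentiable ℂ fun z => (C.map fun b => z - b).prod := by
  induction C using Multiset.induction_on with
  | empty => simp
  | cons a C ih =>
    simp only [Multiset.map_cons, Multiset.prod_cons]
    fun_prop

theorem continuousOn_div_multiset_prod {g : ℂ → ℂ} {s : Set ℂ} (hg : ContinuousOn g s)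
    (C : Multiset ℂ) :
    ContinuousOn (fun z => g z / (C.map fun b => z - b).prod) (s ∩ {z | z ∉ C}) := by
  refine (hg.mono Set.inter_subset_left).div ?_ ?_
  · exact (differentiable_multiset_prod_sub C).continuous.continuousOn
  · exact fun z hz => multiset_prod_sub_ne_zero hz.2

/-- Cauchy's theorem on an annulus for a quotient by a polynomial with given roots. -/
theorem loopIntegral_div_prod_eq {r R : ℝ} (hr : 0 < r) (h₁ : IsLoop γ₁)
    (h₂ : IsLoop γ₂) (m₁ : ∀ θ, γ₁ θ ∈ annulus r R) (m₂ : ∀ θ, γ₂ θ ∈ annulus r R)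
    (hw : windingNumber γ₁ 0 = windingNumber γ₂ 0) (B : Multiset ℂ)
    (hB₁ : ∀ b ∈ B, ∀ θ, γ₁ θ ≠ b) (hB₂ : ∀ b ∈ B, ∀ θ, γ₂ θ ≠ b)
    (hB : ∀ b ∈ B, windingNumber γ₁ b = windingNumber γ₂ b) {h : ℂ → ℂ}
    (hh : DifferentiableOn ℂ h (annulus r R)) :
    loopIntegral γ₁ (fun z => h z / (B.map fun b => z - b).prod) =
      loopIntegral γ₂ (fun z => h z / (B.map fun b => z - b).prod) := by
  induction hn : B.card using Nat.strong_induction_on generalizing B h with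
  | _ n ih =>
  have key : ∀ (C : Multiset ℂ) (g : ℂ → ℂ), DifferentiableOn ℂ g (annulus r R) →
      ContinuousOn (fun z => g z / (C.map fun b => z - b).prod)
        (annulus r R ∩ {z | z ∉ C}) := fun C g hg => continuousOn_div_multiset_prod hg.continuousOn C
  rcases B.empty_or_exists_mem with rfl | ⟨a, haB⟩
  · simpa using loopIntegral_eq_of_differentiableOn hr h₁ h₂ m₁ m₂ hw hh
  obtain ⟨C, rfl⟩ := Multiset.exists_cons_of_mem haB
  rw [Multiset.card_cons] at hn
  -- Two different roots are separated by partial fractions, which lowers the number of roots by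
  -- one. When all roots coincide, the single multiple pole is treated directly.
  by_cases hC : ∃ b ∈ C, b ≠ a
  · obtain ⟨b, hbC, hba⟩ := hC
    obtain ⟨D, rfl⟩ := Multiset.exists_cons_of_mem hbC
    rw [Multiset.card_cons] at hn
    have aux : ∀ γ : ℝ → ℂ, IsLoop γ → (∀ θ, γ θ ∈ annulus r R) →
        (∀ c ∈ a ::ₘ b ::ₘ D, ∀ θ, γ θ ≠ c) →
        loopIntegral γ (fun z => h z / ((a ::ₘ b ::ₘ D).map fun b => z - b).prod) =
          (a - b)⁻¹ * loopIntegral γ (fun z => h z / ((a ::ₘ D).map fun b => z - b).prod) -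
          (a - b)⁻¹ * loopIntegral γ (fun z => h z / ((b ::ₘ D).map fun b => z - b).prod) := by
      intro γ hγ m hm
      rw [← loopIntegral_const_mul, ← loopIntegral_const_mul,
        ← hγ.loopIntegral_sub (s := annulus r R ∩ {z | z ∉ a ::ₘ b ::ₘ D})]
      · refine loopIntegral_congr fun θ => ?_
        have ha : γ θ - a ≠ 0 := sub_ne_zero.2 (hm a (by simp) θ)
        have hb : γ θ - b ≠ 0 := sub_ne_zero.2 (hm b (by simp) θ)
        have hab : a - b ≠ 0 := sub_ne_zero.2 hba.symm
        have hD : (D.map fun b => γ θ - b).prod ≠ 0 := by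
          refine Multiset.prod_ne_zero fun h0 => ?_
          obtain ⟨c, hc, hc0⟩ := Multiset.mem_map.1 h0
          exact hm c (by simp [hc]) θ (sub_eq_zero.1 hc0)
        simp only [Multiset.map_cons, Multiset.prod_cons]
        field_simp
        ring
      · refine continuousOn_const.mul ((key _ _ hh).mono ?_)
        rintro z ⟨hz, hz'⟩
        refine ⟨hz, fun h => hz' ?_⟩
        simp only [Multiset.mem_cons] at h ⊢
        tauto
      · refine continuousOn_const.mul ((key _ _ hh).mono ?_)
        rintro z ⟨hz, hz'⟩
        refine ⟨hz, fun h => hz' ?_⟩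
        simp only [Multiset.mem_cons] at h ⊢
        tauto
      · exact fun θ => ⟨m θ, fun h => hm _ h θ rfl⟩
    have hsub : ∀ c ∈ a ::ₘ D, c ∈ a ::ₘ b ::ₘ D := fun c hc => by
      simp only [Multiset.mem_cons] at hc ⊢; tauto
    have hsub' : ∀ c ∈ b ::ₘ D, c ∈ a ::ₘ b ::ₘ D := fun c hc => by
      simp only [Multiset.mem_cons] at hc ⊢; tauto
    rw [aux γ₁ h₁ m₁ hB₁, aux γ₂ h₂ m₂ hB₂,
      ih (D.card + 1) (by omega) (a ::ₘ D) (fun c hc => hB₁ c (hsub c hc))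
        (fun c hc => hB₂ c (hsub c hc)) (fun c hc => hB c (hsub c hc)) hh (by simp),
      ih (D.card + 1) (by omega) (b ::ₘ D) (fun c hc => hB₁ c (hsub' c hc))
        (fun c hc => hB₂ c (hsub' c hc)) (fun c hc => hB c (hsub' c hc)) hh (by simp)]
  push Not at hC
  have ha₁ := hB₁ a (by simp)
  have ha₂ := hB₂ a (by simp)
  -- For a pole in the annulus, `dslope` splits off a pure power of `z - a`. Its integral is a
  -- winding number for order one and zero for higher order. A pole outside the annulus leaves the
  -- quotient holomorphic.
  by_cases ha : a ∈ annulus r R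
  · have hopen : annulus r R ∈ 𝓝 a := (isOpen_annulus r R).mem_nhds ha
    have hd : DifferentiableOn ℂ (dslope h a) (annulus r R) :=
      (Complex.differentiableOn_dslope hopen).2 hh
    have aux : ∀ γ : ℝ → ℂ, IsLoop γ → (∀ θ, γ θ ∈ annulus r R) → (∀ θ, γ θ ≠ a) →
        loopIntegral γ (fun z => h z / ((a ::ₘ C).map fun b => z - b).prod) =
          loopIntegral γ (fun z => dslope h a z / (C.map fun b => z - b).prod) +
          h a * loopIntegral γ (fun z => ((z - a) ^ (C.card + 1))⁻¹) := by
      intro γ hγ m hm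
      have hne : ∀ z ∈ annulus r R ∩ {z | z ≠ a}, z - a ≠ 0 := fun z hz => sub_ne_zero.2 hz.2
      rw [← loopIntegral_const_mul, ← hγ.loopIntegral_add (s := annulus r R ∩ {z | z ≠ a})]
      · refine loopIntegral_congr fun θ => ?_
        have ha : γ θ - a ≠ 0 := sub_ne_zero.2 (hm θ)
        have hC' := multiset_prod_sub_eq_pow hC (γ θ)
        have hs : h (γ θ) = h a + (γ θ - a) * dslope h a (γ θ) := by
          have := sub_smul_dslope h a (γ θ)
          rw [smul_eq_mul] at this
          rw [this]; ring
        rw [Multiset.map_cons, Multiset.prod_cons, hC', hs]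
        field_simp
        ring
      · refine (key _ _ hd).mono fun z hz => ⟨hz.1, fun h => hz.2 (hC z h)⟩
      · exact continuousOn_const.mul (ContinuousOn.inv₀ (by fun_prop)
          fun z hz => pow_ne_zero _ (hne z hz))
      · exact fun θ => ⟨m θ, hm θ⟩
    rw [aux γ₁ h₁ m₁ ha₁, aux γ₂ h₂ m₂ ha₂,
      ih C.card (by omega) C (fun c hc => hB₁ c (by simp [hc]))
        (fun c hc => hB₂ c (by simp [hc])) (fun c hc => hB c (by simp [hc])) hd rfl]
    congr 2
    rcases Nat.eq_zero_or_pos C.card with h0 | hpos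
    · simp only [h0, zero_add, pow_one, windingNumber_eq, hB a (by simp)]
    · rw [h₁.loopIntegral_sub_pow_inv ha₁ (by omega), h₂.loopIntegral_sub_pow_inv ha₂ (by omega)]
  · refine loopIntegral_eq_of_differentiableOn hr h₁ h₂ m₁ m₂ hw (hh.div ?_ fun z hz => ?_)
    · simp only [Multiset.map_cons, Multiset.prod_cons, multiset_prod_sub_eq_pow hC]
      fun_prop
    · refine Multiset.prod_ne_zero fun h0 => ?_
      obtain ⟨c, hc, hc0⟩ := Multiset.mem_map.1 h0
      rw [sub_eq_zero] at hc0
      rcases Multiset.mem_cons.1 hc with h | h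
      · exact ha (h ▸ hc0 ▸ hz)
      · exact ha (hC c h ▸ hc0 ▸ hz)

/-- Induction on the simple poles: subtracting the polar part at one of them leaves an integrand of
the same shape with one pole fewer. The base case is equality of integrals, because the windings
around the points of `B` agree. -/
theorem loopIntegral_sub_eq_sum_residues_aux {r R : ℝ} (hr : 0 < r) (h₁ : IsLoop γ₁)
    (h₂ : IsLoop γ₂) (m₁ : ∀ θ, γ₁ θ ∈ annulus r R) (m₂ : ∀ θ, γ₂ θ ∈ annulus r R)
    (hw : windingNumber γ₁ 0 = windingNumber γ₂ 0) (B : Multiset ℂ)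
    (hB₁ : ∀ b ∈ B, ∀ θ, γ₁ θ ≠ b) (hB₂ : ∀ b ∈ B, ∀ θ, γ₂ θ ≠ b)
    (hB : ∀ b ∈ B, windingNumber γ₁ b = windingNumber γ₂ b) (A : Finset ℂ)
    (hA : ∀ a ∈ A, a ∈ annulus r R) (hAB : ∀ a ∈ A, a ∉ B)
    (hA₁ : ∀ a ∈ A, ∀ θ, γ₁ θ ≠ a) (hA₂ : ∀ a ∈ A, ∀ θ, γ₂ θ ≠ a) {h : ℂ → ℂ}
    (hh : DifferentiableOn ℂ h (annulus r R)) (res : ℂ → ℂ)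
    (hres : ∀ a ∈ A, Tendsto (fun z => (z - a) *
      (h z / ((∏ a ∈ A, (z - a)) * (B.map fun b => z - b).prod))) (𝓝[≠] a) (𝓝 (res a))) :
    loopIntegral γ₁ (fun z => h z / ((∏ a ∈ A, (z - a)) * (B.map fun b => z - b).prod)) -
      loopIntegral γ₂ (fun z => h z / ((∏ a ∈ A, (z - a)) * (B.map fun b => z - b).prod)) =
      ∑ a ∈ A, 2 * Real.pi * Complex.I * (windingNumber γ₁ a - windingNumber γ₂ a) * res a := by
  induction A using Finset.induction_on generalizing h with
  | empty => simpa [sub_eq_zero] using loopIntegral_div_prod_eq hr h₁ h₂ m₁ m₂ hw B hB₁ hB₂ hB hh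
  | insert a A ha ih =>
    set P : ℂ → ℂ := fun z => (∏ a ∈ A, (z - a)) * (B.map fun b => z - b).prod with hP
    have hPd : Differentiable ℂ P := by
      refine Differentiable.mul ?_ (differentiable_multiset_prod_sub B)
      exact Differentiable.fun_finsetProd fun i _ => by fun_prop
    have hPne : ∀ z, z ∉ A → z ∉ B → P z ≠ 0 := fun z hzA hzB =>
      mul_ne_zero (Finset.prod_ne_zero_iff.2 fun b hb => sub_ne_zero.2 fun h => hzA (h ▸ hb))
        (multiset_prod_sub_ne_zero hzB)
    have hPa : P a ≠ 0 := hPne a ha (hAB a (Finset.mem_insert_self _ _))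
    have haann := hA a (Finset.mem_insert_self _ _)
    have hopen : annulus r R ∈ 𝓝 a := (isOpen_annulus r R).mem_nhds haann
    have hprod : ∀ z, (∏ a ∈ insert a A, (z - a)) * (B.map fun b => z - b).prod =
        (z - a) * P z := fun z => by rw [Finset.prod_insert ha, mul_assoc]
    simp only [hprod] at hres ⊢
    have hc : h a / P a = res a := by
      refine tendsto_nhds_unique ?_ (hres a (Finset.mem_insert_self _ _))
      have h1 : Tendsto (fun z => h z / P z) (𝓝[≠] a) (𝓝 (h a / P a)) :=
        (((hh.continuousOn.continuousAt hopen).div hPd.continuous.continuousAt hPa).tendsto).mono_left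
          nhdsWithin_le_nhds
      refine h1.congr' ?_
      filter_upwards [self_mem_nhdsWithin] with z hz
      have : z - a ≠ 0 := sub_ne_zero.2 hz
      rw [mul_div_assoc', mul_div_mul_left _ _ this]
    -- By `hc` the function `h - res a * P` vanishes at `a`, so it is divisible by `z - a` within
    -- holomorphic functions.
    set h' : ℂ → ℂ := dslope (fun z => h z - res a * P z) a with hh'
    have hd : DifferentiableOn ℂ h' (annulus r R) :=
      (Complex.differentiableOn_dslope hopen).2
        (hh.sub (hPd.const_mul (res a)).differentiableOn)
    have hval : ∀ z, h z = (z - a) * h' z + res a * P z := fun z => by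
      have := sub_smul_dslope (fun z => h z - res a * P z) a z
      rw [smul_eq_mul, ← hc, div_mul_cancel₀ _ hPa, sub_self, sub_zero, hc] at this
      rw [hh', this]; ring
    have hsplit : ∀ z, z ≠ a → z ∉ A → z ∉ B →
        h z / ((z - a) * P z) = h' z / P z + res a * (z - a)⁻¹ := fun z hz hzA hzB => by
      have h1 : z - a ≠ 0 := sub_ne_zero.2 hz
      have h2 := hPne z hzA hzB
      rw [hval z]
      field_simp
    have aux : ∀ γ : ℝ → ℂ, IsLoop γ → (∀ θ, γ θ ∈ annulus r R) →
        (∀ c ∈ insert a A, ∀ θ, γ θ ≠ c) → (∀ c ∈ B, ∀ θ, γ θ ≠ c) →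
        loopIntegral γ (fun z => h z / ((z - a) * P z)) =
          loopIntegral γ (fun z => h' z / P z) +
          res a * (2 * Real.pi * Complex.I * windingNumber γ a) := by
      intro γ hγ m hm hmB
      have hmem : ∀ θ, γ θ ∈ annulus r R ∩ {z | z ≠ a ∧ z ∉ A ∧ z ∉ B} := fun θ =>
        ⟨m θ, hm a (by simp) θ, fun h => hm _ (by simp [h]) θ rfl, fun h => hmB _ h θ rfl⟩
      rw [← windingNumber_eq, ← loopIntegral_const_mul,
        ← hγ.loopIntegral_add (s := annulus r R ∩ {z | z ≠ a ∧ z ∉ A ∧ z ∉ B}) _ _ hmem]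
      · exact loopIntegral_congr fun θ => hsplit _ (hmem θ).2.1 (hmem θ).2.2.1 (hmem θ).2.2.2
      · exact (hd.continuousOn.mono Set.inter_subset_left).div hPd.continuous.continuousOn
          fun z hz => hPne z hz.2.2.1 hz.2.2.2
      · exact continuousOn_const.mul (ContinuousOn.inv₀ (by fun_prop)
          fun z hz => sub_ne_zero.2 hz.2.1)
    have hins : ∀ c ∈ A, c ∈ insert a A := fun c hc => Finset.mem_insert_of_mem hc
    -- The removed polar part is regular at every other pole `c`, so after multiplication by `z - c`
    -- it tends to 0 and the residue there is unchanged.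
    have IH := ih (fun c hc => hA c (hins c hc)) (fun c hc => hAB c (hins c hc))
      (fun c hc => hA₁ c (hins c hc)) (fun c hc => hA₂ c (hins c hc)) hd (fun c hc => by
        have hca : c ≠ a := fun h => ha (h ▸ hc)
        have h1 := hres c (hins c hc)
        have h2 : Tendsto (fun z => (z - c) * (res a * (z - a)⁻¹)) (𝓝[≠] c) (𝓝 0) := by
          have : ContinuousAt (fun z => (z - c) * (res a * (z - a)⁻¹)) c := by
            have : c - a ≠ 0 := sub_ne_zero.2 hca
            fun_prop (disch := assumption)
          simpa using this.tendsto.mono_left nhdsWithin_le_nhds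
        have h3 := h1.sub h2
        rw [sub_zero] at h3
        refine h3.congr' ?_
        have e1 : ∀ᶠ z in 𝓝[≠] c, z ≠ a :=
          (isOpen_ne.mem_nhds hca : {z | z ≠ a} ∈ 𝓝 c) |> mem_nhdsWithin_of_mem_nhds
        have e2 : ∀ᶠ z in 𝓝[≠] c, z ∉ A := by
          have : (↑(A.erase c) : Set ℂ)ᶜ ∈ 𝓝 c :=
            (A.erase c).finite_toSet.isClosed.isOpen_compl.mem_nhds (by simp)
          filter_upwards [mem_nhdsWithin_of_mem_nhds this, self_mem_nhdsWithin] with z hz hzc hzA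
          exact hz (by simpa using ⟨hzA, hzc⟩)
        have e3 : ∀ᶠ z in 𝓝[≠] c, z ∉ B := by
          have : (↑B.toFinset : Set ℂ)ᶜ ∈ 𝓝 c :=
            B.toFinset.finite_toSet.isClosed.isOpen_compl.mem_nhds
              (by simpa using hAB c (hins c hc))
          filter_upwards [mem_nhdsWithin_of_mem_nhds this] with z hz hzB
          exact hz (by simpa using hzB)
        filter_upwards [e1, e2, e3] with z h1 h2 h3
        rw [hsplit z h1 h2 h3]
        ring)
    rw [Finset.sum_insert ha, ← IH, aux γ₁ h₁ m₁ hA₁ hB₁, aux γ₂ h₂ m₂ hA₂ hB₂]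
    ring

/-- The residue theorem for the difference of two loops in an annulus which have the same winding
numbers with respect to the origin and to the points of `B`; the poles in `A` are simple. -/
theorem loopIntegral_sub_eq_sum_residues {r R : ℝ} (hr : 0 < r) (h₁ : IsLoop γ₁)
    (h₂ : IsLoop γ₂) (m₁ : ∀ θ, γ₁ θ ∈ annulus r R) (m₂ : ∀ θ, γ₂ θ ∈ annulus r R)
    (hw : windingNumber γ₁ 0 = windingNumber γ₂ 0) (B : Multiset ℂ)
    (hB₁ : ∀ b ∈ B, ∀ θ, γ₁ θ ≠ b) (hB₂ : ∀ b ∈ B, ∀ θ, γ₂ θ ≠ b)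
    (hB : ∀ b ∈ B, windingNumber γ₁ b = windingNumber γ₂ b) (A : Finset ℂ)
    (hA : ∀ a ∈ A, a ∈ annulus r R) (hAB : ∀ a ∈ A, a ∉ B)
    (hA₁ : ∀ a ∈ A, ∀ θ, γ₁ θ ≠ a) (hA₂ : ∀ a ∈ A, ∀ θ, γ₂ θ ≠ a) {f h : ℂ → ℂ}
    (hh : DifferentiableOn ℂ h (annulus r R))
    (hf : ∀ z ∈ annulus r R, z ∉ A → z ∉ B →
      f z = h z / ((∏ a ∈ A, (z - a)) * (B.map fun b => z - b).prod))
    (res : ℂ → ℂ)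
    (hres : ∀ a ∈ A, Tendsto (fun z => (z - a) * f z) (𝓝[≠] a) (𝓝 (res a))) :
    loopIntegral γ₁ f - loopIntegral γ₂ f =
      ∑ a ∈ A, 2 * Real.pi * Complex.I * (windingNumber γ₁ a - windingNumber γ₂ a) * res a := by
  rw [← loopIntegral_sub_eq_sum_residues_aux hr h₁ h₂ m₁ m₂ hw B hB₁ hB₂ hB A hA hAB hA₁ hA₂ hh res]
  · congr 1
    · exact loopIntegral_congr fun θ =>
        hf _ (m₁ θ) (fun h => hA₁ _ h θ rfl) fun h => hB₁ _ h θ rfl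
    · exact loopIntegral_congr fun θ =>
        hf _ (m₂ θ) (fun h => hA₂ _ h θ rfl) fun h => hB₂ _ h θ rfl
  · intro a ha
    refine (hres a ha).congr' ?_
    have e1 : ∀ᶠ z in 𝓝[≠] a, z ∈ annulus r R :=
      mem_nhdsWithin_of_mem_nhds ((isOpen_annulus r R).mem_nhds (hA a ha))
    have e2 : ∀ᶠ z in 𝓝[≠] a, z ∉ A := by
      have : (↑(A.erase a) : Set ℂ)ᶜ ∈ 𝓝 a :=
        (A.erase a).finite_toSet.isClosed.isOpen_compl.mem_nhds (by simp)
      filter_upwards [mem_nhdsWithin_of_mem_nhds this, self_mem_nhdsWithin] with z hz hza hzA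
      exact hz (by simpa using ⟨hzA, hza⟩)
    have e3 : ∀ᶠ z in 𝓝[≠] a, z ∉ B := by
      have : (↑B.toFinset : Set ℂ)ᶜ ∈ 𝓝 a :=
        B.toFinset.finite_toSet.isClosed.isOpen_compl.mem_nhds (by simpa using hAB a ha)
      filter_upwards [mem_nhdsWithin_of_mem_nhds this] with z hz hzB
      exact hz (by simpa using hzB)
    filter_upwards [e1, e2, e3] with z h1 h2 h3
    rw [hf z h1 h2 h3]

end Loops

/-! ### Winding numbers of circles. -/

section Circles

theorem isLoop_circleMap (ρ : ℝ) : IsLoop (circleMap 0 ρ) where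
  contDiff := contDiff_circleMap 0 ρ
  periodic := periodic_circleMap 0 ρ

theorem loopIntegral_circleMap (ρ : ℝ) (f : ℂ → ℂ) :
    loopIntegral (circleMap 0 ρ) f = ∮ z in C(0, ρ), f z := by
  simp only [loopIntegral, circleIntegral, smul_eq_mul, mul_comm]

theorem windingNumber_circleMap_of_lt {ρ : ℝ} {a : ℂ} (h : ‖a‖ < ρ) :
    windingNumber (circleMap 0 ρ) a = 1 := by
  rw [windingNumber, loopIntegral_circleMap, circleIntegral.integral_sub_inv_of_mem_ball
    (by simpa using h), inv_mul_cancel₀ Complex.two_pi_I_ne_zero]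

theorem windingNumber_circleMap_of_gt {ρ : ℝ} (hρ : 0 ≤ ρ) {a : ℂ} (h : ρ < ‖a‖) :
    windingNumber (circleMap 0 ρ) a = 0 := by
  rw [windingNumber, loopIntegral_circleMap, DiffContOnCl.circleIntegral_eq_zero hρ, mul_zero]
  refine DifferentiableOn.diffContOnCl fun z hz => ?_
  refine DifferentiableAt.differentiableWithinAt ?_
  have : z - a ≠ 0 := by
    rw [sub_ne_zero]
    rintro rfl
    have := Metric.closure_ball_subset_closedBall hz
    rw [mem_closedBall_zero_iff] at this
    linarith
  fun_prop (disch := assumption)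

theorem norm_circleMap {ρ : ℝ} (hρ : 0 ≤ ρ) (θ : ℝ) : ‖circleMap 0 ρ θ‖ = ρ := by
  simp [norm_circleMap_zero, abs_of_nonneg hρ]

end Circles

/-! ### Contour deformation for quotients with q-shifted factorials in the denominator. -/

section QPochQuotient

variable {q : ℂ} {γ γ₁ γ₂ : ℝ → ℂ}

theorem IsLoop.isCompact_range (h : IsLoop γ) : IsCompact (Set.range γ) :=
  h.periodic.compact_of_continuous Real.two_pi_pos.ne' h.continuous

theorem IsLoop.exists_bounds (h : IsLoop γ) (h0 : ∀ θ, γ θ ≠ 0) :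
    ∃ r R : ℝ, 0 < r ∧ ∀ θ, r < ‖γ θ‖ ∧ ‖γ θ‖ < R := by
  obtain ⟨x, ⟨θ₀, rfl⟩, hx⟩ := h.isCompact_range.exists_isMinOn (Set.range_nonempty γ)
    continuous_norm.continuousOn
  obtain ⟨y, ⟨θ₁, rfl⟩, hy⟩ := h.isCompact_range.exists_isMaxOn (Set.range_nonempty γ)
    continuous_norm.continuousOn
  refine ⟨‖γ θ₀‖ / 2, ‖γ θ₁‖ + 1, half_pos (norm_pos_iff.2 (h0 _)), fun θ => ⟨?_, ?_⟩⟩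
  · have h1 : ‖γ θ₀‖ ≤ ‖γ θ‖ := hx ⟨θ, rfl⟩
    have h2 := norm_pos_iff.2 (h0 θ₀)
    linarith
  · have h1 : ‖γ θ‖ ≤ ‖γ θ₁‖ := hy ⟨θ, rfl⟩
    linarith

theorem qPochFin_div (q a : ℂ) (N : ℕ) {z : ℂ} (hz : z ≠ 0) :
    qPochFin q (a / z) N =
      ((Multiset.range N).map fun n => z - a * q ^ n).prod * (z ^ N)⁻¹ := by
  change _ = (∏ n ∈ Finset.range N, (z - a * q ^ n)) * _
  have : (z ^ N)⁻¹ = ∏ _n ∈ Finset.range N, z⁻¹ := by simp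
  rw [this, ← Finset.prod_mul_distrib]
  refine Finset.prod_congr rfl fun n _ => ?_
  field_simp

theorem qPochFin_mul (hq0 : q ≠ 0) {b : ℂ} (hb : b ≠ 0) (N : ℕ) (z : ℂ) :
    qPochFin q (b * z) N = ((Multiset.range N).map fun n => z - (b * q ^ n)⁻¹).prod *
      ∏ n ∈ Finset.range N, (-(b * q ^ n)) := by
  change _ = (∏ n ∈ Finset.range N, (z - (b * q ^ n)⁻¹)) * _
  rw [← Finset.prod_mul_distrib]
  refine Finset.prod_congr rfl fun n _ => ?_
  have : q ^ n ≠ 0 := pow_ne_zero _ hq0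
  field_simp
  ring

theorem exists_pow_norm_lt (hq : ‖q‖ < 1) {ι : Type*} [Finite ι] (a : ι → ℂ) {r : ℝ}
    (hr : 0 < r) : ∃ N : ℕ, ∀ i, ‖a i * q ^ N‖ < r := by
  have : ∀ᶠ N : ℕ in atTop, ∀ i, ‖a i * q ^ N‖ < r := by
    rw [eventually_all]
    intro i
    have := (tendsto_mul_pow_zero hq (a i)).norm
    rw [norm_zero] at this
    exact this.eventually_lt_const hr
  exact this.exists

/-- The points `a_i q^n` with `n < N`. -/
def polesInside (q : ℂ) {ι : Type*} [Fintype ι] (a : ι → ℂ) (N : ℕ) : Multiset ℂ :=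
  ((Finset.univ : Finset ι) ×ˢ Finset.range N).val.map fun p => a p.1 * q ^ p.2

/-- The points `(b_j q^n)⁻¹` with `n < N`. -/
def polesOutside (q : ℂ) {κ : Type*} [Fintype κ] (b : κ → ℂ) (N : ℕ) : Multiset ℂ :=
  ((Finset.univ : Finset κ) ×ˢ Finset.range N).val.map fun p => (b p.1 * q ^ p.2)⁻¹

theorem mem_polesInside {ι : Type*} [Fintype ι] {a : ι → ℂ} {N : ℕ} {x : ℂ} :
    x ∈ polesInside q a N ↔ ∃ i, ∃ n < N, a i * q ^ n = x := by
  simp [polesInside]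

theorem mem_polesOutside {κ : Type*} [Fintype κ] {b : κ → ℂ} {N : ℕ} {x : ℂ} :
    x ∈ polesOutside q b N ↔ ∃ j, ∃ n < N, (b j * q ^ n)⁻¹ = x := by
  simp [polesOutside]

/-- A quotient with `q`-shifted factorials in the denominator is, on an annulus, the quotient of a
holomorphic function by a polynomial. -/
theorem exists_eq_div_prod (hq0 : q ≠ 0) (hq : ‖q‖ < 1) {ι κ : Type*} [Fintype ι] [Fintype κ]
    (a : ι → ℂ) {b : κ → ℂ} (hb : ∀ j, b j ≠ 0) {h : ℂ → ℂ} (hh : DifferentiableOn ℂ h {0}ᶜ)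
    {r R : ℝ} (hr : 0 < r) (hR : 0 < R) :
    ∃ (N : ℕ) (k : ℂ → ℂ), (∀ i, ‖a i * q ^ N‖ < r) ∧ DifferentiableOn ℂ k (annulus r R) ∧
      ∀ z ∈ annulus r R, h z / ((∏ i, qPoch q (a i / z)) * ∏ j, qPoch q (b j * z)) =
        k z / ((polesInside q a N).map fun b => z - b).prod /
          ((polesOutside q b N).map fun b => z - b).prod := by
  -- Beyond index `N` the arguments `a i * q ^ N / z` and `b j * q ^ N * z` have norm less than 1 on
  -- the annulus. The tails of the products have no zeros there and are absorbed into the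
  -- holomorphic factor.
  obtain ⟨N₁, hN₁⟩ := exists_pow_norm_lt hq a hr
  obtain ⟨N₂, hN₂⟩ := exists_pow_norm_lt hq b (inv_pos.2 hR)
  have mono : ∀ (c : ℂ) {m n : ℕ}, m ≤ n → ‖c * q ^ n‖ ≤ ‖c * q ^ m‖ := fun c m n hmn => by
    simp only [norm_mul, norm_pow]
    exact mul_le_mul_of_nonneg_left (pow_le_pow_of_le_one (norm_nonneg _) hq.le hmn)
      (norm_nonneg _)
  set N := max N₁ N₂ with hN
  have ha : ∀ i, ‖a i * q ^ N‖ < r := fun i => (mono _ (le_max_left _ _)).trans_lt (hN₁ i)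
  have hb' : ∀ j, ‖b j * q ^ N‖ < R⁻¹ := fun j => (mono _ (le_max_right _ _)).trans_lt (hN₂ j)
  set D : ℂ → ℂ := fun z => (∏ i, ((z ^ N)⁻¹ * qPoch q (a i * q ^ N / z))) *
    ∏ j, ((∏ n ∈ Finset.range N, (-(b j * q ^ n))) * qPoch q (b j * q ^ N * z)) with hD
  refine ⟨N, fun z => h z / D z, ha, ?_, fun z hz => ?_⟩
  · have hP := differentiable_qPoch hq
    refine (hh.mono fun z hz => ne_zero_of_mem_annulus hr hz).div ?_ fun z hz => ?_
    · intro z hz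
      have hz0 := ne_zero_of_mem_annulus hr hz
      have hzN : z ^ N ≠ 0 := pow_ne_zero _ hz0
      refine DifferentiableAt.differentiableWithinAt ?_
      refine DifferentiableAt.mul ?_ ?_
      · refine DifferentiableAt.fun_finsetProd fun i _ => ?_
        fun_prop (disch := assumption)
      · refine DifferentiableAt.fun_finsetProd fun i _ => ?_
        fun_prop
    · have hz0 := ne_zero_of_mem_annulus hr hz
      refine mul_ne_zero (Finset.prod_ne_zero_iff.2 fun i _ => mul_ne_zero
        (inv_ne_zero (pow_ne_zero _ hz0)) (qPoch_ne_zero_of_norm_lt hq ?_))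
        (Finset.prod_ne_zero_iff.2 fun j _ => mul_ne_zero
          (Finset.prod_ne_zero_iff.2 fun n _ => neg_ne_zero.2
            (mul_ne_zero (hb j) (pow_ne_zero _ hq0))) (qPoch_ne_zero_of_norm_lt hq ?_))
      · rw [norm_div, div_lt_one (norm_pos_iff.2 hz0)]
        exact (ha i).trans hz.1
      · rw [norm_mul]
        calc ‖b j * q ^ N‖ * ‖z‖ ≤ ‖b j * q ^ N‖ * R :=
              mul_le_mul_of_nonneg_left hz.2.le (norm_nonneg _)
          _ < R⁻¹ * R := mul_lt_mul_of_pos_right (hb' j) hR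
          _ = 1 := inv_mul_cancel₀ hR.ne'
  · have hz0 := ne_zero_of_mem_annulus hr hz
    have e1 : ∏ i, qPoch q (a i / z) = ((polesInside q a N).map fun b => z - b).prod *
        ∏ i, ((z ^ N)⁻¹ * qPoch q (a i * q ^ N / z)) := by
      rw [polesInside, Multiset.map_map]
      change _ = (∏ p ∈ (Finset.univ : Finset ι) ×ˢ Finset.range N, (z - a p.1 * q ^ p.2)) * _
      rw [Finset.prod_product, ← Finset.prod_mul_distrib]
      refine Finset.prod_congr rfl fun i _ => ?_
      rw [qPoch_eq_qPochFin_mul hq (a i / z) N, qPochFin_div q _ N hz0, mul_assoc,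
        show a i / z * q ^ N = a i * q ^ N / z by ring]
      rfl
    have e2 : ∏ j, qPoch q (b j * z) = ((polesOutside q b N).map fun b => z - b).prod *
        ∏ j, ((∏ n ∈ Finset.range N, (-(b j * q ^ n))) * qPoch q (b j * q ^ N * z)) := by
      rw [polesOutside, Multiset.map_map]
      change _ = (∏ p ∈ (Finset.univ : Finset κ) ×ˢ Finset.range N, (z - (b p.1 * q ^ p.2)⁻¹)) * _
      rw [Finset.prod_product, ← Finset.prod_mul_distrib]
      refine Finset.prod_congr rfl fun j _ => ?_
      rw [qPoch_eq_qPochFin_mul hq (b j * z) N, qPochFin_mul hq0 (hb j), mul_assoc,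
        show b j * z * q ^ N = b j * q ^ N * z by ring]
      rfl
    rw [e1, e2, hD]
    simp only [div_div]
    congr 1
    ring

/-- Cauchy's theorem for a quotient with `q`-shifted factorials in the denominator. -/
theorem loopIntegral_div_qPoch_eq (hq0 : q ≠ 0) (hq : ‖q‖ < 1) {ι κ : Type*} [Fintype ι]
    [Fintype κ] (a : ι → ℂ) {b : κ → ℂ} (hb : ∀ j, b j ≠ 0) {h : ℂ → ℂ}
    (hh : DifferentiableOn ℂ h {0}ᶜ) (h₁ : IsLoop γ₁) (h₂ : IsLoop γ₂)
    (n₁ : ∀ θ, γ₁ θ ≠ 0) (n₂ : ∀ θ, γ₂ θ ≠ 0)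
    (hw : windingNumber γ₁ 0 = windingNumber γ₂ 0)
    (ha₁ : ∀ i (n : ℕ) θ, γ₁ θ ≠ a i * q ^ n) (ha₂ : ∀ i (n : ℕ) θ, γ₂ θ ≠ a i * q ^ n)
    (ha : ∀ i (n : ℕ), windingNumber γ₁ (a i * q ^ n) = windingNumber γ₂ (a i * q ^ n))
    (hb₁ : ∀ j (n : ℕ) θ, γ₁ θ ≠ (b j * q ^ n)⁻¹) (hb₂ : ∀ j (n : ℕ) θ, γ₂ θ ≠ (b j * q ^ n)⁻¹)
    (hb' : ∀ j (n : ℕ), windingNumber γ₁ (b j * q ^ n)⁻¹ = windingNumber γ₂ (b j * q ^ n)⁻¹) :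
    loopIntegral γ₁ (fun z => h z / ((∏ i, qPoch q (a i / z)) * ∏ j, qPoch q (b j * z))) =
      loopIntegral γ₂ (fun z => h z / ((∏ i, qPoch q (a i / z)) * ∏ j, qPoch q (b j * z))) := by
  obtain ⟨r₁, R₁, hr₁, m₁⟩ := h₁.exists_bounds n₁
  obtain ⟨r₂, R₂, hr₂, m₂⟩ := h₂.exists_bounds n₂
  set r := min r₁ r₂
  set R := max R₁ R₂
  have hr : 0 < r := lt_min hr₁ hr₂
  have m₁' : ∀ θ, γ₁ θ ∈ annulus r R := fun θ =>
    ⟨(min_le_left _ _).trans_lt (m₁ θ).1, (m₁ θ).2.trans_le (le_max_left _ _)⟩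
  have m₂' : ∀ θ, γ₂ θ ∈ annulus r R := fun θ =>
    ⟨(min_le_right _ _).trans_lt (m₂ θ).1, (m₂ θ).2.trans_le (le_max_right _ _)⟩
  have hR : 0 < R := hr.trans ((m₁' 0).1.trans (m₁' 0).2)
  obtain ⟨N, k, -, hk, e⟩ := exists_eq_div_prod hq0 hq a hb hh hr hR
  have key := loopIntegral_div_prod_eq hr h₁ h₂ m₁' m₂' hw
    (polesInside q a N + polesOutside q b N) ?_ ?_ ?_ hk
  · simp only [Multiset.map_add, Multiset.prod_add] at key
    refine (loopIntegral_congr fun θ => ?_).trans (key.trans (loopIntegral_congr fun θ => ?_))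
    · rw [e _ (m₁' θ), div_div]
    · rw [e _ (m₂' θ), div_div]
  all_goals
    intro c hc
    rcases Multiset.mem_add.1 hc with hc | hc
    · obtain ⟨i, n, -, rfl⟩ := mem_polesInside.1 hc
      first | exact ha₁ i n | exact ha₂ i n | exact ha i n
    · obtain ⟨i, n, -, rfl⟩ := mem_polesOutside.1 hc
      first | exact hb₁ i n | exact hb₂ i n | exact hb' i n

/-- The residue theorem for a quotient with `q`-shifted factorials in the denominator, comparing
a separating loop with a small circle. -/
theorem loopIntegral_sub_circle_eq (hq0 : q ≠ 0) (hq : ‖q‖ < 1) {ι κ : Type*} [Fintype ι]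
    [Fintype κ] {a : ι → ℂ} {b : κ → ℂ} (hb : ∀ j, b j ≠ 0) {f h : ℂ → ℂ}
    (hh : DifferentiableOn ℂ h {0}ᶜ)
    (hf : ∀ z, f z = h z / ((∏ i, qPoch q (a i / z)) * ∏ j, qPoch q (b j * z)))
    (hγ : IsLoop γ) (n₁ : ∀ θ, γ θ ≠ 0) (hw : windingNumber γ 0 = 1)
    (ha₁ : ∀ i (n : ℕ) θ, γ θ ≠ a i * q ^ n)
    (ha : ∀ i (n : ℕ), windingNumber γ (a i * q ^ n) = 1)
    (hb₁ : ∀ j (n : ℕ) θ, γ θ ≠ (b j * q ^ n)⁻¹)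
    (hb' : ∀ j (n : ℕ), windingNumber γ (b j * q ^ n)⁻¹ = 0)
    {ρ : ℝ} (hρ : 0 < ρ) (hργ : ∀ θ, ρ < ‖γ θ‖) (hρa : ∀ i (n : ℕ), ‖a i * q ^ n‖ ≠ ρ)
    (hρb : ∀ j (n : ℕ), ρ < ‖(b j * q ^ n)⁻¹‖)
    (hinj : Function.Injective fun p : ι × ℕ => a p.1 * q ^ p.2) (res : ι → ℕ → ℂ)
    (hres : ∀ i n, Tendsto (fun z => (z - a i * q ^ n) * f z) (𝓝[≠] (a i * q ^ n))
      (𝓝 (res i n))) :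
    loopIntegral γ f - loopIntegral (circleMap 0 ρ) f =
      2 * Real.pi * Complex.I * ∑ i, ∑' n : ℕ, if ρ < ‖a i * q ^ n‖ then res i n else 0 := by
  classical
  obtain ⟨r₁, R₁, hr₁, m₁⟩ := hγ.exists_bounds n₁
  have hρ' : ρ / 2 < ρ := half_lt_self hρ
  set r := ρ / 2 with hr
  have hr0 : 0 < r := half_pos hρ
  set R := R₁ + ρ + ∑ i, ‖a i‖ with hR
  have hR₁ : 0 < R₁ := (norm_nonneg _).trans_lt (m₁ 0).2
  have hsum : 0 ≤ ∑ i, ‖a i‖ := Finset.sum_nonneg fun _ _ => norm_nonneg _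
  have mγ : ∀ θ, γ θ ∈ annulus r R := fun θ =>
    ⟨hρ'.trans (hργ θ), by have := (m₁ θ).2; simp only [hR]; linarith⟩
  have mc : ∀ θ, circleMap 0 ρ θ ∈ annulus r R := fun θ => by
    rw [annulus, Set.mem_ofPred_eq, norm_circleMap hρ.le]
    exact ⟨hρ', by linarith⟩
  obtain ⟨N, k, hN, hk, e⟩ := exists_eq_div_prod hq0 hq a hb hh hr0 (by linarith : 0 < R)
  -- Only the poles `a i * q ^ n` outside the circle contribute residues. Both loops wind once
  -- around those inside it and not at all around the poles `(b j * q ^ n)⁻¹`, so these two kinds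
  -- together form `B`.
  set I : Finset (ι × ℕ) := (Finset.univ ×ˢ Finset.range N).filter
    fun p => ρ < ‖a p.1 * q ^ p.2‖ with hI
  set I' : Finset (ι × ℕ) := (Finset.univ ×ˢ Finset.range N).filter
    fun p => ¬ ρ < ‖a p.1 * q ^ p.2‖ with hI'
  set A : Finset ℂ := I.image fun p => a p.1 * q ^ p.2 with hA
  set B : Multiset ℂ := (I'.val.map fun p => a p.1 * q ^ p.2) + polesOutside q b N with hB
  have hBmem : ∀ c ∈ B, (∃ i, ∃ n, ‖a i * q ^ n‖ < ρ ∧ c = a i * q ^ n) ∨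
      ∃ j, ∃ n, c = (b j * q ^ n)⁻¹ := by
    intro c hc
    rcases Multiset.mem_add.1 hc with hc | hc
    · obtain ⟨p, hp, rfl⟩ := Multiset.mem_map.1 hc
      left
      have := (Finset.mem_filter.1 hp).2
      exact ⟨p.1, p.2, lt_of_le_of_ne (not_lt.1 this) (hρa _ _), rfl⟩
    · obtain ⟨i, n, -, rfl⟩ := mem_polesOutside.1 hc
      exact Or.inr ⟨i, n, rfl⟩
  have hAmem : ∀ c ∈ A, ∃ i, ∃ n, ρ < ‖a i * q ^ n‖ ∧ c = a i * q ^ n := by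
    intro c hc
    obtain ⟨p, hp, rfl⟩ := Finset.mem_image.1 hc
    exact ⟨p.1, p.2, (Finset.mem_filter.1 hp).2, rfl⟩
  -- The residue theorem indexes residues by points; injectivity of the parametrization allows the
  -- passage from pairs of indices. The default 0 is never used.
  set res' : ℂ → ℂ := fun c => if hc : ∃ p : ι × ℕ, a p.1 * q ^ p.2 = c then
    res hc.choose.1 hc.choose.2 else 0 with hres'
  have hres'_eq : ∀ i n, res' (a i * q ^ n) = res i n := fun i n => by
    have hc : ∃ p : ι × ℕ, a p.1 * q ^ p.2 = a i * q ^ n := ⟨(i, n), rfl⟩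
    have : hc.choose = (i, n) := hinj hc.choose_spec
    simp only [hres', dif_pos hc, this]
  have hwA : ∀ c ∈ A, windingNumber γ c - windingNumber (circleMap 0 ρ) c = 1 := by
    intro c hc
    obtain ⟨i, n, hlt, rfl⟩ := hAmem c hc
    rw [ha, windingNumber_circleMap_of_gt hρ.le hlt, sub_zero]
  have hlarge : ∀ i, ∀ n, N ≤ n → ‖a i * q ^ n‖ < ρ := fun i n hn => by
    refine lt_of_le_of_lt ?_ ((hN i).trans hρ')
    simp only [norm_mul, norm_pow]
    exact mul_le_mul_of_nonneg_left (pow_le_pow_of_le_one (norm_nonneg _) hq.le hn)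
      (norm_nonneg _)
  have hcirc : ∀ c : ℂ, ‖c‖ ≠ ρ → ∀ θ, circleMap 0 ρ θ ≠ c := fun c hc θ h => by
    rw [← h, norm_circleMap hρ.le] at hc
    exact hc rfl
  have key := loopIntegral_sub_eq_sum_residues hr0 hγ (isLoop_circleMap ρ) mγ mc
    (by rw [hw, windingNumber_circleMap_of_lt (by simpa using hρ)]) B ?_ ?_ ?_ A ?_ ?_ ?_ ?_ hk
    (f := f) ?_ res' ?_
  · rw [key, Finset.sum_congr rfl fun c hc => by rw [hwA c hc, mul_one], ← Finset.mul_sum]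
    congr 1
    rw [hA, Finset.sum_image fun p _ p' _ h => hinj h, hI, Finset.sum_filter, Finset.sum_product]
    refine Finset.sum_congr rfl fun i _ => ?_
    rw [tsum_eq_sum (s := Finset.range N)]
    · exact Finset.sum_congr rfl fun n _ => by rw [hres'_eq]
    · intro n hn
      rw [if_neg (not_lt.2 (hlarge i n (by simpa using hn)).le)]
  · intro c hc
    rcases hBmem c hc with ⟨i, n, -, rfl⟩ | ⟨j, n, rfl⟩
    exacts [ha₁ i n, hb₁ j n]
  · intro c hc
    rcases hBmem c hc with ⟨i, n, hlt, rfl⟩ | ⟨j, n, rfl⟩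
    exacts [hcirc _ hlt.ne, hcirc _ (hρb j n).ne']
  · intro c hc
    rcases hBmem c hc with ⟨i, n, hlt, rfl⟩ | ⟨j, n, rfl⟩
    · rw [ha, windingNumber_circleMap_of_lt hlt]
    · rw [hb', windingNumber_circleMap_of_gt hρ.le (hρb j n)]
  · intro c hc
    obtain ⟨i, n, hlt, rfl⟩ := hAmem c hc
    refine ⟨hρ'.trans hlt, ?_⟩
    have h1 : ‖a i * q ^ n‖ ≤ ‖a i‖ := by
      rw [norm_mul, norm_pow]
      exact mul_le_of_le_one_right (norm_nonneg _) (pow_le_one₀ (norm_nonneg _) hq.le)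
    have h2 : ‖a i‖ ≤ ∑ i, ‖a i‖ :=
      Finset.single_le_sum (fun _ _ => norm_nonneg _) (Finset.mem_univ i)
    simp only [hR]
    linarith
  · intro c hc hcB
    obtain ⟨i, n, hlt, rfl⟩ := hAmem c hc
    rcases hBmem _ hcB with ⟨i', n', hlt', h⟩ | ⟨j, n', h⟩
    · rw [← h] at hlt'
      exact lt_asymm hlt hlt'
    · have := ha i n
      rw [h, hb' j n'] at this
      exact zero_ne_one this
  · intro c hc
    obtain ⟨i, n, hlt, rfl⟩ := hAmem c hc
    exact ha₁ i n
  · intro c hc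
    obtain ⟨i, n, hlt, rfl⟩ := hAmem c hc
    exact hcirc _ hlt.ne'
  · intro z hz _ _
    rw [hf, e z hz, hB, Multiset.map_add, Multiset.prod_add, div_div, ← mul_assoc]
    congr 2
    rw [polesInside, Multiset.map_map, Multiset.map_map, hA, Finset.prod_image fun p _ p' _ h => hinj h]
    exact (Finset.prod_filter_mul_prod_filter_not _ _ _).symm
  · intro c hc
    obtain ⟨i, n, -, rfl⟩ := hAmem c hc
    rw [hres'_eq]
    exact hres i n

end QPochQuotient

/-! ### Loops separating q-orbits from their reciprocals. -/

section Orbits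

variable {q : ℂ} {γ : ℝ → ℂ}

/-- The loop `γ` encircles the origin and the points `a q^n`, but not their reciprocals, for
`a ∈ S` and `n ≥ 0`. -/
structure EnclosesOrbits (q : ℂ) (S : Set ℂ) (γ : ℝ → ℂ) : Prop where
  isLoop : IsLoop γ
  ne_zero : ∀ θ, γ θ ≠ 0
  winding_zero : windingNumber γ 0 = 1
  ne_orbit : ∀ a ∈ S, ∀ (n : ℕ) θ, γ θ ≠ a * q ^ n
  winding_orbit : ∀ a ∈ S, ∀ n : ℕ, windingNumber γ (a * q ^ n) = 1
  ne_inv : ∀ a ∈ S, ∀ (n : ℕ) θ, γ θ ≠ (a * q ^ n)⁻¹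
  winding_inv : ∀ a ∈ S, ∀ n : ℕ, windingNumber γ (a * q ^ n)⁻¹ = 0

theorem EnclosesOrbits.mono {S T : Set ℂ} (h : EnclosesOrbits q S γ)
    (hT : ∀ b ∈ T, ∃ a ∈ S, ∃ m : ℕ, b = a * q ^ m) : EnclosesOrbits q T γ where
  isLoop := h.isLoop
  ne_zero := h.ne_zero
  winding_zero := h.winding_zero
  ne_orbit b hb n := by
    obtain ⟨a, ha, m, rfl⟩ := hT b hb
    simpa only [mul_assoc, ← pow_add] using h.ne_orbit a ha (m + n)
  winding_orbit b hb n := by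
    obtain ⟨a, ha, m, rfl⟩ := hT b hb
    simpa only [mul_assoc, ← pow_add] using h.winding_orbit a ha (m + n)
  ne_inv b hb n := by
    obtain ⟨a, ha, m, rfl⟩ := hT b hb
    simpa only [mul_assoc, ← pow_add] using h.ne_inv a ha (m + n)
  winding_inv b hb n := by
    obtain ⟨a, ha, m, rfl⟩ := hT b hb
    simpa only [mul_assoc, ← pow_add] using h.winding_inv a ha (m + n)

/-- Otherwise `a` would be a point of the inner orbit and also a reciprocal point, so its winding
number would be both 1 and 0. The mere existence of the loop thus forces denominators such as `(ab;
q)_∞` to be nonzero. -/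
theorem EnclosesOrbits.mul_pow_ne_one {S : Set ℂ} (h : EnclosesOrbits q S γ) {a b : ℂ}
    (ha : a ∈ S) (hb : b ∈ S) (n : ℕ) : a * b * q ^ n ≠ 1 := by
  intro h1
  have h2 : a = (b * q ^ n)⁻¹ := eq_inv_of_mul_eq_one_left (by rw [← h1]; ring)
  have h3 := h.winding_orbit a ha 0
  rw [pow_zero, mul_one, h2, h.winding_inv b hb n] at h3
  exact zero_ne_one h3

theorem EnclosesOrbits.qPoch_mul_ne_zero (hq : ‖q‖ < 1) {S : Set ℂ} (h : EnclosesOrbits q S γ)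
    {a b : ℂ} (ha : a ∈ S) (hb : b ∈ S) : qPoch q (a * b) ≠ 0 :=
  qPoch_ne_zero hq (h.mul_pow_ne_one ha hb)

theorem EnclosesOrbits.qPoch_mul_apply_ne_zero (hq : ‖q‖ < 1) {S : Set ℂ}
    (h : EnclosesOrbits q S γ) {a : ℂ} (ha : a ∈ S) (θ : ℝ) : qPoch q (a * γ θ) ≠ 0 :=
  qPoch_ne_zero hq fun n hn => h.ne_inv a ha n θ (eq_inv_of_mul_eq_one_left (by rw [← hn]; ring))

theorem EnclosesOrbits.qPoch_div_apply_ne_zero (hq : ‖q‖ < 1) {S : Set ℂ}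
    (h : EnclosesOrbits q S γ) {a : ℂ} (ha : a ∈ S) (θ : ℝ) : qPoch q (a / γ θ) ≠ 0 :=
  qPoch_ne_zero hq fun n hn => h.ne_orbit a ha n θ (by
    have := h.ne_zero θ
    field_simp at hn
    rw [← hn])

theorem IsLoop.div_const (h : IsLoop γ) (c : ℂ) : IsLoop fun θ => γ θ / c where
  contDiff := h.contDiff.div_const c
  periodic θ := by simp only [h.periodic θ]

theorem IsLoop.loopIntegral_div_const (h : IsLoop γ) (c : ℂ) (f : ℂ → ℂ) :
    loopIntegral (fun θ => γ θ / c) f = loopIntegral γ fun z => f (z / c) / c := by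
  simp only [loopIntegral]
  congr 1
  ext θ
  rw [((h.hasDerivAt θ).div_const c).deriv]
  ring

theorem IsLoop.windingNumber_div_const (h : IsLoop γ) {c : ℂ} (hc : c ≠ 0) (a : ℂ) :
    windingNumber (fun θ => γ θ / c) a = windingNumber γ (c * a) := by
  rw [windingNumber, windingNumber, h.loopIntegral_div_const]
  congr 2
  ext z
  rw [div_eq_mul_inv, ← mul_inv, sub_mul, div_mul_cancel₀ _ hc, mul_comm c a]

end Orbits

/-! ### The Nassrallah-Rahman integral. -/

section NassrallahRahman

variable {q : ℂ} {γ : ℝ → ℂ}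

/-- The integrand of the Nassrallah-Rahman integral. -/
def nrIntegrand (q a b c d e z : ℂ) : ℂ :=
  qPoch q (z ^ 2) * qPoch q (z ^ 2)⁻¹ *
      (qPoch q (a * b * c * d * e * z) * qPoch q (a * b * c * d * e / z)) /
    (qPoch q (a * z) * qPoch q (a / z) * (qPoch q (b * z) * qPoch q (b / z)) *
      (qPoch q (c * z) * qPoch q (c / z)) * (qPoch q (d * z) * qPoch q (d / z)) *
      (qPoch q (e * z) * qPoch q (e / z)))

/-- The value of the Nassrallah-Rahman integral, up to a constant. -/
def nrProduct (q a b c d e : ℂ) : ℂ :=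
  qPoch q (b * c * d * e) * qPoch q (a * c * d * e) * qPoch q (a * b * d * e) *
      qPoch q (a * b * c * e) * qPoch q (a * b * c * d) /
    (qPoch q (a * b) * qPoch q (a * c) * qPoch q (a * d) * qPoch q (a * e) * qPoch q (b * c) *
      qPoch q (b * d) * qPoch q (b * e) * qPoch q (c * d) * qPoch q (c * e) * qPoch q (d * e))

/-- What remains of `nr_telescope` once the common infinite products have been divided out. -/
theorem nr_polynomial_identity (a b c d e z : ℂ) :
    z * (1 - z ^ 2) * ((1 - a * c * d * e) * (1 - a * b * d * e) * (1 - a * b * c * e) *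
        (1 - a * b * c * d) * ((1 - a * z) * (z - a)) -
      (1 - a * b) * (1 - a * c) * (1 - a * d) * (1 - a * e) *
        ((1 - a * b * c * d * e * z) * (z - a * b * c * d * e))) =
    -a * (1 - a * (a * b * c * d * e)) * ((z - a * b * c * d * e) *
        ((1 - a * z) * (1 - b * z) * (1 - c * z) * (1 - d * z) * (1 - e * z)) -
      (1 - a * b * c * d * e * z) *
        ((z - a) * (z - b) * (z - c) * (z - d) * (z - e))) := by
  ring

theorem qPoch_div_mul_qPoch (hq0 : q ≠ 0) (hq : ‖q‖ < 1) {x : ℂ} (hx : x ≠ 0) :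
    qPoch q (x / q) * qPoch q (q ^ 2 / x) = -(x / q) * (qPoch q x * qPoch q (q / x)) := by
  rw [qPoch_step hq (x / q), qPoch_step hq (q / x), show q * (x / q) = x by field_simp,
    show q * (q / x) = q ^ 2 / x by ring]
  field_simp
  ring

/-- The function whose `q`-difference implements the shift `a ↦ q a`. -/
def nrCertificate (q a b c d e z : ℂ) : ℂ :=
  qPoch q (q * z ^ 2) * qPoch q (z ^ 2)⁻¹ * qPoch q (q * (a * b * c * d * e) * z) *
      qPoch q (a * b * c * d * e / z) / z ^ 2 /
    ((∏ i, qPoch q (![a, b, c, d, e] i / z)) *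
      ∏ j, qPoch q (![q * a, q * b, q * c, q * d, q * e] j * z))

theorem qPoch_div_step (hq : ‖q‖ < 1) (x : ℂ) {z : ℂ} (hz : z ≠ 0) :
    qPoch q (x / z) = (z - x) / z * qPoch q (q * x / z) := by
  rw [qPoch_step hq, sub_div, div_self hz, mul_div_assoc]

theorem qPoch_mul_step (hq : ‖q‖ < 1) (x z : ℂ) :
    qPoch q (x * z) = (1 - x * z) * qPoch q (q * x * z) := by
  rw [qPoch_step hq, mul_assoc]

/-- All infinite products at `z` and at `z / q` are rational multiples of the symmetric products `w
x = (qxz, qx/z; q)_∞`. Each of the four terms is then a rational function times the same factor, and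
`nr_polynomial_identity` concludes. -/
theorem nr_telescope (hq0 : q ≠ 0) (hq : ‖q‖ < 1) {a b c d e z : ℂ} (hz : z ≠ 0)
    (h₁ : ∀ x ∈ ({a, b, c, d, e} : Set ℂ), qPoch q (x * z) ≠ 0)
    (h₂ : ∀ x ∈ ({a, b, c, d, e} : Set ℂ), qPoch q (x / z) ≠ 0) :
    (1 - a * c * d * e) * (1 - a * b * d * e) * (1 - a * b * c * e) * (1 - a * b * c * d) *
        (nrIntegrand q (q * a) b c d e z / z) -
      (1 - a * b) * (1 - a * c) * (1 - a * d) * (1 - a * e) * (nrIntegrand q a b c d e z / z) =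
    -a * (1 - a * (a * b * c * d * e)) *
      (nrCertificate q a b c d e z - nrCertificate q a b c d e (z / q) / q) := by
  set w : ℂ → ℂ := fun x => qPoch q (q * x * z) * qPoch q (q * x / z) with hw
  set A := a * b * c * d * e with hA
  set X := qPoch q (q * z ^ 2) * qPoch q (q / z ^ 2) with hX
  have s₁ : ∀ x, qPoch q (x * z) = (1 - x * z) * qPoch q (q * x * z) :=
    fun x => qPoch_mul_step hq x z
  have s₂ : ∀ x, qPoch q (x / z) = (z - x) / z * qPoch q (q * x / z) :=
    fun x => qPoch_div_step hq x hz
  have f₁ : ∀ x, qPoch q (x * z) * qPoch q (x / z) = (1 - x * z) * (z - x) / z * w x :=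
    fun x => by rw [s₁, s₂]; ring
  have f₂ : ∀ x, qPoch q (x / z) * qPoch q (q * x * z) = (z - x) / z * w x :=
    fun x => by rw [s₂]; ring
  have f₃ : ∀ x, qPoch q (q * x / z) * qPoch q (x * z) = (1 - x * z) * w x :=
    fun x => by rw [s₁]; ring
  have s₄ : qPoch q (z ^ 2)⁻¹ = (z ^ 2 - 1) / z ^ 2 * qPoch q (q / z ^ 2) := by
    rw [qPoch_step hq, div_eq_mul_inv q]
    congr 1
    field_simp
  have g₁ : qPoch q (z ^ 2) * qPoch q (z ^ 2)⁻¹ = (1 - z ^ 2) * (z ^ 2 - 1) / z ^ 2 * X := by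
    rw [s₄, qPoch_step hq (z ^ 2)]; ring
  have g₂ : qPoch q (q * z ^ 2) * qPoch q (z ^ 2)⁻¹ = (z ^ 2 - 1) / z ^ 2 * X := by
    rw [s₄]; ring
  have g₃ : qPoch q (z ^ 2 / q) * qPoch q (q ^ 2 / z ^ 2) = -(z ^ 2 / q) * ((1 - z ^ 2) * X) := by
    rw [qPoch_div_mul_qPoch hq0 hq (pow_ne_zero 2 hz), qPoch_step hq (z ^ 2)]
    ring
  have n : ∀ x ∈ ({a, b, c, d, e} : Set ℂ), 1 - x * z ≠ 0 ∧ z - x ≠ 0 ∧ w x ≠ 0 := fun x hx => by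
    have h := mul_ne_zero (h₁ x hx) (h₂ x hx)
    rw [f₁] at h
    simp only [ne_eq, mul_eq_zero, div_eq_zero_iff, not_or] at h
    exact ⟨h.1.1.1, h.1.1.2, h.2⟩
  obtain ⟨a₁, a₂, a₃⟩ := n a (by simp)
  obtain ⟨b₁, b₂, b₃⟩ := n b (by simp)
  obtain ⟨c₁, c₂, c₃⟩ := n c (by simp)
  obtain ⟨d₁, d₂, d₃⟩ := n d (by simp)
  obtain ⟨e₁, e₂, e₃⟩ := n e (by simp)
  have E₁ : nrIntegrand q (q * a) b c d e z / z =
      X * w A / (w a * w b * w c * w d * w e) * (z * (1 - z ^ 2) * (z ^ 2 - 1)) /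
        ((1 - b * z) * (z - b) * ((1 - c * z) * (z - c)) * ((1 - d * z) * (z - d)) *
          ((1 - e * z) * (z - e))) := by
    rw [nrIntegrand, show q * a * b * c * d * e = q * A by rw [hA]; ring, g₁, f₁ b, f₁ c,
      f₁ d, f₁ e]
    -- The products with parameters `q * a` and `q * A` are `w a` and `w A` by definition.
    change (1 - z ^ 2) * (z ^ 2 - 1) / z ^ 2 * X * w A / (w a * _ * _ * _ * _) / z = _
    generalize w A = wA at *
    generalize w a = wa at *
    generalize w b = wb at *
    generalize w c = wc at *
    generalize w d = wd at *
    generalize w e = we at *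
    generalize 1 - b * z = ub at *
    generalize z - b = vb at *
    generalize 1 - c * z = uc at *
    generalize z - c = vc at *
    generalize 1 - d * z = ud at *
    generalize z - d = vd at *
    generalize 1 - e * z = ue at *
    generalize z - e = ve at *
    field_simp
  have E₂ : nrIntegrand q a b c d e z / z =
      X * w A / (w a * w b * w c * w d * w e) *
        (z * (1 - z ^ 2) * (z ^ 2 - 1) * ((1 - A * z) * (z - A))) /
        ((1 - a * z) * (z - a) * ((1 - b * z) * (z - b)) * ((1 - c * z) * (z - c)) *
          ((1 - d * z) * (z - d)) * ((1 - e * z) * (z - e))) := by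
    rw [nrIntegrand, ← hA, g₁, f₁ a, f₁ b, f₁ c, f₁ d, f₁ e, f₁ A]
    generalize w A = wA at *
    generalize w a = wa at *
    generalize w b = wb at *
    generalize w c = wc at *
    generalize w d = wd at *
    generalize w e = we at *
    generalize 1 - a * z = ua at *
    generalize z - a = va at *
    generalize 1 - b * z = ub at *
    generalize z - b = vb at *
    generalize 1 - c * z = uc at *
    generalize z - c = vc at *
    generalize 1 - d * z = ud at *
    generalize z - d = vd at *
    generalize 1 - e * z = ue at *
    generalize z - e = ve at *
    field_simp
  have E₃ : nrCertificate q a b c d e z = X * w A / (w a * w b * w c * w d * w e) *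
      ((z ^ 2 - 1) * (z - A)) / ((z - a) * (z - b) * (z - c) * (z - d) * (z - e)) := by
    simp only [nrCertificate, Fin.prod_univ_five, Matrix.cons_val, ← hA]
    rw [show qPoch q (a / z) * qPoch q (b / z) * qPoch q (c / z) * qPoch q (d / z) *
          qPoch q (e / z) * (qPoch q (q * a * z) * qPoch q (q * b * z) * qPoch q (q * c * z) *
          qPoch q (q * d * z) * qPoch q (q * e * z)) =
        (qPoch q (a / z) * qPoch q (q * a * z)) * (qPoch q (b / z) * qPoch q (q * b * z)) *
        (qPoch q (c / z) * qPoch q (q * c * z)) * (qPoch q (d / z) * qPoch q (q * d * z)) *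
        (qPoch q (e / z) * qPoch q (q * e * z)) by ring,
      show qPoch q (q * z ^ 2) * qPoch q (z ^ 2)⁻¹ * qPoch q (q * A * z) * qPoch q (A / z) =
        qPoch q (q * z ^ 2) * qPoch q (z ^ 2)⁻¹ * (qPoch q (A / z) * qPoch q (q * A * z)) by ring,
      g₂, f₂ a, f₂ b, f₂ c, f₂ d, f₂ e, f₂ A]
    generalize w A = wA at *
    generalize w a = wa at *
    generalize w b = wb at *
    generalize w c = wc at *
    generalize w d = wd at *
    generalize w e = we at *
    generalize z - a = va at *
    generalize z - b = vb at *
    generalize z - c = vc at *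
    generalize z - d = vd at *
    generalize z - e = ve at *
    field_simp
  have E₄ : nrCertificate q a b c d e (z / q) / q = X * w A / (w a * w b * w c * w d * w e) *
      ((z ^ 2 - 1) * (1 - A * z)) /
        ((1 - a * z) * (1 - b * z) * (1 - c * z) * (1 - d * z) * (1 - e * z)) := by
    have t₁ : ∀ x, q * x * (z / q) = x * z := fun x => by field_simp
    have t₂ : ∀ x, x / (z / q) = q * x / z := fun x => by field_simp
    simp only [nrCertificate, Fin.prod_univ_five, Matrix.cons_val, ← hA, t₁, t₂]
    rw [show qPoch q (q * a / z) * qPoch q (q * b / z) * qPoch q (q * c / z) *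
          qPoch q (q * d / z) * qPoch q (q * e / z) * (qPoch q (a * z) * qPoch q (b * z) *
          qPoch q (c * z) * qPoch q (d * z) * qPoch q (e * z)) =
        (qPoch q (q * a / z) * qPoch q (a * z)) * (qPoch q (q * b / z) * qPoch q (b * z)) *
        (qPoch q (q * c / z) * qPoch q (c * z)) * (qPoch q (q * d / z) * qPoch q (d * z)) *
        (qPoch q (q * e / z) * qPoch q (e * z)) by ring,
      show q * (z / q) ^ 2 = z ^ 2 / q by field_simp,
      show ((z / q) ^ 2)⁻¹ = q ^ 2 / z ^ 2 by field_simp,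
      show qPoch q (z ^ 2 / q) * qPoch q (q ^ 2 / z ^ 2) * qPoch q (A * z) * qPoch q (q * A / z) =
        qPoch q (z ^ 2 / q) * qPoch q (q ^ 2 / z ^ 2) *
          (qPoch q (q * A / z) * qPoch q (A * z)) by ring,
      g₃, f₃ a, f₃ b, f₃ c, f₃ d, f₃ e, f₃ A]
    rw [show z ^ 2 - 1 = -(1 - z ^ 2) by ring]
    generalize w A = wA at *
    generalize w a = wa at *
    generalize w b = wb at *
    generalize w c = wc at *
    generalize w d = wd at *
    generalize w e = we at *
    generalize 1 - a * z = ua at *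
    generalize 1 - b * z = ub at *
    generalize 1 - c * z = uc at *
    generalize 1 - d * z = ud at *
    generalize 1 - e * z = ue at *
    field_simp
  rw [E₁, E₂, E₃, E₄]
  have key := nr_polynomial_identity a b c d e z
  rw [← hA] at key
  generalize hα : (1 - a * c * d * e) * (1 - a * b * d * e) * (1 - a * b * c * e) *
    (1 - a * b * c * d) = α at *
  generalize hβ : (1 - a * b) * (1 - a * c) * (1 - a * d) * (1 - a * e) = β at *
  generalize -a * (1 - a * A) = C at *
  generalize X * w A / (w a * w b * w c * w d * w e) = W at *
  generalize 1 - A * z = uA at *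
  generalize z - A = vA at *
  generalize 1 - a * z = ua at *
  generalize z - a = va at *
  generalize 1 - b * z = ub at *
  generalize z - b = vb at *
  generalize 1 - c * z = uc at *
  generalize z - c = vc at *
  generalize 1 - d * z = ud at *
  generalize z - d = vd at *
  generalize 1 - e * z = ue at *
  generalize z - e = ve at *
  generalize z ^ 2 - 1 = y at *
  field_simp
  linear_combination (W * y) * key

/-- The parameters vary together with `z`, because the limits below let parameters tend to 0 under
the integral sign. -/
theorem continuousOn_nrIntegrand_div (hq : ‖q‖ < 1) {X : Type*} [TopologicalSpace X] {s : Set X}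
    {a b c d e z : X → ℂ} (ha : ContinuousOn a s) (hb : ContinuousOn b s) (hc : ContinuousOn c s)
    (hd : ContinuousOn d s) (he : ContinuousOn e s) (hz : ContinuousOn z s)
    (h0 : ∀ p ∈ s, z p ≠ 0)
    (h : ∀ p ∈ s, ∀ x ∈ ({a p, b p, c p, d p, e p} : Set ℂ),
      qPoch q (x * z p) ≠ 0 ∧ qPoch q (x / z p) ≠ 0) :
    ContinuousOn (fun p => nrIntegrand q (a p) (b p) (c p) (d p) (e p) (z p) / z p) s := by
  have hc' : ∀ f : X → ℂ, ContinuousOn f s → ContinuousOn (fun z => qPoch q (f z)) s :=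
    fun f hf => (continuous_qPoch hq).comp_continuousOn hf
  have hA := (((ha.mul hb).mul hc).mul hd).mul he
  have hp : ContinuousOn (fun p => (z p ^ 2)⁻¹) s :=
    ContinuousOn.inv₀ (hz.pow 2) fun p hp => pow_ne_zero 2 (h0 p hp)
  refine ContinuousOn.div (ContinuousOn.div ?_ ?_ fun p hp => ?_) hz h0
  · exact ((hc' _ (hz.pow 2)).mul (hc' _ hp)).mul
      ((hc' _ (hA.mul hz)).mul (hc' _ (hA.div hz h0)))
  · exact (((((hc' _ (ha.mul hz)).mul (hc' _ (ha.div hz h0))).mul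
      ((hc' _ (hb.mul hz)).mul (hc' _ (hb.div hz h0)))).mul
      ((hc' _ (hc.mul hz)).mul (hc' _ (hc.div hz h0)))).mul
      ((hc' _ (hd.mul hz)).mul (hc' _ (hd.div hz h0)))).mul
      ((hc' _ (he.mul hz)).mul (hc' _ (he.div hz h0)))
  · have h' := h p hp
    simp only [Set.mem_insert_iff, Set.mem_singleton_iff, forall_eq_or_imp, forall_eq] at h'
    simp [h']

theorem continuousOn_nrCertificate (hq : ‖q‖ < 1) (a b c d e : ℂ) :
    ContinuousOn (nrCertificate q a b c d e) {z | z ≠ 0 ∧ (∀ i, qPoch q (![a, b, c, d, e] i / z) ≠ 0) ∧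
      ∀ j, qPoch q (![q * a, q * b, q * c, q * d, q * e] j * z) ≠ 0} := by
  have hP := continuous_qPoch hq
  have hc : ∀ f : ℂ → ℂ, ∀ s : Set ℂ, ContinuousOn f s → ContinuousOn (fun z => qPoch q (f z)) s :=
    fun f s hf => hP.comp_continuousOn hf
  set s := {z : ℂ | z ≠ 0 ∧ (∀ i, qPoch q (![a, b, c, d, e] i / z) ≠ 0) ∧
      ∀ j, qPoch q (![q * a, q * b, q * c, q * d, q * e] j * z) ≠ 0} with hs
  have hz : ∀ z ∈ s, z ≠ 0 := fun z hz => hz.1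
  have hi : ∀ x : ℂ, ContinuousOn (fun z => x / z) s := fun x =>
    continuousOn_const.div continuousOn_id hz
  have hp : ContinuousOn (fun z : ℂ => (z ^ 2)⁻¹) s :=
    ContinuousOn.inv₀ (by fun_prop) fun z h => pow_ne_zero 2 (hz z h)
  refine ContinuousOn.div (ContinuousOn.div ?_ (by fun_prop) fun z h => pow_ne_zero 2 (hz z h))
    (ContinuousOn.mul ?_ ?_) fun z h => ?_
  · exact (((hc _ _ (by fun_prop)).mul (hc _ _ hp)).mul (hc _ _ (by fun_prop))).mul (hc _ _ (hi _))
  · exact continuousOn_finsetProd _ fun i _ => hc _ _ (hi _)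
  · exact continuousOn_finsetProd _ fun i _ => hc _ _ (by fun_prop)
  · exact mul_ne_zero (Finset.prod_ne_zero_iff.2 fun i _ => h.2.1 i)
      (Finset.prod_ne_zero_iff.2 fun i _ => h.2.2 i)

/-- The shift `a ↦ q a` in the Nassrallah-Rahman integral. -/
theorem nr_shift (hq0 : q ≠ 0) (hq : ‖q‖ < 1) {a b c d e : ℂ}
    (h0 : ∀ x ∈ ({a, b, c, d, e} : Set ℂ), x ≠ 0)
    (hγ : EnclosesOrbits q {a, b, c, d, e} γ) :
    (1 - a * b) * (1 - a * c) * (1 - a * d) * (1 - a * e) *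
      loopIntegral γ (fun z => nrIntegrand q a b c d e z / z) =
    (1 - a * c * d * e) * (1 - a * b * d * e) * (1 - a * b * c * e) * (1 - a * b * c * d) *
      loopIntegral γ (fun z => nrIntegrand q (q * a) b c d e z / z) := by
  have hL := hγ.isLoop
  have hvec : ∀ i, ![a, b, c, d, e] i ∈ ({a, b, c, d, e} : Set ℂ) := fun i => by
    fin_cases i <;> simp
  have hvec' : ∀ j, ∃ x ∈ ({a, b, c, d, e} : Set ℂ),
      ![q * a, q * b, q * c, q * d, q * e] j = q * x := fun j => by
    fin_cases j
    exacts [⟨a, by simp⟩, ⟨b, by simp⟩, ⟨c, by simp⟩, ⟨d, by simp⟩, ⟨e, by simp⟩]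
  -- Dividing the loop by `q` crosses no pole of the certificate. Its inner poles `x q^n` turn into
  -- `x q^(n+1)` as seen from `γ`, and its outer poles start only at `(q x)⁻¹`, so that even after
  -- rescaling they are excluded reciprocals `(x q^n)⁻¹`.
  have hcauchy : loopIntegral γ (nrCertificate q a b c d e) =
      loopIntegral (fun θ => γ θ / q) (nrCertificate q a b c d e) := by
    refine loopIntegral_div_qPoch_eq hq0 hq ![a, b, c, d, e]
      (b := ![q * a, q * b, q * c, q * d, q * e]) (fun j => ?_) ?_ hL (hL.div_const q) hγ.ne_zero
      (fun θ => div_ne_zero (hγ.ne_zero θ) hq0) ?_ (fun i => hγ.ne_orbit _ (hvec i)) ?_ ?_ ?_ ?_ ?_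
    · obtain ⟨x, hx, e⟩ := hvec' j
      rw [e]
      exact mul_ne_zero hq0 (h0 x hx)
    · have hP := differentiable_qPoch hq
      intro z hz
      have hz0 : z ≠ 0 := hz
      have hz2 : z ^ 2 ≠ 0 := pow_ne_zero 2 hz0
      refine DifferentiableAt.differentiableWithinAt ?_
      fun_prop (disch := assumption)
    · rw [hL.windingNumber_div_const hq0, mul_zero]
    · intro i n θ h
      refine hγ.ne_orbit _ (hvec i) (n + 1) θ ?_
      rw [div_eq_iff hq0] at h
      rw [h]; ring
    · intro i n
      rw [hL.windingNumber_div_const hq0, hγ.winding_orbit _ (hvec i),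
        show q * (![a, b, c, d, e] i * q ^ n) = ![a, b, c, d, e] i * q ^ (n + 1) by ring,
        hγ.winding_orbit _ (hvec i)]
    · intro j n θ
      obtain ⟨x, hx, e⟩ := hvec' j
      rw [e, show q * x * q ^ n = x * q ^ (n + 1) by ring]
      exact hγ.ne_inv x hx (n + 1) θ
    · intro j n θ h
      obtain ⟨x, hx, e⟩ := hvec' j
      refine hγ.ne_inv x hx n θ ?_
      rw [e, div_eq_iff hq0] at h
      rw [h]
      field_simp
    · intro j n
      obtain ⟨x, hx, e⟩ := hvec' j
      rw [e, hL.windingNumber_div_const hq0,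
        show q * (q * x * q ^ n)⁻¹ = (x * q ^ n)⁻¹ by field_simp,
        show q * x * q ^ n = x * q ^ (n + 1) by ring, hγ.winding_inv x hx, hγ.winding_inv x hx]
  rw [hL.loopIntegral_div_const] at hcauchy
  have m₁ : ∀ θ, γ θ ∈ {z | z ≠ 0 ∧ ∀ x ∈ ({a, b, c, d, e} : Set ℂ),
      qPoch q (x * z) ≠ 0 ∧ qPoch q (x / z) ≠ 0} := fun θ =>
    ⟨hγ.ne_zero θ, fun x hx =>
      ⟨hγ.qPoch_mul_apply_ne_zero hq hx θ, hγ.qPoch_div_apply_ne_zero hq hx θ⟩⟩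
  have hshift : ∀ x z, qPoch q (x * z) ≠ 0 → qPoch q (q * x * z) ≠ 0 := fun x z h => by
    rw [qPoch_mul_step hq] at h
    exact (mul_ne_zero_iff.1 h).2
  have hshift' : ∀ x z, z ≠ 0 → qPoch q (x / z) ≠ 0 → qPoch q (q * x / z) ≠ 0 :=
    fun x z hz h => by
      rw [qPoch_div_step hq _ hz] at h
      exact (mul_ne_zero_iff.1 h).2
  set S := {z : ℂ | z ≠ 0 ∧ ∀ x ∈ ({a, b, c, d, e} : Set ℂ),
      qPoch q (x * z) ≠ 0 ∧ qPoch q (x / z) ≠ 0} with hS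
  have c₁ : ∀ k : ℂ, ContinuousOn (fun z => k * (nrIntegrand q a b c d e z / z)) S := fun k =>
    continuousOn_const.mul (continuousOn_nrIntegrand_div hq continuousOn_const continuousOn_const
      continuousOn_const continuousOn_const continuousOn_const continuousOn_id (fun z hz => hz.1)
      fun z hz => hz.2)
  have c₂ : ∀ k : ℂ, ContinuousOn (fun z => k * (nrIntegrand q (q * a) b c d e z / z)) S := fun k =>
    continuousOn_const.mul (continuousOn_nrIntegrand_div hq continuousOn_const continuousOn_const
      continuousOn_const continuousOn_const continuousOn_const continuousOn_id (fun z hz => hz.1)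
      fun z hz x hx => by
        rcases hx with rfl | hx
        · have := hz.2 a (by simp)
          exact ⟨hshift _ _ this.1, hshift' _ _ hz.1 this.2⟩
        · exact hz.2 x (Or.inr hx))
  have c₃ : ContinuousOn (nrCertificate q a b c d e) S :=
    (continuousOn_nrCertificate hq a b c d e).mono fun z hz => ⟨hz.1, fun i => (hz.2 _ (hvec i)).2,
      fun j => by
        obtain ⟨x, hx, e⟩ := hvec' j
        rw [e]
        exact hshift _ _ (hz.2 x hx).1⟩
  have c₄ : ContinuousOn (fun z => nrCertificate q a b c d e (z / q) / q) S := by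
    refine ContinuousOn.div_const ((continuousOn_nrCertificate hq a b c d e).comp
      (by fun_prop) fun z hz => ⟨div_ne_zero hz.1 hq0, fun i => ?_, fun j => ?_⟩) q
    · rw [show ![a, b, c, d, e] i / (z / q) = q * ![a, b, c, d, e] i / z by field_simp]
      exact hshift' _ _ hz.1 (hz.2 _ (hvec i)).2
    · obtain ⟨x, hx, e⟩ := hvec' j
      rw [e, show q * x * (z / q) = x * z by field_simp]
      exact (hz.2 x hx).1
  have e₁ := loopIntegral_congr (γ := γ)
    (f := fun z => (1 - a * c * d * e) * (1 - a * b * d * e) * (1 - a * b * c * e) *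
        (1 - a * b * c * d) * (nrIntegrand q (q * a) b c d e z / z) -
      (1 - a * b) * (1 - a * c) * (1 - a * d) * (1 - a * e) * (nrIntegrand q a b c d e z / z))
    (g := fun z => -a * (1 - a * (a * b * c * d * e)) *
      (nrCertificate q a b c d e z - nrCertificate q a b c d e (z / q) / q))
    fun θ => nr_telescope hq0 hq (hγ.ne_zero θ)
    (fun x hx => hγ.qPoch_mul_apply_ne_zero hq hx θ)
    (fun x hx => hγ.qPoch_div_apply_ne_zero hq hx θ)
  rw [hL.loopIntegral_sub (c₂ _) (c₁ _) m₁,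
    loopIntegral_const_mul, loopIntegral_const_mul, loopIntegral_const_mul,
    hL.loopIntegral_sub c₃ c₄ m₁, hcauchy, sub_self, mul_zero, sub_eq_zero] at e₁
  exact e₁.symm

theorem nrProduct_shift (hq : ‖q‖ < 1) (a b c d e : ℂ)
    (h : qPoch q (a * b) ≠ 0 ∧ qPoch q (a * c) ≠ 0 ∧ qPoch q (a * d) ≠ 0 ∧ qPoch q (a * e) ≠ 0) :
    (1 - a * b) * (1 - a * c) * (1 - a * d) * (1 - a * e) * nrProduct q a b c d e =
    (1 - a * c * d * e) * (1 - a * b * d * e) * (1 - a * b * c * e) * (1 - a * b * c * d) *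
      nrProduct q (q * a) b c d e := by
  have s₂ : ∀ x y, qPoch q (x * y) = (1 - x * y) * qPoch q (q * x * y) :=
    fun x y => qPoch_mul_step hq x y
  have s₄ : ∀ x y u v, qPoch q (x * y * u * v) =
      (1 - x * y * u * v) * qPoch q (q * x * y * u * v) :=
    fun x y u v => by rw [qPoch_step hq, ← mul_assoc, ← mul_assoc, ← mul_assoc]
  rw [s₂ a b, s₂ a c, s₂ a d, s₂ a e] at h
  simp only [ne_eq, mul_eq_zero, not_or] at h
  obtain ⟨⟨h1, h2⟩, ⟨h3, h4⟩, ⟨h5, h6⟩, ⟨h7, h8⟩⟩ := h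
  rw [nrProduct, nrProduct, s₂ a b, s₂ a c, s₂ a d, s₂ a e, s₄ a c d e, s₄ a b d e, s₄ a b c e,
    s₄ a b c d]
  generalize 1 - a * b = x₁ at *
  generalize 1 - a * c = x₂ at *
  generalize 1 - a * d = x₃ at *
  generalize 1 - a * e = x₄ at *
  generalize qPoch q (q * a * b) = y₁ at *
  generalize qPoch q (q * a * c) = y₂ at *
  generalize qPoch q (q * a * d) = y₃ at *
  generalize qPoch q (q * a * e) = y₄ at *
  have c₁ : x₁ * (x₁ * y₁)⁻¹ = y₁⁻¹ := by field_simp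
  have c₂ : x₂ * (x₂ * y₂)⁻¹ = y₂⁻¹ := by field_simp
  have c₃ : x₃ * (x₃ * y₃)⁻¹ = y₃⁻¹ := by field_simp
  have c₄ : x₄ * (x₄ * y₄)⁻¹ = y₄⁻¹ := by field_simp
  generalize qPoch q (b * c * d * e) = n₀
  generalize (1 - a * c * d * e) = m₁
  generalize (1 - a * b * d * e) = m₂
  generalize (1 - a * b * c * e) = m₃
  generalize (1 - a * b * c * d) = m₄
  generalize qPoch q (q * a * c * d * e) = n₁
  generalize qPoch q (q * a * b * d * e) = n₂
  generalize qPoch q (q * a * b * c * e) = n₃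
  generalize qPoch q (q * a * b * c * d) = n₄
  generalize x₁ * y₁ = t₁ at *
  generalize x₂ * y₂ = t₂ at *
  generalize x₃ * y₃ = t₃ at *
  generalize x₄ * y₄ = t₄ at *
  rw [div_eq_mul_inv, div_eq_mul_inv]
  simp only [mul_inv]
  rw [← c₁, ← c₂, ← c₃, ← c₄]
  ring

/-- Cyclic symmetry allows the shift of the first parameter to be applied to each parameter in turn.
-/
theorem nrIntegrand_rotate (q a b c d e z : ℂ) :
    nrIntegrand q a b c d e z = nrIntegrand q b c d e a z := by
  rw [nrIntegrand, nrIntegrand, show b * c * d * e * a = a * b * c * d * e by ring]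
  ring

theorem nrProduct_rotate (q a b c d e : ℂ) :
    nrProduct q a b c d e = nrProduct q b c d e a := by
  rw [nrProduct, nrProduct, show c * d * e * a = a * c * d * e by ring,
    show b * d * e * a = a * b * d * e by ring, show b * c * e * a = a * b * c * e by ring,
    show b * c * d * a = a * b * c * d by ring, mul_comm b a, mul_comm c a, mul_comm d a,
    mul_comm e a]
  ring

/-- Integral and product obey the same recurrence. It is recorded through a common factor `R` rather
than a quotient, since the product may vanish; the rotation moves the next parameter to the front.
-/
theorem nr_shift_rotate (hq0 : q ≠ 0) (hq : ‖q‖ < 1) {a b c d e : ℂ}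
    (h0 : ∀ x ∈ ({a, b, c, d, e} : Set ℂ), x ≠ 0)
    (hγ : EnclosesOrbits q {a, b, c, d, e} γ) :
    ∃ R : ℂ, loopIntegral γ (fun z => nrIntegrand q a b c d e z / z) =
        R * loopIntegral γ (fun z => nrIntegrand q b c d e (q * a) z / z) ∧
      nrProduct q a b c d e = R * nrProduct q b c d e (q * a) := by
  have hne : ∀ x ∈ ({a, b, c, d, e} : Set ℂ), 1 - a * x ≠ 0 := fun x hx =>
    sub_ne_zero.2 fun h => hγ.mul_pow_ne_one (a := a) (by simp) hx 0 (by simpa using h.symm)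
  have hP : ∀ x ∈ ({a, b, c, d, e} : Set ℂ), qPoch q (a * x) ≠ 0 := fun x hx =>
    hγ.qPoch_mul_ne_zero hq (by simp) hx
  have hβ : (1 - a * b) * (1 - a * c) * (1 - a * d) * (1 - a * e) ≠ 0 :=
    mul_ne_zero (mul_ne_zero (mul_ne_zero (hne b (by simp)) (hne c (by simp)))
      (hne d (by simp))) (hne e (by simp))
  refine ⟨(1 - a * c * d * e) * (1 - a * b * d * e) * (1 - a * b * c * e) * (1 - a * b * c * d) /
    ((1 - a * b) * (1 - a * c) * (1 - a * d) * (1 - a * e)), ?_, ?_⟩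
  · simp only [← nrIntegrand_rotate q (q * a) b c d e]
    have := nr_shift hq0 hq h0 hγ
    rw [div_mul_eq_mul_div, ← this, mul_div_cancel_left₀ _ hβ]
  · rw [← nrProduct_rotate q (q * a) b c d e]
    have := nrProduct_shift hq a b c d e
      ⟨hP b (by simp), hP c (by simp), hP d (by simp), hP e (by simp)⟩
    rw [div_mul_eq_mul_div, ← this, mul_div_cancel_left₀ _ hβ]

theorem nr_scale (hq0 : q ≠ 0) (hq : ‖q‖ < 1) {a b c d e : ℂ}
    (h0 : ∀ x ∈ ({a, b, c, d, e} : Set ℂ), x ≠ 0)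
    (hγ : EnclosesOrbits q {a, b, c, d, e} γ) :
    ∃ R : ℂ, loopIntegral γ (fun z => nrIntegrand q a b c d e z / z) =
        R * loopIntegral γ
          (fun z => nrIntegrand q (a * q) (b * q) (c * q) (d * q) (e * q) z / z) ∧
      nrProduct q a b c d e = R * nrProduct q (a * q) (b * q) (c * q) (d * q) (e * q) := by
  have step : ∀ a' b' c' d' e' : ℂ,
      (∀ y ∈ ({a', b', c', d', e'} : Set ℂ), ∃ x ∈ ({a, b, c, d, e} : Set ℂ), ∃ m : ℕ,
        y = x * q ^ m) →
      ∃ R : ℂ, loopIntegral γ (fun z => nrIntegrand q a' b' c' d' e' z / z) =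
        R * loopIntegral γ (fun z => nrIntegrand q b' c' d' e' (a' * q) z / z) ∧
      nrProduct q a' b' c' d' e' = R * nrProduct q b' c' d' e' (a' * q) := by
    intro a' b' c' d' e' h
    rw [mul_comm a' q]
    refine nr_shift_rotate hq0 hq (fun y hy => ?_) (hγ.mono h)
    obtain ⟨x, hx, m, rfl⟩ := h y hy
    exact mul_ne_zero (h0 x hx) (pow_ne_zero _ hq0)
  have hmem : ∀ x ∈ ({a, b, c, d, e} : Set ℂ), ∀ y, (y = x ∨ y = x * q) →
      ∃ x ∈ ({a, b, c, d, e} : Set ℂ), ∃ m : ℕ, y = x * q ^ m := by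
    rintro x hx y (rfl | rfl)
    · exact ⟨y, hx, 0, by simp⟩
    · exact ⟨x, hx, 1, by simp⟩
  have ha := hmem a (by simp)
  have hb := hmem b (by simp)
  have hc := hmem c (by simp)
  have hd := hmem d (by simp)
  have he := hmem e (by simp)
  obtain ⟨R₁, i₁, p₁⟩ := step a b c d e (by
    rintro y (rfl | rfl | rfl | rfl | rfl)
    exacts [ha _ (by simp), hb _ (by simp), hc _ (by simp), hd _ (by simp), he _ (by simp)])
  obtain ⟨R₂, i₂, p₂⟩ := step b c d e (a * q) (by
    rintro y (rfl | rfl | rfl | rfl | rfl)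
    exacts [hb _ (by simp), hc _ (by simp), hd _ (by simp), he _ (by simp), ha _ (by simp)])
  obtain ⟨R₃, i₃, p₃⟩ := step c d e (a * q) (b * q) (by
    rintro y (rfl | rfl | rfl | rfl | rfl)
    exacts [hc _ (by simp), hd _ (by simp), he _ (by simp), ha _ (by simp), hb _ (by simp)])
  obtain ⟨R₄, i₄, p₄⟩ := step d e (a * q) (b * q) (c * q) (by
    rintro y (rfl | rfl | rfl | rfl | rfl)
    exacts [hd _ (by simp), he _ (by simp), ha _ (by simp), hb _ (by simp), hc _ (by simp)])
  obtain ⟨R₅, i₅, p₅⟩ := step e (a * q) (b * q) (c * q) (d * q) (by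
    rintro y (rfl | rfl | rfl | rfl | rfl)
    exacts [he _ (by simp), ha _ (by simp), hb _ (by simp), hc _ (by simp), hd _ (by simp)])
  refine ⟨R₁ * R₂ * R₃ * R₄ * R₅, ?_, ?_⟩
  · rw [i₁, i₂, i₃, i₄, i₅]; ring
  · rw [p₁, p₂, p₃, p₄, p₅]; ring

theorem nr_scale_pow (hq0 : q ≠ 0) (hq : ‖q‖ < 1) {a b c d e : ℂ}
    (h0 : ∀ x ∈ ({a, b, c, d, e} : Set ℂ), x ≠ 0)
    (hγ : EnclosesOrbits q {a, b, c, d, e} γ) (n : ℕ) :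
    ∃ R : ℂ, loopIntegral γ (fun z => nrIntegrand q a b c d e z / z) =
        R * loopIntegral γ (fun z => nrIntegrand q (a * q ^ n) (b * q ^ n) (c * q ^ n)
          (d * q ^ n) (e * q ^ n) z / z) ∧
      nrProduct q a b c d e =
        R * nrProduct q (a * q ^ n) (b * q ^ n) (c * q ^ n) (d * q ^ n) (e * q ^ n) := by
  induction n with
  | zero => exact ⟨1, by simp⟩
  | succ n ih =>
    obtain ⟨R, h1, h2⟩ := ih
    have hS : ∀ y ∈ ({a * q ^ n, b * q ^ n, c * q ^ n, d * q ^ n, e * q ^ n} : Set ℂ),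
        ∃ x ∈ ({a, b, c, d, e} : Set ℂ), ∃ m : ℕ, y = x * q ^ m := by
      rintro y (rfl | rfl | rfl | rfl | rfl)
      exacts [⟨a, by simp, n, rfl⟩, ⟨b, by simp, n, rfl⟩, ⟨c, by simp, n, rfl⟩,
        ⟨d, by simp, n, rfl⟩, ⟨e, by simp, n, rfl⟩]
    obtain ⟨R', h3, h4⟩ := nr_scale hq0 hq (a := a * q ^ n) (b := b * q ^ n) (c := c * q ^ n)
      (d := d * q ^ n) (e := e * q ^ n) (fun y hy => by
        obtain ⟨x, hx, m, rfl⟩ := hS y hy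
        exact mul_ne_zero (h0 x hx) (pow_ne_zero _ hq0)) (hγ.mono hS)
    simp only [mul_assoc, ← pow_succ] at h3 h4
    exact ⟨R * R', by rw [h1, h3, mul_assoc], by rw [h2, h4, mul_assoc]⟩

/-- Convergence of loop integrals along a compact family of continuous integrands. -/
theorem IsLoop.tendsto_loopIntegral (h : IsLoop γ) {u : ℕ → ℂ} {u₀ : ℂ}
    (hu : Tendsto u atTop (𝓝 u₀)) {F : ℂ → ℂ → ℂ}
    (hF : ContinuousOn (fun p : ℂ × ℂ => F p.1 p.2) (insert u₀ (Set.range u) ×ˢ Set.range γ)) :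
    Tendsto (fun n => loopIntegral γ (F (u n))) atTop (𝓝 (loopIntegral γ (F u₀))) ∧
      ∃ C : ℝ, ∀ n θ, ‖F (u n) (γ θ)‖ ≤ C := by
  have hK := hu.isCompact_insert_range.prod h.isCompact_range
  obtain ⟨C, hC⟩ := hK.exists_bound_of_continuousOn hF
  have hC' : ∀ n θ, ‖F (u n) (γ θ)‖ ≤ C := fun n θ =>
    hC (u n, γ θ) ⟨Or.inr ⟨n, rfl⟩, ⟨θ, rfl⟩⟩
  have hcont : ∀ x ∈ insert u₀ (Set.range u), ContinuousOn (F x) (Set.range γ) := fun x hx =>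
    hF.comp (f := fun z => (x, z)) (by fun_prop) fun z hz => ⟨hx, hz⟩
  refine ⟨?_, C, hC'⟩
  refine intervalIntegral.tendsto_integral_filter_of_dominated_convergence
    (fun θ => C * ‖deriv γ θ‖) ?_ ?_ ?_ ?_
  · refine Eventually.of_forall fun n => ?_
    exact (h.continuous_integrand (hcont (u n) (Or.inr ⟨n, rfl⟩))
      fun θ => ⟨θ, rfl⟩).aestronglyMeasurable
  · refine Eventually.of_forall fun n => Eventually.of_forall fun θ _ => ?_
    rw [norm_mul]
    exact mul_le_mul_of_nonneg_right (hC' n θ) (norm_nonneg _)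
  · exact (continuous_const.mul h.continuous_deriv.norm).intervalIntegrable _ _
  · refine Eventually.of_forall fun θ _ => Tendsto.mul_const _ ?_
    have h1 := hF (u₀, γ θ) ⟨Or.inl rfl, ⟨θ, rfl⟩⟩
    have h2 : Tendsto (fun n => (u n, γ θ)) atTop
        (𝓝[insert u₀ (Set.range u) ×ˢ Set.range γ] (u₀, γ θ)) :=
      tendsto_nhdsWithin_iff.2 ⟨hu.prodMk_nhds tendsto_const_nhds,
        Eventually.of_forall fun n => ⟨Or.inr ⟨n, rfl⟩, ⟨θ, rfl⟩⟩⟩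
    exact h1.tendsto.comp h2

/-- Scale all five parameters by `q ^ n` and let `n` grow. The scaled product tends to 1, so the
accumulated factors `R n` tend to the original product, while the scaled integral tends to the one
without parameters. -/
theorem nr_eq_mul_limit (hq0 : q ≠ 0) (hq : ‖q‖ < 1) {a b c d e : ℂ}
    (h0 : ∀ x ∈ ({a, b, c, d, e} : Set ℂ), x ≠ 0)
    (hγ : EnclosesOrbits q {a, b, c, d, e} γ) :
    loopIntegral γ (fun z => nrIntegrand q a b c d e z / z) =
      nrProduct q a b c d e * loopIntegral γ (fun z => qPoch q (z ^ 2) * qPoch q (z ^ 2)⁻¹ / z) := by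
  have hu : Tendsto (fun n : ℕ => q ^ n) atTop (𝓝 0) :=
    tendsto_pow_atTop_nhds_zero_of_norm_lt_one hq
  have hlim := (hγ.isLoop.tendsto_loopIntegral hu
    (F := fun ε z => nrIntegrand q (a * ε) (b * ε) (c * ε) (d * ε) (e * ε) z / z) (by
      refine continuousOn_nrIntegrand_div hq (by fun_prop) (by fun_prop) (by fun_prop)
        (by fun_prop) (by fun_prop) (by fun_prop) ?_ ?_
      · rintro ⟨ε, z⟩ ⟨-, ⟨θ, rfl⟩⟩
        exact hγ.ne_zero θ
      · rintro ⟨ε, z⟩ ⟨hε, ⟨θ, rfl⟩⟩ y hy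
        obtain ⟨x, hx, rfl⟩ : ∃ x ∈ ({a, b, c, d, e} : Set ℂ), y = x * ε := by
          rcases hy with rfl | rfl | rfl | rfl | rfl
          exacts [⟨a, by simp, rfl⟩, ⟨b, by simp, rfl⟩, ⟨c, by simp, rfl⟩, ⟨d, by simp, rfl⟩,
            ⟨e, by simp, rfl⟩]
        rcases hε with hε | ⟨n, hε⟩
        · simp only at hε
          simp [hε]
        · simp only at hε
          have hS : EnclosesOrbits q {x * ε} γ := hγ.mono fun y hy => ⟨x, hx, n, by
            rw [Set.mem_singleton_iff.1 hy, hε]⟩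
          exact ⟨hS.qPoch_mul_apply_ne_zero hq rfl θ, hS.qPoch_div_apply_ne_zero hq rfl θ⟩)).1
  simp only [nrIntegrand, mul_zero, zero_mul, zero_div, qPoch_zero, mul_one, div_one] at hlim
  have hprod : Tendsto (fun n : ℕ => nrProduct q (a * q ^ n) (b * q ^ n) (c * q ^ n) (d * q ^ n)
      (e * q ^ n)) atTop (𝓝 1) := by
    have hc : ContinuousAt (fun ε : ℂ => nrProduct q (a * ε) (b * ε) (c * ε) (d * ε) (e * ε)) 0 := by
      have hP := continuous_qPoch hq
      unfold nrProduct
      refine ContinuousAt.div (by fun_prop) (by fun_prop) (by simp)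
    have := hc.tendsto.comp hu
    simpa [nrProduct, Function.comp_def] using this
  choose R hR₁ hR₂ using nr_scale_pow hq0 hq h0 hγ
  have hRlim : Tendsto R atTop (𝓝 (nrProduct q a b c d e)) := by
    have h1 := (tendsto_const_nhds (x := nrProduct q a b c d e)).div hprod one_ne_zero
    rw [div_one] at h1
    refine h1.congr' ?_
    filter_upwards [hprod.eventually_ne one_ne_zero] with n hn
    simp only [Pi.div_apply]
    rw [hR₂ n, mul_div_cancel_right₀ _ hn]
  have := hRlim.mul hlim
  refine tendsto_nhds_unique (tendsto_const_nhds.congr fun n => ?_) this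
  rw [hR₁ n]
  rfl

/-- The factorization `(z²; q)_∞ = (z, -z, r z, -r z; q)_∞`, where `r² = q`. -/
theorem qPoch_sq (hq : ‖q‖ < 1) {r : ℂ} (hr : r ^ 2 = q) (z : ℂ) :
    qPoch q (z ^ 2) =
      qPoch q z * qPoch q (-z) * (qPoch q (r * z) * qPoch q (-(r * z))) := by
  have hfin : ∀ n : ℕ, qPochFin q (z ^ 2) (2 * n) =
      qPochFin q z n * qPochFin q (-z) n * (qPochFin q (r * z) n * qPochFin q (-(r * z)) n) := by
    intro n
    induction n with
    | zero => simp
    | succ n ih =>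
      rw [show 2 * (n + 1) = 2 * n + 1 + 1 by ring]
      simp only [qPochFin_succ, ih]
      rw [show z ^ 2 * q ^ (2 * n + 1) = (r * z) ^ 2 * q ^ (2 * n) by rw [← hr]; ring]
      ring
  refine tendsto_nhds_unique ((tendsto_qPochFin hq (z ^ 2)).comp
    (tendsto_id.const_mul_atTop' (by norm_num : 0 < 2))) ?_
  refine (((tendsto_qPochFin hq z).mul (tendsto_qPochFin hq (-z))).mul
    ((tendsto_qPochFin hq (r * z)).mul (tendsto_qPochFin hq (-(r * z))))).congr fun n => ?_
  exact (hfin n).symm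

theorem enclosesOrbits_circle (hq : ‖q‖ < 1) {S : Set ℂ} (hS : ∀ x ∈ S, x ≠ 0 ∧ ‖x‖ < 1)
    (hq0 : q ≠ 0) : EnclosesOrbits q S (circleMap 0 1) := by
  have hlt : ∀ x ∈ S, ∀ n : ℕ, ‖x * q ^ n‖ < 1 := fun x hx n => by
    rw [norm_mul, norm_pow]
    exact mul_lt_one_of_nonneg_of_lt_one_left (norm_nonneg _) (hS x hx).2
      (pow_le_one₀ (norm_nonneg _) hq.le)
  have hgt : ∀ x ∈ S, ∀ n : ℕ, 1 < ‖(x * q ^ n)⁻¹‖ := fun x hx n => by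
    rw [norm_inv]
    exact one_lt_inv_iff₀.2 ⟨norm_pos_iff.2 (mul_ne_zero (hS x hx).1 (pow_ne_zero _ hq0)),
      hlt x hx n⟩
  refine ⟨isLoop_circleMap 1, fun θ h => ?_, windingNumber_circleMap_of_lt (by simp),
    fun x hx n θ h => ?_, fun x hx n => windingNumber_circleMap_of_lt (hlt x hx n),
    fun x hx n θ h => ?_, fun x hx n => windingNumber_circleMap_of_gt zero_le_one (hgt x hx n)⟩
  · have := norm_circleMap zero_le_one θ
    rw [h, norm_zero] at this
    exact zero_ne_one this
  · have := hlt x hx n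
    rw [← h, norm_circleMap zero_le_one] at this
    exact lt_irrefl _ this
  · have := hgt x hx n
    rw [← h, norm_circleMap zero_le_one] at this
    exact lt_irrefl _ this

/-- The parameters (q, -q, r, -r, 0) with r² = q make the denominator cancel all of (z^{±2}; q)_∞
except (1 - z²)(1 - z⁻²), whose constant term is 2. The last parameter is approached through `q * q
^ n`, because the shift argument requires nonzero parameters. -/
theorem nr_constant_circle (hq0 : q ≠ 0) (hq : ‖q‖ < 1) :
    loopIntegral (circleMap 0 1) (fun z => qPoch q (z ^ 2) * qPoch q (z ^ 2)⁻¹ / z) =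
      2 * Real.pi * Complex.I * (2 / qPoch q q) := by
  obtain ⟨r, hr⟩ : ∃ r : ℂ, r ^ 2 = q := ⟨q ^ (1 / 2 : ℂ), by
    rw [← Complex.cpow_nat_mul]; norm_num⟩
  have hr0 : r ≠ 0 := by rintro rfl; exact hq0 (by rw [← hr]; simp)
  have hr1 : ‖r‖ < 1 := by
    have : ‖r‖ ^ 2 < 1 := by rw [← norm_pow, hr]; exact hq
    exact (sq_lt_one_iff₀ (norm_nonneg _)).1 this
  have hL := isLoop_circleMap 1
  set I₀ := loopIntegral (circleMap 0 1) (fun z => qPoch q (z ^ 2) * qPoch q (z ^ 2)⁻¹ / z) with hI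
  have hS : ∀ ε : ℂ, ε ≠ 0 → ‖ε‖ < 1 → ∀ x ∈ ({q, -q, r, -r, ε} : Set ℂ), x ≠ 0 ∧ ‖x‖ < 1 := by
    rintro ε h1 h2 x (rfl | rfl | rfl | rfl | rfl)
    · exact ⟨hq0, hq⟩
    · exact ⟨neg_ne_zero.2 hq0, by rwa [norm_neg]⟩
    · exact ⟨hr0, hr1⟩
    · exact ⟨neg_ne_zero.2 hr0, by rwa [norm_neg]⟩
    · exact ⟨h1, h2⟩
  have hval : ∀ n : ℕ, loopIntegral (circleMap 0 1)
      (fun z => nrIntegrand q q (-q) r (-r) (q * q ^ n) z / z) =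
      nrProduct q q (-q) r (-r) (q * q ^ n) * I₀ := fun n => by
    have h1 := hS (q * q ^ n) (mul_ne_zero hq0 (pow_ne_zero _ hq0)) (by
      rw [← pow_succ', norm_pow]
      exact pow_lt_one₀ (norm_nonneg _) hq (by omega))
    exact nr_eq_mul_limit hq0 hq (fun x hx => (h1 x hx).1) (enclosesOrbits_circle hq h1 hq0)
  have hu := tendsto_mul_pow_zero hq q
  have hnorm : ∀ x z : ℂ, ‖x‖ < 1 → ‖z‖ = 1 → qPoch q (x * z) ≠ 0 ∧ qPoch q (x / z) ≠ 0 :=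
    fun x z hx hz => ⟨qPoch_ne_zero_of_norm_lt hq (by rw [norm_mul, hz, mul_one]; exact hx),
      qPoch_ne_zero_of_norm_lt hq (by rw [norm_div, hz, div_one]; exact hx)⟩
  have hlim := (hL.tendsto_loopIntegral hu
    (F := fun ε z => nrIntegrand q q (-q) r (-r) ε z / z) (by
      refine continuousOn_nrIntegrand_div hq (by fun_prop) (by fun_prop) (by fun_prop)
        (by fun_prop) (by fun_prop) (by fun_prop) ?_ ?_
      · rintro ⟨ε, z⟩ ⟨-, ⟨θ, rfl⟩⟩ h
        have := norm_circleMap zero_le_one θ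
        simp only at h
        rw [h, norm_zero] at this
        exact zero_ne_one this
      · rintro ⟨ε, z⟩ ⟨hε, ⟨θ, rfl⟩⟩ y hy
        refine hnorm y _ ?_ (norm_circleMap zero_le_one θ)
        rcases hε with hε | ⟨n, hε⟩
        · simp only at hε hy
          subst hε
          by_cases hy0 : y = 0
          · simp [hy0]
          refine (hS q hq0 hq y ?_).2
          simp only [Set.mem_insert_iff, Set.mem_singleton_iff] at hy ⊢
          tauto
        · simp only at hε hy
          refine (hS ε ?_ ?_ y hy).2
          · rw [← hε]; exact mul_ne_zero hq0 (pow_ne_zero _ hq0)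
          · rw [← hε, ← pow_succ', norm_pow]
            exact pow_lt_one₀ (norm_nonneg _) hq (by omega))).1
  have hF0 : loopIntegral (circleMap 0 1) (fun z => nrIntegrand q q (-q) r (-r) 0 z / z) =
      2 * Real.pi * Complex.I * 2 := by
    have hz0 : ∀ θ : ℝ, circleMap 0 1 θ ≠ 0 := fun θ h => by
      have := norm_circleMap zero_le_one θ
      rw [h, norm_zero] at this
      exact zero_ne_one this
    -- This is (1 - z²)(1 - z⁻²)/z. Only the term with a simple pole has a nonzero integral.
    rw [loopIntegral_congr (g := fun z => (2 * (z - 0)⁻¹ - z) - ((z - 0) ^ 3)⁻¹)]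
    · rw [hL.loopIntegral_sub (s := {0}ᶜ), hL.loopIntegral_sub (s := {0}ᶜ), loopIntegral_const_mul,
        windingNumber_eq, windingNumber_circleMap_of_lt (by simp),
        hL.loopIntegral_sub_pow_inv hz0 (by norm_num),
        hL.loopIntegral_eq_zero_of_hasDerivAt (f := fun z => z) (F := fun z => z ^ 2 / 2)
          (s := Set.univ) (by fun_prop) (by simp)]
      · ring
      · intro z _
        have := ((hasDerivAt_id z).pow 2).div_const 2
        refine this.congr_deriv ?_
        simp
      · exact continuousOn_const.mul (ContinuousOn.inv₀ (by fun_prop) fun z hz => by simpa using hz)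
      · fun_prop
      · exact fun θ => hz0 θ
      · exact (continuousOn_const.mul (ContinuousOn.inv₀ (by fun_prop)
          fun z hz => by simpa using hz)).sub (by fun_prop)
      · exact ContinuousOn.inv₀ (by fun_prop) fun z hz => by simpa using hz
      · exact fun θ => hz0 θ
    · intro θ
      set z := circleMap 0 1 θ with hz
      have hzn : ‖z‖ = 1 := norm_circleMap zero_le_one θ
      have hz' : z ≠ 0 := hz0 θ
      have n1 := hnorm q z hq hzn
      have n2 := hnorm (-q) z (by rwa [norm_neg]) hzn
      have n3 := hnorm r z hr1 hzn
      have n4 := hnorm (-r) z (by rwa [norm_neg]) hzn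
      have f1 : qPoch q (z ^ 2) = (1 - z ^ 2) * (qPoch q (q * z) * qPoch q (-q * z) *
          (qPoch q (r * z) * qPoch q (-r * z))) := by
        rw [qPoch_sq hq hr, qPoch_step hq z, qPoch_step hq (-z), ← neg_mul r z,
          mul_neg q z, ← neg_mul q z]
        ring
      have f2 : qPoch q (z ^ 2)⁻¹ = (1 - (z ^ 2)⁻¹) * (qPoch q (q / z) * qPoch q (-q / z) *
          (qPoch q (r / z) * qPoch q (-r / z))) := by
        rw [← inv_pow, qPoch_sq hq hr, qPoch_step hq z⁻¹, qPoch_step hq (-z⁻¹), ← neg_mul r,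
          mul_neg q, ← neg_mul q]
        simp only [← div_eq_mul_inv]
        ring
      rw [nrIntegrand, f1, f2]
      simp only [mul_zero, zero_mul, zero_div, qPoch_zero, mul_one, sub_zero]
      obtain ⟨n1, n1'⟩ := n1
      obtain ⟨n2, n2'⟩ := n2
      obtain ⟨n3, n3'⟩ := n3
      obtain ⟨n4, n4'⟩ := n4
      generalize qPoch q (q * z) = x1 at *
      generalize qPoch q (-q * z) = x2 at *
      generalize qPoch q (r * z) = x3 at *
      generalize qPoch q (-r * z) = x4 at *
      generalize qPoch q (q / z) = y1 at *
      generalize qPoch q (-q / z) = y2 at *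
      generalize qPoch q (r / z) = y3 at *
      generalize qPoch q (-r / z) = y4 at *
      field_simp
      ring
  have hP0 := qPoch_self_ne_zero hq
  have hlt : ∀ x : ℂ, ‖x‖ < 1 → qPoch q x ≠ 0 := fun x => qPoch_ne_zero_of_norm_lt hq
  have hmul : ∀ x y : ℂ, ‖x‖ < 1 → ‖y‖ < 1 → qPoch q (x * y) ≠ 0 := fun x y hx hy =>
    hlt _ (by rw [norm_mul]; exact mul_lt_one_of_nonneg_of_lt_one_left (norm_nonneg _) hx hy.le)
  have hq' : ‖-q‖ < 1 := by rwa [norm_neg]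
  have hr' : ‖-r‖ < 1 := by rwa [norm_neg]
  have hprod : nrProduct q q (-q) r (-r) 0 = qPoch q q := by
    have e1 : qPoch q q = qPoch q r * qPoch q (-r) * (qPoch q q * qPoch q (-q)) := by
      have := qPoch_sq hq hr r
      rwa [← pow_two, hr] at this
    have e2 : qPoch q r = (1 - r) * qPoch q (q * r) := qPoch_step hq r
    have e3 : qPoch q (-r) = (1 + r) * qPoch q (q * -r) := by
      rw [qPoch_step hq (-r), sub_neg_eq_add]
    have e4 : qPoch q (-q) = (1 + q) * qPoch q (q * -q) := by
      rw [qPoch_step hq (-q), sub_neg_eq_add]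
    have e5 : qPoch q q = (1 - q) * ((1 - q * q) * qPoch q (q * -q * r * -r)) := by
      rw [qPoch_step hq q, qPoch_step hq (q * q), show q * -q * r * -r = q * (q * q) by
        rw [show q * -q * r * -r = q * q * r ^ 2 by ring, hr]; ring]
    have h1 : qPoch q (q * r) ≠ 0 := hmul _ _ hq hr1
    have h2 : qPoch q (q * -r) ≠ 0 := hmul _ _ hq hr'
    have h3 : qPoch q (q * -q) ≠ 0 := hmul _ _ hq hq'
    rw [nrProduct]
    simp only [mul_zero, qPoch_zero, mul_one, one_mul]
    rw [show -q * r = q * -r by ring, show -q * -r = q * r by ring,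
      show r * -r = -q by rw [← hr]; ring]
    -- A form of Euler's identity: evaluate `qPoch_sq` at `z = r` and cancel `(q; q)_∞`.
    have e6 : qPoch q r * qPoch q (-r) * qPoch q (-q) = 1 := by
      apply mul_left_cancel₀ hP0
      linear_combination -e1
    have hrq : 1 - q = (1 - r) * (1 + r) := by rw [← hr]; ring
    have h4 : qPoch q (-q) ≠ 0 := hlt _ hq'
    rw [e2, e3] at e6
    rw [e4] at e6 h4 ⊢
    generalize qPoch q (q * -q * r * -r) = w at *
    generalize qPoch q (q * r) = u at *
    generalize qPoch q (q * -r) = v at *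
    generalize qPoch q (q * -q) = y at *
    generalize qPoch q q = p at *
    rw [div_eq_iff (by simp [*] at h4 ⊢)]
    have hq1 : (1 - q) * (1 + q) * y * (u * v) = 1 := by rw [hrq]; linear_combination e6
    have hy : y * (u * v) * ((1 - q) * (1 + q)) = 1 := by linear_combination hq1
    have hne : (1 - q) * (1 + q) ≠ 0 := right_ne_zero_of_mul_eq_one hy
    apply mul_left_cancel₀ (mul_ne_zero hne (left_ne_zero_of_mul hne))
    linear_combination -e5 - p * (1 + y * (u * v) * ((1 - q) * (1 + q))) * hy
  have hplim : Tendsto (fun n : ℕ => nrProduct q q (-q) r (-r) (q * q ^ n)) atTop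
      (𝓝 (nrProduct q q (-q) r (-r) 0)) := by
    have hc : ContinuousAt (fun ε : ℂ => nrProduct q q (-q) r (-r) ε) 0 := by
      have hP := continuous_qPoch hq
      unfold nrProduct
      refine ContinuousAt.div (by fun_prop) (by fun_prop) ?_
      have := hmul _ _ hq hq'
      have := hmul _ _ hq hr1
      have := hmul _ _ hq hr'
      have := hmul _ _ hq' hr1
      have := hmul _ _ hq' hr'
      have := hmul _ _ hr1 hr'
      simp only [mul_zero, qPoch_zero, mul_one]
      simp only [ne_eq, mul_eq_zero, not_or]
      tauto
    exact hc.tendsto.comp hu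
  have h1 := (hplim.mul_const I₀).congr fun n => (hval n).symm
  have h2 := tendsto_nhds_unique hlim h1
  rw [hF0, hprod] at h2
  have := qPoch_self_ne_zero hq
  field_simp
  rw [mul_comm I₀, ← h2]
  ring

/-- The only singularity is the origin, so Cauchy's theorem with empty families of poles reduces to
the unit circle. -/
theorem nr_constant (hq0 : q ≠ 0) (hq : ‖q‖ < 1) (hL : IsLoop γ) (h0 : ∀ θ, γ θ ≠ 0)
    (hw : windingNumber γ 0 = 1) :
    loopIntegral γ (fun z => qPoch q (z ^ 2) * qPoch q (z ^ 2)⁻¹ / z) =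
      2 * Real.pi * Complex.I * (2 / qPoch q q) := by
  rw [← nr_constant_circle hq0 hq]
  have hP := differentiable_qPoch hq
  have hz0 : ∀ θ : ℝ, circleMap 0 1 θ ≠ 0 := fun θ h => by
    have := norm_circleMap zero_le_one θ
    rw [h, norm_zero] at this
    exact zero_ne_one this
  have := loopIntegral_div_qPoch_eq hq0 hq (Fin.elim0 : Fin 0 → ℂ) (b := (Fin.elim0 : Fin 0 → ℂ))
    (fun j => j.elim0) (h := fun z => qPoch q (z ^ 2) * qPoch q (z ^ 2)⁻¹ / z) (fun z hz => by
      have hz0 : z ≠ 0 := hz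
      have hz2 : z ^ 2 ≠ 0 := pow_ne_zero 2 hz0
      refine DifferentiableAt.differentiableWithinAt ?_
      fun_prop (disch := assumption)) hL (isLoop_circleMap 1) h0 hz0
    (by rw [hw, windingNumber_circleMap_of_lt (by simp)]) (fun i => i.elim0) (fun i => i.elim0)
    (fun i => i.elim0) (fun i => i.elim0) (fun i => i.elim0) (fun i => i.elim0)
  simpa using this

/-- The Nassrallah-Rahman integral. -/
theorem nassrallah_rahman (hq0 : q ≠ 0) (hq : ‖q‖ < 1) {a b c d e : ℂ}
    (h0 : ∀ x ∈ ({a, b, c, d, e} : Set ℂ), x ≠ 0)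
    (hγ : EnclosesOrbits q {a, b, c, d, e} γ) :
    loopIntegral γ (fun z => nrIntegrand q a b c d e z / z) =
      2 * Real.pi * Complex.I * (2 / qPoch q q) * nrProduct q a b c d e := by
  rw [nr_eq_mul_limit hq0 hq h0 hγ, nr_constant hq0 hq hγ.isLoop hγ.ne_zero hγ.winding_zero,
    mul_comm]

end NassrallahRahman

/-! ### Very-well-poised series as sums of one function over a q-orbit. -/

section WellPoised

variable {q : ℂ} {ι : Type*} [Fintype ι]

/-- The function of `x` whose sum over `x q^n` is a very-well-poised series. -/
def vwpWeight (q : ℂ) (y : ι → ℂ) (x : ℂ) : ℂ :=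
  x * (1 - x ^ 2 / q) * ((∏ i, qPoch q (x / y i)) / ∏ i, qPoch q (y i * x))

theorem vwpWeight_mul_pow (hq : ‖q‖ < 1) {y : ι → ℂ} {x : ℂ} (h : ∀ i, qPoch q (y i * x) ≠ 0)
    (n : ℕ) : vwpWeight q y (x * q ^ n) =
      x / (∏ i, qPoch q (y i * x)) *
        (q ^ n * vwpTerm q (x ^ 2 / q) (fun i => x / y i) (fun i => y i * x) n) := by
  have e : ∏ i, qPoch q (y i * x) =
      (∏ i, qPochFin q (y i * x) n) * ∏ i, qPoch q (y i * (x * q ^ n)) := by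
    rw [← Finset.prod_mul_distrib]
    refine Finset.prod_congr rfl fun i _ => ?_
    rw [qPoch_eq_qPochFin_mul hq _ n, mul_assoc]
  have h1 : ∏ i, qPochFin q (y i * x) n ≠ 0 := Finset.prod_ne_zero_iff.2 fun i _ =>
    qPochFin_ne_zero_of_qPoch hq (h i) n
  have h2 : ∏ i, qPoch q (y i * (x * q ^ n)) ≠ 0 := Finset.prod_ne_zero_iff.2 fun i _ => by
    rw [← mul_assoc]
    exact qPoch_mul_pow_ne_zero hq (h i) n
  rw [vwpWeight, vwpTerm, Finset.prod_mul_distrib, e]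
  have e2 : ∀ i, x * q ^ n / y i = x / y i * q ^ n := fun i => by ring
  simp only [e2]
  generalize ∏ i, qPochFin q (y i * x) n = A at *
  generalize ∏ i, qPoch q (y i * (x * q ^ n)) = B at *
  generalize ∏ i, qPoch q (x / y i * q ^ n) = C at *
  field_simp
  ring

theorem hasSum_vwpWeight (hq : ‖q‖ < 1) {y : ι → ℂ} {x : ℂ} (h : ∀ i, qPoch q (y i * x) ≠ 0) :
    HasSum (fun n : ℕ => vwpWeight q y (x * q ^ n))
      (x / (∏ i, qPoch q (y i * x)) *
        vwpSum q (x ^ 2 / q) (fun i => x / y i) fun i => y i * x) := by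
  simp only [vwpWeight_mul_pow hq h]
  exact (hasSum_vwpSum hq _ _ _).mul_left _

end WellPoised

/-! ### A contiguous relation for balanced very-well-poised series with six parameters. -/

section Telescoping

variable {q : ℂ}

/-- The function whose `q`-difference implements `y₁ ↦ y₁ / q`, `y₂ ↦ q y₂`. -/
def vwpCertificate (q y₁ y₂ y₃ y₄ y₅ y₆ x : ℂ) : ℂ :=
  (1 - y₁ / (q * y₂)) *
    (qPoch q (x / y₁) * qPoch q (x / (q * y₂)) * qPoch q (x / (q * y₃)) *
      qPoch q (x / (q * y₄)) * qPoch q (x / (q * y₅)) * qPoch q (x / (q * y₆))) /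
    (qPoch q (y₁ / q * x) * qPoch q (y₂ * x) * qPoch q (y₃ * x) * qPoch q (y₄ * x) *
      qPoch q (y₅ * x) * qPoch q (y₆ * x))

/-- The identity is symmetric in `y₃, ..., y₆`, and the balancing condition fixes their product.
Written in the remaining three elementary symmetric functions it can be checked by expansion. -/
theorem vwp_polynomial_identity (hq0 : q ≠ 0) {y₁ y₂ y₃ y₄ y₅ y₆ : ℂ} (x : ℂ)
    (hy : q ^ 2 * (y₁ * y₂ * y₃ * y₄ * y₅ * y₆) = 1) :
    (1 - y₃ * y₁) * (1 - y₄ * y₁) * (1 - y₅ * y₁) * (1 - y₆ * y₁) / y₁ *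
        (x * (1 - x ^ 2 / q) * ((1 - x / (q * y₂)) * (1 - y₂ * x))) -
      y₂ * ((1 - 1 / (q * y₃ * y₂)) * (1 - 1 / (q * y₄ * y₂)) * (1 - 1 / (q * y₅ * y₂)) *
          (1 - 1 / (q * y₆ * y₂))) * (x * (1 - x ^ 2 / q) * ((1 - x / y₁) * (1 - y₁ / q * x))) =
    (1 - y₁ / (q * y₂)) *
      ((1 - y₁ / q * x) * ((1 - y₂ * x) * (1 - y₃ * x) * (1 - y₄ * x) * (1 - y₅ * x) *
          (1 - y₆ * x)) -
        (1 - x / y₁) * ((1 - x / (q * y₂)) * (1 - x / (q * y₃)) * (1 - x / (q * y₄)) *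
          (1 - x / (q * y₅)) * (1 - x / (q * y₆)))) := by
  have h0 : y₁ * y₂ * y₃ * y₄ * y₅ * y₆ ≠ 0 := right_ne_zero_of_mul_eq_one hy
  simp only [ne_eq, mul_eq_zero, not_or] at h0
  obtain ⟨⟨⟨⟨⟨h1, h2⟩, h3⟩, h4⟩, h5⟩, h6⟩ := h0
  have a1 : ∀ u : ℂ, (1 - y₃ * u) * (1 - y₄ * u) * (1 - y₅ * u) * (1 - y₆ * u) =
      1 - (y₃ + y₄ + y₅ + y₆) * u +
        (y₃ * y₄ + y₃ * y₅ + y₃ * y₆ + y₄ * y₅ + y₄ * y₆ + y₅ * y₆) * u ^ 2 -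
        (y₃ * y₄ * y₅ + y₃ * y₄ * y₆ + y₃ * y₅ * y₆ + y₄ * y₅ * y₆) * u ^ 3 +
        1 / (q ^ 2 * y₁ * y₂) * u ^ 4 := fun u => by
    rw [show 1 / (q ^ 2 * y₁ * y₂) = y₃ * y₄ * y₅ * y₆ by
      field_simp; linear_combination -hy]
    ring
  have a2 : ∀ u : ℂ, (1 - u / y₃) * (1 - u / y₄) * (1 - u / y₅) * (1 - u / y₆) =
      1 - q ^ 2 * y₁ * y₂ *
          (y₃ * y₄ * y₅ + y₃ * y₄ * y₆ + y₃ * y₅ * y₆ + y₄ * y₅ * y₆) * u +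
        q ^ 2 * y₁ * y₂ *
          (y₃ * y₄ + y₃ * y₅ + y₃ * y₆ + y₄ * y₅ + y₄ * y₆ + y₅ * y₆) * u ^ 2 -
        q ^ 2 * y₁ * y₂ * (y₃ + y₄ + y₅ + y₆) * u ^ 3 +
        q ^ 2 * y₁ * y₂ * u ^ 4 := fun u => by
    rw [show q ^ 2 * y₁ * y₂ = 1 / (y₃ * y₄ * y₅ * y₆) by
      field_simp; linear_combination hy]
    field_simp
    ring
  have b1 : ∀ u y : ℂ, 1 - 1 / (q * y * y₂) = 1 - (1 / (q * y₂)) / y := fun u y => by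
    congr 1; field_simp
  have b2 : ∀ y : ℂ, 1 - x / (q * y) = 1 - (x / q) / y := fun y => by rw [div_div]
  rw [show (1 - y₂ * x) * (1 - y₃ * x) * (1 - y₄ * x) * (1 - y₅ * x) * (1 - y₆ * x) =
      (1 - y₂ * x) * ((1 - y₃ * x) * (1 - y₄ * x) * (1 - y₅ * x) * (1 - y₆ * x)) by ring,
    show (1 - x / (q * y₂)) * (1 - x / (q * y₃)) * (1 - x / (q * y₄)) *
          (1 - x / (q * y₅)) * (1 - x / (q * y₆)) = (1 - x / (q * y₂)) *
        ((1 - x / (q * y₃)) * (1 - x / (q * y₄)) * (1 - x / (q * y₅)) * (1 - x / (q * y₆))) by ring,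
    b1 x y₃, b1 x y₄, b1 x y₅, b1 x y₆, b2 y₃, b2 y₄, b2 y₅, b2 y₆, a1, a1, a2, a2]
  generalize y₃ + y₄ + y₅ + y₆ = e₁
  generalize y₃ * y₄ + y₃ * y₅ + y₃ * y₆ + y₄ * y₅ + y₄ * y₆ + y₅ * y₆ = e₂
  generalize y₃ * y₄ * y₅ + y₃ * y₄ * y₆ + y₃ * y₅ * y₆ + y₄ * y₅ * y₆ = e₃
  field_simp
  ring

/-- As for the integral, all four terms are rational multiples of one quotient of infinite products,
and `vwp_polynomial_identity` remains. -/
theorem vwp_telescope (hq0 : q ≠ 0) (hq : ‖q‖ < 1) {y₁ y₂ y₃ y₄ y₅ y₆ x : ℂ}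
    (hy : q ^ 2 * (y₁ * y₂ * y₃ * y₄ * y₅ * y₆) = 1)
    (h : ∀ i, qPoch q (![y₁ / q, y₂, y₃, y₄, y₅, y₆] i * x) ≠ 0) :
    (1 - y₃ * y₁) * (1 - y₄ * y₁) * (1 - y₅ * y₁) * (1 - y₆ * y₁) / y₁ *
        vwpWeight q ![y₁ / q, q * y₂, y₃, y₄, y₅, y₆] x -
      y₂ * ((1 - 1 / (q * y₃ * y₂)) * (1 - 1 / (q * y₄ * y₂)) * (1 - 1 / (q * y₅ * y₂)) *
          (1 - 1 / (q * y₆ * y₂))) * vwpWeight q ![y₁, y₂, y₃, y₄, y₅, y₆] x =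
    vwpCertificate q y₁ y₂ y₃ y₄ y₅ y₆ (x * q) - vwpCertificate q y₁ y₂ y₃ y₄ y₅ y₆ x := by
  have h0 : y₁ * y₂ * y₃ * y₄ * y₅ * y₆ ≠ 0 := right_ne_zero_of_mul_eq_one hy
  simp only [ne_eq, mul_eq_zero, not_or] at h0
  obtain ⟨⟨⟨⟨⟨z1, z2⟩, z3⟩, z4⟩, z5⟩, z6⟩ := h0
  have key := vwp_polynomial_identity hq0 x hy
  have s1 : ∀ y, qPoch q (y * x) = (1 - y * x) * qPoch q (y * (x * q)) := fun y => by
    rw [qPoch_step hq]; ring_nf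
  have s2 : ∀ y, qPoch q (x / (q * y)) = (1 - x / (q * y)) * qPoch q (x / y) := fun y => by
    rw [qPoch_step hq]; congr 2; field_simp
  have s3 : qPoch q (x / y₁) = (1 - x / y₁) * qPoch q (x * q / y₁) := by
    rw [qPoch_step hq]; congr 2; ring
  have s4 : qPoch q (y₁ / q * x) = (1 - y₁ / q * x) * qPoch q (y₁ * x) := by
    rw [qPoch_step hq]; congr 2; field_simp
  have s5 : ∀ y, x * q / (q * y) = x / y := fun y => by field_simp
  have h1 := h 0
  have h2 := h 1
  have h3 := h 2
  have h4 := h 3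
  have h5 := h 4
  have h6 := h 5
  simp only [Matrix.cons_val] at h1 h2 h3 h4 h5 h6
  simp only [vwpWeight, vwpCertificate, Fin.prod_univ_six, Matrix.cons_val]
  rw [show x / (y₁ / q) = x * q / y₁ by field_simp, show y₁ / q * (x * q) = y₁ * x by field_simp,
    show q * y₂ * x = y₂ * (x * q) by ring]
  simp only [s5]
  rw [s4] at h1 ⊢
  rw [s1] at h2 h3 h4 h5 h6
  rw [s3, s2 y₂, s2 y₃, s2 y₄, s2 y₅, s2 y₆, s1 y₂, s1 y₃, s1 y₄, s1 y₅, s1 y₆]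
  simp only [ne_eq, mul_eq_zero, not_or] at h1 h2 h3 h4 h5 h6
  obtain ⟨h1, h1'⟩ := h1
  obtain ⟨h2, h2'⟩ := h2
  obtain ⟨h3, h3'⟩ := h3
  obtain ⟨h4, h4'⟩ := h4
  obtain ⟨h5, h5'⟩ := h5
  obtain ⟨h6, h6'⟩ := h6
  generalize (1 - y₃ * y₁) * (1 - y₄ * y₁) * (1 - y₅ * y₁) * (1 - y₆ * y₁) / y₁ = A at *
  generalize y₂ * ((1 - 1 / (q * y₃ * y₂)) * (1 - 1 / (q * y₄ * y₂)) * (1 - 1 / (q * y₅ * y₂)) *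
          (1 - 1 / (q * y₆ * y₂))) = B at *
  generalize 1 - y₁ / (q * y₂) = c at *
  generalize qPoch q (x * q / y₁) = p1 at *
  generalize qPoch q (x / y₂) = p2 at *
  generalize qPoch q (x / y₃) = p3 at *
  generalize qPoch q (x / y₄) = p4 at *
  generalize qPoch q (x / y₅) = p5 at *
  generalize qPoch q (x / y₆) = p6 at *
  generalize qPoch q (y₁ * x) = r1 at *
  generalize qPoch q (y₂ * (x * q)) = r2 at *
  generalize qPoch q (y₃ * (x * q)) = r3 at *
  generalize qPoch q (y₄ * (x * q)) = r4 at *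
  generalize qPoch q (y₅ * (x * q)) = r5 at *
  generalize qPoch q (y₆ * (x * q)) = r6 at *
  generalize 1 - y₁ / q * x = u1 at *
  generalize 1 - y₂ * x = u2 at *
  generalize 1 - y₃ * x = u3 at *
  generalize 1 - y₄ * x = u4 at *
  generalize 1 - y₅ * x = u5 at *
  generalize 1 - y₆ * x = u6 at *
  generalize 1 - x / y₁ = v1 at *
  generalize 1 - x / (q * y₂) = v2 at *
  generalize 1 - x / (q * y₃) = v3 at *
  generalize 1 - x / (q * y₄) = v4 at *
  generalize 1 - x / (q * y₅) = v5 at *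
  generalize 1 - x / (q * y₆) = v6 at *
  generalize x * (1 - x ^ 2 / q) = w at *
  field_simp
  linear_combination (p1 * p2 * p3 * p4 * p5 * p6) * key

theorem tendsto_vwpCertificate (hq : ‖q‖ < 1) (y₁ y₂ y₃ y₄ y₅ y₆ x : ℂ) :
    Tendsto (fun n : ℕ => vwpCertificate q y₁ y₂ y₃ y₄ y₅ y₆ (x * q ^ n)) atTop
      (𝓝 (1 - y₁ / (q * y₂))) := by
  have hP := continuous_qPoch hq
  have hc : ContinuousAt (vwpCertificate q y₁ y₂ y₃ y₄ y₅ y₆) 0 := by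
    unfold vwpCertificate
    refine ContinuousAt.div ?_ ?_ (by simp)
    · fun_prop
    · fun_prop
  have := hc.tendsto.comp (tendsto_mul_pow_zero hq x)
  simpa [vwpCertificate, Function.comp_def] using this

/-- Summing the telescoping identity over the orbit leaves the limit of the certificate at 0 minus
its value at `x`. The latter vanishes because `x = q y₅` or `x = q y₆` produces the factor `(1;
q)_∞`. The right side does not involve `x`, so a difference of two such series satisfies a
homogeneous relation. -/
theorem vwp_sum_shift (hq0 : q ≠ 0) (hq : ‖q‖ < 1) {y₁ y₂ y₃ y₄ y₅ y₆ x S S' : ℂ}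
    (hy : q ^ 2 * (y₁ * y₂ * y₃ * y₄ * y₅ * y₆) = 1)
    (h : ∀ i, qPoch q (![y₁ / q, y₂, y₃, y₄, y₅, y₆] i * x) ≠ 0)
    (hx : x = q * y₅ ∨ x = q * y₆)
    (hS : HasSum (fun n : ℕ => vwpWeight q ![y₁, y₂, y₃, y₄, y₅, y₆] (x * q ^ n)) S)
    (hS' : HasSum (fun n : ℕ => vwpWeight q ![y₁ / q, q * y₂, y₃, y₄, y₅, y₆] (x * q ^ n)) S') :
    (1 - y₃ * y₁) * (1 - y₄ * y₁) * (1 - y₅ * y₁) * (1 - y₆ * y₁) / y₁ * S' -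
      y₂ * ((1 - 1 / (q * y₃ * y₂)) * (1 - 1 / (q * y₄ * y₂)) * (1 - 1 / (q * y₅ * y₂)) *
          (1 - 1 / (q * y₆ * y₂))) * S = 1 - y₁ / (q * y₂) := by
  have h1 := ((hS'.mul_left _).sub (hS.mul_left _)).tendsto_sum_nat.congr fun n =>
    Finset.sum_congr rfl fun k _ =>
      vwp_telescope hq0 hq (x := x * q ^ k) hy fun i => by
        rw [← mul_assoc]; exact qPoch_mul_pow_ne_zero hq (h i) k
  simp only [mul_assoc x, ← pow_succ] at h1
  simp only [Finset.sum_range_sub (fun n => vwpCertificate q y₁ y₂ y₃ y₄ y₅ y₆ (x * q ^ n))] at h1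
  have h0 : y₁ * y₂ * y₃ * y₄ * y₅ * y₆ ≠ 0 := right_ne_zero_of_mul_eq_one hy
  simp only [ne_eq, mul_eq_zero, not_or] at h0
  have hP1 : qPoch q 1 = 0 := (qPoch_eq_zero_iff hq).2 ⟨0, by simp⟩
  have hg : vwpCertificate q y₁ y₂ y₃ y₄ y₅ y₆ (x * q ^ 0) = 0 := by
    rw [pow_zero, mul_one, vwpCertificate]
    rcases hx with rfl | rfl
    · rw [div_self (mul_ne_zero hq0 h0.1.2), hP1]; simp
    · rw [div_self (mul_ne_zero hq0 h0.2), hP1]; simp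
  rw [hg] at h1
  simp only [sub_zero] at h1
  exact tendsto_nhds_unique h1 (tendsto_vwpCertificate hq y₁ y₂ y₃ y₄ y₅ y₆ x)

end Telescoping

/-! ### A Liouville theorem for q-periodic quotients on the punctured plane. -/

section EllipticQuotient

variable {q : ℂ}

theorem eq_of_frequently_eq {f g : ℂ → ℂ} {z : ℂ} (hf : ContinuousAt f z) (hg : ContinuousAt g z)
    (h : ∃ᶠ w in 𝓝 z, f w = g w) : f z = g z := by
  by_contra hne
  exact h (((hf.sub hg).eventually_ne (sub_ne_zero.2 hne)).mono fun w hw => sub_ne_zero.1 hw)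

theorem frequently_notMem_of_countable {s : Set ℂ} (hs : s.Countable) (z : ℂ) :
    ∃ᶠ w in 𝓝 z, w ∉ s :=
  mem_closure_iff_frequently.1 (Set.Countable.dense_compl ℝ hs z)

theorem isPreconnected_compl_zero : IsPreconnected ({0}ᶜ : Set ℂ) :=
  (isConnected_compl_singleton_of_one_lt_rank (by simp) 0).isPreconnected

theorem frequently_ne_zero_of_differentiableOn {M : ℂ → ℂ} (hM : DifferentiableOn ℂ M {0}ᶜ)
    {z₀ z : ℂ} (h0 : z₀ ≠ 0) (hz₀ : M z₀ ≠ 0) (hz : z ≠ 0) : ∃ᶠ w in 𝓝 z, M w ≠ 0 := by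
  intro h
  refine hz₀ ((hM.analyticOnNhd isOpen_compl_singleton).eqOn_zero_of_preconnected_of_eventuallyEq_zero
    isPreconnected_compl_zero (z₀ := z) hz ?_ h0)
  filter_upwards [h] with w hw using not_not.1 hw

/-- The invariance of `N / M` is kept cross-multiplied because `M` has zeros. In the induction `M (q
^ n * z)` is cancelled where it is nonzero, and continuity covers the other points. -/
theorem quotient_pow_relation (hq0 : q ≠ 0) {N M : ℂ → ℂ} (hN : DifferentiableOn ℂ N {0}ᶜ)
    (hM : DifferentiableOn ℂ M {0}ᶜ) (hrel : ∀ z, z ≠ 0 → N z * M (q * z) = N (q * z) * M z)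
    {z₀ : ℂ} (h0 : z₀ ≠ 0) (hz₀ : M z₀ ≠ 0) (n : ℕ) :
    ∀ z, z ≠ 0 → N z * M (q ^ n * z) = N (q ^ n * z) * M z := by
  induction n with
  | zero => intro z _; simp
  | succ n ih =>
    intro z hz
    have hqn : ∀ n : ℕ, q ^ n ≠ 0 := fun n => pow_ne_zero n hq0
    have hc : ∀ {f : ℂ → ℂ}, DifferentiableOn ℂ f {0}ᶜ → ∀ n : ℕ,
        DifferentiableOn ℂ (fun z => f (q ^ n * z)) {0}ᶜ := fun hf n =>
      hf.comp (by fun_prop) fun w hw => mul_ne_zero (hqn n) hw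
    have hca : ∀ {f : ℂ → ℂ}, DifferentiableOn ℂ f {0}ᶜ → ContinuousAt f z := fun hf =>
      (hf.differentiableAt (isOpen_compl_singleton.mem_nhds hz)).continuousAt
    have hf := frequently_ne_zero_of_differentiableOn (hc hM n) (z₀ := (q ^ n)⁻¹ * z₀)
      (mul_ne_zero (inv_ne_zero (hqn n)) h0) (by simpa [hqn n] using hz₀) hz
    refine eq_of_frequently_eq (f := fun z => N z * M (q ^ (n + 1) * z))
      (g := fun z => N (q ^ (n + 1) * z) * M z) ((hca hN).mul (hca (hc hM (n + 1))))
      ((hca (hc hN (n + 1))).mul (hca hM)) ?_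
    refine (hf.and_eventually (isOpen_compl_singleton.mem_nhds hz)).mono fun w ⟨h1, hw⟩ => ?_
    have h2 := ih w hw
    have h3 := hrel (q ^ n * w) (mul_ne_zero (hqn n) hw)
    rw [← mul_assoc, ← pow_succ'] at h3
    apply mul_right_cancel₀ h1
    linear_combination M (q ^ (n + 1) * w) * h2 + M w * h3

theorem quotient_zpow_relation (hq0 : q ≠ 0) {N M : ℂ → ℂ} (hN : DifferentiableOn ℂ N {0}ᶜ)
    (hM : DifferentiableOn ℂ M {0}ᶜ) (hrel : ∀ z, z ≠ 0 → N z * M (q * z) = N (q * z) * M z)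
    {z₀ : ℂ} (h0 : z₀ ≠ 0) (hz₀ : M z₀ ≠ 0) (k : ℤ) {z : ℂ} (hz : z ≠ 0) :
    N z * M (q ^ k * z) = N (q ^ k * z) * M z := by
  have h := quotient_pow_relation hq0 hN hM hrel h0 hz₀
  obtain ⟨n, rfl | rfl⟩ := k.eq_nat_or_neg
  · simpa using h n z hz
  · have hqn : q ^ n ≠ 0 := pow_ne_zero n hq0
    have := h n (q ^ (-(n : ℤ)) * z) (mul_ne_zero (zpow_ne_zero _ hq0) hz)
    rw [← mul_assoc, zpow_neg, zpow_natCast, mul_inv_cancel₀ hqn, one_mul] at this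
    rw [zpow_neg, zpow_natCast, this.symm]

theorem exists_pow_mul_mem_annulus (hq0 : q ≠ 0) (hq : ‖q‖ < 1) {z : ℂ} (hz : z ≠ 0) :
    ∃ k : ℤ, ‖q‖ ≤ ‖q ^ k * z‖ ∧ ‖q ^ k * z‖ ≤ 1 := by
  have hq' : 0 < ‖q‖ := norm_pos_iff.2 hq0
  obtain ⟨n, hn⟩ := exists_mem_Ioc_zpow (norm_pos_iff.2 hz) ((one_lt_inv₀ hq').2 hq)
  refine ⟨n + 1, ?_, ?_⟩
  · rw [norm_mul, norm_zpow]
    have h1 := hn.1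
    rw [inv_zpow] at h1
    have h2 : 0 < ‖q‖ ^ n := zpow_pos hq' n
    rw [zpow_add_one₀ hq'.ne', mul_right_comm]
    have h3 : 1 ≤ ‖q‖ ^ n * ‖z‖ := by
      rw [inv_lt_iff_one_lt_mul₀ h2] at h1
      rw [mul_comm]
      exact h1.le
    nlinarith
  · rw [norm_mul, norm_zpow]
    have h1 := hn.2
    rw [inv_zpow] at h1
    have h2 : 0 < ‖q‖ ^ (n + 1) := zpow_pos hq' _
    calc ‖q‖ ^ (n + 1) * ‖z‖ ≤ ‖q‖ ^ (n + 1) * (‖q‖ ^ (n + 1))⁻¹ :=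
          mul_le_mul_of_nonneg_left h1 h2.le
      _ = 1 := mul_inv_cancel₀ h2.ne'

/-- Liouville's theorem for quotients of functions on `ℂ^×` which are invariant under `z ↦ q z`. -/
theorem eq_of_quotient_invariant (hq0 : q ≠ 0) (hq : ‖q‖ < 1) {N M : ℂ → ℂ}
    (hN : DifferentiableOn ℂ N {0}ᶜ) (hM : DifferentiableOn ℂ M {0}ᶜ)
    (hrel : ∀ z, z ≠ 0 → N z * M (q * z) = N (q * z) * M z)
    (hne : ∀ z, z ≠ 0 → ∃ k : ℤ, M (q ^ k * z) ≠ 0)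
    {z₀ : ℂ} (h0 : z₀ ≠ 0) (hz₀ : M z₀ ≠ 0) (heq : N z₀ = M z₀) {z : ℂ} (hz : z ≠ 0) :
    N z = M z := by
  have hrel' := fun (k : ℤ) {z : ℂ} (hz : z ≠ 0) =>
    quotient_zpow_relation hq0 hN hM hrel h0 hz₀ k hz
  choose! k hk using hne
  -- The quotient is evaluated at a translate of `z` where `M` does not vanish. By `key` the choice
  -- of translate is irrelevant, so `F` is holomorphic on the whole punctured plane, even at zeros
  -- of `M`.
  set F : ℂ → ℂ := fun z => N (q ^ k z * z) / M (q ^ k z * z) with hF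
  have hqk : ∀ k : ℤ, q ^ k ≠ 0 := fun k => zpow_ne_zero k hq0
  have key : ∀ z, z ≠ 0 → ∀ j : ℤ, M (q ^ j * z) ≠ 0 → F z = N (q ^ j * z) / M (q ^ j * z) := by
    intro z hz j hj
    have := hrel' (j - k z) (mul_ne_zero (hqk (k z)) hz)
    rw [← mul_assoc, ← zpow_add₀ hq0, sub_add_cancel] at this
    rw [hF]
    simp only
    rw [div_eq_div_iff (hk z hz) hj, this]
  have hFq : ∀ z, z ≠ 0 → ∀ j : ℤ, F (q ^ j * z) = F z := by
    intro z hz j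
    have h1 := hk (q ^ j * z) (mul_ne_zero (hqk j) hz)
    rw [← mul_assoc, ← zpow_add₀ hq0] at h1
    rw [key z hz _ h1, hF]
    simp only
    rw [← mul_assoc, ← zpow_add₀ hq0]
  have hFd : ∀ z, z ≠ 0 → DifferentiableAt ℂ F z := by
    intro z hz
    have hmem : q ^ k z * z ∈ ({0}ᶜ : Set ℂ) := mul_ne_zero (hqk _) hz
    have d : ∀ {f : ℂ → ℂ}, DifferentiableOn ℂ f {0}ᶜ →
        DifferentiableAt ℂ (fun w => f (q ^ k z * w)) z := fun hf =>
      (hf.differentiableAt (isOpen_compl_singleton.mem_nhds hmem)).comp z (by fun_prop)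
    refine ((d hN).div (d hM) (hk z hz)).congr_of_eventuallyEq ?_
    filter_upwards [(d hM).continuousAt.eventually_ne (hk z hz),
      isOpen_compl_singleton.mem_nhds hz] with w hw hw0
    exact key w hw0 _ hw
  have hA : IsCompact {z : ℂ | ‖q‖ ≤ ‖z‖ ∧ ‖z‖ ≤ 1} := by
    refine (isCompact_closedBall (0 : ℂ) 1).of_isClosed_subset
      ((isClosed_le continuous_const continuous_norm).inter
        (isClosed_le continuous_norm continuous_const)) fun z hz => ?_
    simpa using hz.2
  have hA0 : ∀ z ∈ {z : ℂ | ‖q‖ ≤ ‖z‖ ∧ ‖z‖ ≤ 1}, z ≠ 0 := fun z hz h => by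
    have := hz.1
    rw [h, norm_zero] at this
    exact (norm_pos_iff.2 hq0).not_ge this
  obtain ⟨C, hC⟩ := hA.exists_bound_of_continuousOn (f := F) fun z hz =>
    (hFd z (hA0 z hz)).continuousAt.continuousWithinAt
  -- Invariance reduces the values to a compact fundamental annulus, so `F ∘ exp` is a bounded
  -- entire function.
  have hbd : Bornology.IsBounded (Set.range fun w => F (Complex.exp w)) := by
    refine isBounded_iff_forall_norm_le.2 ⟨C, ?_⟩
    rintro _ ⟨w, rfl⟩
    obtain ⟨j, hj⟩ := exists_pow_mul_mem_annulus hq0 hq (Complex.exp_ne_zero w)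
    change ‖F (Complex.exp w)‖ ≤ C
    rw [← hFq _ (Complex.exp_ne_zero w) j]
    exact hC _ hj
  have hd : Differentiable ℂ fun w => F (Complex.exp w) := fun w =>
    (hFd _ (Complex.exp_ne_zero w)).comp w Complex.differentiable_exp.differentiableAt
  have hconst := hd.apply_eq_apply_of_bounded hbd (Complex.log z) (Complex.log z₀)
  simp only [Complex.exp_log hz, Complex.exp_log h0] at hconst
  rw [key z₀ h0 0 (by simpa using hz₀)] at hconst
  simp only [zpow_zero, one_mul, heq, div_self hz₀, hF] at hconst
  rw [div_eq_one_iff_eq (hk z hz)] at hconst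
  have := hrel' (k z) hz
  rw [hconst, mul_comm] at this
  exact mul_left_cancel₀ (hk z hz) this

end EllipticQuotient

/-! ### Zero sets of q-shifted factorials. -/

section Countable

variable {q : ℂ}

theorem countable_qPoch_mul_eq_zero (hq : ‖q‖ < 1) (c : ℂ) :
    {z : ℂ | qPoch q (c * z) = 0}.Countable := by
  refine (Set.countable_range fun n : ℕ => (c * q ^ n)⁻¹).mono fun z hz => ?_
  obtain ⟨n, hn⟩ := (qPoch_eq_zero_iff hq).1 hz
  exact ⟨n, (eq_inv_of_mul_eq_one_right (by rw [← hn]; ring)).symm⟩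

theorem countable_qPoch_div_eq_zero (hq : ‖q‖ < 1) (c : ℂ) :
    {z : ℂ | qPoch q (c / z) = 0}.Countable := by
  refine (Set.countable_range fun n : ℕ => c * q ^ n).mono fun z hz => ?_
  obtain ⟨n, hn⟩ := (qPoch_eq_zero_iff hq).1 hz
  have : z ≠ 0 := by rintro rfl; simp at hn
  refine ⟨n, ?_⟩
  field_simp at hn
  exact hn

/-- Nonvanishing of the theta function means that `u` is not an integral power of `q`. This single
condition therefore covers all q-shifts of `u` and of its inverse. -/
theorem qPoch_ne_zero_of_theta (hq0 : q ≠ 0) (hq : ‖q‖ < 1) {u v : ℂ} (hu : u ≠ 0)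
    (h : theta q u ≠ 0) (k : ℤ) (hv : v = u * q ^ k ∨ v = u⁻¹ * q ^ k) : qPoch q v ≠ 0 := by
  rw [ne_eq, theta_eq_zero_iff hq0 hq hu] at h
  refine qPoch_ne_zero hq fun n hn => h ?_
  have hz := fun m : ℤ => zpow_ne_zero m hq0
  rcases hv with rfl | rfl
  · refine ⟨-(k + n), ?_⟩
    rw [zpow_neg, zpow_add₀ hq0, zpow_natCast]
    exact eq_inv_of_mul_eq_one_left (by rw [← hn]; ring)
  · refine ⟨k + n, ?_⟩
    rw [zpow_add₀ hq0, zpow_natCast]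
    field_simp at hn
    exact hn.symm

end Countable

/-! ### The q-difference equation behind Bailey's summation of two very-well-poised series. -/

section WellPoisedDifference

variable {q s x₁ x₂ y₃ y₄ : ℂ}

/-- The parameters `(s z, s / z, y₃, y₄, x₁ / q, x₂ / q)`. -/
def wpParam (q s x₁ x₂ y₃ y₄ z : ℂ) : Fin 6 → ℂ := ![s * z, s / z, y₃, y₄, x₁ / q, x₂ / q]

/-- The very-well-poised series based at `x`. -/
def wpSeries (q s x₁ x₂ y₃ y₄ x z : ℂ) : ℂ :=
  vwpSum q (x ^ 2 / q) (fun i => x / wpParam q s x₁ x₂ y₃ y₄ z i)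
    fun i => wpParam q s x₁ x₂ y₃ y₄ z i * x

/-- The product `(s z x, s x / z, y₃ x, y₄ x; q)_∞`. -/
def wpDenom (q s y₃ y₄ x z : ℂ) : ℂ :=
  qPoch q (s * z * x) * qPoch q (s / z * x) * qPoch q (y₃ * x) * qPoch q (y₄ * x)

/-- The difference of two very-well-poised series, cleared of denominators. -/
def wpDifference (q s x₁ x₂ y₃ y₄ z : ℂ) : ℂ :=
  x₁ * wpSeries q s x₁ x₂ y₃ y₄ x₁ z * (qPoch q (x₂ ^ 2 / q) * wpDenom q s y₃ y₄ x₂ z) -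
    x₂ * wpSeries q s x₁ x₂ y₃ y₄ x₂ z * (qPoch q (x₁ ^ 2 / q) * wpDenom q s y₃ y₄ x₁ z)

/-- The product which evaluates the difference of two very-well-poised series. -/
def wpProduct (q s x₁ x₂ y₃ y₄ z : ℂ) : ℂ :=
  x₁ * theta q (x₂ / x₁) * qPoch q q * qPoch q (x₁ ^ 2 / q) * qPoch q (x₂ ^ 2 / q) *
    qPoch q (1 / s ^ 2) * qPoch q (1 / (y₃ * y₄)) *
    (qPoch q (1 / (s * y₃) / z) * qPoch q (1 / (s * y₄) / z) * qPoch q (1 / (s * y₃) * z) *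
      qPoch q (1 / (s * y₄) * z))

theorem differentiableAt_wpSeries (hq : ‖q‖ < 1) (hs : s ≠ 0) (hq0 : q ≠ 0) (h1 : x₁ ≠ 0)
    (h2 : x₂ ≠ 0) (h3 : y₃ ≠ 0) (h4 : y₄ ≠ 0) (x : ℂ) {z : ℂ} (hz : z ≠ 0) :
    DifferentiableAt ℂ (wpSeries q s x₁ x₂ y₃ y₄ x) z := by
  have hw : ∀ i, AnalyticAt ℂ (fun z => wpParam q s x₁ x₂ y₃ y₄ z i) z := by
    intro i
    fin_cases i
    · exact analyticAt_const.mul analyticAt_id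
    · exact analyticAt_const.div analyticAt_id hz
    all_goals exact analyticAt_const
  have hw0 : ∀ i, wpParam q s x₁ x₂ y₃ y₄ z i ≠ 0 := by
    intro i
    fin_cases i <;> simp [wpParam, *]
  exact (analyticAt_vwpSum hq analyticAt_const (fun i => analyticAt_const.div (hw i) (hw0 i))
    fun i => (hw i).mul analyticAt_const).differentiableAt

theorem differentiableOn_wpDifference (hq : ‖q‖ < 1) (hs : s ≠ 0) (hq0 : q ≠ 0) (h1 : x₁ ≠ 0)
    (h2 : x₂ ≠ 0) (h3 : y₃ ≠ 0) (h4 : y₄ ≠ 0) :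
    DifferentiableOn ℂ (wpDifference q s x₁ x₂ y₃ y₄) {0}ᶜ := by
  intro z hz
  have hz : z ≠ 0 := hz
  have hP := differentiable_qPoch hq
  have hW := fun x => differentiableAt_wpSeries hq hs hq0 h1 h2 h3 h4 x hz
  have hD : ∀ x, DifferentiableAt ℂ (wpDenom q s y₃ y₄ x) z := fun x => by
    unfold wpDenom
    fun_prop (disch := assumption)
  unfold wpDifference
  refine DifferentiableAt.differentiableWithinAt ?_
  exact (((hW _).const_mul _).mul ((hD _).const_mul _)).sub
    (((hW _).const_mul _).mul ((hD _).const_mul _))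

theorem differentiableOn_wpProduct (hq : ‖q‖ < 1) :
    DifferentiableOn ℂ (wpProduct q s x₁ x₂ y₃ y₄) {0}ᶜ := by
  intro z hz
  have hz : z ≠ 0 := hz
  have hP := differentiable_qPoch hq
  unfold wpProduct
  refine DifferentiableAt.differentiableWithinAt ?_
  fun_prop (disch := assumption)

theorem wpProduct_shift (hq0 : q ≠ 0) (hq : ‖q‖ < 1) {z : ℂ} (hz : z ≠ 0) :
    wpProduct q s x₁ x₂ y₃ y₄ (q * z) *
        ((1 - 1 / (s * y₃) * z) * (1 - 1 / (s * y₄) * z)) =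
      wpProduct q s x₁ x₂ y₃ y₄ z *
        ((1 - 1 / (s * y₃) / (q * z)) * (1 - 1 / (s * y₄) / (q * z))) := by
  have e1 : ∀ c, qPoch q (c / (q * z)) = (1 - c / (q * z)) * qPoch q (c / z) := fun c => by
    rw [qPoch_step hq]; congr 2; field_simp
  have e2 : ∀ c, qPoch q (c * z) = (1 - c * z) * qPoch q (c * (q * z)) := fun c => by
    rw [qPoch_step hq]; congr 2; ring
  rw [wpProduct, wpProduct, e1, e1, e2, e2]
  ring

/-- The last two parameters `x₁ / q`, `x₂ / q` give denominators `(x₁²/q)` and `(x₁x₂/q)` at `x₁`,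
and `(x₁x₂/q)` and `(x₂²/q)` at `x₂`. The shared `(x₁x₂/q)` is left out of `wpDifference` and
reappears here as a factor. -/
theorem wpDifference_eq_mul (hq : ‖q‖ < 1) {z S₁ S₂ : ℂ}
    (h1 : ∀ i, qPoch q (wpParam q s x₁ x₂ y₃ y₄ z i * x₁) ≠ 0)
    (h2 : ∀ i, qPoch q (wpParam q s x₁ x₂ y₃ y₄ z i * x₂) ≠ 0)
    (hS₁ : HasSum (fun n : ℕ => vwpWeight q (wpParam q s x₁ x₂ y₃ y₄ z) (x₁ * q ^ n)) S₁)
    (hS₂ : HasSum (fun n : ℕ => vwpWeight q (wpParam q s x₁ x₂ y₃ y₄ z) (x₂ * q ^ n)) S₂) :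
    wpDifference q s x₁ x₂ y₃ y₄ z =
      qPoch q (x₁ ^ 2 / q) * qPoch q (x₂ ^ 2 / q) * qPoch q (x₁ * x₂ / q) *
        wpDenom q s y₃ y₄ x₁ z * wpDenom q s y₃ y₄ x₂ z * (S₁ - S₂) := by
  rw [hS₁.unique (hasSum_vwpWeight hq h1), hS₂.unique (hasSum_vwpWeight hq h2)]
  have e1 : ∏ i, qPoch q (wpParam q s x₁ x₂ y₃ y₄ z i * x₁) =
      wpDenom q s y₃ y₄ x₁ z * qPoch q (x₁ ^ 2 / q) * qPoch q (x₁ * x₂ / q) := by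
    simp only [Fin.prod_univ_six, wpParam, wpDenom, Matrix.cons_val]
    ring_nf
  have e2 : ∏ i, qPoch q (wpParam q s x₁ x₂ y₃ y₄ z i * x₂) =
      wpDenom q s y₃ y₄ x₂ z * qPoch q (x₂ ^ 2 / q) * qPoch q (x₁ * x₂ / q) := by
    simp only [Fin.prod_univ_six, wpParam, wpDenom, Matrix.cons_val]
    ring_nf
  have n1 := Finset.prod_ne_zero_iff.2 fun i (_ : i ∈ Finset.univ) => h1 i
  have n2 := Finset.prod_ne_zero_iff.2 fun i (_ : i ∈ Finset.univ) => h2 i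
  rw [e1] at n1
  rw [e2] at n2
  rw [e1, e2, wpDifference, wpSeries, wpSeries]
  simp only [ne_eq, mul_eq_zero, not_or] at n1 n2
  obtain ⟨⟨a1, a2⟩, a3⟩ := n1
  obtain ⟨⟨b1, b2⟩, b3⟩ := n2
  generalize vwpSum q (x₁ ^ 2 / q) (fun i => x₁ / wpParam q s x₁ x₂ y₃ y₄ z i)
    (fun i => wpParam q s x₁ x₂ y₃ y₄ z i * x₁) = V₁
  generalize vwpSum q (x₂ ^ 2 / q) (fun i => x₂ / wpParam q s x₁ x₂ y₃ y₄ z i)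
    (fun i => wpParam q s x₁ x₂ y₃ y₄ z i * x₂) = V₂
  generalize wpDenom q s y₃ y₄ x₁ z = D₁ at *
  generalize wpDenom q s y₃ y₄ x₂ z = D₂ at *
  generalize qPoch q (x₁ ^ 2 / q) = A at *
  generalize qPoch q (x₂ ^ 2 / q) = B at *
  generalize qPoch q (x₁ * x₂ / q) = C at *
  field_simp

/-- Apply `vwp_sum_shift` at both base points with `y₁ = s q z` and `y₂ = s / (q z)`: the exchange
`y₁ / q`, `q y₂` is exactly `q z ↦ z`. The inhomogeneous terms agree and cancel in the difference.
-/
theorem wpDifference_shift_of_ne_zero (hq0 : q ≠ 0) (hq : ‖q‖ < 1)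
    (hb : s ^ 2 * (x₁ * x₂ * y₃ * y₄) = 1) {z : ℂ} (hz : z ≠ 0)
    (h : ∀ x ∈ ({x₁, x₂} : Set ℂ), ∀ y ∈ ({y₃, y₄, x₁ / q, x₂ / q} : Set ℂ), qPoch q (y * x) ≠ 0)
    (hg : ∀ x ∈ ({x₁, x₂} : Set ℂ), qPoch q (s * x * z) ≠ 0 ∧ qPoch q (s * x / q / z) ≠ 0) :
    wpDifference q s x₁ x₂ y₃ y₄ z *
        ((1 - 1 / (s * y₃) / (q * z)) * (1 - 1 / (s * y₄) / (q * z))) =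
      wpDifference q s x₁ x₂ y₃ y₄ (q * z) *
        ((1 - 1 / (s * y₃) * z) * (1 - 1 / (s * y₄) * z)) := by
  have h0 : s ^ 2 * (x₁ * x₂ * y₃ * y₄) ≠ 0 := by rw [hb]; exact one_ne_zero
  simp only [ne_eq, mul_eq_zero, pow_eq_zero_iff two_ne_zero, not_or] at h0
  obtain ⟨hs, ⟨⟨hx1, hx2⟩, hy3⟩, hy4⟩ := h0
  have hqz : q * z ≠ 0 := mul_ne_zero hq0 hz
  have s1 : ∀ x, qPoch q (s * z * x) = (1 - s * z * x) * qPoch q (s * (q * z) * x) := fun x => by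
    rw [qPoch_step hq]; congr 2; ring
  have s2 : ∀ x, qPoch q (s / (q * z) * x) = (1 - s / (q * z) * x) * qPoch q (s / z * x) :=
    fun x => by rw [qPoch_step hq]; congr 2; field_simp
  have g1 : ∀ x ∈ ({x₁, x₂} : Set ℂ), 1 - s * z * x ≠ 0 ∧ qPoch q (s * (q * z) * x) ≠ 0 ∧
      1 - s / (q * z) * x ≠ 0 ∧ qPoch q (s / z * x) ≠ 0 := fun x hx => by
    obtain ⟨p1, p2⟩ := hg x hx
    rw [show s * x * z = s * z * x by ring, s1] at p1
    rw [show s * x / q / z = s / (q * z) * x by field_simp, s2] at p2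
    exact ⟨(mul_ne_zero_iff.1 p1).1, (mul_ne_zero_iff.1 p1).2, (mul_ne_zero_iff.1 p2).1,
      (mul_ne_zero_iff.1 p2).2⟩
  have hn1 : ∀ x ∈ ({x₁, x₂} : Set ℂ), ∀ i, qPoch q (wpParam q s x₁ x₂ y₃ y₄ z i * x) ≠ 0 := by
    intro x hx i
    have := g1 x hx
    fin_cases i
    · change qPoch q (s * z * x) ≠ 0
      rw [s1]
      exact mul_ne_zero this.1 this.2.1
    · exact this.2.2.2
    all_goals exact h x hx _ (by simp [wpParam])
  have hn2 : ∀ x ∈ ({x₁, x₂} : Set ℂ), ∀ i,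
      qPoch q (wpParam q s x₁ x₂ y₃ y₄ (q * z) i * x) ≠ 0 := by
    intro x hx i
    have := g1 x hx
    fin_cases i
    · exact this.2.1
    · change qPoch q (s / (q * z) * x) ≠ 0
      rw [s2]
      exact mul_ne_zero this.2.2.1 this.2.2.2
    all_goals exact h x hx _ (by simp [wpParam])
  have ew : wpParam q s x₁ x₂ y₃ y₄ z =
      ![s * (q * z) / q, q * (s / (q * z)), y₃, y₄, x₁ / q, x₂ / q] := by
    rw [show s * (q * z) / q = s * z by field_simp, show q * (s / (q * z)) = s / z by field_simp]
    rfl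
  have shift : ∀ x ∈ ({x₁, x₂} : Set ℂ), ∀ S S' : ℂ,
      HasSum (fun n : ℕ => vwpWeight q (wpParam q s x₁ x₂ y₃ y₄ (q * z)) (x * q ^ n)) S →
      HasSum (fun n : ℕ => vwpWeight q (wpParam q s x₁ x₂ y₃ y₄ z) (x * q ^ n)) S' → _ :=
    fun x hx S S' hS hS' => vwp_sum_shift hq0 hq (y₁ := s * (q * z)) (y₂ := s / (q * z))
      (y₃ := y₃) (y₄ := y₄) (y₅ := x₁ / q) (y₆ := x₂ / q) (x := x) (S := S) (S' := S')
      (by field_simp; linear_combination hb) (fun i => by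
        have := g1 x hx
        fin_cases i
        · change qPoch q (s * (q * z) / q * x) ≠ 0
          rw [show s * (q * z) / q = s * z by field_simp, s1]
          exact mul_ne_zero this.1 this.2.1
        · change qPoch q (s / (q * z) * x) ≠ 0
          rw [s2]
          exact mul_ne_zero this.2.2.1 this.2.2.2
        all_goals exact h x hx _ (by simp))
      (by
        rw [mul_div_cancel₀ _ hq0, mul_div_cancel₀ _ hq0]
        simpa using hx) hS (by rw [← ew]; exact hS')
  have m1 : x₁ ∈ ({x₁, x₂} : Set ℂ) := by simp
  have m2 : x₂ ∈ ({x₁, x₂} : Set ℂ) := by simp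
  have hS₁ := hasSum_vwpWeight hq (hn2 x₁ m1)
  have hS₂ := hasSum_vwpWeight hq (hn2 x₂ m2)
  have hT₁ := hasSum_vwpWeight hq (hn1 x₁ m1)
  have hT₂ := hasSum_vwpWeight hq (hn1 x₂ m2)
  rw [wpDifference_eq_mul hq (hn1 x₁ m1) (hn1 x₂ m2) hT₁ hT₂,
    wpDifference_eq_mul hq (hn2 x₁ m1) (hn2 x₂ m2) hS₁ hS₂]
  have E₁ := shift x₁ m1 _ _ hS₁ hT₁
  have E₂ := shift x₂ m2 _ _ hS₂ hT₂
  have D : ∀ x ∈ ({x₁, x₂} : Set ℂ), wpDenom q s y₃ y₄ x z =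
      (1 - s * z * x) * wpDenom q s y₃ y₄ x (q * z) / (1 - s / (q * z) * x) := fun x hx => by
    rw [eq_div_iff (g1 x hx).2.2.1, wpDenom, wpDenom, s1, s2]
    ring
  rw [D x₁ m1, D x₂ m2]
  generalize wpDenom q s y₃ y₄ x₁ (q * z) = D₁
  generalize wpDenom q s y₃ y₄ x₂ (q * z) = D₂
  generalize x₁ / (∏ i, qPoch q (wpParam q s x₁ x₂ y₃ y₄ (q * z) i * x₁)) * _ = S₁ at *
  generalize x₂ / (∏ i, qPoch q (wpParam q s x₁ x₂ y₃ y₄ (q * z) i * x₂)) * _ = S₂ at *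
  generalize x₁ / (∏ i, qPoch q (wpParam q s x₁ x₂ y₃ y₄ z i * x₁)) * _ = T₁ at *
  generalize x₂ / (∏ i, qPoch q (wpParam q s x₁ x₂ y₃ y₄ z i * x₂)) * _ = T₂ at *
  generalize qPoch q (x₁ ^ 2 / q) * qPoch q (x₂ ^ 2 / q) * qPoch q (x₁ * x₂ / q) = K
  have E := E₁.trans E₂.symm
  have r1 : (1 - y₃ * (s * (q * z))) * (1 - y₄ * (s * (q * z))) * (1 - x₁ / q * (s * (q * z))) *
      (1 - x₂ / q * (s * (q * z))) / (s * (q * z)) = (1 - 1 / (s * y₃) / (q * z)) *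
        (1 - 1 / (s * y₄) / (q * z)) * ((1 - s * z * x₁) * (1 - s * z * x₂)) *
          (y₃ * y₄ * (s * (q * z))) := by
    field_simp
    ring
  have r2 : s / (q * z) * ((1 - 1 / (q * y₃ * (s / (q * z)))) * (1 - 1 / (q * y₄ * (s / (q * z)))) *
      (1 - 1 / (q * (x₁ / q) * (s / (q * z)))) * (1 - 1 / (q * (x₂ / q) * (s / (q * z))))) =
      (1 - 1 / (s * y₃) * z) * (1 - 1 / (s * y₄) * z) *
        ((1 - s / (q * z) * x₁) * (1 - s / (q * z) * x₂)) * (y₃ * y₄ * (s * (q * z))) := by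
    rw [show y₃ * y₄ * (s * (q * z)) = q * z / (s * x₁ * x₂) by
      field_simp; linear_combination hb]
    field_simp
    ring
  rw [r1, r2] at E
  have n0 : y₃ * y₄ * (s * (q * z)) ≠ 0 := mul_ne_zero (mul_ne_zero hy3 hy4) (mul_ne_zero hs hqz)
  have n1 := (g1 x₁ m1).2.2.1
  have n2 := (g1 x₂ m2).2.2.1
  generalize y₃ * y₄ * (s * (q * z)) = c at *
  generalize (1 - 1 / (s * y₃) / (q * z)) * (1 - 1 / (s * y₄) / (q * z)) = l at *
  generalize (1 - 1 / (s * y₃) * z) * (1 - 1 / (s * y₄) * z) = m at *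
  generalize 1 - s / (q * z) * x₁ = b1 at *
  generalize 1 - s / (q * z) * x₂ = b2 at *
  generalize 1 - s * z * x₁ = a1 at *
  generalize 1 - s * z * x₂ = a2 at *
  have E' : l * (a1 * a2) * (T₁ - T₂) = m * (b1 * b2) * (S₁ - S₂) := by
    apply mul_right_cancel₀ n0
    linear_combination E
  field_simp
  linear_combination K * D₁ * D₂ * E'

/-- The nonvanishing conditions on `z` fail only on a countable set, and after clearing denominators
both sides are continuous. -/
theorem wpDifference_shift (hq0 : q ≠ 0) (hq : ‖q‖ < 1)
    (hb : s ^ 2 * (x₁ * x₂ * y₃ * y₄) = 1) {z : ℂ} (hz : z ≠ 0)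
    (h : ∀ x ∈ ({x₁, x₂} : Set ℂ), ∀ y ∈ ({y₃, y₄, x₁ / q, x₂ / q} : Set ℂ), qPoch q (y * x) ≠ 0) :
    wpDifference q s x₁ x₂ y₃ y₄ z *
        ((1 - 1 / (s * y₃) / (q * z)) * (1 - 1 / (s * y₄) / (q * z))) =
      wpDifference q s x₁ x₂ y₃ y₄ (q * z) *
        ((1 - 1 / (s * y₃) * z) * (1 - 1 / (s * y₄) * z)) := by
  have h0 : s ^ 2 * (x₁ * x₂ * y₃ * y₄) ≠ 0 := by rw [hb]; exact one_ne_zero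
  simp only [ne_eq, mul_eq_zero, pow_eq_zero_iff two_ne_zero, not_or] at h0
  obtain ⟨hs, ⟨⟨hx1, hx2⟩, hy3⟩, hy4⟩ := h0
  have hd := differentiableOn_wpDifference hq hs hq0 hx1 hx2 hy3 hy4
  have c1 : ∀ w, w ≠ 0 → ContinuousAt (wpDifference q s x₁ x₂ y₃ y₄) w := fun w hw =>
    (hd.differentiableAt (isOpen_compl_singleton.mem_nhds hw)).continuousAt
  have c2 : ContinuousAt (fun z => wpDifference q s x₁ x₂ y₃ y₄ (q * z)) z :=
    (c1 _ (mul_ne_zero hq0 hz)).comp (f := fun z => q * z) (by fun_prop)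
  have hqz : q * z ≠ 0 := mul_ne_zero hq0 hz
  refine eq_of_frequently_eq
    (f := fun z => wpDifference q s x₁ x₂ y₃ y₄ z *
        ((1 - 1 / (s * y₃) / (q * z)) * (1 - 1 / (s * y₄) / (q * z))))
    (g := fun z => wpDifference q s x₁ x₂ y₃ y₄ (q * z) *
        ((1 - 1 / (s * y₃) * z) * (1 - 1 / (s * y₄) * z))) ((c1 z hz).mul ?_) (c2.mul ?_) ?_
  · fun_prop (disch := assumption)
  · fun_prop
  · have hc := ((countable_qPoch_mul_eq_zero hq (s * x₁)).union
      (countable_qPoch_div_eq_zero hq (s * x₁ / q))).union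
      ((countable_qPoch_mul_eq_zero hq (s * x₂)).union
      (countable_qPoch_div_eq_zero hq (s * x₂ / q)))
    refine ((frequently_notMem_of_countable hc z).and_eventually
      (isOpen_compl_singleton.mem_nhds hz)).mono fun w ⟨h1, hw⟩ => ?_
    simp only [Set.mem_union, Set.mem_ofPred_eq, not_or] at h1
    refine wpDifference_shift_of_ne_zero hq0 hq hb hw h ?_
    rintro x (rfl | rfl)
    exacts [h1.1, h1.2]

/-- Both functions satisfy the same first-order q-difference equation, so their quotient is
invariant. Its coefficient is cancelled away from its two zeros, which continuity then fills in. -/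
theorem wpDifference_mul_wpProduct (hq0 : q ≠ 0) (hq : ‖q‖ < 1)
    (hb : s ^ 2 * (x₁ * x₂ * y₃ * y₄) = 1) {z : ℂ} (hz : z ≠ 0)
    (h : ∀ x ∈ ({x₁, x₂} : Set ℂ), ∀ y ∈ ({y₃, y₄, x₁ / q, x₂ / q} : Set ℂ), qPoch q (y * x) ≠ 0) :
    wpDifference q s x₁ x₂ y₃ y₄ z * wpProduct q s x₁ x₂ y₃ y₄ (q * z) =
      wpDifference q s x₁ x₂ y₃ y₄ (q * z) * wpProduct q s x₁ x₂ y₃ y₄ z := by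
  have h0 : s ^ 2 * (x₁ * x₂ * y₃ * y₄) ≠ 0 := by rw [hb]; exact one_ne_zero
  simp only [ne_eq, mul_eq_zero, pow_eq_zero_iff two_ne_zero, not_or] at h0
  obtain ⟨hs, ⟨⟨hx1, hx2⟩, hy3⟩, hy4⟩ := h0
  have c : ∀ {f : ℂ → ℂ}, DifferentiableOn ℂ f {0}ᶜ →
      ContinuousAt f z ∧ ContinuousAt (fun z => f (q * z)) z := fun hf =>
    ⟨(hf.differentiableAt (isOpen_compl_singleton.mem_nhds hz)).continuousAt,
      (hf.differentiableAt (isOpen_compl_singleton.mem_nhds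
        (mul_ne_zero hq0 hz))).continuousAt.comp (f := fun z => q * z) (by fun_prop)⟩
  have cN := c (differentiableOn_wpDifference hq hs hq0 hx1 hx2 hy3 hy4)
  have cM := c (differentiableOn_wpProduct (s := s) (x₁ := x₁) (x₂ := x₂) (y₃ := y₃) (y₄ := y₄) hq)
  refine eq_of_frequently_eq (f := fun z => wpDifference q s x₁ x₂ y₃ y₄ z *
      wpProduct q s x₁ x₂ y₃ y₄ (q * z)) (g := fun z => wpDifference q s x₁ x₂ y₃ y₄ (q * z) *
      wpProduct q s x₁ x₂ y₃ y₄ z) (cN.1.mul cM.2) (cN.2.mul cM.1) ?_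
  have hc : ({s * y₃, s * y₄} : Set ℂ).Countable := (Set.toFinite _).countable
  refine ((frequently_notMem_of_countable hc z).and_eventually
    (isOpen_compl_singleton.mem_nhds hz)).mono fun w ⟨h1, hw⟩ => ?_
  have hm : (1 - 1 / (s * y₃) * w) * (1 - 1 / (s * y₄) * w) ≠ 0 := by
    simp only [Set.mem_insert_iff, Set.mem_singleton_iff, not_or] at h1
    refine mul_ne_zero (fun h => h1.1 ?_) fun h => h1.2 ?_
    · field_simp at h
      linear_combination -h
    · field_simp at h
      linear_combination -h
  have e1 := wpDifference_shift hq0 hq hb hw h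
  have e2 := wpProduct_shift (s := s) (x₁ := x₁) (x₂ := x₂) (y₃ := y₃) (y₄ := y₄) hq0 hq hw
  apply mul_right_cancel₀ hm
  linear_combination wpDifference q s x₁ x₂ y₃ y₄ w * e2 + wpProduct q s x₁ x₂ y₃ y₄ w * e1

/-- At `s x₁ z = 1` one of the two series terminates and the other one is multiplied by `0`. -/
theorem wpDifference_eq_wpProduct_of_eq_one (hq0 : q ≠ 0) (hq : ‖q‖ < 1)
    (hb : s ^ 2 * (x₁ * x₂ * y₃ * y₄) = 1) {z : ℂ} (hz : s * z * x₁ = 1) :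
    wpDifference q s x₁ x₂ y₃ y₄ z = wpProduct q s x₁ x₂ y₃ y₄ z := by
  have h0 : s ^ 2 * (x₁ * x₂ * y₃ * y₄) ≠ 0 := by rw [hb]; exact one_ne_zero
  simp only [ne_eq, mul_eq_zero, pow_eq_zero_iff two_ne_zero, not_or] at h0
  obtain ⟨hs, ⟨⟨hx1, hx2⟩, hy3⟩, hy4⟩ := h0
  have hz' : z = 1 / (s * x₁) := by
    rw [eq_div_iff (mul_ne_zero hs hx1), ← hz]; ring
  have hP1 : qPoch q 1 = 0 := (qPoch_eq_zero_iff hq).2 ⟨0, by simp⟩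
  have hD : wpDenom q s y₃ y₄ x₁ z = 0 := by rw [wpDenom, hz, hP1]; ring
  have hX : wpSeries q s x₁ x₂ y₃ y₄ x₁ z =
      (1 - x₁ ^ 2 / q) * ∏ i, qPoch q (x₁ / wpParam q s x₁ x₂ y₃ y₄ z i) := by
    rw [wpSeries, vwpSum, tsum_eq_single 0]
    · simp [vwpTerm]
    · intro n hn
      have : qPochFin q (wpParam q s x₁ x₂ y₃ y₄ z 0 * x₁) n = 0 := by
        change qPochFin q (s * z * x₁) n = 0
        rw [hz]
        exact Finset.prod_eq_zero (Finset.mem_range.2 (Nat.pos_of_ne_zero hn)) (by simp)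
      rw [vwpTerm, Finset.prod_eq_zero (Finset.mem_univ (0 : Fin 6)) (by rw [this, mul_zero])]
      ring
  rw [wpDifference, hD, hX, wpProduct, wpDenom, theta, hz']
  simp only [Fin.prod_univ_six, wpParam, Matrix.cons_val]
  rw [qPoch_step hq (x₁ ^ 2 / q), show q * (x₁ ^ 2 / q) = x₁ ^ 2 by field_simp,
    show x₁ / (s * (1 / (s * x₁))) = x₁ ^ 2 by field_simp,
    show x₁ / (s / (1 / (s * x₁))) = 1 / s ^ 2 by field_simp,
    show x₁ / (x₁ / q) = q by field_simp, show q / (x₂ / x₁) = x₁ / (x₂ / q) by field_simp,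
    show s * (1 / (s * x₁)) * x₂ = x₂ / x₁ by field_simp,
    show 1 / (s * y₃) / (1 / (s * x₁)) = x₁ / y₃ by field_simp,
    show 1 / (s * y₄) / (1 / (s * x₁)) = x₁ / y₄ by field_simp,
    show s / (1 / (s * x₁)) * x₂ = 1 / (y₃ * y₄) by field_simp; linear_combination hb,
    show 1 / (s * y₃) * (1 / (s * x₁)) = y₄ * x₂ by field_simp; linear_combination -hb,
    show 1 / (s * y₄) * (1 / (s * x₁)) = y₃ * x₂ by field_simp; linear_combination -hb]
  ring

end WellPoisedDifference

/-! ### Bailey's summation formula at nonresonant parameters. -/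

section WellPoisedEvaluation

variable {q s x₁ x₂ y₃ y₄ : ℂ}

/-- The resonances which are to be avoided in the evaluation of `wpDifference`. -/
def wpResonances (s x₁ x₂ y₃ y₄ : ℂ) : Set ℂ :=
  {x₂ / x₁, x₁ ^ 2, x₂ ^ 2, x₁ * x₂, s ^ 2, y₃ * y₄, (s * y₃) * (s * y₃), (s * y₃) * (s * y₄),
    (s * y₄) * (s * y₄), x₁ / y₃, x₁ / y₄, y₃ * x₁, y₄ * x₁, y₃ * x₂, y₄ * x₂}

/-- The zeros in `z` form sequences `q^l / (s y)` tending to 0 and sequences `s y q^(-l)` tending to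
infinity. Since no product `(s y)(s y')` is a power of `q`, an orbit cannot meet both kinds, and
moving far enough along it, away from the kind which it may meet, avoids all zeros. -/
theorem exists_wpProduct_ne_zero (hq0 : q ≠ 0) (hq : ‖q‖ < 1)
    (hb : s ^ 2 * (x₁ * x₂ * y₃ * y₄) = 1)
    (h : ∀ u ∈ wpResonances s x₁ x₂ y₃ y₄, theta q u ≠ 0) {z : ℂ} (hz : z ≠ 0) :
    ∃ k : ℤ, wpProduct q s x₁ x₂ y₃ y₄ (q ^ k * z) ≠ 0 := by
  have h0 : s ^ 2 * (x₁ * x₂ * y₃ * y₄) ≠ 0 := by rw [hb]; exact one_ne_zero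
  simp only [ne_eq, mul_eq_zero, pow_eq_zero_iff two_ne_zero, not_or] at h0
  obtain ⟨hs, ⟨⟨hx1, hx2⟩, hy3⟩, hy4⟩ := h0
  have hth : ∀ u ∈ wpResonances s x₁ x₂ y₃ y₄, u ≠ 0 → ∀ k : ℤ, ∀ v,
      (v = u * q ^ k ∨ v = u⁻¹ * q ^ k) → qPoch q v ≠ 0 := fun u hu hu0 k v hv =>
    qPoch_ne_zero_of_theta hq0 hq hu0 (h u hu) k hv
  have hconst : x₁ * theta q (x₂ / x₁) * qPoch q q * qPoch q (x₁ ^ 2 / q) * qPoch q (x₂ ^ 2 / q) *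
      qPoch q (1 / s ^ 2) * qPoch q (1 / (y₃ * y₄)) ≠ 0 := by
    have p1 : qPoch q (x₁ ^ 2 / q) ≠ 0 := hth (x₁ ^ 2) (by simp [wpResonances]) (by simp [hx1]) (-1) _
      (by left; simp [div_eq_mul_inv])
    have p2 : qPoch q (x₂ ^ 2 / q) ≠ 0 := hth (x₂ ^ 2) (by simp [wpResonances]) (by simp [hx2]) (-1) _
      (by left; simp [div_eq_mul_inv])
    have p3 : qPoch q (1 / s ^ 2) ≠ 0 := hth (s ^ 2) (by simp [wpResonances]) (by simp [hs]) 0 _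
      (by right; simp)
    have p4 : qPoch q (1 / (y₃ * y₄)) ≠ 0 := hth (y₃ * y₄) (by simp [wpResonances])
      (by simp [hy3, hy4]) 0 _ (by right; simp)
    have p5 : theta q (x₂ / x₁) ≠ 0 := h _ (by simp [wpResonances])
    have p6 := qPoch_self_ne_zero hq
    simp only [ne_eq, mul_eq_zero, not_or]
    exact ⟨⟨⟨⟨⟨⟨hx1, p5⟩, p6⟩, p1⟩, p2⟩, p3⟩, p4⟩
  have hY : ∀ y ∈ ({y₃, y₄} : Set ℂ), y ≠ 0 := by rintro y (rfl | rfl) <;> assumption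
  suffices H : ∃ k : ℤ, ∀ y ∈ ({y₃, y₄} : Set ℂ), qPoch q (1 / (s * y) / (q ^ k * z)) ≠ 0 ∧
      qPoch q (1 / (s * y) * (q ^ k * z)) ≠ 0 by
    obtain ⟨k, hk⟩ := H
    obtain ⟨a1, a2⟩ := hk y₃ (by simp)
    obtain ⟨b1, b2⟩ := hk y₄ (by simp)
    exact ⟨k, mul_ne_zero hconst (mul_ne_zero (mul_ne_zero (mul_ne_zero a1 b1) a2) b2)⟩
  have hsmall : ∀ c₁ c₂ : ℂ, ∃ n : ℕ, ‖c₁ * q ^ n‖ < 1 ∧ ‖c₂ * q ^ n‖ < 1 := fun c₁ c₂ => by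
    have : ∀ c, ∀ᶠ n : ℕ in atTop, ‖c * q ^ n‖ < 1 := fun c => by
      have := (tendsto_mul_pow_zero hq c).norm
      rw [norm_zero] at this
      exact this.eventually_lt_const one_pos
    exact ((this c₁).and (this c₂)).exists
  by_cases hres : ∃ y ∈ ({y₃, y₄} : Set ℂ), ∃ m : ℤ, s * y * z = q ^ m
  · obtain ⟨y, hy, m, hm⟩ := hres
    obtain ⟨n, hn₁, hn₂⟩ := hsmall (1 / (s * y₃) / z) (1 / (s * y₄) / z)
    refine ⟨-n, fun y' hy' => ⟨?_, ?_⟩⟩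
    · apply qPoch_ne_zero_of_norm_lt hq
      have : 1 / (s * y') / (q ^ (-n : ℤ) * z) = 1 / (s * y') / z * q ^ n := by
        rw [zpow_neg, zpow_natCast]
        field_simp
      rw [this]
      rcases hy' with rfl | rfl <;> assumption
    · refine qPoch_ne_zero hq fun l hl => ?_
      have hs2 : s * y * (s * y') = q ^ (m + -n + l) := by
        rw [zpow_add₀ hq0, zpow_add₀ hq0, ← hm, zpow_natCast]
        have := hY y' hy'
        generalize q ^ (-(n : ℤ)) = Q at *
        field_simp at hl
        linear_combination -(s * y) * hl
      have hmem : s * y * (s * y') ∈ wpResonances s x₁ x₂ y₃ y₄ := by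
        rcases hy with rfl | rfl <;> rcases hy' with rfl | rfl
        · simp [wpResonances]
        · simp [wpResonances]
        · rw [mul_comm]; simp [wpResonances]
        · simp [wpResonances]
      have := h _ hmem
      rw [ne_eq, theta_eq_zero_iff hq0 hq (mul_ne_zero (mul_ne_zero hs (hY y hy))
        (mul_ne_zero hs (hY y' hy')))] at this
      exact this ⟨_, hs2⟩
  · push Not at hres
    obtain ⟨n, hn₁, hn₂⟩ := hsmall (1 / (s * y₃) * z) (1 / (s * y₄) * z)
    refine ⟨n, fun y' hy' => ⟨?_, ?_⟩⟩
    · refine qPoch_ne_zero hq fun l hl => hres y' hy' (l - n) ?_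
      have := hY y' hy'
      rw [zpow_sub₀ hq0, zpow_natCast, zpow_natCast]
      rw [zpow_natCast] at hl
      field_simp at hl ⊢
      linear_combination -hl
    · apply qPoch_ne_zero_of_norm_lt hq
      have : 1 / (s * y') * (q ^ (n : ℤ) * z) = 1 / (s * y') * z * q ^ n := by
        rw [zpow_natCast]; ring
      rw [this]
      rcases hy' with rfl | rfl <;> assumption

/-- The evaluation of the difference of two very-well-poised series. -/
theorem wpDifference_eq_wpProduct (hq0 : q ≠ 0) (hq : ‖q‖ < 1)
    (hb : s ^ 2 * (x₁ * x₂ * y₃ * y₄) = 1)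
    (h : ∀ u ∈ wpResonances s x₁ x₂ y₃ y₄, theta q u ≠ 0) {z : ℂ} (hz : z ≠ 0) :
    wpDifference q s x₁ x₂ y₃ y₄ z = wpProduct q s x₁ x₂ y₃ y₄ z := by
  have h0 : s ^ 2 * (x₁ * x₂ * y₃ * y₄) ≠ 0 := by rw [hb]; exact one_ne_zero
  simp only [ne_eq, mul_eq_zero, pow_eq_zero_iff two_ne_zero, not_or] at h0
  obtain ⟨hs, ⟨⟨hx1, hx2⟩, hy3⟩, hy4⟩ := h0
  have hth : ∀ u ∈ wpResonances s x₁ x₂ y₃ y₄, u ≠ 0 → ∀ k : ℤ, ∀ v,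
      (v = u * q ^ k ∨ v = u⁻¹ * q ^ k) → qPoch q v ≠ 0 := fun u hu hu0 k v hv =>
    qPoch_ne_zero_of_theta hq0 hq hu0 (h u hu) k hv
  have hyx : ∀ x ∈ ({x₁, x₂} : Set ℂ), ∀ y ∈ ({y₃, y₄, x₁ / q, x₂ / q} : Set ℂ),
      qPoch q (y * x) ≠ 0 := by
    rintro x (rfl | rfl) y (rfl | rfl | rfl | rfl)
    · exact hth (y * x) (by simp [wpResonances]) (by simp [*]) 0 _ (by simp)
    · exact hth (y * x) (by simp [wpResonances]) (by simp [*]) 0 _ (by simp)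
    · exact hth (x ^ 2) (by simp [wpResonances]) (by simp [*]) (-1) _ (by left; field_simp)
    · exact hth (x * x₂) (by simp [wpResonances]) (by simp [*]) (-1) _
        (by left; simp; ring)
    · exact hth (y * x) (by simp [wpResonances]) (by simp [*]) 0 _ (by simp)
    · exact hth (y * x) (by simp [wpResonances]) (by simp [*]) 0 _ (by simp)
    · exact hth (x₁ * x) (by simp [wpResonances]) (by simp [*]) (-1) _
        (by left; simp; ring)
    · exact hth (x ^ 2) (by simp [wpResonances]) (by simp [*]) (-1) _ (by left; field_simp)
  -- The comparison point where `s x₁ z = 1` and the first series terminates. Nonresonance makes the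
  -- product nonzero there.
  have hz0 : 1 / (s * x₁) ≠ 0 := one_div_ne_zero (mul_ne_zero hs hx1)
  refine eq_of_quotient_invariant hq0 hq (differentiableOn_wpDifference hq hs hq0 hx1 hx2 hy3 hy4)
    (differentiableOn_wpProduct hq) (fun z hz => wpDifference_mul_wpProduct hq0 hq hb hz hyx)
    (fun z hz => exists_wpProduct_ne_zero hq0 hq hb h hz) hz0 ?_
    (wpDifference_eq_wpProduct_of_eq_one hq0 hq hb (by field_simp)) hz
  rw [wpProduct,
    show 1 / (s * y₃) / (1 / (s * x₁)) = x₁ / y₃ by field_simp,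
    show 1 / (s * y₄) / (1 / (s * x₁)) = x₁ / y₄ by field_simp,
    show 1 / (s * y₃) * (1 / (s * x₁)) = y₄ * x₂ by field_simp; linear_combination -hb,
    show 1 / (s * y₄) * (1 / (s * x₁)) = y₃ * x₂ by field_simp; linear_combination -hb]
  have p1 : qPoch q (x₁ ^ 2 / q) ≠ 0 := hth (x₁ ^ 2) (by simp [wpResonances]) (by simp [hx1]) (-1) _
    (by left; simp [div_eq_mul_inv])
  have p2 : qPoch q (x₂ ^ 2 / q) ≠ 0 := hth (x₂ ^ 2) (by simp [wpResonances]) (by simp [hx2]) (-1) _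
    (by left; simp [div_eq_mul_inv])
  have p3 : qPoch q (1 / s ^ 2) ≠ 0 := hth (s ^ 2) (by simp [wpResonances]) (by simp [hs]) 0 _
    (by right; simp)
  have p4 : qPoch q (1 / (y₃ * y₄)) ≠ 0 := hth (y₃ * y₄) (by simp [wpResonances])
    (by simp [hy3, hy4]) 0 _ (by right; simp)
  have p5 : theta q (x₂ / x₁) ≠ 0 := h _ (by simp [wpResonances])
  have p6 := qPoch_self_ne_zero hq
  have p7 : qPoch q (x₁ / y₃) ≠ 0 := hth (x₁ / y₃) (by simp [wpResonances]) (by simp [*]) 0 _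
    (by left; simp)
  have p8 : qPoch q (x₁ / y₄) ≠ 0 := hth (x₁ / y₄) (by simp [wpResonances]) (by simp [*]) 0 _
    (by left; simp)
  have p9 := hyx x₂ (by simp) y₃ (by simp)
  have p10 := hyx x₂ (by simp) y₄ (by simp)
  simp only [ne_eq, mul_eq_zero, not_or]
  exact ⟨⟨⟨⟨⟨⟨⟨hx1, p5⟩, p6⟩, p1⟩, p2⟩, p3⟩, p4⟩, ⟨⟨p7, p8⟩, p10⟩, p9⟩

end WellPoisedEvaluation

/-! ### Integrating a very-well-poised series term by term against the Askey-Wilson weight. -/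

section TermwiseIntegration

variable {q : ℂ} {γ : ℝ → ℂ}

/-- Dominated convergence with a geometric bound. It is used again with ratio 1/2 for expansions of
the Cauchy kernel. -/
theorem IsLoop.hasSum_loopIntegral (h : IsLoop γ) (hq : ‖q‖ < 1) {c : ℕ → ℂ} {C₁ : ℝ}
    (hc : ∀ n, ‖c n‖ ≤ C₁) {F : ℕ → ℂ → ℂ} (hF : ∀ n, ContinuousOn (F n) (Set.range γ)) {C₂ : ℝ}
    (hF' : ∀ n θ, ‖F n (γ θ)‖ ≤ C₂) {f : ℂ → ℂ}
    (hf : ∀ θ, HasSum (fun n : ℕ => q ^ n * c n * F n (γ θ)) (f (γ θ))) :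
    HasSum (fun n => q ^ n * c n * loopIntegral γ (F n)) (loopIntegral γ f) := by
  simp only [← loopIntegral_const_mul]
  have hC₁ : 0 ≤ C₁ := (norm_nonneg _).trans (hc 0)
  have hg : Summable fun n : ℕ => ‖q‖ ^ n := summable_geometric_of_lt_one (norm_nonneg _) hq
  refine intervalIntegral.hasSum_integral_of_dominated_convergence
    (fun n θ => ‖q‖ ^ n * (C₁ * C₂ * ‖deriv γ θ‖)) (fun n => ?_) (fun n => ?_) ?_ ?_ ?_
  · exact (h.continuous_integrand (continuousOn_const.mul (hF n))
      fun θ => ⟨θ, rfl⟩).aestronglyMeasurable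
  · refine Eventually.of_forall fun θ _ => ?_
    rw [norm_mul, norm_mul, norm_mul, norm_pow]
    have h1 : ‖c n‖ * ‖F n (γ θ)‖ ≤ C₁ * C₂ :=
      mul_le_mul (hc n) (hF' n θ) (norm_nonneg _) hC₁
    calc ‖q‖ ^ n * ‖c n‖ * ‖F n (γ θ)‖ * ‖deriv γ θ‖
        = ‖q‖ ^ n * (‖c n‖ * ‖F n (γ θ)‖ * ‖deriv γ θ‖) := by ring
      _ ≤ _ := by gcongr
  · exact Eventually.of_forall fun θ _ => hg.mul_right _
  · simp only [tsum_mul_right]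
    exact (continuous_const.mul (continuous_const.mul h.continuous_deriv.norm)).intervalIntegrable
      _ _
  · exact Eventually.of_forall fun θ _ => (hf θ).mul_right _

/-- The common factor `(z^{±2}; q)_∞ / (a z^±, b z^±, c z^±, d z^±; q)_∞`. -/
def awWeight (q a b c d z : ℂ) : ℂ :=
  qPoch q (z ^ 2) * qPoch q (z ^ 2)⁻¹ /
    (qPoch q (a * z) * qPoch q (a / z) * (qPoch q (b * z) * qPoch q (b / z)) *
      (qPoch q (c * z) * qPoch q (c / z)) * (qPoch q (d * z) * qPoch q (d / z)))

theorem nrIntegrand_eq_awWeight_mul (q a b c d e z : ℂ) :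
    nrIntegrand q a b c d e z = awWeight q a b c d z *
      (qPoch q (a * b * c * d * e * z) * qPoch q (a * b * c * d * e / z)) /
        (qPoch q (e * z) * qPoch q (e / z)) := by
  rw [nrIntegrand, awWeight, div_mul_eq_mul_div, div_div]

/-- The part of `nrProduct` which does not depend on the last parameter. -/
def awConst (q a b c d : ℂ) : ℂ :=
  qPoch q (a * b * c * d) / (qPoch q (a * b) * qPoch q (a * c) * qPoch q (a * d) *
    qPoch q (b * c) * qPoch q (b * d) * qPoch q (c * d))

theorem nrProduct_eq_awConst_mul (q a b c d e : ℂ) :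
    nrProduct q a b c d e = awConst q a b c d *
      (qPoch q (b * c * d * e) * qPoch q (a * c * d * e) * qPoch q (a * b * d * e) *
        qPoch q (a * b * c * e)) /
      (qPoch q (a * e) * qPoch q (b * e) * qPoch q (c * e) * qPoch q (d * e)) := by
  rw [nrProduct, awConst, div_mul_eq_mul_div, div_div]
  congr 1 <;> ring

/-- The finite factors `(gz, g/z; q)_n` cancel against `(gz, g/z; q)_∞` and leave the denominators
for `g q^n`. The two numerators depending on `z` already have the argument `abcdg q^n`, so the term
is an integrand with last parameter `g q^n`. -/
theorem awWeight_mul_vwpTerm (hq : ‖q‖ < 1) {a b c d g z : ℂ} (h1 : qPoch q (g * z) ≠ 0)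
    (h2 : qPoch q (g / z) ≠ 0) (p e₁ e₂ e₃ e₄ f₁ f₂ f₃ f₄ : ℂ) (n : ℕ) :
    q ^ n * vwpTerm q p ![e₁, e₂, e₃, e₄] ![f₁, f₂, f₃, f₄] n *
        (nrIntegrand q a b c d (g * q ^ n) z / z) =
      awWeight q a b c d z * (q ^ n *
        vwpTerm q p ![a * b * c * d * g / z, a * b * c * d * g * z, e₁, e₂, e₃, e₄]
          ![g * z, g / z, f₁, f₂, f₃, f₄] n) / (qPoch q (g * z) * qPoch q (g / z)) / z := by
  have i1 : qPoch q (g * z) = qPochFin q (g * z) n * qPoch q (g * q ^ n * z) := by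
    rw [qPoch_eq_qPochFin_mul hq _ n]; congr 2; ring
  have i2 : qPoch q (g / z) = qPochFin q (g / z) n * qPoch q (g * q ^ n / z) := by
    rw [qPoch_eq_qPochFin_mul hq _ n]; congr 2; ring
  rw [nrIntegrand_eq_awWeight_mul, vwpTerm, vwpTerm, i1, i2]
  simp only [Fin.prod_univ_six, Fin.prod_univ_four, Matrix.cons_val]
  rw [show a * b * c * d * g * z * q ^ n = a * b * c * d * (g * q ^ n) * z by ring,
    show a * b * c * d * g / z * q ^ n = a * b * c * d * (g * q ^ n) / z by ring]
  rw [i1] at h1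
  rw [i2] at h2
  obtain ⟨hA, hA'⟩ := mul_ne_zero_iff.1 h1
  obtain ⟨hB, hB'⟩ := mul_ne_zero_iff.1 h2
  generalize qPochFin q (g * z) n = A at *
  generalize qPochFin q (g / z) n = B at *
  generalize qPoch q (g * q ^ n * z) = A' at *
  generalize qPoch q (g * q ^ n / z) = B' at *
  generalize awWeight q a b c d z = W at *
  generalize 1 - p * q ^ (2 * n) = r
  generalize qPoch q (e₁ * q ^ n) * qPochFin q f₁ n = u₁
  generalize qPoch q (e₂ * q ^ n) * qPochFin q f₂ n = u₂
  generalize qPoch q (e₃ * q ^ n) * qPochFin q f₃ n = u₃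
  generalize qPoch q (e₄ * q ^ n) * qPochFin q f₄ n = u₄
  generalize qPoch q (a * b * c * d * (g * q ^ n) * z) = v₁
  generalize qPoch q (a * b * c * d * (g * q ^ n) / z) = v₂
  simp only [div_eq_mul_inv]
  generalize z⁻¹ = y
  generalize q ^ n = Q
  field_simp

/-- In the value of the integral at `g q^n` the denominators `(xg q^n; q)_∞` become finite
factorials in numerators after division by `(xg; q)_∞`. Together with the triple products they give
four new pairs of a very-well-poised term. -/
theorem vwpTerm_mul_nrProduct (hq : ‖q‖ < 1) {a b c d g : ℂ}
    (h : ∀ x ∈ ({a, b, c, d} : Set ℂ), qPoch q (x * g) ≠ 0)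
    (p e₁ e₂ e₃ e₄ f₁ f₂ f₃ f₄ : ℂ) (n : ℕ) :
    vwpTerm q p ![e₁, e₂, e₃, e₄] ![f₁, f₂, f₃, f₄] n * nrProduct q a b c d (g * q ^ n) =
      awConst q a b c d / (qPoch q (a * g) * qPoch q (b * g) * qPoch q (c * g) * qPoch q (d * g)) *
        vwpTerm q p
          ![b * c * d * g, a * c * d * g, a * b * d * g, a * b * c * g, e₁, e₂, e₃, e₄]
          ![a * g, b * g, c * g, d * g, f₁, f₂, f₃, f₄] n := by
  have i : ∀ x, qPoch q (x * g) = qPochFin q (x * g) n * qPoch q (x * g * q ^ n) := fun x => by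
    rw [qPoch_eq_qPochFin_mul hq _ n]
  have m : ∀ x ∈ ({a, b, c, d} : Set ℂ), qPochFin q (x * g) n ≠ 0 ∧
      qPoch q (x * g * q ^ n) ≠ 0 := fun x hx => by
    have := h x hx
    rw [i] at this
    exact mul_ne_zero_iff.1 this
  obtain ⟨ma, ma'⟩ := m a (by simp)
  obtain ⟨mb, mb'⟩ := m b (by simp)
  obtain ⟨mc, mc'⟩ := m c (by simp)
  obtain ⟨md, md'⟩ := m d (by simp)
  rw [nrProduct_eq_awConst_mul, vwpTerm, vwpTerm]
  simp only [Fin.prod_univ_eight, Fin.prod_univ_four, Matrix.cons_val, ← mul_assoc _ g (q ^ n)]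
  rw [i a, i b, i c, i d]
  generalize qPochFin q (a * g) n = a1 at *
  generalize qPochFin q (b * g) n = b1 at *
  generalize qPochFin q (c * g) n = c1 at *
  generalize qPochFin q (d * g) n = d1 at *
  generalize qPoch q (a * g * q ^ n) = a2 at *
  generalize qPoch q (b * g * q ^ n) = b2 at *
  generalize qPoch q (c * g * q ^ n) = c2 at *
  generalize qPoch q (d * g * q ^ n) = d2 at *
  generalize awConst q a b c d = W at *
  generalize 1 - p * q ^ (2 * n) = r
  generalize qPoch q (e₁ * q ^ n) * qPochFin q f₁ n = u₁
  generalize qPoch q (e₂ * q ^ n) * qPochFin q f₂ n = u₂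
  generalize qPoch q (e₃ * q ^ n) * qPochFin q f₃ n = u₃
  generalize qPoch q (e₄ * q ^ n) * qPochFin q f₄ n = u₄
  generalize qPoch q (b * c * d * g * q ^ n) = v₁
  generalize qPoch q (a * c * d * g * q ^ n) = v₂
  generalize qPoch q (a * b * d * g * q ^ n) = v₃
  generalize qPoch q (a * b * c * g * q ^ n) = v₄
  field_simp

theorem loopIntegral_awWeight_mul_vwpSum (hq0 : q ≠ 0) (hq : ‖q‖ < 1) {a b c d g : ℂ}
    (h0 : ∀ x ∈ ({a, b, c, d, g} : Set ℂ), x ≠ 0) (hγ : EnclosesOrbits q {a, b, c, d, g} γ)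
    (p e₁ e₂ e₃ e₄ f₁ f₂ f₃ f₄ : ℂ) :
    loopIntegral γ (fun z => awWeight q a b c d z *
        vwpSum q p ![a * b * c * d * g / z, a * b * c * d * g * z, e₁, e₂, e₃, e₄]
          ![g * z, g / z, f₁, f₂, f₃, f₄] / (qPoch q (g * z) * qPoch q (g / z)) / z) =
      2 * Real.pi * Complex.I * (2 / qPoch q q) * (awConst q a b c d /
        (qPoch q (a * g) * qPoch q (b * g) * qPoch q (c * g) * qPoch q (d * g)) *
        vwpSum q p ![b * c * d * g, a * c * d * g, a * b * d * g, a * b * c * g, e₁, e₂, e₃, e₄]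
          ![a * g, b * g, c * g, d * g, f₁, f₂, f₃, f₄]) := by
  obtain ⟨C₁, hC₁⟩ := exists_norm_vwpTerm_le hq p ![e₁, e₂, e₃, e₄] ![f₁, f₂, f₃, f₄]
  have hmem : ∀ n : ℕ, ∀ y ∈ ({a, b, c, d, g * q ^ n} : Set ℂ),
      ∃ x ∈ ({a, b, c, d, g} : Set ℂ), ∃ m : ℕ, y = x * q ^ m := by
    rintro n y (rfl | rfl | rfl | rfl | rfl)
    exacts [⟨y, by simp, 0, by simp⟩, ⟨y, by simp, 0, by simp⟩, ⟨y, by simp, 0, by simp⟩,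
      ⟨y, by simp, 0, by simp⟩, ⟨g, by simp, n, rfl⟩]
  have hE : ∀ n : ℕ, EnclosesOrbits q {a, b, c, d, g * q ^ n} γ := fun n => hγ.mono (hmem n)
  -- Adding the limit point 0 to the parameters `g q^n` makes their set compact, which bounds all
  -- the integrands uniformly in `n`.
  have hcont : ContinuousOn (fun p : ℂ × ℂ => nrIntegrand q a b c d p.1 p.2 / p.2)
      (insert 0 (Set.range fun n : ℕ => g * q ^ n) ×ˢ Set.range γ) := by
    refine continuousOn_nrIntegrand_div hq (by fun_prop) (by fun_prop) (by fun_prop)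
      (by fun_prop) (by fun_prop) (by fun_prop) ?_ ?_
    · rintro ⟨ε, z⟩ ⟨-, ⟨θ, rfl⟩⟩
      exact hγ.ne_zero θ
    · rintro ⟨ε, z⟩ ⟨hε, ⟨θ, rfl⟩⟩ y hy
      simp only at hε hy ⊢
      rcases hε with hε | ⟨n, rfl⟩
      · rcases hy with rfl | rfl | rfl | rfl | hy
        · exact ⟨hγ.qPoch_mul_apply_ne_zero hq (by simp) θ,
            hγ.qPoch_div_apply_ne_zero hq (by simp) θ⟩
        · exact ⟨hγ.qPoch_mul_apply_ne_zero hq (by simp) θ,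
            hγ.qPoch_div_apply_ne_zero hq (by simp) θ⟩
        · exact ⟨hγ.qPoch_mul_apply_ne_zero hq (by simp) θ,
            hγ.qPoch_div_apply_ne_zero hq (by simp) θ⟩
        · exact ⟨hγ.qPoch_mul_apply_ne_zero hq (by simp) θ,
            hγ.qPoch_div_apply_ne_zero hq (by simp) θ⟩
        · simp [Set.mem_singleton_iff.1 hy, hε]
      · exact ⟨(hE n).qPoch_mul_apply_ne_zero hq hy θ, (hE n).qPoch_div_apply_ne_zero hq hy θ⟩
  obtain ⟨C₂, hC₂⟩ := (hγ.isLoop.tendsto_loopIntegral (tendsto_mul_pow_zero hq g)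
    (F := fun ε z => nrIntegrand q a b c d ε z / z) hcont).2
  have hF : ∀ n : ℕ, ContinuousOn (fun z => nrIntegrand q a b c d (g * q ^ n) z / z)
      (Set.range γ) := fun n =>
    hcont.comp (f := fun z => (g * q ^ n, z)) (by fun_prop) fun z hz => ⟨Or.inr ⟨n, rfl⟩, hz⟩
  have hsum := hγ.isLoop.hasSum_loopIntegral hq hC₁ hF hC₂
    (f := fun z => awWeight q a b c d z *
        vwpSum q p ![a * b * c * d * g / z, a * b * c * d * g * z, e₁, e₂, e₃, e₄]
          ![g * z, g / z, f₁, f₂, f₃, f₄] / (qPoch q (g * z) * qPoch q (g / z)) / z) (fun θ => by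
      set z := γ θ
      have n1 : qPoch q (g * z) ≠ 0 := hγ.qPoch_mul_apply_ne_zero hq (by simp) θ
      have n2 : qPoch q (g / z) ≠ 0 := hγ.qPoch_div_apply_ne_zero hq (by simp) θ
      have := (((hasSum_vwpSum hq p ![a * b * c * d * g / z, a * b * c * d * g * z, e₁, e₂, e₃, e₄]
        ![g * z, g / z, f₁, f₂, f₃, f₄]).mul_left (awWeight q a b c d z)).div_const
          (qPoch q (g * z) * qPoch q (g / z))).div_const z
      simp only [← awWeight_mul_vwpTerm hq n1 n2] at this
      exact this)
  refine hsum.unique ?_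
  have hR := ((hasSum_vwpSum hq p
    ![b * c * d * g, a * c * d * g, a * b * d * g, a * b * c * g, e₁, e₂, e₃, e₄]
    ![a * g, b * g, c * g, d * g, f₁, f₂, f₃, f₄]).mul_left (awConst q a b c d /
        (qPoch q (a * g) * qPoch q (b * g) * qPoch q (c * g) * qPoch q (d * g)))).mul_left
    (2 * Real.pi * Complex.I * (2 / qPoch q q))
  have h0n : ∀ n : ℕ, ∀ y ∈ ({a, b, c, d, g * q ^ n} : Set ℂ), y ≠ 0 := fun n y hy => by
    obtain ⟨x, hx, m, rfl⟩ := hmem n y hy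
    exact mul_ne_zero (h0 x hx) (pow_ne_zero _ hq0)
  have hP : ∀ x ∈ ({a, b, c, d} : Set ℂ), qPoch q (x * g) ≠ 0 := fun x hx =>
    hγ.qPoch_mul_ne_zero hq (by
      simp only [Set.mem_insert_iff, Set.mem_singleton_iff] at hx ⊢
      tauto) (by simp)
  refine (congrArg (HasSum · _) (funext fun n => ?_)).mpr hR
  rw [nassrallah_rahman hq0 hq (h0n n) (hE n), mul_left_comm _ (q ^ n),
    ← vwpTerm_mul_nrProduct hq hP]
  ring

end TermwiseIntegration

/-! ### Evaluation of the contour integral for S as a sum of two series. -/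

section EvaluationS

variable {q : ℂ} {γ : ℝ → ℂ} {t : Fin 8 → ℂ}

theorem ne_zero_of_mem_paramSpace (ht : t ∈ paramSpace) (j : Fin 8) : t j ≠ 0 := by
  intro h
  have : ∏ j, t j = 1 := ht
  rw [Finset.prod_eq_zero (Finset.mem_univ j) h] at this
  exact zero_ne_one this

theorem prod_Icc_one_six (f : Fin 8 → ℂ) :
    ∏ j ∈ Finset.Icc (1 : Fin 8) 6, f j = f 1 * f 2 * f 3 * f 4 * f 5 * f 6 := by
  rw [show Finset.Icc (1 : Fin 8) 6 = {1, 2, 3, 4, 5, 6} by decide]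
  simp [Finset.prod_insert, mul_assoc]

theorem suFactor_eq (q : ℂ) (t : Fin 8 → ℂ) : suFactor q t =
    (qPoch q (t 1 * t 2) * qPoch q (t 1 * t 3) * qPoch q (t 1 * t 4) * qPoch q (t 2 * t 3) *
      qPoch q (t 2 * t 4) * qPoch q (t 3 * t 4)) * qPoch q (t 5 * t 6) /
    (qPoch q (1 / (q * t 0 * t 7)) * qPoch q (1 / (t 0 * t 5)) * qPoch q (1 / (t 0 * t 6)) *
      qPoch q (1 / (t 7 * t 5)) * qPoch q (1 / (t 7 * t 6))) := by
  rw [suFactor, show Finset.Icc (1 : Fin 8) 4 = {1, 2, 3, 4} by decide,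
    Finset.prod_insert (by decide), Finset.prod_insert (by decide), Finset.prod_insert (by decide),
    Finset.prod_singleton, show Finset.Ioc (1 : Fin 8) 4 = {2, 3, 4} by decide,
    show Finset.Ioc (2 : Fin 8) 4 = {3, 4} by decide,
    show Finset.Ioc (3 : Fin 8) 4 = {4} by decide, show Finset.Ioc (4 : Fin 8) 4 = ∅ by decide]
  congr 2
  simp [Finset.prod_insert, mul_assoc]

theorem IsContourS.enclosesOrbits (h : IsContourS q t γ) :
    EnclosesOrbits q {x | ∃ j ∈ Finset.Icc (1 : Fin 8) 6, x = t j} γ where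
  isLoop := IsSeparatingLoop.isLoop h
  ne_zero := h.avoids_included 0 (by simp)
  winding_zero := h.winding_included 0 (by simp)
  ne_orbit := by
    rintro _ ⟨j, hj, rfl⟩ n
    exact h.avoids_included _ (Or.inr ⟨j, hj, n, rfl⟩)
  winding_orbit := by
    rintro _ ⟨j, hj, rfl⟩ n
    exact h.winding_included _ (Or.inr ⟨j, hj, n, rfl⟩)
  ne_inv := by
    rintro _ ⟨j, hj, rfl⟩ n
    exact h.avoids_excluded _ ⟨j, hj, n, rfl⟩
  winding_inv := by
    rintro _ ⟨j, hj, rfl⟩ n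
    exact h.winding_excluded _ ⟨j, hj, n, rfl⟩

/-- The parameters `(τ₂, …, τ₇, τ₁ / q, τ₈ / q)`. -/
def uParam (q : ℂ) (τ : Fin 8 → ℂ) : Fin 8 → ℂ :=
  ![τ 1, τ 2, τ 3, τ 4, τ 5, τ 6, τ 0 / q, τ 7 / q]

/-- The sum of the residues of the integrand of `U_t` at `x q^n`, up to a constant. -/
def uBase (q : ℂ) (τ : Fin 8 → ℂ) (x : ℂ) : ℂ :=
  x / (∏ i, qPoch q (uParam q τ i * x)) *
    vwpSum q (x ^ 2 / q) (fun i => x / uParam q τ i) fun i => uParam q τ i * x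

/-- The sum of two very-well-poised series, with a common prefactor. -/
def uSeries (q : ℂ) (τ : Fin 8 → ℂ) : ℂ :=
  2 / (τ 0 * qPoch q q ^ 2 * theta q (τ 7 / τ 0)) * (uBase q τ (τ 0) - uBase q τ (τ 7))

theorem integrandS_eq_awWeight_mul (q : ℂ) (t : Fin 8 → ℂ) (z : ℂ) :
    integrandS q t z = awWeight q (t 1) (t 2) (t 3) (t 4) z *
      (qPoch q (1 / t 0 / z) * qPoch q (1 / t 7 / z) * qPoch q (1 / t 0 * z) *
        qPoch q (1 / t 7 * z)) /
      (qPoch q (t 5 * z) * qPoch q (t 5 / z) * (qPoch q (t 6 * z) * qPoch q (t 6 / z))) := by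
  rw [integrandS, awWeight, prod_Icc_one_six, div_mul_eq_mul_div, div_div]
  simp only [one_div, ← div_eq_mul_inv _ z]
  congr 1 <;> ring

theorem continuousOn_awWeight (hq : ‖q‖ < 1) (a b c d : ℂ) :
    ContinuousOn (awWeight q a b c d) {z | z ≠ 0 ∧ ∀ x ∈ ({a, b, c, d} : Set ℂ),
      qPoch q (x * z) ≠ 0 ∧ qPoch q (x / z) ≠ 0} := by
  have hP := continuous_qPoch hq
  intro z ⟨hz, h⟩
  have hz2 : z ^ 2 ≠ 0 := pow_ne_zero 2 hz
  simp only [Set.mem_insert_iff, Set.mem_singleton_iff, forall_eq_or_imp, forall_eq] at h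
  refine ContinuousAt.continuousWithinAt (ContinuousAt.div ?_ ?_ (by simp [h]))
  · fun_prop (disch := assumption)
  · fun_prop (disch := assumption)

/-- Since `abcd = s⁻²`, the numerator arguments `x / (s z^{±1})` are `abcd (s x) z^{∓1}`: they match
the Nassrallah-Rahman numerator with `g = s x`. -/
theorem wpSeries_eq_vwpSum {s : ℂ} (hs : s ≠ 0) {a b c d : ℂ} (hb : s ^ 2 * a * b * c * d = 1)
    (x₁ x₂ y₃ y₄ x : ℂ) {z : ℂ} (hz : z ≠ 0) :
    wpSeries q s x₁ x₂ y₃ y₄ x z = vwpSum q (x ^ 2 / q)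
      ![a * b * c * d * (s * x) / z, a * b * c * d * (s * x) * z, x / y₃, x / y₄, x / (x₁ / q),
        x / (x₂ / q)]
      ![s * x * z, s * x / z, y₃ * x, y₄ * x, x₁ / q * x, x₂ / q * x] := by
  have e : a * b * c * d = 1 / s ^ 2 := by
    rw [eq_div_iff (pow_ne_zero 2 hs), ← hb]; ring
  rw [wpSeries, e]
  congr 1
  · funext i
    fin_cases i
    · change x / (s * z) = 1 / s ^ 2 * (s * x) / z
      field_simp
    · change x / (s / z) = 1 / s ^ 2 * (s * x) * z
      field_simp
    all_goals rfl
  · funext i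
    fin_cases i
    · change s * z * x = s * x * z
      ring
    · change s / z * x = s * x / z
      ring
    all_goals rfl

/-- The same relation turns `x / (s t_j)` into the product of the other three parameters and `s x`,
the form in which termwise integration delivers the series. -/
theorem uBase_suParam {s : ℂ} (hb : s ^ 2 * t 1 * t 2 * t 3 * t 4 = 1) (ht : ∀ j, t j ≠ 0)
    (x : ℂ) : uBase q (suParam s t) x = x /
      (qPoch q (t 1 * (s * x)) * qPoch q (t 2 * (s * x)) * qPoch q (t 3 * (s * x)) *
        qPoch q (t 4 * (s * x)) * qPoch q (t 0 / s * x) * qPoch q (t 7 / s * x) *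
        qPoch q (t 5 / s / q * x) * qPoch q (t 6 / s / q * x)) *
      vwpSum q (x ^ 2 / q) ![t 2 * t 3 * t 4 * (s * x), t 1 * t 3 * t 4 * (s * x),
          t 1 * t 2 * t 4 * (s * x), t 1 * t 2 * t 3 * (s * x), x / (t 0 / s), x / (t 7 / s),
          x / (t 5 / s / q), x / (t 6 / s / q)]
        ![t 1 * (s * x), t 2 * (s * x), t 3 * (s * x), t 4 * (s * x), t 0 / s * x, t 7 / s * x,
          t 5 / s / q * x, t 6 / s / q * x] := by
  have hs : s ≠ 0 := by rintro rfl; simp at hb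
  have h1 := ht 1
  have h2 := ht 2
  have h3 := ht 3
  have h4 := ht 4
  have e : ∀ y, s * y * x = y * (s * x) := fun y => by ring
  have f : (fun i => uParam q (suParam s t) i * x) = ![t 1 * (s * x), t 2 * (s * x),
      t 3 * (s * x), t 4 * (s * x), t 0 / s * x, t 7 / s * x, t 5 / s / q * x, t 6 / s / q * x] := by
    funext i
    fin_cases i
    exacts [e _, e _, e _, e _, rfl, rfl, rfl, rfl]
  have g : (fun i => x / uParam q (suParam s t) i) = ![t 2 * t 3 * t 4 * (s * x),
      t 1 * t 3 * t 4 * (s * x), t 1 * t 2 * t 4 * (s * x), t 1 * t 2 * t 3 * (s * x),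
      x / (t 0 / s), x / (t 7 / s), x / (t 5 / s / q), x / (t 6 / s / q)] := by
    funext i
    fin_cases i
    · change x / (s * t 1) = t 2 * t 3 * t 4 * (s * x)
      field_simp
      linear_combination -x * hb
    · change x / (s * t 2) = t 1 * t 3 * t 4 * (s * x)
      field_simp
      linear_combination -x * hb
    · change x / (s * t 3) = t 1 * t 2 * t 4 * (s * x)
      field_simp
      linear_combination -x * hb
    · change x / (s * t 4) = t 1 * t 2 * t 3 * (s * x)
      field_simp
      linear_combination -x * hb
    all_goals rfl
  rw [uBase, f, g]
  have := congrArg (fun F : Fin 8 → ℂ => ∏ i, qPoch q (F i)) f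
  rw [this]
  simp only [Fin.prod_univ_eight, Matrix.cons_val]

set_option maxHeartbeats 1000000 in
/-- The evaluation of the integral `S_t` as a sum of two very-well-poised series. -/
theorem integralS_mul_suFactor (hq0 : q ≠ 0) (hq : ‖q‖ < 1) (ht : t ∈ paramSpace) {s : ℂ}
    (hb : s ^ 2 * t 1 * t 2 * t 3 * t 4 = 1)
    (hgen : ∀ u ∈ wpResonances s (t 5 / s) (t 6 / s) (t 0 / s) (t 7 / s), theta q u ≠ 0)
    (hγ : IsContourS q t γ) :
    integralS q t γ * suFactor q t = uSeries q (suParam s t) := by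
  have h0 := ne_zero_of_mem_paramSpace ht
  have hs : s ≠ 0 := by rintro rfl; simp at hb
  have hE := hγ.enclosesOrbits
  have hL := hE.isLoop
  set x₁ := t 5 / s with hx₁
  set x₂ := t 6 / s with hx₂
  set y₃ := t 0 / s with hy₃
  set y₄ := t 7 / s with hy₄
  have hx1 : x₁ ≠ 0 := div_ne_zero (h0 5) hs
  have hx2 : x₂ ≠ 0 := div_ne_zero (h0 6) hs
  have hy3 : y₃ ≠ 0 := div_ne_zero (h0 0) hs
  have hy4 : y₄ ≠ 0 := div_ne_zero (h0 7) hs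
  have hprod : t 0 * t 1 * t 2 * t 3 * t 4 * t 5 * t 6 * t 7 = 1 := by
    rw [← Fin.prod_univ_eight]; exact ht
  have h1 := h0 1
  have h2 := h0 2
  have h3 := h0 3
  have h4 := h0 4
  -- Dividing the equation of the hypersurface by the relation defining `s`; this is the balancing
  -- condition `hb'` of Bailey's formula.
  have hσ : t 0 * t 7 * t 5 * t 6 = s ^ 2 := by
    have : t 1 * t 2 * t 3 * t 4 ≠ 0 := mul_ne_zero (mul_ne_zero (mul_ne_zero h1 h2) h3) h4
    apply mul_right_cancel₀ this
    linear_combination hprod - hb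
  have hb' : s ^ 2 * (x₁ * x₂ * y₃ * y₄) = 1 := by
    rw [hx₁, hx₂, hy₃, hy₄]
    field_simp
    linear_combination hσ
  have g1 : s * x₁ = t 5 := mul_div_cancel₀ _ hs
  have g2 : s * x₂ = t 6 := mul_div_cancel₀ _ hs
  have g3 : s * y₃ = t 0 := mul_div_cancel₀ _ hs
  have g4 : s * y₄ = t 7 := mul_div_cancel₀ _ hs
  have hth : ∀ u ∈ wpResonances s x₁ x₂ y₃ y₄, u ≠ 0 → ∀ k : ℤ, ∀ v,
      (v = u * q ^ k ∨ v = u⁻¹ * q ^ k) → qPoch q v ≠ 0 := fun u hu hu0 k v hv =>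
    qPoch_ne_zero_of_theta hq0 hq hu0 (hgen u hu) k hv
  have pyx : ∀ x ∈ ({x₁, x₂} : Set ℂ), qPoch q (y₃ * x) ≠ 0 ∧ qPoch q (y₄ * x) ≠ 0 ∧
      qPoch q (x ^ 2 / q) ≠ 0 := by
    rintro x (rfl | rfl)
    · exact ⟨hth (y₃ * x₁) (by simp [wpResonances]) (by simp [*]) 0 _ (by simp),
        hth (y₄ * x₁) (by simp [wpResonances]) (by simp [*]) 0 _ (by simp),
        hth (x₁ ^ 2) (by simp [wpResonances]) (by simp [*]) (-1) _ (by left; field_simp)⟩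
    · exact ⟨hth (y₃ * x₂) (by simp [wpResonances]) (by simp [*]) 0 _ (by simp),
        hth (y₄ * x₂) (by simp [wpResonances]) (by simp [*]) 0 _ (by simp),
        hth (x₂ ^ 2) (by simp [wpResonances]) (by simp [*]) (-1) _ (by left; field_simp)⟩
  have pxx : qPoch q (x₁ * x₂ / q) ≠ 0 :=
    hth (x₁ * x₂) (by simp [wpResonances]) (by simp [*]) (-1) _ (by left; field_simp)
  have pσ : qPoch q (1 / s ^ 2) ≠ 0 := hth (s ^ 2) (by simp [wpResonances]) (by simp [hs]) 0 _
    (by right; simp)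
  have pq := qPoch_self_ne_zero hq
  have pθ : theta q (x₂ / x₁) ≠ 0 := hgen _ (by simp [wpResonances])
  have pyy : qPoch q (1 / (y₃ * y₄)) ≠ 0 := hth (y₃ * y₄) (by simp [wpResonances])
      (by simp [hy3, hy4]) 0 _ (by right; simp)
  have hmem : ∀ x ∈ ({x₁, x₂} : Set ℂ), ∀ y ∈ ({t 1, t 2, t 3, t 4, s * x} : Set ℂ),
      y ∈ {x | ∃ j ∈ Finset.Icc (1 : Fin 8) 6, x = t j} := by
    rintro x hx y (rfl | rfl | rfl | rfl | rfl)
    · exact ⟨1, by decide, rfl⟩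
    · exact ⟨2, by decide, rfl⟩
    · exact ⟨3, by decide, rfl⟩
    · exact ⟨4, by decide, rfl⟩
    · rcases hx with rfl | rfl
      · exact ⟨5, by decide, g1⟩
      · exact ⟨6, by decide, g2⟩
  have hE' : ∀ x ∈ ({x₁, x₂} : Set ℂ), EnclosesOrbits q {t 1, t 2, t 3, t 4, s * x} γ :=
    fun x hx => hE.mono fun y hy => ⟨y, hmem x hx y hy, 0, by simp⟩
  set Φ : ℂ → ℂ → ℂ := fun x z => awWeight q (t 1) (t 2) (t 3) (t 4) z *
    wpSeries q s x₁ x₂ y₃ y₄ x z / (qPoch q (s * x * z) * qPoch q (s * x / z)) / z with hΦ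
  -- Each of the two series is integrated separately. The denominators not depending on `z` are
  -- distributed so that both results carry the same constant in front of `uBase`.
  have hΦint : ∀ x ∈ ({x₁, x₂} : Set ℂ),
      x / (qPoch q (x ^ 2 / q) * qPoch q (y₃ * x) * qPoch q (y₄ * x)) * loopIntegral γ (Φ x) =
        2 * Real.pi * Complex.I * (2 / qPoch q q) * awConst q (t 1) (t 2) (t 3) (t 4) *
          qPoch q (x₁ * x₂ / q) * uBase q (suParam s t) x := by
    intro x hx
    have hx0 : ∀ y ∈ ({t 1, t 2, t 3, t 4, s * x} : Set ℂ), y ≠ 0 := fun y hy => by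
      obtain ⟨j, -, rfl⟩ := hmem x hx y hy
      exact h0 j
    have := loopIntegral_awWeight_mul_vwpSum hq0 hq hx0 (hE' x hx) (x ^ 2 / q) (x / y₃) (x / y₄)
      (x / (x₁ / q)) (x / (x₂ / q)) (y₃ * x) (y₄ * x) (x₁ / q * x) (x₂ / q * x)
    rw [loopIntegral_congr (g := Φ x) fun θ => by
      rw [hΦ]
      simp only
      rw [wpSeries_eq_vwpSum hs hb x₁ x₂ y₃ y₄ x (hE.ne_zero θ)]] at this
    rw [this, uBase_suParam hb h0]
    obtain ⟨p1, p2, p3⟩ := pyx x hx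
    have pE : ∀ j ∈ Finset.Icc (1 : Fin 8) 4, qPoch q (t j * (s * x)) ≠ 0 := fun j hj =>
      (hE' x hx).qPoch_mul_ne_zero hq (by fin_cases j <;> simp at hj ⊢) (by simp)
    have q1 := pE 1 (by decide)
    have q2 := pE 2 (by decide)
    have q3 := pE 3 (by decide)
    have q4 := pE 4 (by decide)
    have e : qPoch q (x₁ / q * x) * qPoch q (x₂ / q * x) =
        qPoch q (x ^ 2 / q) * qPoch q (x₁ * x₂ / q) := by
      rcases hx with rfl | rfl
      · rw [show x₁ / q * x₁ = x₁ ^ 2 / q by ring, show x₂ / q * x₁ = x₁ * x₂ / q by ring]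
      · rw [show x₁ / q * x₂ = x₁ * x₂ / q by ring, show x₂ / q * x₂ = x₂ ^ 2 / q by ring, mul_comm]
    rw [mul_assoc _ (qPoch q (x₁ / q * x)), e]
    generalize vwpSum (ι := Fin 8) q _ _ _ = V
    generalize qPoch q (t 1 * (s * x)) = r1 at *
    generalize qPoch q (t 2 * (s * x)) = r2 at *
    generalize qPoch q (t 3 * (s * x)) = r3 at *
    generalize qPoch q (t 4 * (s * x)) = r4 at *
    generalize qPoch q (y₃ * x) = r5 at *
    generalize qPoch q (y₄ * x) = r6 at *
    generalize qPoch q (x ^ 2 / q) = r7 at *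
    generalize qPoch q (x₁ * x₂ / q) = r8 at *
    generalize awConst q (t 1) (t 2) (t 3) (t 4) = W at *
    generalize 2 * Real.pi * Complex.I * (2 / qPoch q q) = c
    field_simp
  have hΦcont : ∀ x ∈ ({x₁, x₂} : Set ℂ), ∀ c : ℂ,
      ContinuousOn (fun z => c * Φ x z) (Set.range γ) := by
    intro x hx c
    have hz : ∀ z ∈ Set.range γ, z ≠ 0 := by rintro _ ⟨θ, rfl⟩; exact hE.ne_zero θ
    have hP := continuous_qPoch hq
    refine continuousOn_const.mul (ContinuousOn.div (ContinuousOn.div (ContinuousOn.mul ?_ ?_)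
      (ContinuousOn.mul ?_ ?_) ?_) continuousOn_id hz)
    · refine (continuousOn_awWeight hq _ _ _ _).mono ?_
      rintro _ ⟨θ, rfl⟩
      refine ⟨hE.ne_zero θ, fun y hy => ?_⟩
      have hy' : y ∈ ({t 1, t 2, t 3, t 4, s * x} : Set ℂ) := by
        simp only [Set.mem_insert_iff, Set.mem_singleton_iff] at hy ⊢
        tauto
      exact ⟨(hE' x hx).qPoch_mul_apply_ne_zero hq hy' θ,
        (hE' x hx).qPoch_div_apply_ne_zero hq hy' θ⟩
    · exact fun z hz' => (differentiableAt_wpSeries hq hs hq0 hx1 hx2 hy3 hy4 x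
        (hz z hz')).continuousAt.continuousWithinAt
    · exact hP.comp_continuousOn (by fun_prop)
    · exact hP.comp_continuousOn (continuousOn_const.div continuousOn_id hz)
    · rintro _ ⟨θ, rfl⟩
      exact mul_ne_zero ((hE' x hx).qPoch_mul_apply_ne_zero hq (by simp) θ)
        ((hE' x hx).qPoch_div_apply_ne_zero hq (by simp) θ)
  have m1 : x₁ ∈ ({x₁, x₂} : Set ℂ) := by simp
  have m2 : x₂ ∈ ({x₁, x₂} : Set ℂ) := by simp
  obtain ⟨a1, a2, a3⟩ := pyx x₁ m1
  obtain ⟨b1, b2, b3⟩ := pyx x₂ m2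
  -- On the contour, Bailey's formula in `z` identifies the combination of the two series with a
  -- constant multiple of the integrand of S.
  have key := loopIntegral_congr (γ := γ)
    (f := fun z => x₁ / (qPoch q (x₁ ^ 2 / q) * qPoch q (y₃ * x₁) * qPoch q (y₄ * x₁)) * Φ x₁ z -
      x₂ / (qPoch q (x₂ ^ 2 / q) * qPoch q (y₃ * x₂) * qPoch q (y₄ * x₂)) * Φ x₂ z)
    (g := fun z => x₁ * theta q (x₂ / x₁) * qPoch q q * qPoch q (1 / s ^ 2) *
      qPoch q (1 / (y₃ * y₄)) / (qPoch q (y₃ * x₁) * qPoch q (y₄ * x₁) * qPoch q (y₃ * x₂) *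
        qPoch q (y₄ * x₂)) * (integrandS q t z / z)) fun θ => by
      have hz := hE.ne_zero θ
      have n1 := (hE' x₁ m1).qPoch_mul_apply_ne_zero hq (a := s * x₁) (by simp) θ
      have n2 := (hE' x₁ m1).qPoch_div_apply_ne_zero hq (a := s * x₁) (by simp) θ
      have n3 := (hE' x₂ m2).qPoch_mul_apply_ne_zero hq (a := s * x₂) (by simp) θ
      have n4 := (hE' x₂ m2).qPoch_div_apply_ne_zero hq (a := s * x₂) (by simp) θ
      generalize γ θ = z at *
      have hN := wpDifference_eq_wpProduct hq0 hq hb' hgen hz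
      rw [wpDifference, wpProduct, wpDenom, wpDenom, show s * z * x₁ = s * x₁ * z by ring,
        show s * z * x₂ = s * x₂ * z by ring, show s / z * x₁ = s * x₁ / z by ring,
        show s / z * x₂ = s * x₂ / z by ring, g3, g4] at hN
      rw [integrandS_eq_awWeight_mul, hΦ]
      simp only
      rw [← g1, ← g2]
      generalize wpSeries q s x₁ x₂ y₃ y₄ x₁ z = X1 at *
      generalize wpSeries q s x₁ x₂ y₃ y₄ x₂ z = X2 at *
      generalize qPoch q (1 / t 0 / z) * qPoch q (1 / t 7 / z) * qPoch q (1 / t 0 * z) *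
        qPoch q (1 / t 7 * z) = F at *
      generalize qPoch q (s * x₁ * z) = u1 at *
      generalize qPoch q (s * x₁ / z) = u2 at *
      generalize qPoch q (s * x₂ * z) = u3 at *
      generalize qPoch q (s * x₂ / z) = u4 at *
      generalize qPoch q (x₁ ^ 2 / q) = c1 at *
      generalize qPoch q (x₂ ^ 2 / q) = c2 at *
      generalize qPoch q (y₃ * x₁) = c3 at *
      generalize qPoch q (y₄ * x₁) = c4 at *
      generalize qPoch q (y₃ * x₂) = c5 at *
      generalize qPoch q (y₄ * x₂) = c6 at *
      generalize awWeight q (t 1) (t 2) (t 3) (t 4) z = W at *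
      generalize theta q (x₂ / x₁) = d1 at *
      generalize qPoch q q = d2 at *
      generalize qPoch q (1 / s ^ 2) = d3 at *
      generalize qPoch q (1 / (y₃ * y₄)) = d4 at *
      clear_value x₁ x₂
      field_simp
      linear_combination W * hN
  rw [hL.loopIntegral_sub (hΦcont x₁ m1 _) (hΦcont x₂ m2 _) (fun θ => ⟨θ, rfl⟩),
    loopIntegral_const_mul, loopIntegral_const_mul, loopIntegral_const_mul, hΦint x₁ m1,
    hΦint x₂ m2] at key
  rw [integralS, suFactor_eq, uSeries]
  -- The entries 0 and 7 of `suParam s t` are `x₁` and `x₂`. The balancing relation then rewrites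
  -- the arguments in `suFactor` as those produced by Bailey's formula.
  change _ = 2 / (x₁ * qPoch q q ^ 2 * theta q (x₂ / x₁)) *
    (uBase q (suParam s t) x₁ - uBase q (suParam s t) x₂)
  rw [← g1, ← g2, ← g3, ← g4,
    show 1 / (q * (s * y₃) * (s * y₄)) = x₁ * x₂ / q by
      field_simp; linear_combination -hb',
    show 1 / (s * y₃ * (s * x₁)) = y₄ * x₂ by field_simp; linear_combination -hb',
    show 1 / (s * y₃ * (s * x₂)) = y₄ * x₁ by field_simp; linear_combination -hb',
    show 1 / (s * y₄ * (s * x₁)) = y₃ * x₂ by field_simp; linear_combination -hb',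
    show 1 / (s * y₄ * (s * x₂)) = y₃ * x₁ by field_simp; linear_combination -hb',
    show s * x₁ * (s * x₂) = 1 / (y₃ * y₄) by field_simp; linear_combination hb']
  have haw : awConst q (t 1) (t 2) (t 3) (t 4) = qPoch q (1 / s ^ 2) /
      (qPoch q (t 1 * t 2) * qPoch q (t 1 * t 3) * qPoch q (t 1 * t 4) *
    qPoch q (t 2 * t 3) * qPoch q (t 2 * t 4) * qPoch q (t 3 * t 4)) := by
    rw [awConst, show t 1 * t 2 * t 3 * t 4 = 1 / s ^ 2 by
      field_simp; linear_combination hb]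
  have pK : qPoch q (t 1 * t 2) * qPoch q (t 1 * t 3) * qPoch q (t 1 * t 4) *
      qPoch q (t 2 * t 3) * qPoch q (t 2 * t 4) * qPoch q (t 3 * t 4) ≠ 0 := by
    have pE : ∀ i j : Fin 8, t i ∈ ({t 1, t 2, t 3, t 4} : Set ℂ) →
        t j ∈ ({t 1, t 2, t 3, t 4} : Set ℂ) → qPoch q (t i * t j) ≠ 0 := fun i j hi hj => by
      refine (hE' x₁ m1).qPoch_mul_ne_zero hq ?_ ?_
      · simp only [Set.mem_insert_iff, Set.mem_singleton_iff] at hi ⊢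
        tauto
      · simp only [Set.mem_insert_iff, Set.mem_singleton_iff] at hj ⊢
        tauto
    refine mul_ne_zero (mul_ne_zero (mul_ne_zero (mul_ne_zero (mul_ne_zero ?_ ?_) ?_) ?_) ?_) ?_ <;>
      exact pE _ _ (by simp) (by simp)
  rw [haw] at key
  have hpi := Complex.two_pi_I_ne_zero
  generalize uBase q (suParam s t) x₁ = U1 at *
  generalize uBase q (suParam s t) x₂ = U2 at *
  generalize (loopIntegral γ fun z => integrandS q t z / z) = L at *
  generalize 2 * (Real.pi : ℂ) * Complex.I = ω at *
  generalize qPoch q (t 1 * t 2) * qPoch q (t 1 * t 3) * qPoch q (t 1 * t 4) *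
      qPoch q (t 2 * t 3) * qPoch q (t 2 * t 4) * qPoch q (t 3 * t 4) = K at *
  generalize qPoch q (y₃ * x₁) = c3 at *
  generalize qPoch q (y₄ * x₁) = c4 at *
  generalize qPoch q (y₃ * x₂) = c5 at *
  generalize qPoch q (y₄ * x₂) = c6 at *
  generalize theta q (x₂ / x₁) = d1 at *
  generalize qPoch q q = d2 at *
  generalize qPoch q (1 / s ^ 2) = d3 at *
  generalize qPoch q (1 / (y₃ * y₄)) = d4 at *
  generalize qPoch q (x₁ * x₂ / q) = d5 at *
  clear_value x₁ x₂
  clear hgen hth hΦint hΦcont hΦ hE' hmem pyx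
  field_simp at key ⊢
  linear_combination -key

end EvaluationS

/-! ### The elliptic kernel in the integrand for U. -/

section Kernel

variable {q μ a a' : ℂ}

/-- The elliptic function of `z` which has simple poles at `a q^n` and `a' q^n`. -/
def uKernel (q μ a a' z : ℂ) : ℂ :=
  theta q (a * a' / (μ * z)) * theta q (z / μ) / (z * (theta q (a / z) * theta q (a' / z)))

theorem uKernel_comm (q μ a a' z : ℂ) : uKernel q μ a a' z = uKernel q μ a' a z := by
  rw [uKernel, uKernel, mul_comm a a', mul_comm (theta q (a / z))]

theorem theta_div_q_mul (hq0 : q ≠ 0) (hq : ‖q‖ < 1) {c z : ℂ} (hc : c ≠ 0) (hz : z ≠ 0) :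
    theta q (c / (q * z)) = -(c / (q * z)) * theta q (c / z) := by
  have hx : c / (q * z) ≠ 0 := div_ne_zero hc (mul_ne_zero hq0 hz)
  have := theta_q_mul hq0 hq hx
  rw [show q * (c / (q * z)) = c / z by field_simp] at this
  rw [this]
  field_simp

/-- The theta multipliers of numerator and denominator cancel, taking into account the explicit
factor `z`. -/
theorem uKernel_q_mul (hq0 : q ≠ 0) (hq : ‖q‖ < 1) (hμ : μ ≠ 0) (ha : a ≠ 0) (ha' : a' ≠ 0)
    {z : ℂ} (hz : z ≠ 0) : uKernel q μ a a' (q * z) = uKernel q μ a a' z := by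
  have h1 : theta q (a * a' / (μ * (q * z))) =
      -(a * a' / μ / (q * z)) * theta q (a * a' / (μ * z)) := by
    have := theta_div_q_mul hq0 hq (c := a * a' / μ) (div_ne_zero (mul_ne_zero ha ha') hμ) hz
    simp only [div_div] at this ⊢
    exact this
  have h2 : theta q (q * z / μ) = -(z / μ)⁻¹ * theta q (z / μ) := by
    rw [← theta_q_mul hq0 hq (div_ne_zero hz hμ), mul_div_assoc]
  rw [uKernel, uKernel, h1, h2, theta_div_q_mul hq0 hq ha hz, theta_div_q_mul hq0 hq ha' hz]
  by_cases h3 : theta q (a / z) = 0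
  · simp [h3]
  by_cases h4 : theta q (a' / z) = 0
  · simp [h4]
  field_simp

theorem uKernel_mul_pow (hq0 : q ≠ 0) (hq : ‖q‖ < 1) (hμ : μ ≠ 0) (ha : a ≠ 0) (ha' : a' ≠ 0)
    {z : ℂ} (hz : z ≠ 0) (n : ℕ) : uKernel q μ a a' (z * q ^ n) = uKernel q μ a a' z := by
  induction n with
  | zero => simp
  | succ n ih =>
    rw [pow_succ, ← mul_assoc, mul_comm _ q,
      uKernel_q_mul hq0 hq hμ ha ha' (mul_ne_zero hz (pow_ne_zero n hq0)), ih]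

theorem continuousAt_theta (hq : ‖q‖ < 1) {x : ℂ} (hx : x ≠ 0) : ContinuousAt (theta q) x := by
  have hP := continuous_qPoch hq
  unfold theta
  fun_prop (disch := assumption)

/-- Only the factor `1 - a / w` of `θ(a/w)` vanishes at `a`. The auxiliary `μ` enters the residue
through `θ(a/μ) θ(a'/μ)` alone, which the normalization of the integrand removes. -/
theorem tendsto_uKernel (hq : ‖q‖ < 1) (hμ : μ ≠ 0) (ha : a ≠ 0) (ha' : a' ≠ 0)
    (hθ : theta q (a' / a) ≠ 0) :
    Tendsto (fun w => (w - a) * uKernel q μ a a' w) (𝓝[≠] a)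
      (𝓝 (theta q (a / μ) * theta q (a' / μ) / (qPoch q q ^ 2 * theta q (a' / a)))) := by
  have hP := continuous_qPoch hq
  have h1 : ContinuousAt (fun w => theta q (a * a' / (μ * w)) * theta q (w / μ) /
      (qPoch q (q * a / w) * qPoch q (q * w / a) * theta q (a' / w))) a := by
    have c1 : ContinuousAt (fun w => theta q (a * a' / (μ * w))) a :=
      (continuousAt_theta hq (x := a * a' / (μ * a)) (div_ne_zero (mul_ne_zero ha ha')
        (mul_ne_zero hμ ha))).comp (f := fun w => a * a' / (μ * w))
        (ContinuousAt.div (by fun_prop) (by fun_prop) (mul_ne_zero hμ ha))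
    have c2 : ContinuousAt (fun w => theta q (w / μ)) a :=
      (continuousAt_theta hq (x := a / μ) (div_ne_zero ha hμ)).comp (f := fun w => w / μ)
        (by fun_prop)
    have c3 : ContinuousAt (fun w => theta q (a' / w)) a :=
      (continuousAt_theta hq (x := a' / a) (div_ne_zero ha' ha)).comp (f := fun w => a' / w)
        (by fun_prop (disch := assumption))
    refine (c1.mul c2).div (ContinuousAt.mul ?_ c3) ?_
    · fun_prop (disch := assumption)
    · rw [mul_div_cancel_right₀ _ ha]
      exact mul_ne_zero (mul_ne_zero (qPoch_self_ne_zero hq) (qPoch_self_ne_zero hq)) hθ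
  have h2 := h1.tendsto.mono_left (nhdsWithin_le_nhds (s := {a}ᶜ))
  rw [mul_div_cancel_right₀ _ ha, show a * a' / (μ * a) = a' / μ by field_simp,
    show theta q (a' / μ) * theta q (a / μ) / (qPoch q q * qPoch q q * theta q (a' / a)) =
      theta q (a / μ) * theta q (a' / μ) / (qPoch q q ^ 2 * theta q (a' / a)) by ring] at h2
  refine h2.congr' ?_
  have h3 : ∀ᶠ w in 𝓝[≠] a, w ≠ 0 := (eventually_ne_nhds ha).filter_mono nhdsWithin_le_nhds
  filter_upwards [self_mem_nhdsWithin, h3] with w hw hw0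
  have hw' : w - a ≠ 0 := sub_ne_zero.2 hw
  have e : theta q (a / w) = (w - a) / w * (qPoch q (q * a / w) * qPoch q (q * w / a)) := by
    rw [theta, qPoch_div_step hq a hw0, show q / (a / w) = q * w / a by field_simp]
    ring
  rw [uKernel, e]
  generalize qPoch q (q * a / w) * qPoch q (q * w / a) = X
  generalize theta q (a' / w) = Y
  generalize theta q (a * a' / (μ * w)) * theta q (w / μ) = Z
  field_simp

end Kernel

/-! ### The integrand for U as kernel times weight, and its contours. -/

section IntegralU

variable {q μ : ℂ} {τ : Fin 8 → ℂ} {γ : ℝ → ℂ}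

/-- The numerator of the integrand of `U_t`. -/
def uNumerator (q μ : ℂ) (τ : Fin 8 → ℂ) (z : ℂ) : ℂ :=
  2 * ((theta q (τ 0 * τ 7 / (μ * z)) * theta q (z / μ)) /
      (theta q (τ 0 / μ) * theta q (τ 7 / μ))) * (1 - z ^ 2 / q) *
    (qPoch q (z / τ 1) * qPoch q (z / τ 2) * qPoch q (z / τ 3) * qPoch q (z / τ 4) *
      qPoch q (z / τ 5) * qPoch q (z / τ 6)) / z

theorem integrandU_div_eq (q μ : ℂ) (τ : Fin 8 → ℂ) (z : ℂ) :
    integrandU q μ τ z / z = uNumerator q μ τ z /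
      ((∏ i, qPoch q (![τ 0, τ 7] i / z)) * ∏ j, qPoch q (uParam q τ j * z)) := by
  rw [integrandU, uNumerator, prod_Icc_one_six, Fin.prod_univ_two, Fin.prod_univ_eight,
    Finset.prod_pair (by decide)]
  simp only [uParam, Matrix.cons_val, div_eq_mul_inv, mul_inv, one_mul]
  rw [show τ 0 * z * q⁻¹ = τ 0 * q⁻¹ * z by ring, show τ 7 * z * q⁻¹ = τ 7 * q⁻¹ * z by ring]
  ring

theorem differentiableOn_uNumerator (hq : ‖q‖ < 1) (hμ : μ ≠ 0) (h0 : τ 0 ≠ 0) (h7 : τ 7 ≠ 0) :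
    DifferentiableOn ℂ (uNumerator q μ τ) {0}ᶜ := by
  intro z hz
  have hz : z ≠ 0 := hz
  have hP := differentiable_qPoch hq
  have h1 : τ 0 * τ 7 / (μ * z) ≠ 0 := div_ne_zero (mul_ne_zero h0 h7) (mul_ne_zero hμ hz)
  have h2 : z / μ ≠ 0 := div_ne_zero hz hμ
  have h3 : μ * z ≠ 0 := mul_ne_zero hμ hz
  refine DifferentiableAt.differentiableWithinAt ?_
  unfold uNumerator theta
  fun_prop (disch := assumption)

theorem vwpWeight_uParam_div (q : ℂ) (τ : Fin 8 → ℂ) {z : ℂ} (hz : z ≠ 0) :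
    vwpWeight q (uParam q τ) z / z =
      (1 - z ^ 2 / q) * ((∏ i, qPoch q (z / uParam q τ i)) / ∏ i, qPoch q (uParam q τ i * z)) := by
  rw [vwpWeight, mul_assoc, mul_div_cancel_left₀ _ hz]

/-- Multiplying and dividing by `(qz/τ₁, qz/τ₈; q)_∞` completes `(τ₁/z, τ₈/z; q)_∞` to theta
functions. The extra numerators are the ones of the parameters `τ₁/q`, `τ₈/q` in the well-poised
weight. -/
theorem integrandU_div_eq_uKernel_mul {z : ℂ} (hz : z ≠ 0)
    (h1 : theta q (τ 0 / z) ≠ 0) (h2 : theta q (τ 7 / z) ≠ 0) :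
    integrandU q μ τ z / z = 2 / (theta q (τ 0 / μ) * theta q (τ 7 / μ)) *
      uKernel q μ (τ 0) (τ 7) z * (vwpWeight q (uParam q τ) z / z) := by
  rw [integrandU_div_eq, vwpWeight_uParam_div q τ hz, uNumerator, uKernel]
  simp only [Fin.prod_univ_two, Matrix.cons_val]
  rw [Fin.prod_univ_eight (fun i => qPoch q (z / uParam q τ i))]
  simp only [uParam, Matrix.cons_val]
  rw [show z / (τ 0 / q) = q / (τ 0 / z) by rw [div_div_eq_mul_div, div_div_eq_mul_div, mul_comm],
    show z / (τ 7 / q) = q / (τ 7 / z) by rw [div_div_eq_mul_div, div_div_eq_mul_div, mul_comm]]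
  simp only [theta] at h1 h2 ⊢
  obtain ⟨a1, a2⟩ := mul_ne_zero_iff.1 h1
  obtain ⟨b1, b2⟩ := mul_ne_zero_iff.1 h2
  generalize ∏ j, qPoch q (![τ 1, τ 2, τ 3, τ 4, τ 5, τ 6, τ 0 / q, τ 7 / q] j * z) = D
  generalize qPoch q (τ 0 / z) = p1 at *
  generalize qPoch q (q / (τ 0 / z)) = p2 at *
  generalize qPoch q (τ 7 / z) = p3 at *
  generalize qPoch q (q / (τ 7 / z)) = p4 at *
  generalize qPoch q (τ 0 / μ) * qPoch q (q / (τ 0 / μ)) = c1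
  generalize qPoch q (τ 7 / μ) * qPoch q (q / (τ 7 / μ)) = c2
  generalize qPoch q (τ 0 * τ 7 / (μ * z)) * qPoch q (q / (τ 0 * τ 7 / (μ * z))) = c3
  generalize qPoch q (z / μ) * qPoch q (q / (z / μ)) = c4
  generalize qPoch q (z / τ 1) * qPoch q (z / τ 2) * qPoch q (z / τ 3) * qPoch q (z / τ 4) *
      qPoch q (z / τ 5) * qPoch q (z / τ 6) = c5
  generalize (1 - z ^ 2 / q) = c6
  simp only [div_eq_mul_inv, mul_inv]
  generalize D⁻¹ = D'
  generalize c1⁻¹ = c1'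
  generalize c2⁻¹ = c2'
  field_simp

theorem IsContourU.isLoop (h : IsContourU q τ γ) : IsLoop γ := IsSeparatingLoop.isLoop h

theorem IsContourU.ne_zero (h : IsContourU q τ γ) (θ : ℝ) : γ θ ≠ 0 :=
  h.avoids_included 0 (by simp) θ

theorem IsContourU.winding_zero (h : IsContourU q τ γ) : windingNumber γ 0 = 1 :=
  h.winding_included 0 (by simp)

theorem IsContourU.orbit (h : IsContourU q τ γ) (i : Fin 2) (n : ℕ) :
    (∀ θ, γ θ ≠ ![τ 0, τ 7] i * q ^ n) ∧ windingNumber γ (![τ 0, τ 7] i * q ^ n) = 1 := by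
  have : ![τ 0, τ 7] i * q ^ n ∈ {0} ∪
      {z | ∃ j ∈ ({0, 7} : Finset (Fin 8)), ∃ n : ℕ, z = τ j * q ^ n} := by
    refine Or.inr ?_
    fin_cases i
    · exact ⟨0, by decide, n, rfl⟩
    · exact ⟨7, by decide, n, rfl⟩
  exact ⟨h.avoids_included _ this, h.winding_included _ this⟩

theorem IsContourU.inv_orbit (h : IsContourU q τ γ) (j : Fin 8) (n : ℕ) :
    (∀ θ, γ θ ≠ (uParam q τ j * q ^ n)⁻¹) ∧ windingNumber γ (uParam q τ j * q ^ n)⁻¹ = 0 := by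
  have : (uParam q τ j * q ^ n)⁻¹ ∈
      ({z | ∃ j ∈ ({0, 7} : Finset (Fin 8)), ∃ n : ℕ, z = (τ j)⁻¹ * q * (q ^ n)⁻¹} ∪
        {z | ∃ j ∈ Finset.Icc (1 : Fin 8) 6, ∃ n : ℕ, z = (τ j)⁻¹ * (q ^ n)⁻¹}) := by
    have h1 : ∀ i : Fin 8, (τ i / q * q ^ n)⁻¹ = (τ i)⁻¹ * q * (q ^ n)⁻¹ := fun i => by
      rw [mul_inv, inv_div, div_eq_inv_mul]
    have h2 : ∀ i : Fin 8, (τ i * q ^ n)⁻¹ = (τ i)⁻¹ * (q ^ n)⁻¹ := fun i => mul_inv _ _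
    fin_cases j
    · exact Or.inr ⟨1, by decide, n, h2 1⟩
    · exact Or.inr ⟨2, by decide, n, h2 2⟩
    · exact Or.inr ⟨3, by decide, n, h2 3⟩
    · exact Or.inr ⟨4, by decide, n, h2 4⟩
    · exact Or.inr ⟨5, by decide, n, h2 5⟩
    · exact Or.inr ⟨6, by decide, n, h2 6⟩
    · exact Or.inl ⟨0, by decide, n, h1 0⟩
    · exact Or.inl ⟨7, by decide, n, h1 7⟩
  exact ⟨h.avoids_excluded _ this, h.winding_excluded _ this⟩

theorem IsContourU.qPoch_ne_zero (hq : ‖q‖ < 1) (h : IsContourU q τ γ) (i : Fin 2) (j : Fin 8) :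
    qPoch q (uParam q τ j * ![τ 0, τ 7] i) ≠ 0 := by
  refine TrigHyp.qPoch_ne_zero hq fun n hn => ?_
  have h1 := (h.orbit i 0).2
  have h2 : ![τ 0, τ 7] i * q ^ 0 = (uParam q τ j * q ^ n)⁻¹ :=
    eq_inv_of_mul_eq_one_left (by rw [← hn]; ring)
  rw [h2, (h.inv_orbit j n).2] at h1
  exact zero_ne_one h1

end IntegralU

/-! ### Evaluation of the contour integral for U by residues. -/

section ResiduesU

variable {q μ : ℂ} {τ : Fin 8 → ℂ} {γ : ℝ → ℂ}

theorem analyticAt_theta_div (hq : ‖q‖ < 1) {a z : ℂ} (ha : a ≠ 0) (hz : z ≠ 0) :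
    AnalyticAt ℂ (fun z => theta q (a / z)) z :=
  analyticAt_theta hq (analyticAt_const.div analyticAt_id hz) (div_ne_zero ha hz)

theorem eventually_theta_div_ne_zero (hq0 : q ≠ 0) (hq : ‖q‖ < 1) {a z : ℂ} (ha : a ≠ 0)
    (hz : z ≠ 0) : ∀ᶠ w in 𝓝[≠] z, theta q (a / w) ≠ 0 := by
  refine (analyticAt_theta_div hq ha hz).eventually_eq_zero_or_eventually_ne_zero.resolve_left
    fun h => ?_
  have hc : (Set.range fun k : ℤ => a / q ^ k).Countable := Set.countable_range _
  obtain ⟨w, hw, hw', hw0⟩ := ((frequently_notMem_of_countable hc z).and_eventually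
    (h.and (eventually_ne_nhds hz))).exists
  obtain ⟨k, hk⟩ := (theta_eq_zero_iff hq0 hq (div_ne_zero ha hw0)).1 hw'
  exact hw ⟨k, by simp only; rw [← hk]; field_simp⟩

theorem continuousAt_vwpWeight_div (hq : ‖q‖ < 1) (τ : Fin 8 → ℂ) {z : ℂ} (hz : z ≠ 0)
    (h : ∀ i, qPoch q (uParam q τ i * z) ≠ 0) :
    ContinuousAt (fun z => vwpWeight q (uParam q τ) z / z) z := by
  have hP := continuous_qPoch hq
  unfold vwpWeight
  refine ContinuousAt.div (ContinuousAt.mul (by fun_prop) (ContinuousAt.div ?_ ?_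
    (Finset.prod_ne_zero_iff.2 fun i _ => h i))) continuousAt_id hz
  · fun_prop
  · fun_prop

/-- By q-periodicity the kernel near `a q^n` is the kernel near `a` in the variable `z / q^n`. The
resulting factor `q^n` cancels against the division by `z = a q^n`, so the residues are values of
the weight along the orbit. -/
theorem tendsto_residue (hq0 : q ≠ 0) (hq : ‖q‖ < 1) (hμ : μ ≠ 0) {a a' : ℂ} (ha : a ≠ 0)
    (ha' : a' ≠ 0) (h1 : theta q (a / μ) ≠ 0) (h2 : theta q (a' / μ) ≠ 0)
    (hθ : theta q (a' / a) ≠ 0) (n : ℕ) (h : ∀ i, qPoch q (uParam q τ i * a) ≠ 0)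
    {f : ℂ → ℂ} (hf : ∀ z, z ≠ 0 → theta q (a / z) ≠ 0 → theta q (a' / z) ≠ 0 →
      f z = 2 / (theta q (a / μ) * theta q (a' / μ)) * uKernel q μ a a' z *
        (vwpWeight q (uParam q τ) z / z)) :
    Tendsto (fun z => (z - a * q ^ n) * f z) (𝓝[≠] (a * q ^ n))
      (𝓝 (2 / (a * qPoch q q ^ 2 * theta q (a' / a)) *
        vwpWeight q (uParam q τ) (a * q ^ n))) := by
  have hqn : q ^ n ≠ 0 := pow_ne_zero n hq0
  have hz : a * q ^ n ≠ 0 := mul_ne_zero ha hqn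
  have hw : Tendsto (fun z => z / q ^ n) (𝓝[≠] (a * q ^ n)) (𝓝[≠] a) := by
    refine tendsto_nhdsWithin_iff.2 ⟨?_, ?_⟩
    · have : ContinuousAt (fun z : ℂ => z / q ^ n) (a * q ^ n) := by fun_prop
      have := this.tendsto.mono_left (nhdsWithin_le_nhds (s := {a * q ^ n}ᶜ))
      rwa [mul_div_cancel_right₀ _ hqn] at this
    · filter_upwards [self_mem_nhdsWithin] with z hz hz'
      exact hz (by rw [Set.mem_singleton_iff] at *; rw [← hz', div_mul_cancel₀ _ hqn])
  have k1 := (tendsto_uKernel hq hμ ha ha' hθ).comp hw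
  have k2 := (continuousAt_vwpWeight_div hq τ hz fun i => by
    rw [← mul_assoc]; exact qPoch_mul_pow_ne_zero hq (h i) n).tendsto.mono_left
      (nhdsWithin_le_nhds (s := {a * q ^ n}ᶜ))
  have k3 := (k1.mul k2).const_mul (q ^ n * (2 / (theta q (a / μ) * theta q (a' / μ))))
  have e : q ^ n * (2 / (theta q (a / μ) * theta q (a' / μ))) *
      (theta q (a / μ) * theta q (a' / μ) / (qPoch q q ^ 2 * theta q (a' / a)) *
        (vwpWeight q (uParam q τ) (a * q ^ n) / (a * q ^ n))) =
      2 / (a * qPoch q q ^ 2 * theta q (a' / a)) * vwpWeight q (uParam q τ) (a * q ^ n) := by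
    have := qPoch_self_ne_zero hq
    generalize vwpWeight q (uParam q τ) (a * q ^ n) = V
    field_simp
  rw [e] at k3
  refine k3.congr' ?_
  filter_upwards [eventually_theta_div_ne_zero hq0 hq ha hz,
    eventually_theta_div_ne_zero hq0 hq ha' hz,
    (eventually_ne_nhds hz).filter_mono nhdsWithin_le_nhds] with z z1 z2 z3
  have hE : uKernel q μ a a' z = uKernel q μ a a' (z / q ^ n) := by
    have := uKernel_mul_pow hq0 hq hμ ha ha' (div_ne_zero z3 hqn) n
    rwa [div_mul_cancel₀ _ hqn] at this
  rw [hf z z3 z1 z2, hE]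
  simp only [Function.comp_apply]
  generalize vwpWeight q (uParam q τ) z / z = V
  generalize uKernel q μ a a' (z / q ^ n) = E
  field_simp

/-- Countably many norms are to be avoided. Allowing integer exponents makes the choice valid for
all radii `ρ ‖q‖^N` at once. -/
theorem exists_radius (q : ℂ) (a : Fin 2 → ℂ) :
    ∃ ρ : ℝ, 0 < ρ ∧ ∀ i, ∀ k : ℤ, ρ ≠ ‖a i * q ^ k‖ := by
  have hc : (Set.range fun p : Fin 2 × ℤ => ‖a p.1 * q ^ p.2‖).Countable := Set.countable_range _
  obtain ⟨ρ, hρ, hρ'⟩ := (hc.dense_compl ℝ).exists_mem_open (isOpen_Ioi (a := (0 : ℝ)))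
    ⟨1, Set.mem_Ioi.2 one_pos⟩
  exact ⟨ρ, hρ', fun i k h => hρ ⟨(i, k), h.symm⟩⟩

theorem tendsto_loopIntegral_circle_zero {f : ℂ → ℂ} {ρ : ℕ → ℝ} (hρ : ∀ n, 0 < ρ n)
    (h0 : Tendsto ρ atTop (𝓝 0)) {C : ℝ}
    (hC : ∀ᶠ n in atTop, ∀ z, ‖z‖ = ρ n → ‖f z‖ ≤ C) :
    Tendsto (fun n => loopIntegral (circleMap 0 (ρ n)) f) atTop (𝓝 0) := by
  have h1 : Tendsto (fun n => C * ρ n * |2 * Real.pi - 0|) atTop (𝓝 0) := by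
    have := (h0.const_mul C).mul_const |2 * Real.pi - 0|
    simpa using this
  refine squeeze_zero_norm' ?_ h1
  filter_upwards [hC] with n hn
  refine intervalIntegral.norm_integral_le_of_norm_le_const fun θ _ => ?_
  rw [norm_mul, deriv_circleMap, norm_mul, Complex.norm_I, mul_one, norm_circleMap (hρ n).le]
  exact mul_le_mul_of_nonneg_right (hn _ (norm_circleMap (hρ n).le θ)) (hρ n).le

theorem theta_div_ne_zero_of_norm (hq0 : q ≠ 0) (hq : ‖q‖ < 1) {a z : ℂ} (ha : a ≠ 0) (hz : z ≠ 0)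
    (h : ∀ k : ℤ, ‖z‖ ≠ ‖a * q ^ k‖) : theta q (a / z) ≠ 0 := by
  rw [ne_eq, theta_eq_zero_iff hq0 hq (div_ne_zero ha hz)]
  rintro ⟨k, hk⟩
  refine h (-k) ?_
  rw [zpow_neg, ← hk]
  congr 1
  field_simp

/-- The kernel is q-periodic, so its bound on one circle free of poles holds on all the scaled
circles. The weight divided by `z` is continuous at 0. -/
theorem exists_bound_integrandU (hq0 : q ≠ 0) (hq : ‖q‖ < 1) (hμ : μ ≠ 0) (h0 : τ 0 ≠ 0)
    (h7 : τ 7 ≠ 0) {ρ : ℝ} (hρ : 0 < ρ)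
    (hρ' : ∀ i : Fin 2, ∀ k : ℤ, ρ ≠ ‖![τ 0, τ 7] i * q ^ k‖) :
    ∃ C, ∀ᶠ N : ℕ in atTop, ∀ z, ‖z‖ = ρ * ‖q‖ ^ N → ‖integrandU q μ τ z / z‖ ≤ C := by
  have hP := continuous_qPoch hq
  have hq' : 0 < ‖q‖ := norm_pos_iff.2 hq0
  have hsphere : ∀ w ∈ Metric.sphere (0 : ℂ) ρ, w ≠ 0 ∧ theta q (τ 0 / w) ≠ 0 ∧
      theta q (τ 7 / w) ≠ 0 := fun w hw => by
    have hw' : ‖w‖ = ρ := by simpa using hw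
    have hw0 : w ≠ 0 := norm_pos_iff.1 (by rw [hw']; exact hρ)
    exact ⟨hw0, theta_div_ne_zero_of_norm hq0 hq h0 hw0 (by rw [hw']; exact hρ' 0),
      theta_div_ne_zero_of_norm hq0 hq h7 hw0 (by rw [hw']; exact hρ' 1)⟩
  obtain ⟨C₁, hC₁⟩ := (isCompact_sphere (0 : ℂ) ρ).exists_bound_of_continuousOn
    (f := uKernel q μ (τ 0) (τ 7)) fun w hw => by
      obtain ⟨w0, w1, w2⟩ := hsphere w hw
      have c1 : ContinuousAt (fun w => theta q (τ 0 * τ 7 / (μ * w))) w :=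
        (continuousAt_theta hq (x := τ 0 * τ 7 / (μ * w)) (div_ne_zero (mul_ne_zero h0 h7)
          (mul_ne_zero hμ w0))).comp (f := fun w => τ 0 * τ 7 / (μ * w))
          (ContinuousAt.div (by fun_prop) (by fun_prop) (mul_ne_zero hμ w0))
      have c2 : ContinuousAt (fun w => theta q (w / μ)) w :=
        (continuousAt_theta hq (x := w / μ) (div_ne_zero w0 hμ)).comp (f := fun w => w / μ)
          (by fun_prop)
      exact ((c1.mul c2).div (continuousAt_id.mul ((analyticAt_theta_div hq h0 w0).continuousAt.mul
        (analyticAt_theta_div hq h7 w0).continuousAt))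
        (mul_ne_zero w0 (mul_ne_zero w1 w2))).continuousWithinAt
  have hc : ContinuousAt (fun z : ℂ => (1 - z ^ 2 / q) *
      ((∏ i, qPoch q (z / uParam q τ i)) / ∏ i, qPoch q (uParam q τ i * z))) 0 := by
    refine ContinuousAt.mul (by fun_prop) (ContinuousAt.div ?_ ?_ (by simp))
    · fun_prop
    · fun_prop
  set G := fun z : ℂ => (1 - z ^ 2 / q) *
      ((∏ i, qPoch q (z / uParam q τ i)) / ∏ i, qPoch q (uParam q τ i * z)) with hG
  obtain ⟨ε, hε, hC₂⟩ := Metric.eventually_nhds_iff.1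
    (hc.norm.eventually_lt (continuousAt_const (y := ‖G 0‖ + 1)) (lt_add_one _))
  have hlim : Tendsto (fun N : ℕ => ρ * ‖q‖ ^ N) atTop (𝓝 0) := by
    simpa using (tendsto_pow_atTop_nhds_zero_of_lt_one (norm_nonneg _) hq).const_mul ρ
  refine ⟨‖2 / (theta q (τ 0 / μ) * theta q (τ 7 / μ))‖ * C₁ * (‖G 0‖ + 1), ?_⟩
  filter_upwards [hlim.eventually_lt_const hε] with N hN z hz
  have hqN : q ^ N ≠ 0 := pow_ne_zero N hq0
  have hz0 : z ≠ 0 := norm_pos_iff.1 (by rw [hz]; positivity)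
  have hw : z / q ^ N ∈ Metric.sphere (0 : ℂ) ρ := by
    rw [mem_sphere_zero_iff_norm, norm_div, norm_pow, hz]
    field_simp
  have hnz : ∀ i : Fin 2, ∀ k : ℤ, ‖z‖ ≠ ‖![τ 0, τ 7] i * q ^ k‖ := fun i k h => by
    refine hρ' i (k - N) ?_
    rw [zpow_sub₀ hq0, zpow_natCast, ← mul_div_assoc, norm_div, ← h, hz, norm_pow]
    field_simp
  have hE : uKernel q μ (τ 0) (τ 7) z = uKernel q μ (τ 0) (τ 7) (z / q ^ N) := by
    have := uKernel_mul_pow hq0 hq hμ h0 h7 (div_ne_zero hz0 hqN) N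
    rwa [div_mul_cancel₀ _ hqN] at this
  rw [integrandU_div_eq_uKernel_mul hz0 (theta_div_ne_zero_of_norm hq0 hq h0 hz0 (hnz 0))
    (theta_div_ne_zero_of_norm hq0 hq h7 hz0 (hnz 1)), norm_mul, norm_mul, hE,
    vwpWeight_uParam_div q τ hz0]
  have h1 := hC₁ _ hw
  have h2 : ‖G z‖ < ‖G 0‖ + 1 := hC₂ (by rw [dist_zero_right, hz]; exact hN)
  have : 0 ≤ C₁ := (norm_nonneg _).trans h1
  gcongr

/-- The evaluation of the integral `U_t` as a sum of two very-well-poised series. -/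
theorem integralU_eq_uSeries (hq0 : q ≠ 0) (hq : ‖q‖ < 1) (hτ : ∀ j, τ j ≠ 0) (hμ : μ ≠ 0)
    (h1 : theta q (τ 0 / μ) ≠ 0) (h2 : theta q (τ 7 / μ) ≠ 0) (hθ : theta q (τ 7 / τ 0) ≠ 0)
    (hγ : IsContourU q τ γ) : integralU q μ τ γ = uSeries q τ := by
  have h0 := hτ 0
  have h7 := hτ 7
  have hq' : 0 < ‖q‖ := norm_pos_iff.2 hq0
  have hL := hγ.isLoop
  have hy : ∀ i, uParam q τ i ≠ 0 := fun i => by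
    fin_cases i
    exacts [hτ 1, hτ 2, hτ 3, hτ 4, hτ 5, hτ 6, div_ne_zero (hτ 0) hq0, div_ne_zero (hτ 7) hq0]
  have hP0 : ∀ i, qPoch q (uParam q τ i * τ 0) ≠ 0 := hγ.qPoch_ne_zero hq 0
  have hP7 : ∀ i, qPoch q (uParam q τ i * τ 7) ≠ 0 := hγ.qPoch_ne_zero hq 1
  have hθ' : theta q (τ 0 / τ 7) = -(τ 0 / τ 7) * theta q (τ 7 / τ 0) := by
    have := theta_inv hq (x := τ 7 / τ 0) (div_ne_zero h7 h0)
    rwa [inv_div] at this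
  have hθ7 : theta q (τ 0 / τ 7) ≠ 0 := by
    rw [hθ']
    exact mul_ne_zero (neg_ne_zero.2 (div_ne_zero h0 h7)) hθ
  -- By the inversion formula for theta, the corresponding constant for the orbit of `τ 7` is `-K`;
  -- this is the origin of the minus sign in `uSeries`.
  set K := 2 / (τ 0 * qPoch q q ^ 2 * theta q (τ 7 / τ 0)) with hK
  set res : Fin 2 → ℕ → ℂ := fun i n =>
    ![K, -K] i * vwpWeight q (uParam q τ) (![τ 0, τ 7] i * q ^ n) with hres
  have hlim_res : ∀ i n, Tendsto (fun z => (z - ![τ 0, τ 7] i * q ^ n) * (integrandU q μ τ z / z))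
      (𝓝[≠] (![τ 0, τ 7] i * q ^ n)) (𝓝 (res i n)) := by
    intro i n
    fin_cases i
    · exact tendsto_residue hq0 hq hμ h0 h7 h1 h2 hθ n hP0 fun z hz z1 z2 =>
        integrandU_div_eq_uKernel_mul hz z1 z2
    · have := tendsto_residue hq0 hq hμ h7 h0 h2 h1 hθ7 n hP7
        (f := fun z => integrandU q μ τ z / z) fun z hz z1 z2 => by
          rw [uKernel_comm, mul_comm (theta q (τ 7 / μ))]
          exact integrandU_div_eq_uKernel_mul hz z2 z1
      rw [show 2 / (τ 7 * qPoch q q ^ 2 * theta q (τ 0 / τ 7)) = -K by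
        rw [hθ', hK]
        have := qPoch_self_ne_zero hq
        field_simp] at this
      exact this
  have hsum : ∀ i, HasSum (res i) (![K, -K] i * uBase q τ (![τ 0, τ 7] i)) := by
    intro i
    refine (hasSum_vwpWeight hq (y := uParam q τ) (x := ![τ 0, τ 7] i) ?_).mul_left _
    fin_cases i
    exacts [hP0, hP7]
  obtain ⟨ρ₀, hρ₀, hρ₀'⟩ := exists_radius q ![τ 0, τ 7]
  set ρ : ℕ → ℝ := fun N => ρ₀ * ‖q‖ ^ N with hρdef
  have hρ : ∀ N, 0 < ρ N := fun N => by positivity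
  have hρlim : Tendsto ρ atTop (𝓝 0) := by
    simpa using (tendsto_pow_atTop_nhds_zero_of_lt_one (norm_nonneg _) hq).const_mul ρ₀
  obtain ⟨C, hC⟩ := exists_bound_integrandU (μ := μ) hq0 hq hμ h0 h7 hρ₀ hρ₀'
  have hcirc := tendsto_loopIntegral_circle_zero hρ hρlim hC
  obtain ⟨r, R, hr, hrγ⟩ := hL.exists_bounds hγ.ne_zero
  have hinj : Function.Injective fun p : Fin 2 × ℕ => ![τ 0, τ 7] p.1 * q ^ p.2 := by
    have hcross : ∀ m n : ℕ, τ 0 * q ^ m ≠ τ 7 * q ^ n := fun m n h => by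
      rw [ne_eq, theta_eq_zero_iff hq0 hq (div_ne_zero h7 h0)] at hθ
      refine hθ ⟨m - n, ?_⟩
      rw [zpow_sub₀ hq0, zpow_natCast, zpow_natCast, div_eq_div_iff h0 (pow_ne_zero n hq0), ← h,
        mul_comm]
    have hpow : ∀ a : ℂ, a ≠ 0 → ∀ m n : ℕ, a * q ^ m = a * q ^ n → m = n := fun a ha m n h => by
      have := congrArg norm (mul_left_cancel₀ ha h)
      rw [norm_pow, norm_pow] at this
      exact (pow_right_injective₀ hq' hq.ne) this
    rintro ⟨i, m⟩ ⟨j, n⟩ h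
    fin_cases i <;> fin_cases j
    · have := hpow _ h0 m n h
      simp [this]
    · exact absurd h (hcross m n)
    · exact absurd h.symm (hcross n m)
    · have := hpow _ h7 m n h
      simp [this]
  -- For large `N` the circle lies inside the curve and away from all excluded poles, so deforming
  -- the contour onto it collects the residues outside the circle.
  have hid : ∀ᶠ N in atTop, loopIntegral γ (fun z => integrandU q μ τ z / z) -
      loopIntegral (circleMap 0 (ρ N)) (fun z => integrandU q μ τ z / z) =
      2 * Real.pi * Complex.I * ∑ i, ∑' n : ℕ,
        if ρ N < ‖![τ 0, τ 7] i * q ^ n‖ then res i n else 0 := by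
    have e1 : ∀ᶠ N in atTop, ∀ j, ρ N * ‖uParam q τ j‖ < 1 := eventually_all.2 fun j => by
      have := hρlim.mul_const ‖uParam q τ j‖
      rw [zero_mul] at this
      exact this.eventually_lt_const one_pos
    filter_upwards [e1, hρlim.eventually_lt_const hr] with N hN1 hN2
    refine loopIntegral_sub_circle_eq hq0 hq hy (differentiableOn_uNumerator hq hμ h0 h7)
      (integrandU_div_eq q μ τ) hL hγ.ne_zero hγ.winding_zero (fun i n => (hγ.orbit i n).1)
      (fun i n => (hγ.orbit i n).2) (fun j n => (hγ.inv_orbit j n).1)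
      (fun j n => (hγ.inv_orbit j n).2) (hρ N) (fun θ => hN2.trans (hrγ θ).1) (fun i n h => ?_)
      (fun j n => ?_) hinj res hlim_res
    · refine hρ₀' i (n - N) ?_
      rw [zpow_sub₀ hq0, zpow_natCast, zpow_natCast, ← mul_div_assoc, norm_div, h, norm_pow]
      simp only [hρdef]
      field_simp
    · rw [norm_inv, lt_inv_comm₀ (hρ N) (norm_pos_iff.2 (mul_ne_zero (hy j) (pow_ne_zero n hq0))),
        ← one_div, lt_div_iff₀ (hρ N), norm_mul, norm_pow]
      have : ‖q‖ ^ n ≤ 1 := pow_le_one₀ (norm_nonneg _) hq.le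
      have h3 := hN1 j
      have h4 : ‖uParam q τ j‖ * ‖q‖ ^ n ≤ ‖uParam q τ j‖ :=
        mul_le_of_le_one_right (norm_nonneg _) this
      nlinarith [hρ N]
  -- As the circles shrink the truncated sums exhaust the summable residues; dominated convergence
  -- gives the limit.
  have hsumlim : Tendsto (fun N => ∑ i, ∑' n : ℕ,
      if ρ N < ‖![τ 0, τ 7] i * q ^ n‖ then res i n else 0) atTop
      (𝓝 (∑ i, ![K, -K] i * uBase q τ (![τ 0, τ 7] i))) := by
    refine tendsto_finsetSum _ fun i _ => ?_
    rw [← (hsum i).tsum_eq]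
    refine tendsto_tsum_of_dominated_convergence (bound := fun n => ‖res i n‖)
      (hsum i).summable.norm (fun n => ?_) (Eventually.of_forall fun N n => ?_)
    · have hne : ![τ 0, τ 7] i * q ^ n ≠ 0 := mul_ne_zero (by
        fin_cases i
        exacts [h0, h7]) (pow_ne_zero n hq0)
      refine tendsto_const_nhds.congr' ?_
      filter_upwards [hρlim.eventually_lt_const (norm_pos_iff.2 hne)] with N hN
      rw [if_pos hN]
    · split_ifs
      · exact le_rfl
      · simp
  have hfin := tendsto_nhds_unique (((tendsto_const_nhds
    (x := loopIntegral γ fun z => integrandU q μ τ z / z)).sub hcirc).congr' hid)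
    (hsumlim.const_mul (2 * (Real.pi : ℂ) * Complex.I))
  rw [sub_zero, Fin.sum_univ_two] at hfin
  have hpi := Complex.two_pi_I_ne_zero
  rw [integralU, hfin, inv_mul_cancel_left₀ hpi, uSeries]
  simp only [Matrix.cons_val]
  rw [← hK]
  ring

end ResiduesU

/-! ### Stability of winding numbers under perturbation of q-orbits. -/

section WindingStability

variable {q : ℂ} {γ : ℝ → ℂ}

/-- Expand `(z - p')⁻¹` in powers of `(p' - p) / (z - p)`: all terms but the first are higher poles
and integrate to 0. The powers of 2 put the geometric ratio 1/2 in evidence for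
`hasSum_loopIntegral`. -/
theorem IsLoop.windingNumber_eq_of_norm_sub_le (h : IsLoop γ) {p p' : ℂ} (hp : ∀ θ, γ θ ≠ p)
    (hp' : ∀ θ, 2 * ‖p' - p‖ ≤ ‖γ θ - p‖) : windingNumber γ p' = windingNumber γ p := by
  have hne : ∀ z ∈ Set.range γ, z - p ≠ 0 := by
    rintro _ ⟨θ, rfl⟩
    exact sub_ne_zero.2 (hp θ)
  have hcont : ContinuousOn (fun z => (z - p)⁻¹) (Set.range γ) :=
    ContinuousOn.inv₀ (by fun_prop) hne
  obtain ⟨C, hC⟩ := h.isCompact_range.exists_bound_of_continuousOn hcont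
  set F : ℕ → ℂ → ℂ := fun n z => (2 * (p' - p) * (z - p)⁻¹) ^ n * (z - p)⁻¹ with hF
  have hle : ∀ θ, ‖2 * (p' - p) * (γ θ - p)⁻¹‖ ≤ 1 := fun θ => by
    rw [norm_mul, norm_mul, norm_inv, Complex.norm_two, ← div_eq_mul_inv]
    exact div_le_one_of_le₀ (hp' θ) (norm_nonneg _)
  have hsum := h.hasSum_loopIntegral (q := 1 / 2) (by norm_num) (c := fun _ => 1) (C₁ := 1)
    (by simp) (F := F) (fun n => ((continuousOn_const.mul hcont).pow n).mul hcont) (C₂ := C)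
    (fun n θ => by
      rw [hF, norm_mul, norm_pow]
      calc _ ≤ 1 * ‖(γ θ - p)⁻¹‖ := mul_le_mul_of_nonneg_right
            (pow_le_one₀ (norm_nonneg _) (hle θ)) (norm_nonneg _)
        _ ≤ C := by rw [one_mul]; exact hC _ ⟨θ, rfl⟩)
    (f := fun z => (z - p')⁻¹) (fun θ => by
      have hθ := hne _ ⟨θ, rfl⟩
      have hr : ‖(p' - p) * (γ θ - p)⁻¹‖ < 1 := by
        have := hle θ
        rw [mul_assoc, norm_mul, Complex.norm_two] at this
        linarith
      have := (hasSum_geometric_of_norm_lt_one hr).mul_right (γ θ - p)⁻¹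
      have e : (1 - (p' - p) * (γ θ - p)⁻¹)⁻¹ * (γ θ - p)⁻¹ = (γ θ - p')⁻¹ := by
        rw [← mul_inv, sub_mul, mul_assoc, inv_mul_cancel₀ hθ]
        congr 1
        ring
      rw [e] at this
      refine (congrArg (HasSum · _) (funext fun n => ?_)).mpr this
      have h2 : (1 / 2 : ℂ) ^ n * 2 ^ n = 1 := by rw [← mul_pow]; norm_num
      simp only [hF, mul_pow]
      linear_combination ((p' - p) ^ n * ((γ θ - p)⁻¹) ^ n * (γ θ - p)⁻¹) * h2)
  have hzero : ∀ n ≠ 0, (1 / 2 : ℂ) ^ n * 1 * loopIntegral γ (F n) = 0 := fun n hn => by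
    rw [loopIntegral_congr (g := fun z => (2 * (p' - p)) ^ n * ((z - p) ^ (n + 1))⁻¹) fun θ => by
      simp only [hF, mul_pow, inv_pow, pow_succ, mul_inv]; ring,
      loopIntegral_const_mul, h.loopIntegral_sub_pow_inv hp (by omega)]
    simp
  have := hsum.unique (hasSum_single 0 hzero)
  rw [windingNumber, windingNumber, this]
  simp [hF]

/-- Expand `(z - p)⁻¹` in powers of `z / p`: every term is a monomial and has a primitive. -/
theorem IsLoop.windingNumber_eq_zero_of_norm_le (h : IsLoop γ) {p : ℂ} (hp : p ≠ 0)
    (hp' : ∀ θ, 2 * ‖γ θ‖ ≤ ‖p‖) : windingNumber γ p = 0 := by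
  set F : ℕ → ℂ → ℂ := fun n z => -(2 * p⁻¹ * z) ^ n * p⁻¹ with hF
  have hle : ∀ θ, ‖2 * p⁻¹ * γ θ‖ ≤ 1 := fun θ => by
    rw [mul_right_comm, norm_mul, norm_mul, norm_inv, Complex.norm_two, ← div_eq_mul_inv]
    exact div_le_one_of_le₀ (hp' θ) (norm_nonneg _)
  have hsum := h.hasSum_loopIntegral (q := 1 / 2) (by norm_num) (c := fun _ => 1) (C₁ := 1)
    (by simp) (F := F) (fun n => by fun_prop) (C₂ := ‖p⁻¹‖)
    (fun n θ => by
      rw [hF, norm_mul, norm_neg, norm_pow]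
      exact mul_le_of_le_one_left (norm_nonneg _) (pow_le_one₀ (norm_nonneg _) (hle θ)))
    (f := fun z => (z - p)⁻¹) (fun θ => by
      have hr : ‖p⁻¹ * γ θ‖ < 1 := by
        have := hle θ
        rw [mul_assoc, norm_mul, Complex.norm_two] at this
        linarith
      have := ((hasSum_geometric_of_norm_lt_one hr).mul_right p⁻¹).neg
      have e : -((1 - p⁻¹ * γ θ)⁻¹ * p⁻¹) = (γ θ - p)⁻¹ := by
        rw [← mul_inv, ← inv_neg, sub_mul, mul_right_comm, inv_mul_cancel₀ hp]
        congr 1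
        ring
      rw [e] at this
      refine (congrArg (HasSum · _) (funext fun n => ?_)).mpr this
      have h2 : (1 / 2 : ℂ) ^ n * 2 ^ n = 1 := by rw [← mul_pow]; norm_num
      simp only [hF, mul_pow]
      linear_combination (-(p⁻¹ ^ n * γ θ ^ n * p⁻¹)) * h2)
  have hzero : ∀ n, (1 / 2 : ℂ) ^ n * 1 * loopIntegral γ (F n) = 0 := fun n => by
    rw [h.loopIntegral_eq_zero_of_hasDerivAt (F := fun z =>
      -((2 * p⁻¹) ^ n * p⁻¹ / (n + 1)) * z ^ (n + 1)) (s := Set.univ)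
      (by fun_prop) (by simp) (fun z _ => ?_), mul_zero]
    refine ((hasDerivAt_pow (n + 1) z).const_mul _).congr_deriv ?_
    have : (n : ℂ) + 1 ≠ 0 := Nat.cast_add_one_ne_zero n
    simp only [hF, mul_pow, Nat.add_sub_cancel]
    push_cast
    field_simp
  simp only [hzero] at hsum
  rw [windingNumber, hsum.unique hasSum_zero, mul_zero]

theorem IsLoop.eventually_windingNumber_eq (h : IsLoop γ) {p : ℂ} (hp : ∀ θ, γ θ ≠ p) :
    ∀ᶠ p' in 𝓝 p, (∀ θ, γ θ ≠ p') ∧ windingNumber γ p' = windingNumber γ p := by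
  obtain ⟨δ, hδ, hδ'⟩ : ∃ δ > 0, ∀ θ, δ ≤ ‖γ θ - p‖ := by
    obtain ⟨z, ⟨θ₀, rfl⟩, hz⟩ := h.isCompact_range.exists_isMinOn ⟨_, 0, rfl⟩
      (f := fun z => ‖z - p‖) (by fun_prop)
    exact ⟨_, norm_pos_iff.2 (sub_ne_zero.2 (hp θ₀)), fun θ => hz ⟨θ, rfl⟩⟩
  filter_upwards [Metric.ball_mem_nhds p (half_pos hδ)] with p' hp'
  rw [mem_ball_iff_norm] at hp'
  refine ⟨fun θ h' => ?_, h.windingNumber_eq_of_norm_sub_le hp fun θ => ?_⟩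
  · have := hδ' θ
    rw [h'] at this
    linarith
  · have := hδ' θ
    linarith

/-- Finitely many orbit points are moved individually. The others lie so close to 0, uniformly in
the perturbation, that their winding number is that of the origin. -/
theorem IsLoop.eventually_orbit (h : IsLoop γ) (hq : ‖q‖ < 1) (h0 : ∀ θ, γ θ ≠ 0) {a : ℂ}
    (ha : ∀ (n : ℕ) θ, γ θ ≠ a * q ^ n) :
    ∀ᶠ a' in 𝓝 a, ∀ n : ℕ, (∀ θ, γ θ ≠ a' * q ^ n) ∧
      (windingNumber γ (a' * q ^ n) = windingNumber γ (a * q ^ n) ∨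
        windingNumber γ (a' * q ^ n) = windingNumber γ 0) := by
  obtain ⟨r, R, hr, hrγ⟩ := h.exists_bounds h0
  have hlim : Tendsto (fun n : ℕ => 2 * ((‖a‖ + 1) * ‖q‖ ^ n)) atTop (𝓝 0) := by
    simpa using ((tendsto_pow_atTop_nhds_zero_of_lt_one (norm_nonneg _) hq).const_mul
      (‖a‖ + 1)).const_mul 2
  obtain ⟨K, hK⟩ := eventually_atTop.1 (hlim.eventually_lt_const hr)
  have h1 : ∀ᶠ a' in 𝓝 a, ∀ n ∈ Finset.range K, (∀ θ, γ θ ≠ a' * q ^ n) ∧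
      windingNumber γ (a' * q ^ n) = windingNumber γ (a * q ^ n) := by
    refine (Finset.range K).eventually_all.2 fun n _ => ?_
    have : ContinuousAt (fun a' : ℂ => a' * q ^ n) a := by fun_prop
    exact this.tendsto.eventually (h.eventually_windingNumber_eq (ha n))
  have h2 : ∀ᶠ a' in 𝓝 a, ‖a'‖ < ‖a‖ + 1 :=
    continuous_norm.continuousAt.eventually_lt continuousAt_const (lt_add_one _)
  filter_upwards [h1, h2] with a' h1 h2 n
  by_cases hn : n < K
  · exact ⟨(h1 n (Finset.mem_range.2 hn)).1, Or.inl (h1 n (Finset.mem_range.2 hn)).2⟩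
  · have h3 := hK n (not_lt.1 hn)
    have h4 : ‖a' * q ^ n‖ ≤ (‖a‖ + 1) * ‖q‖ ^ n := by
      rw [norm_mul, norm_pow]
      gcongr
    refine ⟨fun θ h' => ?_, Or.inr (h.windingNumber_eq_of_norm_sub_le h0 fun θ => ?_)⟩
    · have := (hrγ θ).1
      rw [h'] at this
      have : 0 ≤ ‖a' * q ^ n‖ := norm_nonneg _
      linarith
    · have := (hrγ θ).1
      rw [sub_zero, sub_zero]
      linarith

/-- The same argument with the tail of the reciprocal orbit far outside the curve. -/
theorem IsLoop.eventually_inv_orbit (h : IsLoop γ) (hq0 : q ≠ 0) (hq : ‖q‖ < 1)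
    (h0 : ∀ θ, γ θ ≠ 0) {b : ℂ} (hb : b ≠ 0) (hb' : ∀ (n : ℕ) θ, γ θ ≠ (b * q ^ n)⁻¹)
    (hw : ∀ n : ℕ, windingNumber γ (b * q ^ n)⁻¹ = 0) :
    ∀ᶠ b' in 𝓝 b, ∀ n : ℕ, (∀ θ, γ θ ≠ (b' * q ^ n)⁻¹) ∧
      windingNumber γ (b' * q ^ n)⁻¹ = 0 := by
  obtain ⟨r, R, hr, hrγ⟩ := h.exists_bounds h0
  have hR : 0 < R := hr.trans ((hrγ 0).1.trans (hrγ 0).2)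
  have hlim : Tendsto (fun n : ℕ => 2 * R * ((‖b‖ + 1) * ‖q‖ ^ n)) atTop (𝓝 0) := by
    simpa using ((tendsto_pow_atTop_nhds_zero_of_lt_one (norm_nonneg _) hq).const_mul
      (‖b‖ + 1)).const_mul (2 * R)
  obtain ⟨K, hK⟩ := eventually_atTop.1 (hlim.eventually_lt_const one_pos)
  have h1 : ∀ᶠ b' in 𝓝 b, ∀ n ∈ Finset.range K, (∀ θ, γ θ ≠ (b' * q ^ n)⁻¹) ∧
      windingNumber γ (b' * q ^ n)⁻¹ = windingNumber γ (b * q ^ n)⁻¹ := by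
    refine (Finset.range K).eventually_all.2 fun n _ => ?_
    have : ContinuousAt (fun b' : ℂ => (b' * q ^ n)⁻¹) b :=
      ContinuousAt.inv₀ (by fun_prop) (mul_ne_zero hb (pow_ne_zero n hq0))
    exact this.tendsto.eventually (h.eventually_windingNumber_eq (hb' n))
  have h2 : ∀ᶠ b' in 𝓝 b, ‖b'‖ < ‖b‖ + 1 :=
    continuous_norm.continuousAt.eventually_lt continuousAt_const (lt_add_one _)
  filter_upwards [h1, h2, eventually_ne_nhds hb] with b' h1 h2 h3 n
  by_cases hn : n < K
  · exact ⟨(h1 n (Finset.mem_range.2 hn)).1, by rw [(h1 n (Finset.mem_range.2 hn)).2, hw]⟩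
  · have hne : b' * q ^ n ≠ 0 := mul_ne_zero h3 (pow_ne_zero n hq0)
    have h4 : 2 * R * ‖b' * q ^ n‖ < 1 := by
      refine lt_of_le_of_lt ?_ (hK n (not_lt.1 hn))
      rw [norm_mul, norm_pow]
      gcongr
    have h5 : 2 * R < ‖(b' * q ^ n)⁻¹‖ := by
      rw [norm_inv, ← one_div, lt_div_iff₀ (norm_pos_iff.2 hne)]
      exact h4
    refine ⟨fun θ h' => ?_, h.windingNumber_eq_zero_of_norm_le (inv_ne_zero hne) fun θ => ?_⟩
    · have := (hrγ θ).2
      rw [h'] at this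
      linarith
    · have := (hrγ θ).2
      linarith


end WindingStability

/-! ### Independence of the contour and of μ at every parameter. -/

section Independence

variable {q : ℂ}

theorem integralS_eq_integralS (hq0 : q ≠ 0) (hq : ‖q‖ < 1) {t : Fin 8 → ℂ} (ht : t ∈ paramSpace)
    {γ₁ γ₂ : ℝ → ℂ} (h₁ : IsContourS q t γ₁) (h₂ : IsContourS q t γ₂) :
    integralS q t γ₁ = integralS q t γ₂ := by
  have e₁ := h₁.enclosesOrbits
  have e₂ := h₂.enclosesOrbits
  set a : Fin 6 → ℂ := ![t 1, t 2, t 3, t 4, t 5, t 6] with ha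
  have hmem : ∀ i, a i ∈ {x | ∃ j ∈ Finset.Icc (1 : Fin 8) 6, x = t j} := fun i => by
    fin_cases i
    exacts [⟨1, by decide, rfl⟩, ⟨2, by decide, rfl⟩, ⟨3, by decide, rfl⟩, ⟨4, by decide, rfl⟩,
      ⟨5, by decide, rfl⟩, ⟨6, by decide, rfl⟩]
  have ha0 : ∀ i, a i ≠ 0 := fun i => by
    obtain ⟨j, -, hj⟩ := hmem i
    rw [hj]
    exact ne_zero_of_mem_paramSpace ht j
  set N : ℂ → ℂ := fun z => qPoch q (z ^ 2) * qPoch q ((z ^ 2)⁻¹) *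
    (qPoch q ((t 0)⁻¹ * z) * qPoch q ((t 0)⁻¹ * z⁻¹)) *
    (qPoch q ((t 7)⁻¹ * z) * qPoch q ((t 7)⁻¹ * z⁻¹)) / z with hN
  have hNd : DifferentiableOn ℂ N {0}ᶜ := fun z hz => by
    have hz : z ≠ 0 := hz
    have hz2 : z ^ 2 ≠ 0 := pow_ne_zero 2 hz
    have hP := differentiable_qPoch hq
    refine DifferentiableAt.differentiableWithinAt ?_
    simp only [hN]
    fun_prop (disch := assumption)
  have hcongr : ∀ z, integrandS q t z / z =
      N z / ((∏ i, qPoch q (a i / z)) * ∏ i, qPoch q (a i * z)) := fun z => by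
    rw [integrandS, prod_Icc_one_six, Fin.prod_univ_six, Fin.prod_univ_six]
    simp only [hN, ha, Matrix.cons_val, div_eq_mul_inv, mul_inv]
    ring
  rw [integralS, integralS]
  simp only [hcongr]
  rw [loopIntegral_div_qPoch_eq hq0 hq a ha0 hNd e₁.isLoop e₂.isLoop e₁.ne_zero e₂.ne_zero
    (e₁.winding_zero.trans e₂.winding_zero.symm)
    (fun i => e₁.ne_orbit _ (hmem i)) (fun i => e₂.ne_orbit _ (hmem i))
    (fun i n => (e₁.winding_orbit _ (hmem i) n).trans (e₂.winding_orbit _ (hmem i) n).symm)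
    (fun i => e₁.ne_inv _ (hmem i)) (fun i => e₂.ne_inv _ (hmem i))
    (fun i n => (e₁.winding_inv _ (hmem i) n).trans (e₂.winding_inv _ (hmem i) n).symm)]

variable {τ : Fin 8 → ℂ} {γ : ℝ → ℂ} {μ : ℂ}

/-- A fixed curve stays admissible when `τ 0` moves a little. The perturbed point leaves the
hypersurface, which is harmless because the evaluation of the integral for U does not use the
product relation. -/
theorem IsContourU.eventually_update (hq0 : q ≠ 0) (hq : ‖q‖ < 1) (hτ : τ 0 ≠ 0)
    (h : IsContourU q τ γ) :
    ∀ᶠ x in 𝓝 (τ 0), IsContourU q (Function.update τ 0 x) γ := by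
  have h1 := h.isLoop.eventually_orbit hq h.ne_zero (a := τ 0) fun n => (h.orbit 0 n).1
  have h2 := h.isLoop.eventually_inv_orbit hq0 hq h.ne_zero (b := τ 0 / q) (div_ne_zero hτ hq0)
    (fun n => (h.inv_orbit 6 n).1) fun n => (h.inv_orbit 6 n).2
  have h3 : ContinuousAt (fun x : ℂ => x / q) (τ 0) := by fun_prop
  have hw : ∀ n, windingNumber γ (τ 0 * q ^ n) = 1 := fun n => (h.orbit 0 n).2
  filter_upwards [h1, h3.tendsto.eventually h2] with x hx1 hx2
  have hinc : ∀ a ∈ ({0} ∪ {z | ∃ j ∈ ({0, 7} : Finset (Fin 8)), ∃ n : ℕ,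
      z = Function.update τ 0 x j * q ^ n} : Set ℂ),
      (∀ θ, γ θ ≠ a) ∧ windingNumber γ a = 1 := by
    rintro a (rfl | ⟨j, hj, n, rfl⟩)
    · exact ⟨h.ne_zero, h.winding_zero⟩
    · by_cases hj0 : j = 0
      · subst hj0
        rw [Function.update_self]
        refine ⟨(hx1 n).1, ?_⟩
        rcases (hx1 n).2 with h' | h'
        · rw [h', hw]
        · rw [h', h.winding_zero]
      · rw [Function.update_of_ne hj0]
        have : τ j * q ^ n ∈ ({0} ∪ {z | ∃ j ∈ ({0, 7} : Finset (Fin 8)), ∃ n : ℕ,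
          z = τ j * q ^ n} : Set ℂ) := Or.inr ⟨j, hj, n, rfl⟩
        exact ⟨h.avoids_included _ this, h.winding_included _ this⟩
  have hexc : ∀ b ∈ ({z | ∃ j ∈ ({0, 7} : Finset (Fin 8)), ∃ n : ℕ,
        z = (Function.update τ 0 x j)⁻¹ * q * (q ^ n)⁻¹} ∪
      {z | ∃ j ∈ Finset.Icc (1 : Fin 8) 6, ∃ n : ℕ,
        z = (Function.update τ 0 x j)⁻¹ * (q ^ n)⁻¹} : Set ℂ),
      (∀ θ, γ θ ≠ b) ∧ windingNumber γ b = 0 := by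
    rintro b (⟨j, hj, n, rfl⟩ | ⟨j, hj, n, rfl⟩)
    · by_cases hj0 : j = 0
      · subst hj0
        rw [Function.update_self, show x⁻¹ * q * (q ^ n)⁻¹ = (x / q * q ^ n)⁻¹ by
          rw [mul_inv, inv_div, div_eq_inv_mul]]
        exact hx2 n
      · rw [Function.update_of_ne hj0]
        have := Set.mem_union_left {z | ∃ j ∈ Finset.Icc (1 : Fin 8) 6, ∃ n : ℕ,
          z = (τ j)⁻¹ * (q ^ n)⁻¹} (a := {z | ∃ j ∈ ({0, 7} : Finset (Fin 8)), ∃ n : ℕ,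
          z = (τ j)⁻¹ * q * (q ^ n)⁻¹}) (x := (τ j)⁻¹ * q * (q ^ n)⁻¹) ⟨j, hj, n, rfl⟩
        exact ⟨h.avoids_excluded _ this, h.winding_excluded _ this⟩
    · have hj0 : j ≠ 0 := by
        rintro rfl
        exact absurd hj (by decide)
      rw [Function.update_of_ne hj0]
      have := Set.mem_union_right {z | ∃ j ∈ ({0, 7} : Finset (Fin 8)), ∃ n : ℕ,
          z = (τ j)⁻¹ * q * (q ^ n)⁻¹} (b := {z | ∃ j ∈ Finset.Icc (1 : Fin 8) 6, ∃ n : ℕ,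
          z = (τ j)⁻¹ * (q ^ n)⁻¹}) (x := (τ j)⁻¹ * (q ^ n)⁻¹) ⟨j, hj, n, rfl⟩
      exact ⟨h.avoids_excluded _ this, h.winding_excluded _ this⟩
  exact ⟨h.contDiff, h.periodic, fun a ha => (hinc a ha).1, fun b hb => (hexc b hb).1,
    fun a ha => (hinc a ha).2, fun b hb => (hexc b hb).2⟩

theorem IsContourU.qPoch_div_ne_zero (hq : ‖q‖ < 1) (h : IsContourU q τ γ) (i : Fin 2) (θ : ℝ) :
    qPoch q (![τ 0, τ 7] i / γ θ) ≠ 0 := by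
  refine TrigHyp.qPoch_ne_zero hq fun n hn => (h.orbit i n).1 θ ?_
  rw [div_mul_eq_mul_div, div_eq_one_iff_eq (h.ne_zero θ)] at hn
  exact hn.symm

theorem IsContourU.qPoch_mul_ne_zero (hq : ‖q‖ < 1) (h : IsContourU q τ γ) (j : Fin 8) (θ : ℝ) :
    qPoch q (uParam q τ j * γ θ) ≠ 0 := by
  refine TrigHyp.qPoch_ne_zero hq fun n hn => (h.inv_orbit j n).1 θ ?_
  exact eq_inv_of_mul_eq_one_left (by rw [← hn]; ring)

theorem tendsto_integralU_update (hq : ‖q‖ < 1) (hμ : μ ≠ 0) (hτ : τ 0 ≠ 0) (h7 : τ 7 ≠ 0)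
    (hθ0 : theta q (τ 0 / μ) ≠ 0) (hθ7 : theta q (τ 7 / μ) ≠ 0) {u : ℕ → ℂ}
    (hu : Tendsto u atTop (𝓝 (τ 0))) (hu0 : ∀ n, u n ≠ 0) (huθ : ∀ n, theta q (u n / μ) ≠ 0)
    (h : IsContourU q τ γ) (huγ : ∀ n, IsContourU q (Function.update τ 0 (u n)) γ) :
    Tendsto (fun n => integralU q μ (Function.update τ 0 (u n)) γ) atTop
      (𝓝 (integralU q μ τ γ)) := by
  have key := (h.isLoop.tendsto_loopIntegral hu
    (F := fun x z => integrandU q μ (Function.update τ 0 x) z / z) ?_).1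
  · rw [Function.update_eq_self] at key
    exact key.const_mul _
  · rintro ⟨x, z⟩ ⟨hx, ⟨θ, rfl⟩⟩
    have hx' : x ≠ 0 ∧ theta q (x / μ) ≠ 0 ∧ IsContourU q (Function.update τ 0 x) γ := by
      rcases hx with hx | ⟨n, hx⟩
      · change x = τ 0 at hx
        subst hx
        rw [Function.update_eq_self]
        exact ⟨hτ, hθ0, h⟩
      · change u n = x at hx
        subst hx
        exact ⟨hu0 n, huθ n, huγ n⟩
    obtain ⟨hx0, hxθ, hxγ⟩ := hx'
    have hz := h.ne_zero θ
    have hP := (differentiable_qPoch hq).continuous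
    have c1 : (∏ i, qPoch q (![x, τ 7] i / γ θ)) *
        (qPoch q (τ 1 * γ θ) * qPoch q (τ 2 * γ θ) * qPoch q (τ 3 * γ θ) * qPoch q (τ 4 * γ θ) *
        qPoch q (τ 5 * γ θ) * qPoch q (τ 6 * γ θ) * qPoch q (x / q * γ θ) *
        qPoch q (τ 7 / q * γ θ)) ≠ 0 := by
      refine mul_ne_zero (Finset.prod_ne_zero_iff.2 fun i _ => hxγ.qPoch_div_ne_zero hq i θ) ?_
      have := Finset.prod_ne_zero_iff.2 fun j (_ : j ∈ Finset.univ) => hxγ.qPoch_mul_ne_zero hq j θ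
      rw [Fin.prod_univ_eight] at this
      exact this
    rw [Fin.prod_univ_two] at c1
    simp only [Matrix.cons_val] at c1
    have h1 : μ * γ θ ≠ 0 := mul_ne_zero hμ hz
    have h2 : x * τ 7 / (μ * γ θ) ≠ 0 := div_ne_zero (mul_ne_zero hx0 h7) h1
    have h3 : γ θ / μ ≠ 0 := div_ne_zero hz hμ
    have h4 : x / μ ≠ 0 := div_ne_zero hx0 hμ
    have h5 : qPoch q (x / μ) * qPoch q (q / (x / μ)) *
      (qPoch q (τ 7 / μ) * qPoch q (q / (τ 7 / μ))) ≠ 0 := mul_ne_zero hxθ hθ7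
    refine ContinuousAt.continuousWithinAt ?_
    have e : (fun p : ℂ × ℂ => integrandU q μ (Function.update τ 0 p.1) p.2 / p.2) =
        fun p => 2 * ((theta q (p.1 * τ 7 / (μ * p.2)) * theta q (p.2 / μ)) /
          (theta q (p.1 / μ) * theta q (τ 7 / μ))) * (1 - p.2 ^ 2 / q) *
          (qPoch q (p.2 / τ 1) * qPoch q (p.2 / τ 2) * qPoch q (p.2 / τ 3) * qPoch q (p.2 / τ 4) *
            qPoch q (p.2 / τ 5) * qPoch q (p.2 / τ 6)) / p.2 /
          (qPoch q (p.1 / p.2) * qPoch q (τ 7 / p.2) *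
        (qPoch q (τ 1 * p.2) * qPoch q (τ 2 * p.2) * qPoch q (τ 3 * p.2) * qPoch q (τ 4 * p.2) *
        qPoch q (τ 5 * p.2) * qPoch q (τ 6 * p.2) * qPoch q (p.1 / q * p.2) *
        qPoch q (τ 7 / q * p.2))) := by
      funext p
      rw [integrandU_div_eq, uNumerator, Fin.prod_univ_two, Fin.prod_univ_eight]
      rfl
    rw [e]
    unfold theta
    fun_prop (disch := assumption)

/-- The evaluation by residues needs `θ(τ₈/τ₁) ≠ 0`, that is, simple poles. Perturbing `τ 0`
restores this condition with both curves still admissible. There both integrals equal the same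
series, and continuity gives the limit. -/
theorem integralU_eq_integralU (hq0 : q ≠ 0) (hq : ‖q‖ < 1) (hτ : ∀ j, τ j ≠ 0) {μ₁ μ₂ : ℂ}
    (hμ₁ : μ₁ ≠ 0) (hμ₂ : μ₂ ≠ 0) (h₁ : theta q (τ 0 / μ₁) ≠ 0) (h₁' : theta q (τ 7 / μ₁) ≠ 0)
    (h₂ : theta q (τ 0 / μ₂) ≠ 0) (h₂' : theta q (τ 7 / μ₂) ≠ 0) {γ₁ γ₂ : ℝ → ℂ}
    (hγ₁ : IsContourU q τ γ₁) (hγ₂ : IsContourU q τ γ₂) :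
    integralU q μ₁ τ γ₁ = integralU q μ₂ τ γ₂ := by
  have hθ : ∀ μ : ℂ, μ ≠ 0 → theta q (τ 0 / μ) ≠ 0 → ∀ᶠ x in 𝓝 (τ 0), theta q (x / μ) ≠ 0 :=
    fun μ hμ h => by
      have h1 : ContinuousAt (theta q) (τ 0 / μ) := continuousAt_theta hq (div_ne_zero (hτ 0) hμ)
      have h2 : ContinuousAt (fun x : ℂ => x / μ) (τ 0) := by fun_prop
      exact (ContinuousAt.comp (f := fun x : ℂ => x / μ) h1 h2).eventually_ne h
  have hev : ∀ᶠ x in 𝓝[≠] τ 0, x ≠ 0 ∧ theta q (x / μ₁) ≠ 0 ∧ theta q (x / μ₂) ≠ 0 ∧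
      theta q (τ 7 / x) ≠ 0 ∧ IsContourU q (Function.update τ 0 x) γ₁ ∧
      IsContourU q (Function.update τ 0 x) γ₂ := by
    have e := ((eventually_ne_nhds (hτ 0)).and ((hθ μ₁ hμ₁ h₁).and ((hθ μ₂ hμ₂ h₂).and
      ((hγ₁.eventually_update hq0 hq (hτ 0)).and
        (hγ₂.eventually_update hq0 hq (hτ 0)))))).filter_mono
      (nhdsWithin_le_nhds (s := {τ 0}ᶜ))
    filter_upwards [e, eventually_theta_div_ne_zero hq0 hq (hτ 7) (hτ 0)] with x h h'
    exact ⟨h.1, h.2.1, h.2.2.1, h', h.2.2.2⟩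
  obtain ⟨u, hu, hu'⟩ := exists_seq_forall_of_frequently hev.frequently
  have hu1 : Tendsto u atTop (𝓝 (τ 0)) := hu.mono_right nhdsWithin_le_nhds
  have l₁ := tendsto_integralU_update hq hμ₁ (hτ 0) (hτ 7) h₁ h₁' hu1 (fun n => (hu' n).1)
    (fun n => (hu' n).2.1) hγ₁ (fun n => (hu' n).2.2.2.2.1)
  have l₂ := tendsto_integralU_update hq hμ₂ (hτ 0) (hτ 7) h₂ h₂' hu1 (fun n => (hu' n).1)
    (fun n => (hu' n).2.2.1) hγ₂ (fun n => (hu' n).2.2.2.2.2)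
  refine tendsto_nhds_unique l₁ (l₂.congr fun n => ?_)
  obtain ⟨h1, h2, h3, h4, h5, h6⟩ := hu' n
  have hτ' : ∀ j, Function.update τ 0 (u n) j ≠ 0 := fun j => by
    by_cases hj : j = 0
    · subst hj
      rwa [Function.update_self]
    · rw [Function.update_of_ne hj]
      exact hτ j
  have e0 : Function.update τ 0 (u n) 0 = u n := Function.update_self ..
  have e7 : Function.update τ 0 (u n) 7 = τ 7 := Function.update_of_ne (by decide) ..
  rw [integralU_eq_uSeries hq0 hq hτ' hμ₁ (by rwa [e0]) (by rwa [e7]) (by rwa [e0, e7]) h5,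
    integralU_eq_uSeries hq0 hq hτ' hμ₂ (by rwa [e0]) (by rwa [e7]) (by rwa [e0, e7]) h6]

end Independence

/-! ### Comparison with the ₁₀W₉ series in standard notation. -/

section Series

variable {q : ℂ}

/-- The very-well-poised factors telescope to (1 - a q^(2n)) / (1 - a); the identity is
cross-multiplied to be free of conditions. -/
theorem qPochFin_mul_neg_ratio {r a : ℂ} (hr : r ^ 2 = a) (n : ℕ) :
    (1 - a) * (qPochFin q (q * r) n * qPochFin q (-(q * r)) n) =
      (1 - a * q ^ (2 * n)) * (qPochFin q r n * qPochFin q (-r) n) := by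
  induction n with
  | zero => simp [qPochFin]
  | succ n ih =>
    simp only [qPochFin_succ]
    linear_combination (1 - q * r * q ^ n) * (1 + q * r * q ^ n) * ih -
      (1 - a * q ^ (2 * n)) * (qPochFin q r n * qPochFin q (-r) n) * (q ^ (n + 1)) ^ 2 * hr +
      (1 - a * q ^ (2 * (n + 1))) * (qPochFin q r n * qPochFin q (-r) n) * (q ^ n) ^ 2 * hr

theorem qPochFin_mul_neg_ne_zero (hq : ‖q‖ < 1) {r a : ℂ} (hr : r ^ 2 = a) (ha : qPoch q a ≠ 0)
    (n : ℕ) : qPochFin q r n * qPochFin q (-r) n ≠ 0 := by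
  rw [qPochFin, qPochFin, ← Finset.prod_mul_distrib]
  refine Finset.prod_ne_zero_iff.2 fun j _ h => ha ((qPoch_eq_zero_iff hq).2 ⟨2 * j, ?_⟩)
  rw [← hr]
  linear_combination -h

/-- The parameter `τ₁/q` supplies both `(τ₁²/q; q)_n` and `1/(q; q)_n`. The seven others give the
well-poised pairs of the ₁₀W₉ series. -/
theorem vwpTerm_eq_mul (hq0 : q ≠ 0) (hq : ‖q‖ < 1) {τ : Fin 8 → ℂ} (hτ : ∀ j, τ j ≠ 0)
    (ha : qPoch q (τ 0 ^ 2 / q) ≠ 0) (h : ∀ i, qPoch q (τ 0 / uParam q τ i) ≠ 0) (n : ℕ) :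
    q ^ n * vwpTerm q (τ 0 ^ 2 / q) (fun i => τ 0 / uParam q τ i) (fun i => uParam q τ i * τ 0) n =
      (1 - τ 0 ^ 2 / q) * (∏ i, qPoch q (τ 0 / uParam q τ i)) *
      ((((τ 0 ^ 2 / q) :: (q * (τ 0 ^ 2 / q) ^ (1 / 2 : ℂ)) ::
        (-(q * (τ 0 ^ 2 / q) ^ (1 / 2 : ℂ))) :: [τ 0 * τ 1, τ 0 * τ 2, τ 0 * τ 3, τ 0 * τ 4,
          τ 0 * τ 5, τ 0 * τ 6, τ 0 * τ 7 / q]).map fun a => qPochFin q a n).prod /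
      (qPochFin q q n * ((((τ 0 ^ 2 / q) ^ (1 / 2 : ℂ)) :: (-(τ 0 ^ 2 / q) ^ (1 / 2 : ℂ)) ::
        [τ 0 * τ 1, τ 0 * τ 2, τ 0 * τ 3, τ 0 * τ 4, τ 0 * τ 5, τ 0 * τ 6, τ 0 * τ 7 / q].map
          fun b => q * (τ 0 ^ 2 / q) / b).map fun b => qPochFin q b n).prod) * q ^ n) := by
  have hr : ((τ 0 ^ 2 / q) ^ (1 / 2 : ℂ)) ^ 2 = τ 0 ^ 2 / q := by
    rw [one_div]
    exact Complex.cpow_nat_inv_pow _ two_ne_zero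
  have e1 := qPochFin_mul_neg_ratio (q := q) hr n
  have e2 := qPochFin_mul_neg_ne_zero hq hr ha n
  generalize (τ 0 ^ 2 / q) ^ (1 / 2 : ℂ) = r at *
  have hf : ∀ i, qPochFin q (τ 0 / uParam q τ i) n ≠ 0 := fun i =>
    qPochFin_ne_zero_of_qPoch hq (h i) n
  have hs : ∀ i, qPoch q (τ 0 / uParam q τ i) = qPochFin q (τ 0 / uParam q τ i) n *
    qPoch q (τ 0 / uParam q τ i * q ^ n) := fun i => qPoch_eq_qPochFin_mul hq _ n
  have hd : ∀ j, q * (τ 0 ^ 2 / q) / (τ 0 * τ j) = τ 0 / τ j := fun j => by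
    have := hτ 0
    have := hτ j
    field_simp
  have hd7 : q * (τ 0 ^ 2 / q) / (τ 0 * τ 7 / q) = τ 0 / (τ 7 / q) := by
    have := hτ 0
    have := hτ 7
    field_simp
  have h6 : τ 0 / (τ 0 / q) = q := div_div_cancel₀ (hτ 0)
  have hc : ∀ j, τ j * τ 0 = τ 0 * τ j := fun j => mul_comm _ _
  have h8 : τ 0 / q * τ 0 = τ 0 ^ 2 / q := by ring
  have h9 : τ 7 / q * τ 0 = τ 0 * τ 7 / q := by ring
  rw [vwpTerm, Finset.prod_mul_distrib]
  simp only [hs, Finset.prod_mul_distrib]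
  generalize (∏ i, qPoch q (τ 0 / uParam q τ i * q ^ n)) = Q
  rw [Fin.prod_univ_eight, Fin.prod_univ_eight]
  simp only [List.map_cons, List.map_nil, List.prod_cons, List.prod_nil, hd, hd7]
  have g := hf
  simp only [Fin.forall_fin_succ, Fin.forall_fin_zero] at g
  simp only [uParam, Matrix.cons_val, h6, h8, h9, hc] at g ⊢
  have g0 := hf 0
  have g1 := hf 1
  have g2 := hf 2
  have g3 := hf 3
  have g4 := hf 4
  have g5 := hf 5
  have g6 := hf 6
  have g7 := hf 7
  simp only [uParam, Matrix.cons_val, h6] at g0 g1 g2 g3 g4 g5 g6 g7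
  clear g hf hs h hd hd7 hc
  obtain ⟨m1, m2⟩ := mul_ne_zero_iff.1 e2
  generalize qPochFin q (τ 0 / τ 1) n = A1 at *
  generalize qPochFin q (τ 0 / τ 2) n = A2 at *
  generalize qPochFin q (τ 0 / τ 3) n = A3 at *
  generalize qPochFin q (τ 0 / τ 4) n = A4 at *
  generalize qPochFin q (τ 0 / τ 5) n = A5 at *
  generalize qPochFin q (τ 0 / τ 6) n = A6 at *
  generalize qPochFin q q n = A0 at *
  generalize qPochFin q (τ 0 / (τ 7 / q)) n = A7 at *
  generalize qPochFin q r n = r1 at *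
  generalize qPochFin q (-r) n = r2 at *
  generalize qPochFin q (q * r) n = r3 at *
  generalize qPochFin q (-(q * r)) n = r4 at *
  generalize qPochFin q (τ 0 * τ 1) n = B1 at *
  generalize qPochFin q (τ 0 * τ 2) n = B2 at *
  generalize qPochFin q (τ 0 * τ 3) n = B3 at *
  generalize qPochFin q (τ 0 * τ 4) n = B4 at *
  generalize qPochFin q (τ 0 * τ 5) n = B5 at *
  generalize qPochFin q (τ 0 * τ 6) n = B6 at *
  generalize qPochFin q (τ 0 * τ 7 / q) n = B7 at *
  generalize qPochFin q (τ 0 ^ 2 / q) n = B0 at *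
  generalize τ 0 ^ 2 / q = a at *
  rw [mul_one, ← mul_div_right_comm, ← mul_div_assoc, eq_div_iff (by simp [*])]
  linear_combination (-(q ^ n * Q * A0 * A1 * A2 * A3 * A4 * A5 * A6 * A7 * B0 * B1 * B2 * B3 * B4 *
    B5 * B6 * B7)) * e1

-- In the prefactor, the parameter `τ₁/q` contributes `(q; q)_∞` and turns `(τ₁²/q; q)_∞` into
-- `(τ₁²; q)_∞` after cancelling `1 - τ₁²/q`. The parameter `τ₈/q` cancels half of the theta
-- function and leaves `(τ₈/τ₁; q)_∞`.
set_option maxHeartbeats 1000000 in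
theorem uBase_mul_eq_seriesTerm (hq0 : q ≠ 0) (hq : ‖q‖ < 1) {τ : Fin 8 → ℂ} (hτ : ∀ j, τ j ≠ 0)
    (ha : qPoch q (τ 0 ^ 2 / q) ≠ 0) (h : ∀ i, qPoch q (τ 0 / uParam q τ i) ≠ 0) :
    2 / (τ 0 * qPoch q q ^ 2 * theta q (τ 7 / τ 0)) * uBase q τ (τ 0) = seriesTerm q τ := by
  have hsum : vwpSum q (τ 0 ^ 2 / q) (fun i => τ 0 / uParam q τ i) (fun i => uParam q τ i * τ 0) =
      (1 - τ 0 ^ 2 / q) * (∏ i, qPoch q (τ 0 / uParam q τ i)) * vwpW q (τ 0 ^ 2 / q)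
        [τ 0 * τ 1, τ 0 * τ 2, τ 0 * τ 3, τ 0 * τ 4, τ 0 * τ 5, τ 0 * τ 6, τ 0 * τ 7 / q] q := by
    rw [vwpSum, vwpW, basicPhi, ← tsum_mul_left]
    exact tsum_congr (vwpTerm_eq_mul hq0 hq hτ ha h)
  have h7 := h 7
  have hst := qPoch_step hq (τ 0 ^ 2 / q)
  rw [mul_div_cancel₀ _ hq0] at hst
  have hq' := qPoch_self_ne_zero hq
  have h06 : τ 0 / (τ 0 / q) = q := div_div_cancel₀ (hτ 0)
  have h67 : τ 0 / (τ 7 / q) = q / (τ 7 / τ 0) := by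
    rw [div_div_eq_mul_div, div_div_eq_mul_div, mul_comm]
  rw [uBase, hsum, seriesTerm, prod_Icc_one_six, Fin.prod_univ_eight, Fin.prod_univ_eight, theta]
  rw [hst] at ha
  generalize vwpW q (τ 0 ^ 2 / q) _ q = W
  simp only [uParam, Matrix.cons_val, h06, h67] at h7 ⊢
  rw [show τ 0 / q * τ 0 = τ 0 ^ 2 / q by ring, hst,
    show τ 7 / q * τ 0 = τ 0 * τ 7 / q by ring]
  simp only [mul_comm _ (τ 0)]
  have ha1 := left_ne_zero_of_mul ha
  have := hτ 0
  generalize (1 - τ 0 ^ 2 / q) = a1 at *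
  generalize qPoch q (q / (τ 7 / τ 0)) = A7 at *
  generalize qPoch q q = Q at *
  have c0 : τ 0 * (τ 0)⁻¹ = 1 := mul_inv_cancel₀ this
  have c1 : Q * Q⁻¹ = 1 := mul_inv_cancel₀ hq'
  have c2 : A7 * A7⁻¹ = 1 := mul_inv_cancel₀ h7
  have c3 : a1 * a1⁻¹ = 1 := mul_inv_cancel₀ ha1
  simp only [div_eq_mul_inv, mul_inv, ← inv_pow]
  clear hst ha hsum h h06 h67
  generalize (qPoch q (τ 7 * (τ 0)⁻¹))⁻¹ = T
  generalize (qPoch q (τ 0 ^ 2))⁻¹ = Z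
  generalize (qPoch q (τ 0 * τ 7 * q⁻¹))⁻¹ = Y7
  generalize (qPoch q (τ 0 * τ 1))⁻¹ = Y1
  generalize (qPoch q (τ 0 * τ 2))⁻¹ = Y2
  generalize (qPoch q (τ 0 * τ 3))⁻¹ = Y3
  generalize (qPoch q (τ 0 * τ 4))⁻¹ = Y4
  generalize (qPoch q (τ 0 * τ 5))⁻¹ = Y5
  generalize (qPoch q (τ 0 * τ 6))⁻¹ = Y6
  generalize qPoch q (τ 0 * (τ 1)⁻¹) = X1
  generalize qPoch q (τ 0 * (τ 2)⁻¹) = X2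
  generalize qPoch q (τ 0 * (τ 3)⁻¹) = X3
  generalize qPoch q (τ 0 * (τ 4)⁻¹) = X4
  generalize qPoch q (τ 0 * (τ 5)⁻¹) = X5
  generalize qPoch q (τ 0 * (τ 6)⁻¹) = X6
  generalize (τ 0)⁻¹ = u at *
  generalize Q⁻¹ = Q' at *
  generalize A7⁻¹ = A7' at *
  generalize a1⁻¹ = a1' at *
  generalize τ 0 = v at *
  calc _ = 2 * (Q' * Z * Y7 * T) * (X1 * Y1 * (X2 * Y2) * (X3 * Y3) * (X4 * Y4) * (X5 * Y5) *
        (X6 * Y6)) * W * ((v * u) * (Q * Q') * (A7 * A7') * (a1 * a1')) := by ring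
    _ = _ := by rw [c0, c1, c2, c3]; ring

/-- Exchanging the two distinguished parameters only permutes the last two entries of `uParam`, in
which `uBase` is symmetric. -/
theorem uBase_swap (q : ℂ) (τ : Fin 8 → ℂ) (x : ℂ) :
    uBase q (τ ∘ Equiv.swap 0 7) x = uBase q τ x := by
  have e : uParam q (τ ∘ Equiv.swap 0 7) = uParam q τ ∘ Equiv.swap 6 7 := by
    funext i
    fin_cases i <;> rfl
  rw [uBase, uBase, e]
  generalize uParam q τ = y
  have h1 : ∏ i, qPoch q ((y ∘ Equiv.swap 6 7) i * x) = ∏ i, qPoch q (y i * x) :=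
    Fintype.prod_equiv (Equiv.swap 6 7) _ _ fun _ => rfl
  rw [h1]
  have h2 : ∀ n, vwpTerm q (x ^ 2 / q) (fun i => x / (y ∘ Equiv.swap 6 7) i)
      (fun i => (y ∘ Equiv.swap 6 7) i * x) n =
      vwpTerm q (x ^ 2 / q) (fun i => x / y i) (fun i => y i * x) n := fun n =>
    congrArg ((1 - x ^ 2 / q * q ^ (2 * n)) * ·)
      (Fintype.prod_equiv (Equiv.swap 6 7) _ _ fun _ => rfl)
  simp only [vwpSum, h2]

theorem seriesU_eq_uSeries (hq0 : q ≠ 0) (hq : ‖q‖ < 1) {τ : Fin 8 → ℂ} (hτ : ∀ j, τ j ≠ 0)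
    (h0 : qPoch q (τ 0 ^ 2 / q) ≠ 0) (h7 : qPoch q (τ 7 ^ 2 / q) ≠ 0)
    (hθ : theta q (τ 7 / τ 0) ≠ 0)
    (h : ∀ j ∈ Finset.Icc (1 : Fin 8) 6, qPoch q (τ 0 / τ j) ≠ 0 ∧ qPoch q (τ 7 / τ j) ≠ 0) :
    seriesU q τ = uSeries q τ := by
  set σ := τ ∘ Equiv.swap 0 7 with hσ
  have s0 : σ 0 = τ 7 := rfl
  have s7 : σ 7 = τ 0 := rfl
  have hP := qPoch_self_ne_zero hq
  have a1 : qPoch q (τ 0 / (τ 7 / q)) ≠ 0 := by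
    rw [show τ 0 / (τ 7 / q) = q / (τ 7 / τ 0) by
      rw [div_div_eq_mul_div, div_div_eq_mul_div, mul_comm]]
    exact right_ne_zero_of_mul hθ
  have a2 : qPoch q (τ 7 / (τ 0 / q)) ≠ 0 := by
    rw [show τ 7 / (τ 0 / q) = τ 7 / τ 0 * q ^ 1 by rw [div_div_eq_mul_div, mul_div_right_comm,
      pow_one]]
    exact qPoch_mul_pow_ne_zero hq (left_ne_zero_of_mul hθ) 1
  have e0 : ∀ i, qPoch q (τ 0 / uParam q τ i) ≠ 0 := fun i => by
    fin_cases i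
    exacts [(h 1 (by decide)).1, (h 2 (by decide)).1, (h 3 (by decide)).1, (h 4 (by decide)).1,
      (h 5 (by decide)).1, (h 6 (by decide)).1, by
        change qPoch q (τ 0 / (τ 0 / q)) ≠ 0
        rwa [div_div_cancel₀ (hτ 0)], a1]
  have e7 : ∀ i, qPoch q (σ 0 / uParam q σ i) ≠ 0 := fun i => by
    fin_cases i
    exacts [(h 1 (by decide)).2, (h 2 (by decide)).2, (h 3 (by decide)).2, (h 4 (by decide)).2,
      (h 5 (by decide)).2, (h 6 (by decide)).2, by
        change qPoch q (τ 7 / (τ 7 / q)) ≠ 0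
        rwa [div_div_cancel₀ (hτ 7)], a2]
  have t := uBase_mul_eq_seriesTerm hq0 hq (τ := σ) (fun j => hτ _) (by rwa [s0]) e7
  have hinv := theta_inv hq (x := τ 7 / τ 0) (div_ne_zero (hτ 7) (hτ 0))
  rw [inv_div] at hinv
  rw [s0, s7, uBase_swap, hinv] at t
  rw [seriesU, ← hσ, ← t, ← uBase_mul_eq_seriesTerm hq0 hq hτ h0 e0, uSeries]
  have := hτ 0
  have := hτ 7
  generalize theta q (τ 7 / τ 0) = T at *
  generalize qPoch q q = Q at *
  field_simp
  ring

end Series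

/-! ### Generic validity and the identity theorem for meromorphic functions. -/

section Generic

/-- The identity theorem on a connected set: vanishing near one point would spread to the whole
neighbourhood of `x`. -/
theorem frequently_ne_zero_of_ball {E : Type*} [NormedAddCommGroup E] [NormedSpace ℂ E]
    {k : E → ℂ} {s : Set E} (hk : AnalyticOnNhd ℂ k s) (hs : IsPreconnected s) {x y : E}
    (hy : y ∈ s) (h : ∃ᶠ w in 𝓝 x, k w ≠ 0) (hs' : s ∈ 𝓝 x) :
    ∃ᶠ w in 𝓝 y, k w ≠ 0 := by
  intro h'
  refine h ?_
  have : k =ᶠ[𝓝 y] 0 := by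
    filter_upwards [h'] with w hw using not_not.1 hw
  have := hk.eqOn_zero_of_preconnected_of_eventuallyEq_zero hs hy this
  filter_upwards [hs'] with w hw
  exact not_not.2 (this hw)

theorem AnalyticAt.exists_ball {E : Type*} [NormedAddCommGroup E] [NormedSpace ℂ E]
    {k : E → ℂ} {x : E} (hk : AnalyticAt ℂ k x) {p : E → Prop} (hp : ∀ᶠ w in 𝓝 x, p w) :
    ∃ r > 0, AnalyticOnNhd ℂ k (Metric.ball x r) ∧ ∀ w ∈ Metric.ball x r, p w := by
  obtain ⟨r, hr, h⟩ := Metric.eventually_nhds_iff_ball.1 (hk.eventually_analyticAt.and hp)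
  exact ⟨r, hr, fun w hw => (h w hw).1, fun w hw => (h w hw).2⟩

/-- Germs of analytic functions form an integral domain. This allows generic conditions to be
combined by multiplying their defining functions. -/
theorem frequently_mul_ne_zero {E : Type*} [NormedAddCommGroup E] [NormedSpace ℂ E]
    {k l : E → ℂ} {x : E} (hk : AnalyticAt ℂ k x) (hl : AnalyticAt ℂ l x)
    (hk' : ∃ᶠ w in 𝓝 x, k w ≠ 0) (hl' : ∃ᶠ w in 𝓝 x, l w ≠ 0) :
    ∃ᶠ w in 𝓝 x, k w * l w ≠ 0 := by
  intro h
  obtain ⟨r, hr, hkr, hr'⟩ := AnalyticAt.exists_ball hk (h.and hl.eventually_analyticAt)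
  obtain ⟨y, hky, hy⟩ := (hk'.and_eventually (Metric.ball_mem_nhds x hr)).exists
  refine frequently_ne_zero_of_ball (s := Metric.ball x r) (y := y)
    (fun w hw => (hr' w hw).2) (convex_ball x r).isPreconnected
    hy hl' (Metric.ball_mem_nhds x hr) ?_
  filter_upwards [(hkr y hy).continuousAt.eventually_ne hky,
    Metric.isOpen_ball.mem_nhds hy] with w hw hw' hlw
  exact (hr' w hw').1 (mul_ne_zero hw hlw)

variable {E : Type*} [NormedAddCommGroup E] [NormedSpace ℂ E]

/-- Near `x`, the property `Q` holds off the zero set of an analytic function that does not vanish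
identically. -/
def HoldsGenericallyAt (Q : E → Prop) (x : E) : Prop :=
  ∃ k : E → ℂ, AnalyticAt ℂ k x ∧ (∃ᶠ w in 𝓝 x, k w ≠ 0) ∧ ∀ᶠ w in 𝓝 x, k w ≠ 0 → Q w

theorem HoldsGenericallyAt.and {Q R : E → Prop} {x : E} (hQ : HoldsGenericallyAt Q x)
    (hR : HoldsGenericallyAt R x) : HoldsGenericallyAt (fun w => Q w ∧ R w) x := by
  obtain ⟨k, hk, hk', hkQ⟩ := hQ
  obtain ⟨l, hl, hl', hlR⟩ := hR
  refine ⟨fun w => k w * l w, hk.mul hl, frequently_mul_ne_zero hk hl hk' hl', ?_⟩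
  filter_upwards [hkQ, hlR] with w h1 h2 h
  exact ⟨h1 (left_ne_zero_of_mul h), h2 (right_ne_zero_of_mul h)⟩

theorem HoldsGenericallyAt.mono {Q R : E → Prop} {x : E} (hQ : HoldsGenericallyAt Q x)
    (h : ∀ w, Q w → R w) : HoldsGenericallyAt R x := by
  obtain ⟨k, hk, hk', hkQ⟩ := hQ
  exact ⟨k, hk, hk', hkQ.mono fun w hw hw' => h w (hw hw')⟩

theorem HoldsGenericallyAt.comp {F : Type*} [NormedAddCommGroup F] [NormedSpace ℂ F]
    {Q : E → Prop} {φ : F ≃ₜ E} {x : F} (hQ : HoldsGenericallyAt Q (φ x))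
    (hφ : AnalyticAt ℂ φ x) : HoldsGenericallyAt (fun w => Q (φ w)) x := by
  obtain ⟨k, hk, hk', hkQ⟩ := hQ
  rw [← φ.map_nhds_eq] at hk' hkQ
  exact ⟨fun w => k (φ w), hk.comp hφ, hk', hkQ⟩

/-- An entire function that does not vanish identically. -/
structure IsEntireNonzero (H : E → ℂ) : Prop where
  analyticAt : ∀ w, AnalyticAt ℂ H w
  exists_ne_zero : ∃ w, H w ≠ 0

theorem IsEntireNonzero.frequently {H : E → ℂ} (h : IsEntireNonzero H) (x : E) :
    ∃ᶠ w in 𝓝 x, H w ≠ 0 := by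
  obtain ⟨y, hy⟩ := h.exists_ne_zero
  exact frequently_ne_zero_of_ball (fun w _ => h.analyticAt w) isPreconnected_univ
    (Set.mem_univ x)
    ((h.analyticAt y).continuousAt.eventually_ne hy).frequently univ_mem

theorem IsEntireNonzero.mul {H K : E → ℂ} (hH : IsEntireNonzero H) (hK : IsEntireNonzero K) :
    IsEntireNonzero fun w => H w * K w where
  analyticAt w := (hH.analyticAt w).mul (hK.analyticAt w)
  exists_ne_zero := (frequently_mul_ne_zero (hH.analyticAt 0) (hK.analyticAt 0) (hH.frequently 0)
    (hK.frequently 0)).exists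

theorem IsEntireNonzero.prod {ι : Type*} (s : Finset ι) {H : ι → E → ℂ}
    (hH : ∀ i ∈ s, IsEntireNonzero (H i)) : IsEntireNonzero fun w => ∏ i ∈ s, H i w := by
  classical
  induction s using Finset.induction_on with
  | empty => exact ⟨fun w => by simpa using analyticAt_const, 0, by simp⟩
  | insert a s ha ih =>
    simp only [Finset.prod_insert ha]
    exact (hH a (by simp)).mul (ih fun i hi => hH i (by simp [hi]))

theorem IsEntireNonzero.comp {F : Type*} [NormedAddCommGroup F] [NormedSpace ℂ F] {H : E → ℂ}
    (hH : IsEntireNonzero H) (φ : F ≃ₜ E) (hφ : ∀ x, AnalyticAt ℂ φ x) :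
    IsEntireNonzero fun w => H (φ w) where
  analyticAt w := (hH.analyticAt (φ w)).comp (hφ w)
  exists_ne_zero := by
    obtain ⟨y, hy⟩ := hH.exists_ne_zero
    exact ⟨φ.symm y, by rwa [φ.apply_symm_apply]⟩

theorem IsEntireNonzero.holdsGenericallyAt {H : E → ℂ} (h : IsEntireNonzero H) {Q : E → Prop}
    (hQ : ∀ w, H w ≠ 0 → Q w) (x : E) : HoldsGenericallyAt Q x :=
  ⟨H, h.analyticAt x, h.frequently x, Eventually.of_forall hQ⟩

/-- Near `x`, the function `f` is a quotient of analytic functions off the zeros of the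
denominator. -/
def IsMeromorphicNear (f : E → ℂ) (x : E) : Prop :=
  ∃ g k : E → ℂ, AnalyticAt ℂ g x ∧ AnalyticAt ℂ k x ∧ (∃ᶠ w in 𝓝 x, k w ≠ 0) ∧
    ∀ᶠ w in 𝓝 x, k w ≠ 0 → f w = g w / k w

/-- The identity theorem for meromorphic functions. -/
theorem holdsGenericallyAt_mul_eq {f G H : E → ℂ} (hf : ∀ x, IsMeromorphicNear f x)
    (hG : ∀ w, AnalyticAt ℂ G w) (hH : ∀ w, AnalyticAt ℂ H w) {x₀ : E}
    (h₀ : ∀ᶠ w in 𝓝 x₀, f w * H w = G w) (x : E) :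
    HoldsGenericallyAt (fun w => f w * H w = G w) x := by
  set A : Set E := {x | HoldsGenericallyAt (fun w => f w * H w = G w) x} with hA
  -- On a ball where `f = g / k`, the relation is the vanishing of the analytic function `g * H - G
  -- * k`. Holding generically near one point of the ball, it holds throughout, so `A` is open and
  -- closed.
  have key : ∀ x, ∃ r > 0, ∀ y ∈ Metric.ball x r, y ∈ A → Metric.ball x r ⊆ A := by
    intro x
    obtain ⟨g, k, hg, hk, hk', hfg⟩ := hf x
    obtain ⟨r, hr, hgr, hr'⟩ := AnalyticAt.exists_ball hg (hk.eventually_analyticAt.and hfg)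
    have hkr : AnalyticOnNhd ℂ k (Metric.ball x r) := fun w hw => (hr' w hw).1
    have hconn : IsPreconnected (Metric.ball x r) := (convex_ball x r).isPreconnected
    have hfreq : ∀ y ∈ Metric.ball x r, ∃ᶠ w in 𝓝 y, k w ≠ 0 := fun y hy =>
      frequently_ne_zero_of_ball hkr hconn hy hk'
        (Metric.ball_mem_nhds x hr)
    refine ⟨r, hr, fun y hy hyA => ?_⟩
    obtain ⟨l, hl, hl', hlA⟩ := hyA
    have hD : AnalyticOnNhd ℂ (fun w => g w * H w - G w * k w) (Metric.ball x r) := fun w hw =>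
      ((hgr w hw).mul (hH w)).sub ((hG w).mul (hkr w hw))
    have hD0 : ∀ᶠ w in 𝓝 y, g w * H w - G w * k w = 0 := by
      by_contra hne
      refine frequently_mul_ne_zero ((hkr y hy).mul hl) (hD y hy)
        (frequently_mul_ne_zero (hkr y hy) hl (hfreq y hy) hl') (not_eventually.1 hne) ?_
      filter_upwards [hlA, Metric.isOpen_ball.mem_nhds hy] with w hw hwr hprod
      have hkw : k w ≠ 0 := left_ne_zero_of_mul (left_ne_zero_of_mul hprod)
      have hlw : l w ≠ 0 := right_ne_zero_of_mul (left_ne_zero_of_mul hprod)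
      refine right_ne_zero_of_mul hprod ?_
      have e1 := hw hlw
      have e2 := (hr' w hwr).2 hkw
      rw [e2] at e1
      rw [← e1]
      field_simp
      ring
    have hD1 := hD.eqOn_zero_of_preconnected_of_eventuallyEq_zero hconn hy hD0
    intro z hz
    refine ⟨k, hkr z hz, hfreq z hz, ?_⟩
    filter_upwards [Metric.isOpen_ball.mem_nhds hz] with w hw hkw
    have e1 := hD1 hw
    simp only [Pi.zero_apply] at e1
    rw [(hr' w hw).2 hkw]
    field_simp
    linear_combination e1
  have hopen : IsOpen A := Metric.isOpen_iff.2 fun x hx => by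
    obtain ⟨r, hr, h⟩ := key x
    exact ⟨r, hr, h x (Metric.mem_ball_self hr) hx⟩
  have hclosed : IsClosed A := by
    refine ⟨Metric.isOpen_iff.2 fun x hx => ?_⟩
    obtain ⟨r, hr, h⟩ := key x
    exact ⟨r, hr, fun y hy hyA => hx (h y hy hyA (Metric.mem_ball_self hr))⟩
  have hne : A.Nonempty := ⟨x₀, fun _ => 1, analyticAt_const, by simp,
    h₀.mono fun w hw _ => hw⟩
  have := IsClopen.eq_univ ⟨hclosed, hopen⟩ hne
  change x ∈ A
  rw [this]
  trivial

end Generic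

/-! ### Logarithmic coordinates on the hypersurface. -/

section Chart

/-- The logarithmic coordinates of a point of the hypersurface `t₁ ⋯ t₈ = 1`. -/
def logCoord (w : Fin 7 → ℂ) : Fin 8 → ℂ :=
  ![w 0, w 1, w 2, w 3, w 4, w 5, w 6, -(w 0 + w 1 + w 2 + w 3 + w 4 + w 5 + w 6)]

/-- The universal cover of the hypersurface `t₁ ⋯ t₈ = 1`. -/
def expChart (w : Fin 7 → ℂ) (j : Fin 8) : ℂ := Complex.exp (logCoord w j)

theorem logCoord_castSucc (w : Fin 7 → ℂ) (i : Fin 7) : logCoord w i.castSucc = w i := by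
  fin_cases i <;> rfl

theorem analyticAt_logCoord (j : Fin 8) (w : Fin 7 → ℂ) :
    AnalyticAt ℂ (fun w => logCoord w j) w := by
  have h : ∀ i, AnalyticAt ℂ (fun w : Fin 7 → ℂ => w i) w := fun i =>
    (ContinuousLinearMap.proj (R := ℂ) (φ := fun _ : Fin 7 => ℂ) i).analyticAt w
  fin_cases j
  exacts [h 0, h 1, h 2, h 3, h 4, h 5, h 6,
    (((((((h 0).add (h 1)).add (h 2)).add (h 3)).add (h 4)).add (h 5)).add (h 6)).neg]

theorem analyticAt_expChart_apply (j : Fin 8) (w : Fin 7 → ℂ) :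
    AnalyticAt ℂ (fun w => expChart w j) w := (analyticAt_logCoord j w).cexp

theorem analyticAt_expChart (w : Fin 7 → ℂ) : AnalyticAt ℂ expChart w :=
  analyticAt_pi_iff.2 fun j => analyticAt_expChart_apply j w

theorem expChart_ne_zero (w : Fin 7 → ℂ) (j : Fin 8) : expChart w j ≠ 0 := Complex.exp_ne_zero _

theorem expChart_mem_paramSpace (w : Fin 7 → ℂ) : expChart w ∈ paramSpace := by
  change ∏ j, Complex.exp (logCoord w j) = 1
  rw [← Complex.exp_sum, Fin.sum_univ_eight]
  simp only [logCoord, Matrix.cons_val]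
  rw [← Complex.exp_zero]
  congr 1
  ring

/-- A local inverse of `expChart` near `expChart w₀`. -/
def logChart (w₀ : Fin 7 → ℂ) (t : Fin 8 → ℂ) (i : Fin 7) : ℂ :=
  w₀ i + Complex.log (t i.castSucc / expChart w₀ i.castSucc)

theorem eq_of_mem_paramSpace {t u : Fin 8 → ℂ} (ht : t ∈ paramSpace) (hu : u ∈ paramSpace)
    (h : ∀ i : Fin 7, t i.castSucc = u i.castSucc) : t = u := by
  funext j
  refine Fin.lastCases ?_ h j
  have h1 : (∏ i : Fin 7, t i.castSucc) * t (Fin.last 7) = 1 := by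
    rw [← Fin.prod_univ_castSucc]; exact ht
  have h2 : (∏ i : Fin 7, u i.castSucc) * u (Fin.last 7) = 1 := by
    rw [← Fin.prod_univ_castSucc]; exact hu
  simp only [h] at h1
  exact mul_left_cancel₀ (left_ne_zero_of_mul_eq_one h1) (h1.trans h2.symm)

theorem expChart_logChart (w₀ : Fin 7 → ℂ) {t : Fin 8 → ℂ} (ht : t ∈ paramSpace) :
    expChart (logChart w₀ t) = t := by
  refine eq_of_mem_paramSpace (expChart_mem_paramSpace _) ht fun i => ?_
  have h0 := expChart_ne_zero w₀ i.castSucc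
  rw [expChart, logCoord_castSucc, logChart, Complex.exp_add,
    Complex.exp_log (div_ne_zero (ne_zero_of_mem_paramSpace ht _) h0), ← logCoord_castSucc w₀ i]
  exact mul_div_cancel₀ _ h0

theorem exists_expChart_eq {t : Fin 8 → ℂ} (ht : t ∈ paramSpace) : ∃ w, expChart w = t :=
  ⟨logChart 0 t, expChart_logChart 0 ht⟩

/-- The principal logarithm inverts the exponential as long as imaginary parts move by less than π;
this is why `logChart` is centred at `w₀`. -/
theorem eventually_logChart_expChart (w₀ : Fin 7 → ℂ) :
    ∀ᶠ w in 𝓝 w₀, logChart w₀ (expChart w) = w := by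
  have h : ∀ i, ∀ᶠ w in 𝓝 w₀, |((w i) - (w₀ i)).im| < Real.pi := fun i => by
    have : ContinuousAt (fun w : Fin 7 → ℂ => |((w i) - (w₀ i)).im|) w₀ :=
      (continuous_abs.comp (Complex.continuous_im.comp (by fun_prop))).continuousAt
    exact this.eventually_lt continuousAt_const (by simpa using Real.pi_pos)
  filter_upwards [eventually_all.2 h] with w hw
  funext i
  have := abs_lt.1 (hw i)
  rw [logChart, expChart, expChart, logCoord_castSucc, logCoord_castSucc, ← Complex.exp_sub,
    Complex.log_exp this.1 this.2.le]
  ring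

theorem logChart_expChart_self (w₀ : Fin 7 → ℂ) : logChart w₀ (expChart w₀) = w₀ :=
  (eventually_logChart_expChart w₀).self_of_nhds

theorem analyticAt_logChart (w₀ : Fin 7 → ℂ) : AnalyticAt ℂ (logChart w₀) (expChart w₀) := by
  refine analyticAt_pi_iff.2 fun i => analyticAt_const.add ?_
  have h : AnalyticAt ℂ (fun t : Fin 8 → ℂ => t i.castSucc) (expChart w₀) :=
    (ContinuousLinearMap.proj (R := ℂ) (φ := fun _ : Fin 8 => ℂ) i.castSucc).analyticAt _
  refine (h.div analyticAt_const (expChart_ne_zero w₀ _)).clog ?_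
  change expChart w₀ i.castSucc / expChart w₀ i.castSucc ∈ _
  rw [div_self (expChart_ne_zero w₀ _)]
  exact Complex.one_mem_slitPlane

/-- The covering map is a local homeomorphism onto the hypersurface. Statements relative to
`paramSpace` thereby become statements about full neighbourhoods in ℂ⁷. -/
theorem map_expChart_nhds (w₀ : Fin 7 → ℂ) :
    map expChart (𝓝 w₀) = 𝓝[paramSpace] (expChart w₀) := by
  refine le_antisymm ?_ fun s hs => ?_
  · exact tendsto_nhdsWithin_iff.2 ⟨(analyticAt_expChart w₀).continuousAt,
      Eventually.of_forall expChart_mem_paramSpace⟩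
  · have h := (analyticAt_logChart w₀).continuousAt.tendsto
    rw [logChart_expChart_self] at h
    filter_upwards [nhdsWithin_le_nhds (h hs), self_mem_nhdsWithin] with t ht ht'
    rw [Set.mem_preimage, Set.mem_preimage, expChart_logChart w₀ ht'] at ht
    exact ht

theorem generically_of_expChart {P : (Fin 8 → ℂ) → Prop}
    (h : ∀ w, HoldsGenericallyAt (fun w => P (expChart w)) w) : Generically P := by
  intro t₀ ht₀
  obtain ⟨w₀, rfl⟩ := exists_expChart_eq ht₀
  obtain ⟨k, hk, hk', hkP⟩ := h w₀
  refine ⟨fun t => k (logChart w₀ t), ?_, ?_, ?_⟩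
  · refine AnalyticAt.comp ?_ (analyticAt_logChart w₀)
    rwa [logChart_expChart_self]
  · rw [← map_expChart_nhds, frequently_map]
    refine (hk'.and_eventually (eventually_logChart_expChart w₀)).mono fun w hw => ?_
    simp only [hw.2]
    exact hw.1
  · rw [← map_expChart_nhds, eventually_map]
    filter_upwards [hkP, eventually_logChart_expChart w₀] with w hw hw'
    rwa [hw']

/-- The relation is only assumed off the zeros of `K`. Multiplying numerator and denominator by `K`
moves those points into the zero set of the denominator. -/
theorem isMeromorphic_of_expChart {F : (Fin 8 → ℂ) → ℂ} {G H K : (Fin 7 → ℂ) → ℂ}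
    (hG : ∀ w, AnalyticAt ℂ G w) (hH : IsEntireNonzero H) (hK : IsEntireNonzero K)
    (h : ∀ w, K w ≠ 0 → F (expChart w) * H w = G w) : IsMeromorphic F := by
  intro t₀ ht₀
  obtain ⟨w₀, rfl⟩ := exists_expChart_eq ht₀
  have hlog := analyticAt_logChart w₀
  have hKH := hK.mul hH
  refine ⟨fun t => K (logChart w₀ t) * G (logChart w₀ t),
    fun t => K (logChart w₀ t) * H (logChart w₀ t), ?_, ?_, ?_, ?_⟩
  · exact AnalyticAt.comp (g := fun w => K w * G w) ((hK.analyticAt _).mul (hG _)) hlog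
  · exact AnalyticAt.comp (g := fun w => K w * H w) (hKH.analyticAt _) hlog
  · rw [← map_expChart_nhds, frequently_map]
    refine ((hKH.frequently w₀).and_eventually (eventually_logChart_expChart w₀)).mono
      fun w hw => ?_
    simp only [hw.2]
    exact hw.1
  · rw [← map_expChart_nhds, eventually_map]
    filter_upwards [eventually_logChart_expChart w₀] with w hw hne
    simp only [hw] at hne ⊢
    rw [eq_div_iff hne, ← h w (left_ne_zero_of_mul hne)]
    ring

theorem IsMeromorphic.isMeromorphicNear {F : (Fin 8 → ℂ) → ℂ} (hF : IsMeromorphic F)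
    (w : Fin 7 → ℂ) : IsMeromorphicNear (fun w => F (expChart w)) w := by
  obtain ⟨g, h, hg, hh, hh', hF⟩ := hF _ (expChart_mem_paramSpace w)
  rw [← map_expChart_nhds] at hh' hF
  exact ⟨fun w => g (expChart w), fun w => h (expChart w), hg.comp (analyticAt_expChart w),
    hh.comp (analyticAt_expChart w), hh', hF⟩

end Chart

/-! ### Nonvanishing of theta factors by restriction to a generic line, and the symmetries of the
cover. -/

section Monomials

variable {q : ℂ}

/-- A point at which the logarithms of all relevant monomials are nonzero. -/
def genericPoint : Fin 7 → ℂ := ![1, 10, 100, 1000, 10000, 100000, 1000000]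

/-- `x` is a nowhere vanishing entire function of the form `c exp (n z)` on the line through
`genericPoint`. -/
structure IsMonomial (x : (Fin 7 → ℂ) → ℂ) (n : ℂ) : Prop where
  analyticAt : ∀ w, AnalyticAt ℂ x w
  ne_zero : ∀ w, x w ≠ 0
  line : ∀ z : ℂ, x (z • genericPoint) = x 0 * Complex.exp (n * z)

theorem isMonomial_const {c : ℂ} (hc : c ≠ 0) : IsMonomial (fun _ => c) 0 where
  analyticAt _ := analyticAt_const
  ne_zero _ := hc
  line z := by simp

theorem isMonomial_exp {l : (Fin 7 → ℂ) → ℂ} {n : ℂ} (hl : ∀ w, AnalyticAt ℂ l w)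
    (h : ∀ z : ℂ, l (z • genericPoint) = l 0 + n * z) :
    IsMonomial (fun w => Complex.exp (l w)) n where
  analyticAt w := (hl w).cexp
  ne_zero _ := Complex.exp_ne_zero _
  line z := by rw [h, Complex.exp_add]

namespace IsMonomial

variable {x y : (Fin 7 → ℂ) → ℂ} {n m : ℂ}

theorem mul (hx : IsMonomial x n) (hy : IsMonomial y m) :
    IsMonomial (fun w => x w * y w) (n + m) where
  analyticAt w := (hx.analyticAt w).mul (hy.analyticAt w)
  ne_zero w := mul_ne_zero (hx.ne_zero w) (hy.ne_zero w)
  line z := by rw [hx.line, hy.line, add_mul, Complex.exp_add]; ring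

theorem div (hx : IsMonomial x n) (hy : IsMonomial y m) :
    IsMonomial (fun w => x w / y w) (n - m) where
  analyticAt w := (hx.analyticAt w).div (hy.analyticAt w) (hy.ne_zero w)
  ne_zero w := div_ne_zero (hx.ne_zero w) (hy.ne_zero w)
  line z := by rw [hx.line, hy.line, sub_mul, Complex.exp_sub, mul_div_mul_comm]

theorem sq (hx : IsMonomial x n) : IsMonomial (fun w => x w ^ 2) (n + n) := by
  simpa only [pow_two] using hx.mul hx

theorem exists_eq (hx : IsMonomial x n) (hn : n ≠ 0) {c : ℂ} (hc : c ≠ 0) : ∃ w, x w = c := by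
  refine ⟨(Complex.log (c / x 0) / n) • genericPoint, ?_⟩
  rw [hx.line, mul_div_cancel₀ _ hn, Complex.exp_log (div_ne_zero hc (hx.ne_zero 0)),
    mul_div_cancel₀ _ (hx.ne_zero 0)]

/-- A monomial with nonzero exponent takes every nonzero value on the line, in particular 1/2, where
the product does not vanish. -/
theorem qPoch (hx : IsMonomial x n) (hq : ‖q‖ < 1) (hn : n ≠ 0) :
    IsEntireNonzero fun w => qPoch q (x w) where
  analyticAt w := analyticAt_qPoch hq (hx.analyticAt w)
  exists_ne_zero := by
    obtain ⟨w, hw⟩ := hx.exists_eq hn (c := 1 / 2) (by norm_num)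
    refine ⟨w, qPoch_ne_zero_of_norm_lt hq ?_⟩
    rw [hw]
    norm_num

/-- At a point of value √‖q‖ both arguments `x` and `q / x` have norm √‖q‖ < 1. -/
theorem theta (hx : IsMonomial x n) (hq0 : q ≠ 0) (hq : ‖q‖ < 1) (hn : n ≠ 0) :
    IsEntireNonzero fun w => theta q (x w) where
  analyticAt w := analyticAt_theta hq (hx.analyticAt w) (hx.ne_zero w)
  exists_ne_zero := by
    have h0 : 0 < ‖q‖ := norm_pos_iff.2 hq0
    have h1 : 0 < Real.sqrt ‖q‖ := Real.sqrt_pos.2 h0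
    have h2 : Real.sqrt ‖q‖ < 1 := by rwa [Real.sqrt_lt' one_pos, one_pow]
    have h3 : ‖((Real.sqrt ‖q‖ : ℝ) : ℂ)‖ = Real.sqrt ‖q‖ := by
      rw [Complex.norm_real, Real.norm_of_nonneg h1.le]
    obtain ⟨w, hw⟩ := hx.exists_eq hn (c := (Real.sqrt ‖q‖ : ℝ)) (by exact_mod_cast h1.ne')
    refine ⟨w, mul_ne_zero (qPoch_ne_zero_of_norm_lt hq ?_) (qPoch_ne_zero_of_norm_lt hq ?_)⟩
    · rwa [hw, h3]
    · rwa [hw, norm_div, h3, Real.div_sqrt]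

end IsMonomial

/-- The exponents of the coordinates along the line through `genericPoint`. -/
def genericExponent : Fin 8 → ℂ := ![1, 10, 100, 1000, 10000, 100000, 1000000, -1111111]

theorem isMonomial_expChart (j : Fin 8) :
    IsMonomial (fun w => expChart w j) (genericExponent j) := by
  refine isMonomial_exp (analyticAt_logCoord j) fun z => ?_
  fin_cases j <;>
    simp only [logCoord, genericPoint, genericExponent, Pi.smul_apply, smul_eq_mul, Pi.zero_apply,
      Matrix.cons_val, Fin.reduceFinMk, Fin.zero_eta, Fin.mk_one] <;> ring

/-- A logarithm of the parameter `s` with `s² t₂ t₃ t₄ t₅ = 1`. -/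
def logScale (w : Fin 7 → ℂ) : ℂ := -(w 1 + w 2 + w 3 + w 4) / 2

theorem analyticAt_coord (i : Fin 7) (w : Fin 7 → ℂ) :
    AnalyticAt ℂ (fun w : Fin 7 → ℂ => w i) w :=
  (ContinuousLinearMap.proj (R := ℂ) (φ := fun _ : Fin 7 => ℂ) i).analyticAt w

theorem analyticAt_logScale (w : Fin 7 → ℂ) : AnalyticAt ℂ logScale w :=
  ((((analyticAt_coord 1 w).add (analyticAt_coord 2 w)).add (analyticAt_coord 3 w)).add
    (analyticAt_coord 4 w)).neg.div analyticAt_const two_ne_zero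

/-- The parameter `s` with `s² t₂ t₃ t₄ t₅ = 1`. -/
def scale (w : Fin 7 → ℂ) : ℂ := Complex.exp (logScale w)

theorem isMonomial_scale : IsMonomial scale (-5555) := by
  refine isMonomial_exp analyticAt_logScale fun z => ?_
  simp only [logScale, genericPoint, Pi.smul_apply, smul_eq_mul, Pi.zero_apply, Matrix.cons_val]
  ring

theorem scale_sq_mul (w : Fin 7 → ℂ) :
    scale w ^ 2 * expChart w 1 * expChart w 2 * expChart w 3 * expChart w 4 = 1 := by
  simp only [scale, expChart, logCoord, Matrix.cons_val, ← Complex.exp_nat_mul, ← Complex.exp_add]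
  rw [← Complex.exp_zero]
  congr 1
  rw [logScale]
  push_cast
  ring

theorem eq_or_eq_neg_scale {s : ℂ} {w : Fin 7 → ℂ}
    (hs : s ^ 2 * expChart w 1 * expChart w 2 * expChart w 3 * expChart w 4 = 1) :
    s = scale w ∨ s = -scale w := by
  rw [← sq_eq_sq_iff_eq_or_eq_neg]
  have h := hs.trans (scale_sq_mul w).symm
  simpa only [mul_left_inj' (expChart_ne_zero w _)] using h

/-- The lift of `t ↦ suParam s t` to the universal cover. -/
def reflect (w : Fin 7 → ℂ) : Fin 7 → ℂ :=
  ![w 5 - logScale w, w 1 + logScale w, w 2 + logScale w, w 3 + logScale w, w 4 + logScale w,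
    w 0 - logScale w, logCoord w 7 - logScale w]

theorem analyticAt_reflect (w : Fin 7 → ℂ) : AnalyticAt ℂ reflect w := by
  have h := analyticAt_coord (w := w)
  have hs := analyticAt_logScale w
  refine analyticAt_pi_iff.2 fun i => ?_
  fin_cases i
  exacts [(h 5).sub hs, (h 1).add hs, (h 2).add hs, (h 3).add hs, (h 4).add hs, (h 0).sub hs,
    (analyticAt_logCoord 7 w).sub hs]

theorem logScale_reflect (w : Fin 7 → ℂ) : logScale (reflect w) = -logScale w := by
  simp only [reflect, logScale, Matrix.cons_val]
  ring

/-- The coordinates 0, 5 and 6, 7 are exchanged and the scale changes sign. Being an involution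
makes `reflect` a homeomorphism, so generic conditions can be pulled back along it. -/
theorem reflect_involutive : Function.Involutive reflect := by
  intro w
  rw [reflect, logScale_reflect]
  funext i
  fin_cases i <;> simp only [reflect, logCoord, Matrix.cons_val, Fin.reduceFinMk, Fin.zero_eta,
      Fin.mk_one] <;> [ring; ring; ring; ring; ring; ring; (rw [logScale]; ring)]

/-- `reflect` as a homeomorphism. -/
def reflectHomeomorph : (Fin 7 → ℂ) ≃ₜ (Fin 7 → ℂ) where
  toEquiv := reflect_involutive.toPerm
  continuous_toFun := continuous_iff_continuousAt.2 fun w => (analyticAt_reflect w).continuousAt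
  continuous_invFun := continuous_iff_continuousAt.2 fun w => (analyticAt_reflect w).continuousAt

theorem expChart_reflect (w : Fin 7 → ℂ) : expChart (reflect w) = suParam (scale w) (expChart w) := by
  funext j
  fin_cases j <;> simp only [expChart, suParam, scale, reflect, logCoord, Matrix.cons_val,
    Fin.reduceFinMk, Fin.zero_eta, Fin.mk_one, Complex.exp_add, Complex.exp_sub] <;>
    [ring; ring; ring; ring; skip]
  rw [← Complex.exp_sub]
  congr 1
  rw [logScale]
  ring

/-- The lift of `t ↦ -t` to the universal cover. -/
def shiftHomeomorph : (Fin 7 → ℂ) ≃ₜ (Fin 7 → ℂ) :=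
  Homeomorph.addRight fun _ => (Real.pi : ℂ) * Complex.I

theorem shiftHomeomorph_apply (w : Fin 7 → ℂ) (i : Fin 7) :
    shiftHomeomorph w i = w i + Real.pi * Complex.I := rfl

theorem analyticAt_shiftHomeomorph (w : Fin 7 → ℂ) : AnalyticAt ℂ shiftHomeomorph w :=
  analyticAt_id.add analyticAt_const

theorem expChart_shiftHomeomorph (w : Fin 7 → ℂ) : expChart (shiftHomeomorph w) = -expChart w := by
  funext j
  refine Fin.lastCases ?_ (fun i => ?_) j
  · change Complex.exp (-(shiftHomeomorph w 0 + shiftHomeomorph w 1 + shiftHomeomorph w 2 +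
      shiftHomeomorph w 3 + shiftHomeomorph w 4 + shiftHomeomorph w 5 + shiftHomeomorph w 6)) =
      -Complex.exp (-(w 0 + w 1 + w 2 + w 3 + w 4 + w 5 + w 6))
    simp only [shiftHomeomorph_apply]
    -- The dependent coordinate moves by -7πi = πi - 4 · 2πi, so it changes sign as well.
    rw [show -((w 0 + (Real.pi : ℂ) * Complex.I) + (w 1 + (Real.pi : ℂ) * Complex.I) +
      (w 2 + (Real.pi : ℂ) * Complex.I) + (w 3 + (Real.pi : ℂ) * Complex.I) +
      (w 4 + (Real.pi : ℂ) * Complex.I) + (w 5 + (Real.pi : ℂ) * Complex.I) +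
      (w 6 + (Real.pi : ℂ) * Complex.I)) = -(w 0 + w 1 + w 2 + w 3 + w 4 + w 5 + w 6) +
      Real.pi * Complex.I + (-4 : ℤ) * (2 * Real.pi * Complex.I) by push_cast; ring,
      Complex.exp_add, Complex.exp_int_mul_two_pi_mul_I, Complex.exp_add, Complex.exp_pi_mul_I]
    ring
  · rw [Pi.neg_apply, expChart, expChart, logCoord_castSucc, logCoord_castSucc]
    rw [shiftHomeomorph_apply, Complex.exp_add, Complex.exp_pi_mul_I, mul_neg_one]

end Monomials

/-! ### Entire numerators and denominators for the series and the prefactor. -/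

section Denominators

variable {q : ℂ}

/-- The denominator of `uSeries`. -/
def uDenom (q : ℂ) (τ : Fin 8 → ℂ) : ℂ :=
  theta q (τ 7 / τ 0) *
    ((∏ i, qPoch q (uParam q τ i * τ 0)) * ∏ i, qPoch q (uParam q τ i * τ 7))

/-- The numerator of `uSeries`. -/
def uNum (q : ℂ) (τ : Fin 8 → ℂ) : ℂ :=
  2 / (τ 0 * qPoch q q ^ 2) *
    (τ 0 * vwpSum q (τ 0 ^ 2 / q) (fun i => τ 0 / uParam q τ i) (fun i => uParam q τ i * τ 0) *
        (∏ i, qPoch q (uParam q τ i * τ 7)) -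
      τ 7 * vwpSum q (τ 7 ^ 2 / q) (fun i => τ 7 / uParam q τ i) (fun i => uParam q τ i * τ 7) *
        ∏ i, qPoch q (uParam q τ i * τ 0))

theorem uSeries_mul_uDenom {τ : Fin 8 → ℂ} (h : uDenom q τ ≠ 0) :
    uSeries q τ * uDenom q τ = uNum q τ := by
  obtain ⟨h1, h2⟩ := mul_ne_zero_iff.1 h
  obtain ⟨h2, h3⟩ := mul_ne_zero_iff.1 h2
  rw [uSeries, uDenom, uNum, uBase, uBase]
  generalize theta q (τ 7 / τ 0) = T at *
  generalize ∏ i, qPoch q (uParam q τ i * τ 0) = A at *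
  generalize ∏ i, qPoch q (uParam q τ i * τ 7) = B at *
  generalize vwpSum (ι := Fin 8) q (τ 0 ^ 2 / q) _ _ = V
  generalize vwpSum (ι := Fin 8) q (τ 7 ^ 2 / q) _ _ = V'
  simp only [div_eq_mul_inv, mul_inv]
  generalize (τ 0)⁻¹ = u
  generalize (qPoch q q ^ 2)⁻¹ = P
  field_simp

/-- The exponents of `uParam` along the line through `genericPoint`. -/
def uExponent : Fin 8 → ℂ := ![10, 100, 1000, 10000, 100000, 1000000, 1, -1111111]

theorem isMonomial_uParam (hq0 : q ≠ 0) (i : Fin 8) :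
    IsMonomial (fun w => uParam q (expChart w) i) (uExponent i) := by
  have h : ∀ j n, genericExponent j - 0 = n →
      IsMonomial (fun w => expChart w j / q) n := fun j n hn =>
    hn ▸ (isMonomial_expChart j).div (isMonomial_const hq0)
  have h6 := h 0 1 (by simp [genericExponent])
  have h7 := h 7 (-1111111) (by simp [genericExponent])
  fin_cases i
  exacts [isMonomial_expChart 1, isMonomial_expChart 2, isMonomial_expChart 3,
    isMonomial_expChart 4, isMonomial_expChart 5, isMonomial_expChart 6, h6, h7]

/-- Every argument is a monomial, and the powers of ten in `genericPoint` keep its exponent from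
cancelling to zero. The denominators below are treated in the same way. -/
theorem isEntireNonzero_uDenom (hq0 : q ≠ 0) (hq : ‖q‖ < 1) :
    IsEntireNonzero fun w => uDenom q (expChart w) := by
  have hE := isMonomial_expChart
  have hU := isMonomial_uParam hq0
  refine (((hE 7).div (hE 0)).theta hq0 hq ?_).mul
    ((IsEntireNonzero.prod _ fun i _ => ((hU i).mul (hE 0)).qPoch hq ?_).mul
      (IsEntireNonzero.prod _ fun i _ => ((hU i).mul (hE 7)).qPoch hq ?_))
  · simp only [genericExponent, Matrix.cons_val]
    norm_num
  · fin_cases i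
    all_goals
      simp only [genericExponent, uExponent, Matrix.cons_val, Fin.reduceFinMk, Fin.zero_eta,
        Fin.mk_one]
      norm_num
  · fin_cases i
    all_goals
      simp only [genericExponent, uExponent, Matrix.cons_val, Fin.reduceFinMk, Fin.zero_eta,
        Fin.mk_one]
      norm_num

theorem analyticAt_uNum (hq0 : q ≠ 0) (hq : ‖q‖ < 1) (w : Fin 7 → ℂ) :
    AnalyticAt ℂ (fun w => uNum q (expChart w)) w := by
  have hE := isMonomial_expChart
  have hU := isMonomial_uParam hq0
  have hV : ∀ j, AnalyticAt ℂ (fun w => vwpSum q (expChart w j ^ 2 / q)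
      (fun i => expChart w j / uParam q (expChart w) i)
      (fun i => uParam q (expChart w) i * expChart w j)) w := fun j =>
    analyticAt_vwpSum hq (((hE j).sq.div (isMonomial_const hq0)).analyticAt w)
      (fun i => ((hE j).div (hU i)).analyticAt w) fun i => ((hU i).mul (hE j)).analyticAt w
  have hP : ∀ j, AnalyticAt ℂ (fun w => ∏ i, qPoch q (uParam q (expChart w) i * expChart w j)) w :=
    fun j => Finset.analyticAt_fun_prod _ fun i _ =>
      analyticAt_qPoch hq (((hU i).mul (hE j)).analyticAt w)
  have h0 : expChart w 0 * qPoch q q ^ 2 ≠ 0 :=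
    mul_ne_zero (expChart_ne_zero w 0) (pow_ne_zero 2 (qPoch_self_ne_zero hq))
  exact (analyticAt_const.div (((hE 0).analyticAt w).mul analyticAt_const) h0).mul
    (((((hE 0).analyticAt w).mul (hV 0)).mul (hP 7)).sub
      ((((hE 7).analyticAt w).mul (hV 7)).mul (hP 0)))

/-- The numerator of `suFactor`. -/
def suNum (q : ℂ) (t : Fin 8 → ℂ) : ℂ :=
  (qPoch q (t 1 * t 2) * qPoch q (t 1 * t 3) * qPoch q (t 1 * t 4) * qPoch q (t 2 * t 3) *
    qPoch q (t 2 * t 4) * qPoch q (t 3 * t 4)) * qPoch q (t 5 * t 6)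

/-- The denominator of `suFactor`. -/
def suDenom (q : ℂ) (t : Fin 8 → ℂ) : ℂ :=
  qPoch q (1 / (q * t 0 * t 7)) * qPoch q (1 / (t 0 * t 5)) * qPoch q (1 / (t 0 * t 6)) *
    qPoch q (1 / (t 7 * t 5)) * qPoch q (1 / (t 7 * t 6))

theorem suFactor_eq_div (q : ℂ) (t : Fin 8 → ℂ) : suFactor q t = suNum q t / suDenom q t :=
  suFactor_eq q t

theorem isEntireNonzero_suNum (hq : ‖q‖ < 1) :
    IsEntireNonzero fun w => suNum q (expChart w) := by
  have h : ∀ i j, genericExponent i + genericExponent j ≠ 0 →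
      IsEntireNonzero fun w => qPoch q (expChart w i * expChart w j) := fun i j hij =>
    ((isMonomial_expChart i).mul (isMonomial_expChart j)).qPoch hq hij
  refine ((((((h 1 2 ?_).mul (h 1 3 ?_)).mul (h 1 4 ?_)).mul (h 2 3 ?_)).mul (h 2 4 ?_)).mul
    (h 3 4 ?_)).mul (h 5 6 ?_)
  all_goals try simp only [genericExponent, Matrix.cons_val]
  all_goals norm_num

theorem isEntireNonzero_suDenom (hq0 : q ≠ 0) (hq : ‖q‖ < 1) :
    IsEntireNonzero fun w => suDenom q (expChart w) := by
  have hE := isMonomial_expChart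
  have h : ∀ i j, 0 - (genericExponent i + genericExponent j) ≠ 0 →
      IsEntireNonzero fun w => qPoch q (1 / (expChart w i * expChart w j)) := fun i j hij =>
    ((isMonomial_const one_ne_zero).div ((hE i).mul (hE j))).qPoch hq hij
  refine ((((((isMonomial_const one_ne_zero).div (((isMonomial_const hq0).mul (hE 0)).mul
    (hE 7))).qPoch hq ?_).mul (h 0 5 ?_)).mul (h 0 6 ?_)).mul (h 7 5 ?_)).mul (h 7 6 ?_)
  all_goals try simp only [genericExponent, Matrix.cons_val]
  all_goals norm_num

/-- The product of the theta functions of the resonances. -/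
def resonanceDenom (q : ℂ) (w : Fin 7 → ℂ) : ℂ :=
  let s := scale w
  let x₁ := expChart w 5 / s
  let x₂ := expChart w 6 / s
  let y₃ := expChart w 0 / s
  let y₄ := expChart w 7 / s
  theta q (x₂ / x₁) * theta q (x₁ ^ 2) * theta q (x₂ ^ 2) * theta q (x₁ * x₂) * theta q (s ^ 2) *
    theta q (y₃ * y₄) * theta q ((s * y₃) * (s * y₃)) * theta q ((s * y₃) * (s * y₄)) *
    theta q ((s * y₄) * (s * y₄)) * theta q (x₁ / y₃) * theta q (x₁ / y₄) * theta q (y₃ * x₁) *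
    theta q (y₄ * x₁) * theta q (y₃ * x₂) * theta q (y₄ * x₂)

theorem isEntireNonzero_resonanceDenom (hq0 : q ≠ 0) (hq : ‖q‖ < 1) :
    IsEntireNonzero (resonanceDenom q) := by
  have hs := isMonomial_scale
  have x₁ := (isMonomial_expChart 5).div hs
  have x₂ := (isMonomial_expChart 6).div hs
  have y₃ := (isMonomial_expChart 0).div hs
  have y₄ := (isMonomial_expChart 7).div hs
  refine ((((((((((((((((x₂.div x₁).theta hq0 hq ?_).mul (x₁.sq.theta hq0 hq ?_)).mul
    (x₂.sq.theta hq0 hq ?_)).mul ((x₁.mul x₂).theta hq0 hq ?_)).mul (hs.sq.theta hq0 hq ?_)).mul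
    ((y₃.mul y₄).theta hq0 hq ?_)).mul (((hs.mul y₃).mul (hs.mul y₃)).theta hq0 hq ?_)).mul
    (((hs.mul y₃).mul (hs.mul y₄)).theta hq0 hq ?_)).mul
    (((hs.mul y₄).mul (hs.mul y₄)).theta hq0 hq ?_)).mul ((x₁.div y₃).theta hq0 hq ?_)).mul
    ((x₁.div y₄).theta hq0 hq ?_)).mul ((y₃.mul x₁).theta hq0 hq ?_)).mul
    ((y₄.mul x₁).theta hq0 hq ?_)).mul ((y₃.mul x₂).theta hq0 hq ?_)).mul
    ((y₄.mul x₂).theta hq0 hq ?_))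
  all_goals try simp only [genericExponent, Matrix.cons_val]
  all_goals norm_num

theorem theta_ne_zero_of_mem_wpResonances {w : Fin 7 → ℂ} (h : resonanceDenom q w ≠ 0) :
    ∀ u ∈ wpResonances (scale w) (expChart w 5 / scale w) (expChart w 6 / scale w)
      (expChart w 0 / scale w) (expChart w 7 / scale w), theta q u ≠ 0 := by
  simp only [resonanceDenom, mul_ne_zero_iff] at h
  simp only [wpResonances, Set.mem_insert_iff, Set.mem_singleton_iff, forall_eq_or_imp, forall_eq]
  tauto

/-- A function whose nonvanishing makes all terms of `seriesU` well defined. -/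
def seriesDenom (q : ℂ) (τ : Fin 8 → ℂ) : ℂ :=
  qPoch q (τ 0 ^ 2 / q) * qPoch q (τ 7 ^ 2 / q) * theta q (τ 7 / τ 0) *
    ∏ j ∈ Finset.Icc (1 : Fin 8) 6, (qPoch q (τ 0 / τ j) * qPoch q (τ 7 / τ j))

theorem isEntireNonzero_seriesDenom (hq0 : q ≠ 0) (hq : ‖q‖ < 1) :
    IsEntireNonzero fun w => seriesDenom q (expChart w) := by
  have hE := isMonomial_expChart
  have hc := isMonomial_const hq0
  refine (((((hE 0).sq.div hc).qPoch hq ?_).mul (((hE 7).sq.div hc).qPoch hq ?_)).mul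
    (((hE 7).div (hE 0)).theta hq0 hq ?_)).mul (IsEntireNonzero.prod _ fun j hj =>
    (((hE 0).div (hE j)).qPoch hq ?_).mul (((hE 7).div (hE j)).qPoch hq ?_))
  · simp only [genericExponent, Matrix.cons_val]
    norm_num
  · simp only [genericExponent, Matrix.cons_val]
    norm_num
  · simp only [genericExponent, Matrix.cons_val]
    norm_num
  · fin_cases j
    on_goal 1 => exact absurd hj (by decide)
    on_goal 7 => exact absurd hj (by decide)
    all_goals
      simp only [genericExponent, Matrix.cons_val, Fin.reduceFinMk, Fin.mk_one]
      norm_num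
  · fin_cases j
    on_goal 1 => exact absurd hj (by decide)
    on_goal 7 => exact absurd hj (by decide)
    all_goals
      simp only [genericExponent, Matrix.cons_val, Fin.reduceFinMk, Fin.mk_one]
      norm_num

theorem seriesU_eq_uSeries_of_seriesDenom (hq0 : q ≠ 0) (hq : ‖q‖ < 1) {τ : Fin 8 → ℂ}
    (hτ : ∀ j, τ j ≠ 0) (h : seriesDenom q τ ≠ 0) : seriesU q τ = uSeries q τ := by
  obtain ⟨h, h4⟩ := mul_ne_zero_iff.1 h
  obtain ⟨h, h3⟩ := mul_ne_zero_iff.1 h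
  obtain ⟨h1, h2⟩ := mul_ne_zero_iff.1 h
  exact seriesU_eq_uSeries hq0 hq hτ h1 h2 h3 fun j hj =>
    mul_ne_zero_iff.1 (Finset.prod_ne_zero_iff.1 h4 j hj)

end Denominators

/-! ### Invariance under t ↦ -t. -/

section Parity

variable (q : ℂ)

theorem uParam_neg (τ : Fin 8 → ℂ) : uParam q (-τ) = -uParam q τ := by
  funext i
  fin_cases i <;> simp [uParam, neg_div]

theorem uBase_neg (τ : Fin 8 → ℂ) (x : ℂ) : uBase q (-τ) (-x) = -uBase q τ x := by
  simp only [uBase, uParam_neg, Pi.neg_apply, neg_mul_neg, neg_div_neg_eq, neg_sq]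
  rw [neg_div, neg_mul]

/-- The prefactor and both values of `uBase` are odd. -/
theorem uSeries_neg (τ : Fin 8 → ℂ) : uSeries q (-τ) = uSeries q τ := by
  simp only [uSeries, uBase_neg, Pi.neg_apply, neg_div_neg_eq]
  rw [neg_mul, neg_mul, div_neg]
  ring

theorem suFactor_neg (t : Fin 8 → ℂ) : suFactor q (-t) = suFactor q t := by
  simp only [suFactor_eq, Pi.neg_apply, mul_neg, neg_mul, neg_neg]

theorem suParam_neg (s : ℂ) (t : Fin 8 → ℂ) : suParam s (-t) = -suParam s t := by
  funext i
  fin_cases i <;> simp [suParam, neg_div]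

theorem suParam_neg_left (s : ℂ) (t : Fin 8 → ℂ) : suParam (-s) t = -suParam s t := by
  funext i
  fin_cases i <;> simp [suParam, div_neg]

end Parity

/-! ### The meromorphic function S. -/

section TrigS

variable {q : ℂ}

/-- The two square roots differ by a sign, which changes all parameters by a sign, and the series is
even. Hence either choice of `s` gives the same value. -/
theorem uSeries_suParam_expChart {s : ℂ} {w : Fin 7 → ℂ}
    (hs : s ^ 2 * expChart w 1 * expChart w 2 * expChart w 3 * expChart w 4 = 1) :
    uSeries q (suParam s (expChart w)) = uSeries q (expChart (reflect w)) := by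
  rw [expChart_reflect]
  rcases eq_or_eq_neg_scale hs with rfl | rfl
  · rfl
  · rw [suParam_neg_left, uSeries_neg]

open Classical in
/-- The function `S_t`: the contour integral if there is a contour, and the sum of two
very-well-poised series otherwise. -/
def trigS (q : ℂ) (t : Fin 8 → ℂ) : ℂ :=
  if h : ∃ γ, IsContourS q t γ then integralS q t h.choose
  else uSeries q (suParam (((t 1 * t 2 * t 3 * t 4)⁻¹) ^ (1 / 2 : ℂ)) t) / suFactor q t

/-- A function of `w` off whose zeros the formula for `S_t` holds. -/
def sDenom (q : ℂ) (w : Fin 7 → ℂ) : ℂ :=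
  suNum q (expChart w) * suDenom q (expChart w) * resonanceDenom q w *
    uDenom q (expChart (reflect w))

theorem isEntireNonzero_uDenom_reflect (hq0 : q ≠ 0) (hq : ‖q‖ < 1) :
    IsEntireNonzero fun w => uDenom q (expChart (reflect w)) :=
  (isEntireNonzero_uDenom hq0 hq).comp reflectHomeomorph analyticAt_reflect

theorem isEntireNonzero_sDenom (hq0 : q ≠ 0) (hq : ‖q‖ < 1) : IsEntireNonzero (sDenom q) :=
  (((isEntireNonzero_suNum hq).mul (isEntireNonzero_suDenom hq0 hq)).mul
    (isEntireNonzero_resonanceDenom hq0 hq)).mul (isEntireNonzero_uDenom_reflect hq0 hq)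

theorem suFactor_ne_zero {w : Fin 7 → ℂ} (hw : sDenom q w ≠ 0) : suFactor q (expChart w) ≠ 0 := by
  simp only [sDenom, mul_ne_zero_iff] at hw
  rw [suFactor_eq_div]
  exact div_ne_zero hw.1.1.1 hw.1.1.2

/-- Clearing denominators puts the evaluation into the form `f * H = G` with entire `G` and `H`
required by the identity theorem. -/
theorem mul_suFactor_eq_uSeries_iff {w : Fin 7 → ℂ} (hw : sDenom q w ≠ 0) (x : ℂ) :
    x * suFactor q (expChart w) = uSeries q (expChart (reflect w)) ↔
      x * (suNum q (expChart w) * uDenom q (expChart (reflect w))) =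
        uNum q (expChart (reflect w)) * suDenom q (expChart w) := by
  simp only [sDenom, mul_ne_zero_iff] at hw
  obtain ⟨⟨⟨-, h2⟩, -⟩, h4⟩ := hw
  rw [← uSeries_mul_uDenom h4, suFactor_eq_div, ← mul_div_assoc, div_eq_iff h2]
  constructor
  · intro h
    linear_combination uDenom q (expChart (reflect w)) * h
  · intro h
    refine mul_right_cancel₀ h4 ?_
    linear_combination h

theorem integralS_mul_suFactor_expChart (hq0 : q ≠ 0) (hq : ‖q‖ < 1) {w : Fin 7 → ℂ}
    (hw : sDenom q w ≠ 0) {γ : ℝ → ℂ} (hγ : IsContourS q (expChart w) γ) :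
    integralS q (expChart w) γ * suFactor q (expChart w) = uSeries q (expChart (reflect w)) := by
  simp only [sDenom, mul_ne_zero_iff] at hw
  rw [expChart_reflect]
  exact integralS_mul_suFactor hq0 hq (expChart_mem_paramSpace w) (scale_sq_mul w)
    (theta_ne_zero_of_mem_wpResonances hw.1.2) hγ

theorem trigS_mul_suFactor (hq0 : q ≠ 0) (hq : ‖q‖ < 1) {w : Fin 7 → ℂ} (hw : sDenom q w ≠ 0) :
    trigS q (expChart w) * suFactor q (expChart w) = uSeries q (expChart (reflect w)) := by
  rw [trigS]
  split_ifs with h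
  · exact integralS_mul_suFactor_expChart hq0 hq hw h.choose_spec
  · rw [div_mul_cancel₀ _ (suFactor_ne_zero hw), uSeries_suParam_expChart]
    have h0 := expChart_ne_zero w
    rw [one_div, show (2 : ℂ)⁻¹ = ((2 : ℕ) : ℂ)⁻¹ by norm_num,
      Complex.cpow_nat_inv_pow _ two_ne_zero]
    have := h0 1
    have := h0 2
    have := h0 3
    have := h0 4
    field_simp

/-- In either branch of the definition the series formula holds off the zeros of `sDenom`, which
gives meromorphy. The agreement with every contour integral is independence of the contour. -/
theorem isTrigS_trigS (hq0 : q ≠ 0) (hq : ‖q‖ < 1) : IsTrigS q (trigS q) := by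
  refine ⟨isMeromorphic_of_expChart
    (G := fun w => uNum q (expChart (reflect w)) * suDenom q (expChart w))
    (fun w => ?_) ((isEntireNonzero_suNum hq).mul (isEntireNonzero_uDenom_reflect hq0 hq))
    (isEntireNonzero_sDenom hq0 hq) fun w hw =>
      (mul_suFactor_eq_uSeries_iff hw _).1 (trigS_mul_suFactor hq0 hq hw), fun t ht γ hγ => ?_⟩
  · exact ((analyticAt_uNum hq0 hq (reflect w)).comp (analyticAt_reflect w)).mul
      ((isEntireNonzero_suDenom hq0 hq).analyticAt w)
  · have h : ∃ γ, IsContourS q t γ := ⟨γ, hγ⟩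
    rw [trigS, dif_pos h]
    exact integralS_eq_integralS hq0 hq ht hγ h.choose_spec

theorem isContourS_circle (hq0 : q ≠ 0) (hq : ‖q‖ < 1) {t : Fin 8 → ℂ}
    (ht : ∀ j ∈ Finset.Icc (1 : Fin 8) 6, t j ≠ 0 ∧ ‖t j‖ < 1) :
    IsContourS q t (circleMap 0 1) := by
  have h := enclosesOrbits_circle (q := q) hq
    (S := {x | ∃ j ∈ Finset.Icc (1 : Fin 8) 6, x = t j}) (by
      rintro _ ⟨j, hj, rfl⟩
      exact ht j hj) hq0
  refine ⟨h.isLoop.contDiff, h.isLoop.periodic, ?_, ?_, ?_, ?_⟩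
  · rintro _ (rfl | ⟨j, hj, n, rfl⟩)
    · exact h.ne_zero
    · exact h.ne_orbit _ ⟨j, hj, rfl⟩ n
  · rintro _ ⟨j, hj, n, rfl⟩
    exact h.ne_inv _ ⟨j, hj, rfl⟩ n
  · rintro _ (rfl | ⟨j, hj, n, rfl⟩)
    · exact h.winding_zero
    · exact h.winding_orbit _ ⟨j, hj, rfl⟩ n
  · rintro _ ⟨j, hj, n, rfl⟩
    exact h.winding_inv _ ⟨j, hj, rfl⟩ n

/-- On a nonempty open set the unit circle is a contour, so there `S` is an explicit integral and
the series formula applies. The identity theorem carries the formula to the neighbourhood of any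
point. -/
theorem IsTrigS.holdsGenericallyAt (hq0 : q ≠ 0) (hq : ‖q‖ < 1) {S : (Fin 8 → ℂ) → ℂ}
    (hS : IsTrigS q S) (x : Fin 7 → ℂ) :
    HoldsGenericallyAt (fun w => suFactor q (expChart w) ≠ 0 ∧
      S (expChart w) * suFactor q (expChart w) = uSeries q (expChart (reflect w))) x := by
  have hK := isEntireNonzero_sDenom hq0 hq
  -- At this point `t₁, ..., t₇` equal exp(-1), so `t₂, ..., t₇` lie in the unit disc; `t₈` is
  -- large, but it is unconstrained for S.
  have hev : ∀ᶠ w in 𝓝 (fun _ => -1 : Fin 7 → ℂ),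
      ∀ j ∈ Finset.Icc (1 : Fin 8) 6, ‖expChart w j‖ < 1 := by
    refine (Finset.Icc (1 : Fin 8) 6).eventually_all.2 fun j hj => ?_
    refine (analyticAt_expChart_apply j _).continuousAt.norm.eventually_lt continuousAt_const ?_
    have : logCoord (fun _ => -1) j = -1 := by
      fin_cases j
      on_goal 1 => exact absurd hj (by decide)
      on_goal 7 => exact absurd hj (by decide)
      all_goals rfl
    rw [expChart, this, Complex.norm_exp]
    simp
  obtain ⟨w₀, hw₀, hw₀'⟩ := ((hK.frequently _).and_eventually hev.eventually_nhds).exists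
  have h := holdsGenericallyAt_mul_eq (f := fun w => S (expChart w))
    (G := fun w => uNum q (expChart (reflect w)) * suDenom q (expChart w))
    (H := fun w => suNum q (expChart w) * uDenom q (expChart (reflect w)))
    hS.1.isMeromorphicNear
    (fun w => ((analyticAt_uNum hq0 hq (reflect w)).comp (analyticAt_reflect w)).mul
      ((isEntireNonzero_suDenom hq0 hq).analyticAt w))
    ((isEntireNonzero_suNum hq).mul (isEntireNonzero_uDenom_reflect hq0 hq)).analyticAt
    (x₀ := w₀) (by
      filter_upwards [hw₀', (hK.analyticAt w₀).continuousAt.eventually_ne hw₀] with w hw hw'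
      have hγ := isContourS_circle hq0 hq fun j hj => ⟨expChart_ne_zero w j, hw j hj⟩
      rw [← hS.2 _ (expChart_mem_paramSpace w) _ hγ]
      exact (mul_suFactor_eq_uSeries_iff hw' _).1
        (integralS_mul_suFactor_expChart hq0 hq hw' hγ)) x
  refine (h.and (hK.holdsGenericallyAt (fun _ => id) x)).mono fun w ⟨h1, h2⟩ => ?_
  exact ⟨suFactor_ne_zero h2, (mul_suFactor_eq_uSeries_iff h2 _).2 h1⟩

end TrigS

/-! ### The meromorphic function U. -/

section TrigU

variable {q : ℂ}

open Classical in
/-- The function `U_t`: the contour integral if there is a contour, and the sum of two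
very-well-poised series otherwise. -/
def trigU (q : ℂ) (t : Fin 8 → ℂ) : ℂ :=
  if h : ∃ p : ℂ × (ℝ → ℂ), p.1 ≠ 0 ∧ theta q (t 0 / p.1) ≠ 0 ∧ theta q (t 7 / p.1) ≠ 0 ∧
      IsContourU q t p.2 then integralU q h.choose.1 t h.choose.2
  else uSeries q t

theorem trigU_eq_uSeries (hq0 : q ≠ 0) (hq : ‖q‖ < 1) {w : Fin 7 → ℂ}
    (hw : uDenom q (expChart w) ≠ 0) : trigU q (expChart w) = uSeries q (expChart w) := by
  rw [trigU]
  split_ifs with h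
  · obtain ⟨h1, h2, h3, h4⟩ := h.choose_spec
    exact integralU_eq_uSeries hq0 hq (expChart_ne_zero w) h1 h2 h3 (left_ne_zero_of_mul hw) h4
  · rfl

theorem isTrigU_trigU (hq0 : q ≠ 0) (hq : ‖q‖ < 1) : IsTrigU q (trigU q) := by
  have hK := isEntireNonzero_uDenom hq0 hq
  refine ⟨isMeromorphic_of_expChart (analyticAt_uNum hq0 hq) hK hK fun w hw => ?_,
    fun t ht μ hμ h0 h7 γ hγ => ?_⟩
  · rw [trigU_eq_uSeries hq0 hq hw, uSeries_mul_uDenom hw]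
  · have h : ∃ p : ℂ × (ℝ → ℂ), p.1 ≠ 0 ∧ theta q (t 0 / p.1) ≠ 0 ∧ theta q (t 7 / p.1) ≠ 0 ∧
      IsContourU q t p.2 := ⟨(μ, γ), hμ, h0, h7, hγ⟩
    rw [trigU, dif_pos h]
    obtain ⟨h1, h2, h3, h4⟩ := h.choose_spec
    exact integralU_eq_integralU hq0 hq (ne_zero_of_mem_paramSpace ht) hμ h1 h0 h7 h2 h3 hγ h4

theorem isContourU_circle (hq0 : q ≠ 0) (hq : ‖q‖ < 1) {t : Fin 8 → ℂ} (ht : ∀ j, t j ≠ 0) {ρ : ℝ}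
    (hρ : 0 < ρ) (h₁ : ∀ j ∈ ({0, 7} : Finset (Fin 8)), ‖t j‖ < ρ ∧ ‖t j‖ * ρ < ‖q‖)
    (h₂ : ∀ j ∈ Finset.Icc (1 : Fin 8) 6, ‖t j‖ * ρ < 1) :
    IsContourU q t (circleMap 0 ρ) := by
  have hpow : ∀ n : ℕ, ‖q‖ ^ n ≤ 1 := fun n => pow_le_one₀ (norm_nonneg _) hq.le
  have hpow' : ∀ n : ℕ, 0 < ‖q‖ ^ n := fun n => pow_pos (norm_pos_iff.2 hq0) n
  have hinc : ∀ a ∈ ({0} ∪ {z | ∃ j ∈ ({0, 7} : Finset (Fin 8)), ∃ n : ℕ,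
      z = t j * q ^ n} : Set ℂ), ‖a‖ < ρ := by
    rintro a (rfl | ⟨j, hj, n, rfl⟩)
    · simpa using hρ
    · rw [norm_mul, norm_pow]
      exact (mul_le_of_le_one_right (norm_nonneg _) (hpow n)).trans_lt (h₁ j hj).1
  have hexc : ∀ b ∈ ({z | ∃ j ∈ ({0, 7} : Finset (Fin 8)), ∃ n : ℕ,
        z = (t j)⁻¹ * q * (q ^ n)⁻¹} ∪
      {z | ∃ j ∈ Finset.Icc (1 : Fin 8) 6, ∃ n : ℕ, z = (t j)⁻¹ * (q ^ n)⁻¹} : Set ℂ),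
      ρ < ‖b‖ := by
    rintro b (⟨j, hj, n, rfl⟩ | ⟨j, hj, n, rfl⟩)
    · have hj0 : 0 < ‖t j‖ := norm_pos_iff.2 (ht j)
      rw [norm_mul, norm_mul, norm_inv, norm_inv, norm_pow]
      calc ρ < ‖t j‖⁻¹ * ‖q‖ := by
            rw [← div_eq_inv_mul, lt_div_iff₀ hj0, mul_comm]
            exact (h₁ j hj).2
        _ ≤ ‖t j‖⁻¹ * ‖q‖ * (‖q‖ ^ n)⁻¹ :=
            le_mul_of_one_le_right (by positivity) (one_le_inv_iff₀.2 ⟨hpow' n, hpow n⟩)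
    · have hj0 : 0 < ‖t j‖ := norm_pos_iff.2 (ht j)
      rw [norm_mul, norm_inv, norm_inv, norm_pow]
      calc ρ < ‖t j‖⁻¹ := by
            rw [← one_div, lt_div_iff₀ hj0, mul_comm]
            exact h₂ j hj
        _ ≤ ‖t j‖⁻¹ * (‖q‖ ^ n)⁻¹ :=
            le_mul_of_one_le_right (by positivity) (one_le_inv_iff₀.2 ⟨hpow' n, hpow n⟩)
  refine ⟨(isLoop_circleMap ρ).contDiff, (isLoop_circleMap ρ).periodic, fun a ha θ h => ?_,
    fun b hb θ h => ?_, fun a ha => windingNumber_circleMap_of_lt (hinc a ha),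
    fun b hb => windingNumber_circleMap_of_gt hρ.le (hexc b hb)⟩
  · have := hinc a ha
    rw [← h, norm_circleMap hρ.le] at this
    exact lt_irrefl _ this
  · have := hexc b hb
    rw [← h, norm_circleMap hρ.le] at this
    exact lt_irrefl _ this

/-- A region with circular contours: |t₁| = |t₈| = |q|³, the six other parameters of modulus |q|⁻¹,
and a circle of radius |q|². The moduli multiply to 1, and the strict inequalities persist nearby.
-/
theorem exists_eventually_isContourU (hq0 : q ≠ 0) (hq : ‖q‖ < 1) :
    ∃ w₀ : Fin 7 → ℂ, ∃ γ, ∀ᶠ w in 𝓝 w₀, IsContourU q (expChart w) γ := by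
  have h0 : 0 < ‖q‖ := norm_pos_iff.2 hq0
  obtain ⟨l, hl⟩ : ∃ l : ℂ, l = ((Real.log ‖q‖ : ℝ) : ℂ) := ⟨_, rfl⟩
  have hle : Complex.exp l = (‖q‖ : ℂ) := by
    rw [hl, ← Complex.ofReal_exp, Real.exp_log h0]
  have hle' : ‖Complex.exp (3 * l)‖ = ‖q‖ ^ 3 := by
    rw [show (3 : ℂ) * l = ((3 : ℕ) : ℂ) * l by norm_num, Complex.exp_nat_mul, hle, norm_pow,
      Complex.norm_real, norm_norm]
  set w₀ : Fin 7 → ℂ := ![3 * l, -l, -l, -l, -l, -l, -l] with hw₀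
  have e₁ : ∀ j ∈ ({0, 7} : Finset (Fin 8)), ‖expChart w₀ j‖ = ‖q‖ ^ 3 := by
    intro j hj
    rw [← hle']
    rcases Finset.mem_insert.1 hj with rfl | hj
    · rfl
    · rw [Finset.mem_singleton.1 hj, expChart]
      congr 2
      simp only [hw₀, logCoord, Matrix.cons_val]
      ring
  have e₂ : ∀ j ∈ Finset.Icc (1 : Fin 8) 6, ‖expChart w₀ j‖ = ‖q‖⁻¹ := by
    intro j hj
    have : logCoord w₀ j = -l := by
      fin_cases j
      on_goal 1 => exact absurd hj (by decide)
      on_goal 7 => exact absurd hj (by decide)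
      all_goals rfl
    rw [expChart, this, Complex.exp_neg, norm_inv, hle, Complex.norm_real, norm_norm]
  have hcont : ∀ j, ContinuousAt (fun w => ‖expChart w j‖) w₀ := fun j =>
    (analyticAt_expChart_apply j w₀).continuousAt.norm
  have h32 : ‖q‖ ^ 3 < ‖q‖ ^ 2 := pow_lt_pow_right_of_lt_one₀ h0 hq (by norm_num)
  have h51 : ‖q‖ ^ 3 * ‖q‖ ^ 2 < ‖q‖ := by
    rw [← pow_add]
    simpa using pow_lt_pow_right_of_lt_one₀ h0 hq (m := 1) (n := 5) (by norm_num)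
  have h12 : ‖q‖⁻¹ * ‖q‖ ^ 2 < 1 := by
    rw [pow_two, inv_mul_cancel_left₀ h0.ne']
    exact hq
  refine ⟨w₀, circleMap 0 (‖q‖ ^ 2), ?_⟩
  have a₁ : ∀ᶠ w in 𝓝 w₀, ∀ j ∈ ({0, 7} : Finset (Fin 8)),
      ‖expChart w j‖ < ‖q‖ ^ 2 ∧ ‖expChart w j‖ * ‖q‖ ^ 2 < ‖q‖ := by
    refine (Finset.eventually_all _).2 fun j hj => ?_
    exact ((hcont j).eventually_lt continuousAt_const (by rwa [e₁ j hj])).and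
      (((hcont j).mul_const _).eventually_lt continuousAt_const (by rwa [e₁ j hj]))
  have a₂ : ∀ᶠ w in 𝓝 w₀, ∀ j ∈ Finset.Icc (1 : Fin 8) 6, ‖expChart w j‖ * ‖q‖ ^ 2 < 1 := by
    refine (Finset.eventually_all _).2 fun j hj => ?_
    exact ((hcont j).mul_const _).eventually_lt continuousAt_const (by rwa [e₂ j hj])
  filter_upwards [a₁, a₂] with w h₁ h₂
  exact isContourU_circle hq0 hq (expChart_ne_zero w) (pow_pos h0 2) h₁ h₂

theorem exists_theta_div_ne_zero (hq0 : q ≠ 0) (hq : ‖q‖ < 1) {a b : ℂ} (ha : a ≠ 0) (hb : b ≠ 0) :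
    ∃ μ : ℂ, μ ≠ 0 ∧ theta q (a / μ) ≠ 0 ∧ theta q (b / μ) ≠ 0 :=
  ((((eventually_ne_nhds (one_ne_zero' ℂ)).filter_mono nhdsWithin_le_nhds).and
    ((eventually_theta_div_ne_zero hq0 hq ha one_ne_zero).and
      (eventually_theta_div_ne_zero hq0 hq hb one_ne_zero)))).exists

/-- As for S, from the open set of parameters admitting a common circular contour, with an auxiliary
`μ` chosen for each parameter. -/
theorem IsTrigU.holdsGenericallyAt (hq0 : q ≠ 0) (hq : ‖q‖ < 1) {U : (Fin 8 → ℂ) → ℂ}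
    (hU : IsTrigU q U) (x : Fin 7 → ℂ) :
    HoldsGenericallyAt (fun w => U (expChart w) = uSeries q (expChart w)) x := by
  have hK := isEntireNonzero_uDenom hq0 hq
  obtain ⟨w₁, γ, hγ⟩ := exists_eventually_isContourU hq0 hq
  obtain ⟨w₀, hw₀, hw₀'⟩ := ((hK.frequently w₁).and_eventually hγ.eventually_nhds).exists
  have h := holdsGenericallyAt_mul_eq (f := fun w => U (expChart w)) hU.1.isMeromorphicNear
    (analyticAt_uNum hq0 hq) hK.analyticAt (x₀ := w₀) (by
      filter_upwards [hw₀', (hK.analyticAt w₀).continuousAt.eventually_ne hw₀] with w hw hw'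
      have h0 := expChart_ne_zero w
      obtain ⟨μ, hμ, h1, h2⟩ := exists_theta_div_ne_zero hq0 hq (h0 0) (h0 7)
      rw [← hU.2 _ (expChart_mem_paramSpace w) μ hμ h1 h2 γ hw,
        integralU_eq_uSeries hq0 hq h0 hμ h1 h2 (left_ne_zero_of_mul hw') hw,
        uSeries_mul_uDenom hw']) x
  refine (h.and (hK.holdsGenericallyAt (fun _ => id) x)).mono fun w ⟨h1, h2⟩ => ?_
  rw [← uSeries_mul_uDenom h2] at h1
  exact mul_right_cancel₀ h2 h1

end TrigU

/-! ### Parity, the relation between S and U, and the series expression. -/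

section Main

variable {q : ℂ} {S U : (Fin 8 → ℂ) → ℂ}

theorem IsTrigS.generically_neg (hq0 : q ≠ 0) (hq : ‖q‖ < 1) (hS : IsTrigS q S) :
    Generically fun t => S (-t) = S t := by
  refine generically_of_expChart fun x => ?_
  have h := hS.holdsGenericallyAt hq0 hq
  refine ((h x).and ((h (shiftHomeomorph x)).comp (analyticAt_shiftHomeomorph x))).mono
    fun w ⟨⟨h1, h2⟩, _, h4⟩ => ?_
  have hs : scale w ^ 2 * expChart (shiftHomeomorph w) 1 * expChart (shiftHomeomorph w) 2 *
      expChart (shiftHomeomorph w) 3 * expChart (shiftHomeomorph w) 4 = 1 := by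
    simp only [expChart_shiftHomeomorph, Pi.neg_apply]
    linear_combination scale_sq_mul w
  rw [← uSeries_suParam_expChart hs, expChart_shiftHomeomorph, suFactor_neg, suParam_neg,
    uSeries_neg, ← expChart_reflect, ← h2] at h4
  exact mul_right_cancel₀ h1 h4

theorem IsTrigU.generically_neg (hq0 : q ≠ 0) (hq : ‖q‖ < 1) (hU : IsTrigU q U) :
    Generically fun t => U (-t) = U t := by
  refine generically_of_expChart fun x => ?_
  have h := hU.holdsGenericallyAt hq0 hq
  refine ((h x).and ((h (shiftHomeomorph x)).comp (analyticAt_shiftHomeomorph x))).mono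
    fun w ⟨h1, h2⟩ => ?_
  rw [expChart_shiftHomeomorph, uSeries_neg, ← h1] at h2
  exact h2

/-- There are only two admissible `s` at each point. One corresponds to `reflect`, the other to
`reflect` followed by the lift of t ↦ -t, and both are homeomorphisms of the cover. No parity of `P`
is required. -/
theorem HoldsGenericallyAt.forall_suParam {P : (Fin 8 → ℂ) → Prop}
    (h : ∀ x, HoldsGenericallyAt (fun w => P (expChart w)) x) (x : Fin 7 → ℂ) :
    HoldsGenericallyAt (fun w => ∀ s : ℂ, s ^ 2 * expChart w 1 * expChart w 2 * expChart w 3 *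
      expChart w 4 = 1 → P (suParam s (expChart w))) x := by
  have h1 := (h (reflect x)).comp (φ := reflectHomeomorph) (analyticAt_reflect x)
  have h2 := ((h (shiftHomeomorph (reflect x))).comp
    (analyticAt_shiftHomeomorph (reflect x))).comp (φ := reflectHomeomorph) (analyticAt_reflect x)
  refine (h1.and h2).mono fun w ⟨h1, h2⟩ s hs => ?_
  change P (expChart (reflect w)) at h1
  change P (expChart (shiftHomeomorph (reflect w))) at h2
  rw [expChart_shiftHomeomorph, expChart_reflect, ← suParam_neg_left] at h2
  rw [expChart_reflect] at h1
  rcases eq_or_eq_neg_scale hs with rfl | rfl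
  · exact h1
  · exact h2

/-- Stated for any `V` that agrees generically with the series, so that the relation with U and the
₁₀φ₉ expression are two instances. -/
theorem IsTrigS.generically_mul_suFactor_eq (hq0 : q ≠ 0) (hq : ‖q‖ < 1) (hS : IsTrigS q S)
    {V : (Fin 8 → ℂ) → ℂ}
    (hV : ∀ x, HoldsGenericallyAt (fun w => V (expChart w) = uSeries q (expChart w)) x) :
    Generically fun t => ∀ s : ℂ, s ^ 2 * t 1 * t 2 * t 3 * t 4 = 1 →
      S t * suFactor q t = V (suParam s t) := by
  refine generically_of_expChart fun x => ?_
  refine ((hS.holdsGenericallyAt hq0 hq x).and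
    (HoldsGenericallyAt.forall_suParam (P := fun t => V t = uSeries q t) hV x)).mono
    fun w ⟨⟨_, h1⟩, h2⟩ s hs => ?_
  rw [h1, h2 s hs, uSeries_suParam_expChart hs]

theorem holdsGenericallyAt_seriesU (hq0 : q ≠ 0) (hq : ‖q‖ < 1) (x : Fin 7 → ℂ) :
    HoldsGenericallyAt (fun w => seriesU q (expChart w) = uSeries q (expChart w)) x :=
  (isEntireNonzero_seriesDenom hq0 hq).holdsGenericallyAt
    (fun w hw => seriesU_eq_uSeries_of_seriesDenom hq0 hq (expChart_ne_zero w) hw) x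

end Main

end TrigHyp

end

theorem proposition5p7 (q : ℂ) (hq0 : q ≠ 0) (hq1 : ‖q‖ < 1) :
    -- the meromorphic functions `S_t` and `U_t` exist
    (∃ S, TrigHyp.IsTrigS q S) ∧ (∃ U, TrigHyp.IsTrigU q U) ∧
    ∀ S U : (Fin 8 → ℂ) → ℂ, TrigHyp.IsTrigS q S → TrigHyp.IsTrigU q U →
      -- they descend to the quotient of the hypersurface by `t ↦ -t`
      TrigHyp.Generically (fun t => S (-t) = S t) ∧
      TrigHyp.Generically (fun t => U (-t) = U t) ∧
      -- the relation between `S_t` and `U_t`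
      TrigHyp.Generically (fun t => ∀ s : ℂ, s ^ 2 * t 1 * t 2 * t 3 * t 4 = 1 →
        S t * TrigHyp.suFactor q t = U (TrigHyp.suParam s t)) ∧
      -- the resulting expression of `S_t` as a sum of two very-well-poised series
      TrigHyp.Generically (fun t => ∀ s : ℂ, s ^ 2 * t 1 * t 2 * t 3 * t 4 = 1 →
        S t * TrigHyp.suFactor q t = TrigHyp.seriesU q (TrigHyp.suParam s t)) := by
  exact ⟨⟨_, TrigHyp.isTrigS_trigS hq0 hq1⟩, ⟨_, TrigHyp.isTrigU_trigU hq0 hq1⟩,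
    fun S U hS hU => ⟨hS.generically_neg hq0 hq1, hU.generically_neg hq0 hq1,
      hS.generically_mul_suFactor_eq hq0 hq1 (hU.holdsGenericallyAt hq0 hq1),
      hS.generically_mul_suFactor_eq hq0 hq1 (TrigHyp.holdsGenericallyAt_seriesU hq0 hq1)⟩⟩
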